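/- **Setting.** Let $\Omega\subset\mathbb R^2$ be a bounded domain whose boundary is a closed curve without self-intersections, $\partial\Omega=\bigcup_{j=1}^n\overline\Gamma_j$, where the $\Gamma_j$ are consecutive open arcs, $\Gamma_j\subset\{q_j=0\}$ for an irreducible quadratic polynomial $q_j$ that is positive at the points of $\Omega$ near $\Gamma_j$. The internal angles of $\Omega$ at the common endpoints $z_j$ of consecutive arcs lie in $(0,2\pi)$. Let $\triangle$ be a triangulation of $\Omega$: a finite set of closed triangles with union $\overline\Omega$, each of which may have one edge replaced by a curved piece of some $\overline\Gamma_j$, such that two different triangles are disjoint or meet in a common vertex or in a common straight edge. Triangles with a curved edge are *pie-shaped*; the other triangles that share an edge with a pie-shaped one are *buffer* triangles; the remaining ones are *ordinary*. For a pie-shaped triangle $T$ let $T^*$ be the straight triangle with the same vertices; we suppose that $T\cap T^*$ contains a disk of positive radius, and $c_T$ denotes the center of a largest disk contained in $T\cap T^*$. For a buffer triangle $c_T$ is the barycenter. Assume: (A) all $z_j$ are vertices; (B) no interior edge has both endpoints on $\partial\Omega$; (C) no two pie-shaped triangles share an edge; (D) every pie-shaped triangle is star-shaped with respect to its interior vertex;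 (E) if $T$ is pie-shaped with curved edge on $\overline\Gamma_j$, then $q_j>0$ on $T\setminus\overline\Gamma_j$; (F) no two buffer triangles share an edge. **Spaces.** $\mathbb P_d$ is the space of bivariate polynomials of total degree at most $d$. $\mathbb S^{1,2}_{5,0}(\triangle)$ is the set of functions $s$ on $\overline\Omega$ with $s\in C^1(\Omega)$, $s|_T\in\mathbb P_5$ for ordinary $T$, $s|_T\in\mathbb P_6$ for pie-shaped and buffer $T$, $s$ twice differentiable at every interior vertex, and $s|_{\partial\Omega}=0$. **Interpolation operator.** Let $u\in H^5(\Omega)\cap H^1_0(\Omega)$ and identify $u$ with its representative in $C^3(\overline\Omega)$. Derivatives on $T$ at boundary points of $T$ are the continuous extensions of the derivatives in the interior of $T$. For an edge $e=\langle v',v''\rangle$ let $z_e^i=v'+\frac i4(v''-v')$, and let $D_{e^\perp}$ be the derivative in a unit direction orthogonal to $e$. Then $I_\triangle u|_T=I_Tu$, where * for ordinary $T$, $I_Tu\in\mathbb P_5$ matches the derivatives of $u$ of order $\le 2$ at the three vertices, and $D_{e^\perp}u(z_e^2)$ for the three edges $e$; * for pie-shaped $T$ with curved edge on $\overline\Gamma_j$,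 $I_Tu=p\,q_j$, where $p\in\mathbb P_4$ matches the derivatives of $u/q_j$ of order $\le2$ at the interior vertex of $T$, and of order $\le 1$ at the two boundary vertices and at $c_T$; * for a buffer triangle $T$ with boundary vertex $v_1$, interior vertices $v_2,v_3$ and edges $e_1=\langle v_2,v_3\rangle$, $e_2=\langle v_1,v_2\rangle$, $e_3=\langle v_1,v_3\rangle$, let $T_i\ne T$ be the triangle sharing $e_i$ with $T$. Then $p=I_Tu\in\mathbb P_6$ satisfies $p(c_T)=u(c_T)$; for $i=1,2,3$ it matches $I_{T_i}u$ at $z_{e_i}^2$ and $D_{e_i^\perp}I_{T_i}u$ at $z_{e_i}^1$ and $z_{e_i}^3$; it matches the derivatives of order $\le2$ of $I_{T_1}u$ at $v_2,v_3$, and those of $I_{T_2}u$ at $v_1$. **Theorem.** For every $u\in H^5(\Omega)\cap H^1_0(\Omega)$ the interpolant $I_\triangle u$ is well defined (that is, there is exactly one function on $\overline\Omega$ with the properties above, and $u$ does have a representative in $C^3(\overline\Omega)$), and $I_\triangle u\in\mathbb S^{1,2}_{5,0}(\triangle)$. Moreover, $I_\triangle u$ is twice differentiable (relative to $\overline\Omega$)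 at all vertices of $\triangle$, including those on the boundary. -/

import Mathlib

open Set Filter MeasureTheory TopologicalSpace
open scoped Topology ENNReal ContDiff Distributions

namespace ConicSpline

/-- The Euclidean plane `ℝ²`. -/
abbrev Plane : Type := EuclideanSpace ℝ (Fin 2)

/-- Bivariate real polynomials; the space `ℙ_d` is `{p | p.totalDegree ≤ d}`. -/
abbrev BiPoly : Type := MvPolynomial (Fin 2) ℝ

/-- The function on the plane defined by a bivariate polynomial. -/
noncomputable def polyFun (p : BiPoly) : Plane → ℝ :=
  fun x => MvPolynomial.eval (fun i => x i) p

/-! ### Derivatives and nodal functionals -/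

/-- The directional derivative `D_τ f`. -/
noncomputable def dirDeriv (τ : Plane) (f : Plane → ℝ) : Plane → ℝ :=
  fun x => fderiv ℝ f x τ

/-- The mixed directional derivative `D_{τ₁}^a D_{τ₂}^b f`. -/
noncomputable def mixedDeriv (τ₁ τ₂ : Plane) (a b : ℕ) (f : Plane → ℝ) : Plane → ℝ :=
  (dirDeriv τ₁)^[a] ((dirDeriv τ₂)^[b] f)

/-- The coordinate unit vectors. -/
noncomputable def unitVec (i : Fin 2) : Plane := EuclideanSpace.single i 1

/-- The partial derivative `D_x^a D_y^b f`. -/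
noncomputable def partialDeriv (a b : ℕ) (f : Plane → ℝ) : Plane → ℝ :=
  mixedDeriv (unitVec 0) (unitVec 1) a b f

/-- The data `(z, τ₁, τ₂, a, b)` of the nodal functional `f ↦ D_{τ₁}^a D_{τ₂}^b (f|_T)(z)`. -/
structure NodalFunctional where
  point : Plane
  dir₁ : Plane
  dir₂ : Plane
  ord₁ : ℕ
  ord₂ : ℕ

/-- `c` is the nodal value `η (f|_K)` on the closed set `K` (the closure of its interior): it is the
value at the node of the continuous extension of the derivative from the interior of `K`.
This is how derivatives of functions in `C^k(K)` are defined at points of the boundary of `K`. -/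
def NodalFunctional.HasValue (η : NodalFunctional) (K : Set Plane) (f : Plane → ℝ) (c : ℝ) :
    Prop :=
  Tendsto (mixedDeriv η.dir₁ η.dir₂ η.ord₁ η.ord₂ f) (𝓝[interior K] η.point) (𝓝 c)

/-- The nodal value `η p` of a polynomial. -/
noncomputable def NodalFunctional.poly (η : NodalFunctional) (p : BiPoly) : ℝ :=
  mixedDeriv η.dir₁ η.dir₂ η.ord₁ η.ord₂ (polyFun p) η.point

/-- The functionals `D_x^a D_y^b f(z)`, `0 ≤ a + b ≤ k`. -/
def jetNodes (z : Plane) (k : ℕ) : Set NodalFunctional :=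
  {η | ∃ a b : ℕ, a + b ≤ k ∧ η = ⟨z, unitVec 0, unitVec 1, a, b⟩}

/-- The functionals `D_{e^⊥} f(z)` for the edge `e = [v', v'']`; both choices of the unit normal
are included (the two functionals differ by the factor `-1`). -/
def normalNodes (v' v'' z : Plane) : Set NodalFunctional :=
  {η | ∃ τ : Plane, ‖τ‖ = 1 ∧ inner ℝ τ (v'' - v') = 0 ∧ η = ⟨z, τ, τ, 1, 0⟩}

/-- The point `z_e^j = v' + (j/4) (v'' - v')` of the edge `e = [v', v'']`. -/
noncomputable def edgePoint (v' v'' : Plane) (j : ℕ) : Plane :=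
  v' + ((j : ℝ) / 4) • (v'' - v')

/-- The functionals `f(z_e^2)` and `D_{e^⊥} f(z_e^j)`, `j = 1, 3`, for the edge `e = [v', v'']`. -/
def edgeNodes (v' v'' : Plane) : Set NodalFunctional :=
  jetNodes (edgePoint v' v'' 2) 0 ∪ normalNodes v' v'' (edgePoint v' v'' 1) ∪
    normalNodes v' v'' (edgePoint v' v'' 3)

/-! ### Sobolev spaces on open subsets of the plane -/

/-- `g` is the weak derivative `∂^{(a,b)} u` on `Ω`. -/
def HasWeakDeriv (Ω : Opens Plane) (a b : ℕ) (u g : Plane → ℝ) : Prop :=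
  ∀ φ : 𝓓(Ω, ℝ), ∫ x in (Ω : Set Plane), u x * partialDeriv a b φ x =
    (-1) ^ (a + b) * ∫ x in (Ω : Set Plane), g x * φ x

/-- `u ∈ L²(Ω)`. -/
def MemL2 (Ω : Opens Plane) (u : Plane → ℝ) : Prop :=
  MemLp u 2 (volume.restrict (Ω : Set Plane))

/-- `u ∈ H^m(Ω)`: all weak derivatives of order at most `m` are in `L²(Ω)`. -/
def MemH (Ω : Opens Plane) (m : ℕ) (u : Plane → ℝ) : Prop :=
  MemL2 Ω u ∧ ∀ a b : ℕ, a + b ≤ m → ∃ g : Plane → ℝ, MemL2 Ω g ∧ HasWeakDeriv Ω a b u g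

/-- `u ∈ H^1_0(Ω)`: `u` is the limit in `H^1(Ω)` of test functions on `Ω`. (On a bounded Lipschitz
domain these are the functions in `H^1(Ω)` whose trace on the boundary is zero.) -/
def MemH10 (Ω : Opens Plane) (u : Plane → ℝ) : Prop :=
  ∃ gx gy : Plane → ℝ, MemL2 Ω u ∧ MemL2 Ω gx ∧ MemL2 Ω gy ∧
    HasWeakDeriv Ω 1 0 u gx ∧ HasWeakDeriv Ω 0 1 u gy ∧
    ∃ φ : ℕ → 𝓓(Ω, ℝ),
      Tendsto (fun k => eLpNorm (fun x => φ k x - u x) 2 (volume.restrict (Ω : Set Plane)))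
        atTop (𝓝 0) ∧
      Tendsto (fun k => eLpNorm (fun x => partialDeriv 1 0 (φ k) x - gx x) 2
        (volume.restrict (Ω : Set Plane))) atTop (𝓝 0) ∧
      Tendsto (fun k => eLpNorm (fun x => partialDeriv 0 1 (φ k) x - gy x) 2
        (volume.restrict (Ω : Set Plane))) atTop (𝓝 0)

/-- `w` is a representative of `u` in `C^3(Ω̄)`: `w = u` almost everywhere on `Ω`, `w` is three times
continuously differentiable in `Ω`, and its partial derivatives of order at most three extend
continuously to the closure of `Ω`. -/
structure IsC3Representative (Ω : Opens Plane) (u w : Plane → ℝ) : Prop where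
  ae_eq : w =ᵐ[volume.restrict (Ω : Set Plane)] u
  contDiffOn : ContDiffOn ℝ 3 w Ω
  extends_closure : ∀ a b : ℕ, a + b ≤ 3 → ∃ g : Plane → ℝ,
    ContinuousOn g (closure (Ω : Set Plane)) ∧ EqOn g (partialDeriv a b w) Ω

/-! ### Piecewise conic domains -/

/-- A bounded domain whose boundary is a closed curve without self-intersections, composed of `n`
arcs of irreducible conics. The closed `j`-th arc is `curve j '' [0, 1]`, and the open arc `Γ_j` is
`curve j '' (0, 1)`. (The domain is the interior of the Jordan curve, so it is simply connected.) -/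
structure ConicDomain (n : ℕ) [NeZero n] where
  Ω : Opens Plane
  curve : Fin n → ℝ → Plane
  q : Fin n → BiPoly
  isConnected : IsConnected (Ω : Set Plane)
  isBounded : Bornology.IsBounded (Ω : Set Plane)
  /-- Regular parametrizations of the arcs. -/
  contDiff_curve : ∀ j, ContDiff ℝ 1 (curve j)
  deriv_curve_ne : ∀ j, ∀ t ∈ Icc (0 : ℝ) 1, deriv (curve j) t ≠ 0
  /-- The arcs are joined end to end (indices modulo `n`) ... -/
  curve_joint : ∀ j, curve j 1 = curve (j + 1) 0
  /-- ... without self-intersections. -/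
  curve_inj : ∀ j k, ∀ s ∈ Ico (0 : ℝ) 1, ∀ t ∈ Ico (0 : ℝ) 1,
    curve j s = curve k t → j = k ∧ s = t
  frontier_eq : frontier (Ω : Set Plane) = ⋃ j, curve j '' Icc 0 1
  /-- The internal angles are neither `0` nor `2π`: the two one-sided tangents at a joint do not
  have the same direction. -/
  angle : ∀ j, ¬ SameRay ℝ (deriv (curve (j + 1)) 0) (-(deriv (curve j) 1))
  q_irreducible : ∀ j, Irreducible (q j)
  q_degree : ∀ j, (q j).totalDegree = 2
  q_zero : ∀ j, ∀ t ∈ Ioo (0 : ℝ) 1, polyFun (q j) (curve j t) = 0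
  /-- `q j` is positive at the points of `Ω` near `Γ_j`. -/
  q_pos : ∀ j, ∀ t ∈ Ioo (0 : ℝ) 1,
    ∀ᶠ x in 𝓝[(Ω : Set Plane)] (curve j t), 0 < polyFun (q j) x

/-- The closed arc `Γ̄_j`. -/
def ConicDomain.closedArc {n : ℕ} [NeZero n] (D : ConicDomain n) (j : Fin n) : Set Plane :=
  D.curve j '' Icc 0 1

/-! ### Triangulations -/

/-- A finite family of triangles, some of which (the pie-shaped ones) have one edge replaced by a
piece of an arc `Γ̄_j` of the boundary of the domain.
Vertices are numbered such that the curved edge of a pie-shaped triangle joins the vertices `1`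
and `2`. -/
structure CurvedTriangles {n : ℕ} [NeZero n] (D : ConicDomain n) (ι : Type) where
  vert : ι → Fin 3 → Plane
  /-- The set of points of each (closed) triangle. -/
  cell : ι → Set Plane
  /-- `Δ_P` -/
  pie : Set ι
  /-- The curved edge of the pie-shaped triangle `T` is the piece of the arc with the number
  `arc T` between the parameters `lo T` and `hi T`. -/
  arc : ι → Fin n
  lo : ι → ℝ
  hi : ι → ℝ
  /-- Centre `c_T` and radius `ρ_T` of the inscribed disk `B_T` of a pie-shaped triangle. -/
  center : ι → Plane
  radius : ι → ℝ

namespace CurvedTriangles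

variable {n : ℕ} [NeZero n] {D : ConicDomain n} {ι : Type}

/-- The `i`-th and the `k`-th vertex of `T` are joined by a straight edge of `T`. -/
def IsStraight (Δ : CurvedTriangles D ι) (T : ι) (i k : Fin 3) : Prop :=
  i ≠ k ∧ (T ∈ Δ.pie → i = 0 ∨ k = 0)

/-- The straight edges of `T`. -/
def edges (Δ : CurvedTriangles D ι) (T : ι) : Set (Set Plane) :=
  {e | ∃ i k, Δ.IsStraight T i k ∧ e = segment ℝ (Δ.vert T i) (Δ.vert T k)}

/-- The curved edge of a pie-shaped triangle. -/
def curvedEdge (Δ : CurvedTriangles D ι) (T : ι) : Set Plane :=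
  D.curve (Δ.arc T) '' Icc (Δ.lo T) (Δ.hi T)

/-- The triangle `T^*` with straight edges and the same vertices as `T`. -/
def straightened (Δ : CurvedTriangles D ι) (T : ι) : Set Plane :=
  convexHull ℝ (range (Δ.vert T))

/-- The conic polynomial `q_j`, where the curved edge of the pie-shaped triangle `T` is on `Γ_j`. -/
def conic (Δ : CurvedTriangles D ι) (T : ι) : BiPoly := D.q (Δ.arc T)

/-- `T ∈ Δ_B`: buffer triangles share an edge with a pie-shaped triangle. -/
def IsBuffer (Δ : CurvedTriangles D ι) (T : ι) : Prop :=
  T ∉ Δ.pie ∧ ∃ T' ∈ Δ.pie, (Δ.edges T ∩ Δ.edges T').Nonempty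

/-- `T ∈ Δ_0`: ordinary triangles. -/
def IsOrdinary (Δ : CurvedTriangles D ι) (T : ι) : Prop :=
  T ∉ Δ.pie ∧ ¬ Δ.IsBuffer T

/-- The triangles form a triangulation of `Ω`. -/
structure IsTriangulation (Δ : CurvedTriangles D ι) : Prop where
  affineIndependent : ∀ T, AffineIndependent ℝ (Δ.vert T)
  cell_straight : ∀ T, T ∉ Δ.pie → Δ.cell T = Δ.straightened T
  arc_param : ∀ T ∈ Δ.pie, 0 ≤ Δ.lo T ∧ Δ.lo T < Δ.hi T ∧ Δ.hi T ≤ 1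
  arc_lo : ∀ T ∈ Δ.pie, D.curve (Δ.arc T) (Δ.lo T) = Δ.vert T 1
  arc_hi : ∀ T ∈ Δ.pie, D.curve (Δ.arc T) (Δ.hi T) = Δ.vert T 2
  /-- The straight edges of a pie-shaped triangle meet its curved edge only at the vertices. -/
  edge_inter_arc : ∀ T ∈ Δ.pie, ∀ i : Fin 3, i ≠ 0 →
    segment ℝ (Δ.vert T 0) (Δ.vert T i) ∩ Δ.curvedEdge T = {Δ.vert T i}
  /-- A pie-shaped triangle is the closed region bounded by its two straight edges and its
  curved edge. -/
  isCompact_pie : ∀ T ∈ Δ.pie, IsCompact (Δ.cell T)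
  isConnected_pie : ∀ T ∈ Δ.pie, IsConnected (interior (Δ.cell T))
  closure_pie : ∀ T ∈ Δ.pie, closure (interior (Δ.cell T)) = Δ.cell T
  frontier_pie : ∀ T ∈ Δ.pie, frontier (Δ.cell T) =
    segment ℝ (Δ.vert T 0) (Δ.vert T 1) ∪ segment ℝ (Δ.vert T 0) (Δ.vert T 2) ∪ Δ.curvedEdge T
  /-- The disk `B_T` inscribed in `T ∩ T^*` is a largest disk contained in this set. -/
  radius_pos : ∀ T ∈ Δ.pie, 0 < Δ.radius T
  disk_subset : ∀ T ∈ Δ.pie,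
    Metric.closedBall (Δ.center T) (Δ.radius T) ⊆ Δ.cell T ∩ Δ.straightened T
  disk_max : ∀ T ∈ Δ.pie, ∀ (c : Plane) (r : ℝ),
    Metric.closedBall c r ⊆ Δ.cell T ∩ Δ.straightened T → r ≤ Δ.radius T
  cover : ⋃ T, Δ.cell T = closure (D.Ω : Set Plane)
  /-- Two triangles are disjoint or meet in a common vertex or in a common straight edge. -/
  conforming : ∀ T T', T ≠ T' →
    Δ.cell T ∩ Δ.cell T' = ∅ ∨
    (∃ i k, Δ.vert T i = Δ.vert T' k ∧ Δ.cell T ∩ Δ.cell T' = {Δ.vert T i}) ∨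
    Δ.cell T ∩ Δ.cell T' ∈ Δ.edges T ∩ Δ.edges T'
  /-- Numbering convention: the vertex `0` of a buffer triangle is its boundary vertex. -/
  buffer_vert : ∀ T, Δ.IsBuffer T → Δ.vert T 0 ∈ frontier (D.Ω : Set Plane)

/-- The conditions (A)-(F). -/
structure IsAdmissible (Δ : CurvedTriangles D ι) : Prop where
  /-- The endpoints of all arcs are vertices. -/
  condA : ∀ j, ∃ T i, Δ.vert T i = D.curve j 0
  /-- No interior edge has both endpoints on the boundary. -/
  condB : ∀ T i k, Δ.IsStraight T i k →
    ¬ (Δ.vert T i ∈ frontier (D.Ω : Set Plane) ∧ Δ.vert T k ∈ frontier (D.Ω : Set Plane))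
  /-- No pair of pie-shaped triangles shares an edge. -/
  condC : ∀ T ∈ Δ.pie, ∀ T' ∈ Δ.pie, T ≠ T' → Δ.edges T ∩ Δ.edges T' = ∅
  /-- Pie-shaped triangles are star-shaped with respect to their interior vertex. -/
  condD : ∀ T ∈ Δ.pie, StarConvex ℝ (Δ.vert T 0) (Δ.cell T)
  /-- `q_j` is positive on a pie-shaped triangle with curved edge on `Γ_j`, except on `Γ̄_j`. -/
  condE : ∀ T ∈ Δ.pie, ∀ x ∈ Δ.cell T \ D.closedArc (Δ.arc T), 0 < polyFun (Δ.conic T) x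
  /-- No pair of buffer triangles shares an edge. -/
  condF : ∀ T T', Δ.IsBuffer T → Δ.IsBuffer T' → T ≠ T' → Δ.edges T ∩ Δ.edges T' = ∅

/-! ### Spline spaces -/

/-- The space `S^1_d(Δ)`. -/
structure MemS1 (Δ : CurvedTriangles D ι) (d : ℕ) (s : Plane → ℝ) : Prop where
  contDiffOn : ContDiffOn ℝ 1 s D.Ω
  ordinary : ∀ T, Δ.IsOrdinary T →
    ∃ p : BiPoly, p.totalDegree ≤ d ∧ EqOn s (polyFun p) (Δ.cell T)
  pie_or_buffer : ∀ T, T ∈ Δ.pie ∨ Δ.IsBuffer T →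
    ∃ p : BiPoly, p.totalDegree ≤ d + 1 ∧ EqOn s (polyFun p) (Δ.cell T)

/-- The space `S^{1,2}_{d,I}(Δ)`: splines in `S^1_d(Δ)` that are twice differentiable at all
interior vertices. -/
def MemS12I (Δ : CurvedTriangles D ι) (d : ℕ) (s : Plane → ℝ) : Prop :=
  Δ.MemS1 d s ∧ ∀ T i, Δ.vert T i ∈ D.Ω → DifferentiableAt ℝ (fderiv ℝ s) (Δ.vert T i)

/-- The space `S^{1,2}_{d,0}(Δ)`: splines in `S^{1,2}_{d,I}(Δ)` that vanish on the boundary. -/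
def MemS120 (Δ : CurvedTriangles D ι) (d : ℕ) (s : Plane → ℝ) : Prop :=
  Δ.MemS12I d s ∧ ∀ x ∈ frontier (D.Ω : Set Plane), s x = 0

/-- `s` is twice differentiable at `v` relative to the closed domain `Ω̄`. -/
def TwiceDiffAt (D : ConicDomain n) (s : Plane → ℝ) (v : Plane) : Prop :=
  (∀ᶠ x in 𝓝[closure (D.Ω : Set Plane)] v,
    DifferentiableWithinAt ℝ s (closure (D.Ω : Set Plane)) x) ∧
  DifferentiableWithinAt ℝ (fderivWithin ℝ s (closure (D.Ω : Set Plane)))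
    (closure (D.Ω : Set Plane)) v

/-! ### The interpolation operator -/

/-- The set `N_T^0` for an ordinary triangle. -/
def nodesOrdinary (Δ : CurvedTriangles D ι) (T : ι) : Set NodalFunctional :=
  (⋃ i, jetNodes (Δ.vert T i) 2) ∪
    ⋃ (i : Fin 3) (k : Fin 3) (_ : i < k), normalNodes (Δ.vert T i) (Δ.vert T k)
      (edgePoint (Δ.vert T i) (Δ.vert T k) 2)

/-- The set `N_T^P` for a pie-shaped triangle. -/
def nodesPie (Δ : CurvedTriangles D ι) (T : ι) : Set NodalFunctional :=
  jetNodes (Δ.vert T 0) 2 ∪ jetNodes (Δ.vert T 1) 1 ∪ jetNodes (Δ.vert T 2) 1 ∪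
    jetNodes (Δ.center T) 1

/-- The set `N_T^{B,1}` for a buffer triangle: the value at the barycenter. -/
def nodesBuffer (Δ : CurvedTriangles D ι) (T : ι) : Set NodalFunctional :=
  jetNodes ((1 / 3 : ℝ) • (Δ.vert T 0 + Δ.vert T 1 + Δ.vert T 2)) 0

/-- The set `N_1` for a buffer triangle, belonging to the edge that joins its interior vertices. -/
def nodesBuffer₁ (Δ : CurvedTriangles D ι) (T : ι) : Set NodalFunctional :=
  edgeNodes (Δ.vert T 1) (Δ.vert T 2) ∪ jetNodes (Δ.vert T 1) 2 ∪ jetNodes (Δ.vert T 2) 2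

/-- The set `N_2` for a buffer triangle, belonging to one of the edges with an endpoint on the
boundary. -/
def nodesBuffer₂ (Δ : CurvedTriangles D ι) (T : ι) : Set NodalFunctional :=
  edgeNodes (Δ.vert T 0) (Δ.vert T 1) ∪ jetNodes (Δ.vert T 0) 2

/-- The set `N_3` for a buffer triangle, belonging to the other edge with an endpoint on the
boundary. -/
def nodesBuffer₃ (Δ : CurvedTriangles D ι) (T : ι) : Set NodalFunctional :=
  edgeNodes (Δ.vert T 0) (Δ.vert T 2)

/-- `P T` is the local interpolant `I_T w` of the function `w ∈ C^3(Ω̄)`, for every triangle `T`. -/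
structure IsLocalInterpolants (Δ : CurvedTriangles D ι) (w : Plane → ℝ) (P : ι → BiPoly) :
    Prop where
  /-- Ordinary triangles: Argyris interpolation by quintics. -/
  ordinary : ∀ T, Δ.IsOrdinary T → (P T).totalDegree ≤ 5 ∧
    ∀ η ∈ Δ.nodesOrdinary T, η.HasValue (Δ.cell T) w (η.poly (P T))
  /-- Pie-shaped triangles: `I_T w = p q_j`, where the quartic `p` interpolates `w / q_j`. -/
  pie : ∀ T ∈ Δ.pie, ∃ p : BiPoly, p.totalDegree ≤ 4 ∧ P T = p * Δ.conic T ∧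
    ∀ η ∈ Δ.nodesPie T,
      η.HasValue (Δ.cell T) (fun x => w x / polyFun (Δ.conic T) x) (η.poly p)
  /-- Buffer triangles: a polynomial in `ℙ_6` that interpolates `w` at the barycenter, and the local
  interpolants of the neighbouring triangles at the nodes on the edges. -/
  buffer : ∀ T, Δ.IsBuffer T → (P T).totalDegree ≤ 6 ∧
    (∀ η ∈ Δ.nodesBuffer T, η.HasValue (Δ.cell T) w (η.poly (P T))) ∧
    ∀ T', T' ≠ T →
      (segment ℝ (Δ.vert T 1) (Δ.vert T 2) ∈ Δ.edges T' →
        ∀ η ∈ Δ.nodesBuffer₁ T, η.poly (P T) = η.poly (P T')) ∧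
      (segment ℝ (Δ.vert T 0) (Δ.vert T 1) ∈ Δ.edges T' →
        ∀ η ∈ Δ.nodesBuffer₂ T, η.poly (P T) = η.poly (P T')) ∧
      (segment ℝ (Δ.vert T 0) (Δ.vert T 2) ∈ Δ.edges T' →
        ∀ η ∈ Δ.nodesBuffer₃ T, η.poly (P T) = η.poly (P T'))

/-- `s` is, on the closure of `Ω`, the interpolant `I_Δ u`: on every triangle it coincides with the
local interpolant of the `C^3(Ω̄)` representative of `u`. -/
def IsInterpolant (Δ : CurvedTriangles D ι) (u s : Plane → ℝ) : Prop :=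
  ∃ (w : Plane → ℝ) (P : ι → BiPoly), IsC3Representative D.Ω u w ∧
    Δ.IsLocalInterpolants w P ∧ ∀ T, EqOn s (polyFun (P T)) (Δ.cell T)

end CurvedTriangles

end ConicSpline

/-! Two facts carry the theorem: `u` has a C³ representative up to the boundary that vanishes there,
and every local interpolant, of whatever type, has the 2-jet of this function `w` at each of its
three vertices (`jet_eq`).

Regularity. If the parallelogram with corner x and sides p₁, p₂ lies in Ω, integration by parts in
its two parameters writes a function at x as an integral, with bounded weights, of the function, its
derivatives along p₁ and p₂ and its mixed derivative (`average_eq`). For weak derivatives of `u`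
these integrals are convolutions of bounded kernels with integrable functions, hence continuous on
the whole plane (`IsWeakFamily.exists_continuous_rep`). So derivatives of order at most three have
limits at a boundary point from any set near the point on which one fixed parallelogram works. Along
an open arc it works on all of Ω, because the gradient of the conic is not zero; at a boundary
vertex there is one for each triangle (`exists_parallelogram_vert`). At a joint the limits from
different triangles agree: triangles with a common edge have the same limit, and small circles about
the joint meet ∂Ω at most twice, so the triangles cannot fall into two groups without common edges
(`exists_tendsto_joint`). Finally, the zero extension of `u` has bounded weak derivatives on the
plane, so it is Lipschitz, and every boundary point is a limit of exterior points; hence w = 0 on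
∂Ω.

Quotients. At a boundary vertex of a pie-shaped triangle `w` and q vanish on the arc and ∇q ≠ 0.
Lines in a direction in which q increases lead from the triangle back to the arc
(`exists_hitsAlong`), and the rule of L'Hôpital along them yields limits of w/q and of its gradient.
Since q is zero at the vertex, the 2-jet of pq there depends only on the 1-jet of p, and it turns
out to be that of `w` (`exists_jet_div_boundary`).

Unisolvence. The numbers of conditions are the dimensions 21, 28 and 15, so uniqueness implies
existence. A polynomial is zero if on generic lines through an interior point of the triangle it has
more zeros, with multiplicity, than its degree allows (`eq_zero_of_vanOrd_sides`). In the pie-shaped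
case the conditions first force a triple zero at c_T (`unisolvent_pie`).

Gluing. On a common edge the difference of two local interpolants has triple zeros at the endpoints,
and the remaining edge conditions annihilate it together with its gradient (`vanOrd_two_sub`). This
gives a C¹ function; common 2-jets make its gradient differentiable at all vertices. Buffer
triangles have no buffer neighbours, so they can be treated last. On a curved edge the interpolant
vanishes because of the factor q. -/

namespace ConicSpline

/-! ### Plane vectors -/

/-- The cross product of two plane vectors. -/
def cross (a b : Plane) : ℝ := a 0 * b 1 - a 1 * b 0

/-- Rotation by a right angle. -/
noncomputable def rot (d : Plane) : Plane := !₂[-d 1, d 0]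

@[simp] lemma rot_zero_coord (d : Plane) : rot d 0 = -d 1 := rfl
@[simp] lemma rot_one_coord (d : Plane) : rot d 1 = d 0 := rfl
@[simp] lemma unitVec_zero_zero : unitVec 0 0 = 1 := by simp [unitVec]
@[simp] lemma unitVec_zero_one : unitVec 0 1 = 0 := by simp [unitVec]
@[simp] lemma unitVec_one_zero : unitVec 1 0 = 0 := by simp [unitVec]
@[simp] lemma unitVec_one_one : unitVec 1 1 = 1 := by simp [unitVec]

lemma plane_ext {a b : Plane} (h0 : a 0 = b 0) (h1 : a 1 = b 1) : a = b := by
  ext i; fin_cases i <;> assumption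

lemma plane_eq (b : Plane) : b = b 0 • unitVec 0 + b 1 • unitVec 1 := by
  apply plane_ext <;> simp

lemma inner_plane (a b : Plane) : inner ℝ a b = a 0 * b 0 + a 1 * b 1 := by
  simp [PiLp.inner_apply, Fin.sum_univ_two]; ring

lemma normSq_pos_of_ne {d : Plane} (h : d ≠ 0) : 0 < d 0 * d 0 + d 1 * d 1 := by
  rw [← inner_plane]; exact real_inner_self_pos.2 h

lemma cross_rot_ne {d : Plane} (h : d ≠ 0) : cross d (rot d) ≠ 0 := by
  have := normSq_pos_of_ne h
  simp only [cross, rot_zero_coord, rot_one_coord]; nlinarith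

lemma eq_smul_rot {d τ : Plane} (hd : d ≠ 0) (h : inner ℝ τ d = 0) :
    ∃ c : ℝ, τ = c • rot d := by
  have hp := normSq_pos_of_ne hd
  rw [inner_plane] at h
  refine ⟨(τ 1 * d 0 - τ 0 * d 1) / (d 0 * d 0 + d 1 * d 1), plane_ext ?_ ?_⟩
  · simp only [PiLp.smul_apply, rot_zero_coord, smul_eq_mul]
    rw [div_mul_eq_mul_div, eq_div_iff hp.ne']; linear_combination (d 0) * h
  · simp only [PiLp.smul_apply, rot_one_coord, smul_eq_mul]
    rw [div_mul_eq_mul_div, eq_div_iff hp.ne']; linear_combination (d 1) * h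

lemma ne_of_cross_ne {a b : Plane} (h : cross a b ≠ 0) : a ≠ 0 ∧ b ≠ 0 := by
  constructor <;> rintro rfl <;> simp [cross] at h

lemma eq_smul_of_cross_eq_zero {a b : Plane} (ha : a ≠ 0) (h : cross a b = 0) :
    ∃ c : ℝ, b = c • a := by
  have hp := normSq_pos_of_ne ha
  unfold cross at h
  refine ⟨(a 0 * b 0 + a 1 * b 1) / (a 0 * a 0 + a 1 * a 1), plane_ext ?_ ?_⟩
  · simp only [PiLp.smul_apply, smul_eq_mul]
    rw [div_mul_eq_mul_div, eq_div_iff hp.ne']; linear_combination (-a 1) * h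
  · simp only [PiLp.smul_apply, smul_eq_mul]
    rw [div_mul_eq_mul_div, eq_div_iff hp.ne']; linear_combination (a 0) * h

lemma exists_coords {a b : Plane} (h : cross a b ≠ 0) (x : Plane) :
    x = (cross x b / cross a b) • a + (cross a x / cross a b) • b := by
  apply plane_ext <;> simp <;> field_simp <;> unfold cross <;> ring

lemma cross_ne_of_affineIndependent {v : Fin 3 → Plane} (h : AffineIndependent ℝ v) :
    cross (v 1 - v 0) (v 2 - v 0) ≠ 0 := by
  intro h0
  have hne : v 1 - v 0 ≠ 0 := by
    rw [sub_ne_zero]; exact fun h' => by simpa using h.injective h'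
  obtain ⟨c, hc⟩ := eq_smul_of_cross_eq_zero hne h0
  -- If v₂ - v₀ = c (v₁ - v₀), then (c - 1) v₀ - c v₁ + v₂ = 0 with weights of sum zero, the last of
  -- which is 1.
  have := (affineIndependent_iff_of_fintype (k := ℝ) (p := v)).1 h ![c - 1, -c, 1]
    (by simp [Fin.sum_univ_three]; ring) (by
      rw [Finset.weightedVSub_eq_weightedVSubOfPoint_of_sum_eq_zero _ _ _
        (by simp [Fin.sum_univ_three]; ring) (v 0)]
      simp [Fin.sum_univ_three, Finset.weightedVSubOfPoint_apply, hc]) 2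
  simp at this

/-! ### Derivatives of polynomial functions -/

/-- The directional derivative of a polynomial. -/
noncomputable def polyD (τ : Plane) (p : BiPoly) : BiPoly :=
  MvPolynomial.C (τ 0) * MvPolynomial.pderiv 0 p + MvPolynomial.C (τ 1) * MvPolynomial.pderiv 1 p

/-- The derivative of a polynomial function. -/
noncomputable def polyGrad (p : BiPoly) (x : Plane) : Plane →L[ℝ] ℝ :=
  polyFun (MvPolynomial.pderiv 0 p) x • EuclideanSpace.proj 0 +
    polyFun (MvPolynomial.pderiv 1 p) x • EuclideanSpace.proj 1

@[simp] lemma polyFun_add (p q : BiPoly) (x : Plane) :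
    polyFun (p + q) x = polyFun p x + polyFun q x := by simp [polyFun]
@[simp] lemma polyFun_sub (p q : BiPoly) (x : Plane) :
    polyFun (p - q) x = polyFun p x - polyFun q x := by simp [polyFun]
@[simp] lemma polyFun_mul (p q : BiPoly) (x : Plane) :
    polyFun (p * q) x = polyFun p x * polyFun q x := by simp [polyFun]
@[simp] lemma polyFun_C (c : ℝ) (x : Plane) : polyFun (MvPolynomial.C c) x = c := by
  simp [polyFun]
@[simp] lemma polyFun_X (i : Fin 2) (x : Plane) : polyFun (MvPolynomial.X i) x = x i := by
  simp [polyFun]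
@[simp] lemma polyFun_zero (x : Plane) : polyFun 0 x = 0 := by simp [polyFun]
@[simp] lemma polyFun_smul (c : ℝ) (p : BiPoly) (x : Plane) :
    polyFun (c • p) x = c * polyFun p x := by simp [polyFun, MvPolynomial.smul_eval]

lemma polyGrad_apply (p : BiPoly) (x τ : Plane) : polyGrad p x τ = polyFun (polyD τ p) x := by
  simp [polyGrad, polyD, mul_comm]

lemma hasFDerivAt_polyFun (p : BiPoly) (x : Plane) : HasFDerivAt (polyFun p) (polyGrad p x) x := by
  induction p using MvPolynomial.induction_on with
  | C a =>
    have : polyFun (MvPolynomial.C a) = fun _ => a := by ext; simp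
    rw [this]
    refine (hasFDerivAt_const a x).congr_fderiv ?_
    ext τ; simp [polyGrad]
  | add p q hp hq =>
    have : polyFun (p + q) = polyFun p + polyFun q := by ext; simp
    rw [this]
    refine (hp.add hq).congr_fderiv ?_
    ext τ; simp [polyGrad]; ring
  | mul_X p i hp =>
    have : polyFun (p * MvPolynomial.X i) = fun y => polyFun p y * y i := by ext; simp
    rw [this]
    have h2 : HasFDerivAt (fun y : Plane => y i) (EuclideanSpace.proj i : Plane →L[ℝ] ℝ) x :=
      (EuclideanSpace.proj i : Plane →L[ℝ] ℝ).hasFDerivAt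
    refine (hp.mul h2).congr_fderiv ?_
    ext τ
    fin_cases i <;> simp [polyGrad, MvPolynomial.pderiv_mul, MvPolynomial.pderiv_X] <;> ring

lemma fderiv_polyFun (p : BiPoly) (x : Plane) : fderiv ℝ (polyFun p) x = polyGrad p x :=
  (hasFDerivAt_polyFun p x).fderiv

lemma continuous_polyFun (p : BiPoly) : Continuous (polyFun p) :=
  continuous_iff_continuousAt.2 fun x => (hasFDerivAt_polyFun p x).continuousAt

lemma hasFDerivAt_polyGrad (p : BiPoly) (x : Plane) :
    HasFDerivAt (polyGrad p) ((polyGrad (MvPolynomial.pderiv 0 p) x).smulRight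
      (EuclideanSpace.proj 0 : Plane →L[ℝ] ℝ) + (polyGrad (MvPolynomial.pderiv 1 p) x).smulRight
      (EuclideanSpace.proj 1 : Plane →L[ℝ] ℝ)) x :=
  HasFDerivAt.add
    ((hasFDerivAt_polyFun _ x).smul_const (EuclideanSpace.proj 0 : Plane →L[ℝ] ℝ))
    ((hasFDerivAt_polyFun _ x).smul_const (EuclideanSpace.proj 1 : Plane →L[ℝ] ℝ))

lemma continuous_polyGrad (p : BiPoly) : Continuous (polyGrad p) :=
  continuous_iff_continuousAt.2 fun x => (hasFDerivAt_polyGrad p x).continuousAt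

lemma dirDeriv_polyFun (τ : Plane) (p : BiPoly) : dirDeriv τ (polyFun p) = polyFun (polyD τ p) := by
  ext x; rw [dirDeriv, fderiv_polyFun, polyGrad_apply]

lemma dirDeriv_iterate_polyFun (τ : Plane) (a : ℕ) (p : BiPoly) :
    (dirDeriv τ)^[a] (polyFun p) = polyFun ((polyD τ)^[a] p) := by
  induction a generalizing p with
  | zero => rfl
  | succ a ih => rw [Function.iterate_succ_apply, Function.iterate_succ_apply, dirDeriv_polyFun, ih]

lemma polyD_unitVec (i : Fin 2) : polyD (unitVec i) = MvPolynomial.pderiv i := by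
  ext1 p; fin_cases i <;> simp [polyD]

/-- The partial derivative of a polynomial. -/
noncomputable def partPoly (a b : ℕ) (p : BiPoly) : BiPoly :=
  (MvPolynomial.pderiv 0)^[a] ((MvPolynomial.pderiv 1)^[b] p)

lemma mixedDeriv_polyFun (a b : ℕ) (p : BiPoly) :
    mixedDeriv (unitVec 0) (unitVec 1) a b (polyFun p) = polyFun (partPoly a b p) := by
  rw [mixedDeriv, dirDeriv_iterate_polyFun, dirDeriv_iterate_polyFun, polyD_unitVec, polyD_unitVec]
  rfl

lemma pderiv_comm (p : BiPoly) (i j : Fin 2) :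
    MvPolynomial.pderiv i (MvPolynomial.pderiv j p) =
      MvPolynomial.pderiv j (MvPolynomial.pderiv i p) := by
  ext m
  simp only [MvPolynomial.coeff_pderiv]
  by_cases h : i = j
  · subst h; rfl
  · rw [add_right_comm]
    simp [Finsupp.single_apply, h, Ne.symm h]; ring

lemma partPoly_pderiv_one (a b : ℕ) (p : BiPoly) :
    partPoly a b (MvPolynomial.pderiv 1 p) = partPoly a (b + 1) p := by
  rw [partPoly, ← Function.iterate_succ_apply]; rfl

lemma partPoly_pderiv_zero (a b : ℕ) (p : BiPoly) :
    partPoly a b (MvPolynomial.pderiv 0 p) = partPoly (a + 1) b p := by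
  have : ∀ q : BiPoly, (MvPolynomial.pderiv 1)^[b] (MvPolynomial.pderiv 0 q) =
      MvPolynomial.pderiv 0 ((MvPolynomial.pderiv 1)^[b] q) := by
    induction b with
    | zero => intro q; rfl
    | succ b ih => intro q; rw [Function.iterate_succ_apply, pderiv_comm, ih]; rfl
  rw [partPoly, this, ← Function.iterate_succ_apply]; rfl

lemma partPoly_sub (a b : ℕ) (p q : BiPoly) :
    partPoly a b (p - q) = partPoly a b p - partPoly a b q := by
  unfold partPoly
  rw [iterate_map_sub, iterate_map_sub]

lemma totalDegree_pderiv_le (p : BiPoly) (i : Fin 2) :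
    (MvPolynomial.pderiv i p).totalDegree ≤ p.totalDegree - 1 := by
  rw [MvPolynomial.totalDegree, Finset.sup_le_iff]
  intro m hm
  rw [MvPolynomial.mem_support_iff, MvPolynomial.coeff_pderiv] at hm
  have : m + Finsupp.single i 1 ∈ p.support :=
    MvPolynomial.mem_support_iff.2 (left_ne_zero_of_mul hm)
  have := MvPolynomial.le_totalDegree this
  rw [Finsupp.sum_add_index' (by simp) (by simp)] at this
  simp at this
  omega

lemma totalDegree_polyD_le (τ : Plane) (p : BiPoly) :
    (polyD τ p).totalDegree ≤ p.totalDegree - 1 := by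
  refine (MvPolynomial.totalDegree_add _ _).trans (max_le ?_ ?_) <;>
  refine (MvPolynomial.totalDegree_mul _ _).trans ?_ <;>
  simpa using totalDegree_pderiv_le p _

lemma polyD_sub (τ : Plane) (p q : BiPoly) : polyD τ (p - q) = polyD τ p - polyD τ q := by
  simp [polyD]; ring

lemma polyD_smul (c : ℝ) (τ : Plane) (p : BiPoly) (x : Plane) :
    polyFun (polyD (c • τ) p) x = c * polyFun (polyD τ p) x := by
  simp [polyD]; ring

/-! ### Vanishing of order `k` at a point -/

/-- `p` vanishes at `v` to order `k`: its derivatives of order less than `k` are zero. -/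
def VanOrd (k : ℕ) (p : BiPoly) (v : Plane) : Prop :=
  ∀ a b, a + b < k → polyFun (partPoly a b p) v = 0

lemma VanOrd.mono {k l : ℕ} {p : BiPoly} {v : Plane} (h : VanOrd k p v) (hl : l ≤ k) :
    VanOrd l p v := fun a b hab => h a b (by omega)

lemma VanOrd.eval {k : ℕ} {p : BiPoly} {v : Plane} (h : VanOrd (k + 1) p v) : polyFun p v = 0 :=
  h 0 0 (by omega)

lemma VanOrd.pderiv {k : ℕ} {p : BiPoly} {v : Plane} (h : VanOrd (k + 1) p v) (i : Fin 2) :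
    VanOrd k (MvPolynomial.pderiv i p) v := by
  intro a b hab
  fin_cases i
  · exact (partPoly_pderiv_zero a b p) ▸ h (a + 1) b (by omega)
  · exact (partPoly_pderiv_one a b p) ▸ h a (b + 1) (by omega)

lemma vanOrd_succ {k : ℕ} {p : BiPoly} {v : Plane} (h : polyFun p v = 0)
    (h' : ∀ i, VanOrd k (MvPolynomial.pderiv i p) v) : VanOrd (k + 1) p v := by
  rintro (_ | a) (_ | b) hab
  · exact h
  · rw [← partPoly_pderiv_one]; exact h' 1 _ _ (by omega)
  · rw [← partPoly_pderiv_zero]; exact h' 0 _ _ (by omega)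
  · rw [← partPoly_pderiv_zero]; exact h' 0 _ _ (by omega)

lemma VanOrd.add {k : ℕ} {p q : BiPoly} {v : Plane} (h : VanOrd k p v) (h' : VanOrd k q v) :
    VanOrd k (p + q) v := by
  induction k generalizing p q with
  | zero => exact fun a b hab => absurd hab (by omega)
  | succ k ih =>
    exact vanOrd_succ (by simp [h.eval, h'.eval])
      fun i => by rw [map_add]; exact ih (h.pderiv i) (h'.pderiv i)

lemma VanOrd.C_mul {k : ℕ} {p : BiPoly} {v : Plane} (h : VanOrd k p v) (c : ℝ) :
    VanOrd k (MvPolynomial.C c * p) v := by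
  induction k generalizing p with
  | zero => exact fun a b hab => absurd hab (by omega)
  | succ k ih =>
    exact vanOrd_succ (by simp [h.eval])
      fun i => by rw [MvPolynomial.pderiv_C_mul]; exact ih (h.pderiv i)

lemma VanOrd.polyD {k : ℕ} {p : BiPoly} {v : Plane} (h : VanOrd (k + 1) p v) (τ : Plane) :
    VanOrd k (polyD τ p) v := ((h.pderiv 0).C_mul _).add ((h.pderiv 1).C_mul _)

lemma vanOrd_one {p : BiPoly} {v : Plane} (h : polyFun p v = 0) : VanOrd 1 p v :=
  vanOrd_succ h fun _ a b hab => absurd hab (by omega)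

/-- Two independent directions span the plane, so their derivatives determine both partial
derivatives. This allows edge directions in place of the coordinate axes. -/
lemma vanOrd_of_polyD {k : ℕ} {p : BiPoly} {v d e : Plane} (hde : cross d e ≠ 0)
    (h : polyFun p v = 0) (hd : VanOrd k (ConicSpline.polyD d p) v)
    (he : VanOrd k (ConicSpline.polyD e p) v) : VanOrd (k + 1) p v := by
  refine vanOrd_succ h fun i => ?_
  have key : MvPolynomial.pderiv i p =
      MvPolynomial.C (cross (unitVec i) e / cross d e) * ConicSpline.polyD d p +
      MvPolynomial.C (cross d (unitVec i) / cross d e) * ConicSpline.polyD e p := by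
    have h0 := congrFun (congrArg WithLp.ofLp (exists_coords hde (unitVec i)))
    have h1 := h0 1
    replace h0 := h0 0
    generalize cross (unitVec i) e / cross d e = s at *
    generalize cross d (unitVec i) / cross d e = t at *
    simp only [PiLp.add_apply, PiLp.smul_apply, smul_eq_mul] at h0 h1
    simp only [ConicSpline.polyD, mul_add, ← mul_assoc, ← map_mul]
    rw [show MvPolynomial.pderiv i p = MvPolynomial.C (unitVec i 0) * MvPolynomial.pderiv 0 p +
      MvPolynomial.C (unitVec i 1) * MvPolynomial.pderiv 1 p by
        rw [← polyD_unitVec]; rfl, h0, h1]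
    simp only [map_add]; ring
  rw [key]
  exact (hd.C_mul _).add (he.C_mul _)

/-! ### Restriction of polynomials to lines -/

/-- The univariate polynomial `t ↦ p (a + t b)`. -/
noncomputable def lineP (p : BiPoly) (a b : Plane) : Polynomial ℝ :=
  MvPolynomial.aeval (fun i => Polynomial.C (a i) + Polynomial.C (b i) * Polynomial.X) p

lemma eval_lineP (p : BiPoly) (a b : Plane) (t : ℝ) :
    (lineP p a b).eval t = polyFun p (a + t • b) := by
  induction p using MvPolynomial.induction_on with
  | C c => simp [lineP]
  | add p q hp hq => simp_all [lineP]
  | mul_X p i hp =>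
    rw [lineP] at hp ⊢
    rw [map_mul, Polynomial.eval_mul, hp, MvPolynomial.aeval_X]
    simp [mul_comm t]

lemma derivative_lineP (p : BiPoly) (a b : Plane) :
    Polynomial.derivative (lineP p a b) = lineP (polyD b p) a b := by
  induction p using MvPolynomial.induction_on with
  | C c => simp [lineP, polyD]
  | add p q hp hq => simp_all [lineP, polyD]; ring
  | mul_X p i hp =>
    simp only [lineP, polyD, map_add, map_mul, MvPolynomial.aeval_C, MvPolynomial.aeval_X,
      Polynomial.derivative_mul, MvPolynomial.pderiv_mul, Polynomial.algebraMap_eq] at hp ⊢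
    rw [hp]
    fin_cases i <;> simp [MvPolynomial.pderiv_X] <;> ring

lemma natDegree_lineP_le (p : BiPoly) (a b : Plane) :
    (lineP p a b).natDegree ≤ p.totalDegree := by
  rw [← mul_one p.totalDegree]
  refine MvPolynomial.aeval_natDegree_le p le_rfl _ fun i => ?_
  exact (Polynomial.natDegree_add_le _ _).trans (by
    
    rw [Polynomial.natDegree_C]
    exact max_le (by omega) ((Polynomial.natDegree_C_mul_le _ _).trans Polynomial.natDegree_X_le))

lemma VanOrd.iterate_derivative_lineP {k : ℕ} {p : BiPoly} {a b : Plane} {t : ℝ}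
    (h : VanOrd k p (a + t • b)) {i : ℕ} (hi : i < k) :
    (Polynomial.derivative^[i] (lineP p a b)).IsRoot t := by
  induction i generalizing p k with
  | zero =>
    obtain ⟨k, rfl⟩ : ∃ l, k = l + 1 := ⟨k - 1, by omega⟩
    rw [Function.iterate_zero, id, Polynomial.IsRoot, eval_lineP]; exact h.eval
  | succ i ih =>
    obtain ⟨k, rfl⟩ : ∃ l, k = l + 1 := ⟨k - 1, by omega⟩
    rw [Function.iterate_succ_apply, derivative_lineP]; exact ih (h.polyD b) (by omega)

/-- In characteristic zero, vanishing derivatives give the multiplicity of a root, and a nonzero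
polynomial has at most as many roots, with multiplicity, as its degree. -/
lemma polynomial_eq_zero_of_roots {r : Polynomial ℝ} {ι : Type*} [Fintype ι] {t : ι → ℝ}
    (ht : Function.Injective t) (μ : ι → ℕ)
    (h : ∀ k, ∀ i < μ k, (Polynomial.derivative^[i] r).IsRoot (t k))
    (hd : r.natDegree < ∑ k, μ k) : r = 0 := by
  classical
  by_contra hr
  have h1 : ∀ k, μ k ≤ r.roots.count (t k) := by
    intro k
    rcases Nat.eq_zero_or_pos (μ k) with h0 | h0
    · omega
    · rw [Polynomial.count_roots]
      have := (Polynomial.lt_rootMultiplicity_iff_isRoot_iterate_derivative (t := t k)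
        (n := μ k - 1) hr).2 (fun m hm => h k m (by omega))
      omega
  have h2 : ∑ k, r.roots.count (t k) ≤ r.roots.card := by
    rw [← Finset.sum_image (s := Finset.univ) (g := t) (f := fun x => r.roots.count x)
      (fun _ _ _ _ h => ht h)]
    calc _ ≤ ∑ x ∈ Finset.univ.image t ∪ r.roots.toFinset, r.roots.count x :=
          Finset.sum_le_sum_of_subset Finset.subset_union_left
      _ = _ := Multiset.sum_count_eq_card (fun a ha => by simp_all)
  have := Finset.sum_le_sum (s := Finset.univ) fun k _ => h1 k
  have := r.card_roots'
  omega

/-- Restriction to a line of a polynomial with zeros of high total multiplicity. -/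
lemma lineP_eq_zero {p : BiPoly} {a b : Plane} {ι : Type*} [Fintype ι] {t : ι → ℝ}
    (ht : Function.Injective t) (μ : ι → ℕ) (h : ∀ k, VanOrd (μ k) p (a + t k • b))
    (hd : p.totalDegree < ∑ k, μ k) (s : ℝ) : polyFun p (a + s • b) = 0 := by
  rw [← eval_lineP, polynomial_eq_zero_of_roots ht μ
    (fun k i hi => (h k).iterate_derivative_lineP hi)
    ((natDegree_lineP_le p a b).trans_lt hd), Polynomial.eval_zero]

lemma lineP_eq_zero_of_infinite {p : BiPoly} {a b : Plane} {S : Set ℝ} (hS : S.Infinite)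
    (h : ∀ t ∈ S, polyFun p (a + t • b) = 0) (s : ℝ) : polyFun p (a + s • b) = 0 := by
  rw [← eval_lineP, Polynomial.eq_zero_of_infinite_isRoot (lineP p a b) (hS.mono fun t ht => by
    rw [mem_ofPred_eq, Polynomial.IsRoot, eval_lineP, h t ht]), Polynomial.eval_zero]

lemma eq_zero_of_polyFun {p : BiPoly} (h : ∀ x, polyFun p x = 0) : p = 0 := by
  refine MvPolynomial.funext fun x => ?_
  simpa [polyFun] using h (WithLp.toLp 2 x)

/-! ### Gluing along edges -/

/-- Vanishing along the line includes the tangential derivative; together with the normal derivative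
this is the whole gradient. -/
lemma vanOrd_two_on_line {p : BiPoly} {a d : Plane} (hd : d ≠ 0)
    (h : ∀ t : ℝ, polyFun p (a + t • d) = 0)
    (h' : ∀ t : ℝ, polyFun (polyD (rot d) p) (a + t • d) = 0) (t : ℝ) :
    VanOrd 2 p (a + t • d) := by
  refine vanOrd_of_polyD (cross_rot_ne hd) (h t) (vanOrd_one ?_) (vanOrd_one (h' t))
  have h0 : lineP p a d = 0 := Polynomial.funext fun s => by rw [eval_lineP, h]; simp
  rw [← eval_lineP, ← derivative_lineP, h0]; simp

/-- The gluing conditions on an edge with one triangle with polynomials of degree six. -/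
lemma vanOrd_edge_six {p : BiPoly} {a d : Plane} (hd : d ≠ 0) (hp : p.totalDegree ≤ 6)
    (ha : VanOrd 3 p a) (hb : VanOrd 3 p (a + d))
    (hm : polyFun p (a + (2 / 4 : ℝ) • d) = 0)
    (h1 : polyFun (polyD (rot d) p) (a + (1 / 4 : ℝ) • d) = 0)
    (h3 : polyFun (polyD (rot d) p) (a + (3 / 4 : ℝ) • d) = 0) (t : ℝ) :
    VanOrd 2 p (a + t • d) := by
  have ha0 : a = a + (0 : ℝ) • d := by simp
  have hb0 : a + d = a + (1 : ℝ) • d := by simp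
  rw [ha0] at ha; rw [hb0] at hb
  refine vanOrd_two_on_line hd (fun s => ?_) (fun s => ?_) t
  -- The values: 3 + 3 + 1 = 7 zeros for degree six. The normal derivative below: 2 + 2 + 1 + 1 = 6
  -- zeros for degree five.
  · refine lineP_eq_zero (t := ![0, 1, 2 / 4]) ?_ ![3, 3, 1] ?_ ?_ s
    · intro i j; fin_cases i <;> fin_cases j <;> norm_num
    · intro k; fin_cases k
      · exact ha
      · exact hb
      · exact vanOrd_one hm
    · simp [Fin.sum_univ_three]; omega
  · refine lineP_eq_zero (t := ![0, 1, 1 / 4, 3 / 4]) ?_ ![2, 2, 1, 1] ?_ ?_ s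
    · intro i j; fin_cases i <;> fin_cases j <;> norm_num
    · intro k; fin_cases k
      · exact ha.polyD _
      · exact hb.polyD _
      · exact vanOrd_one h1
      · exact vanOrd_one h3
    · have := totalDegree_polyD_le (rot d) p
      simp [Fin.sum_univ_four]; omega

/-- The gluing conditions on an edge between two triangles with polynomials of degree five. -/
lemma vanOrd_edge_five {p : BiPoly} {a d : Plane} (hd : d ≠ 0) (hp : p.totalDegree ≤ 5)
    (ha : VanOrd 3 p a) (hb : VanOrd 3 p (a + d))
    (h2 : polyFun (polyD (rot d) p) (a + (2 / 4 : ℝ) • d) = 0) (t : ℝ) :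
    VanOrd 2 p (a + t • d) := by
  have ha0 : a = a + (0 : ℝ) • d := by simp
  have hb0 : a + d = a + (1 : ℝ) • d := by simp
  rw [ha0] at ha; rw [hb0] at hb
  refine vanOrd_two_on_line hd (fun s => ?_) (fun s => ?_) t
  -- The values: 3 + 3 = 6 zeros for degree five. The normal derivative below: 2 + 2 + 1 = 5 zeros
  -- for degree four.
  · refine lineP_eq_zero (t := ![0, 1]) ?_ ![3, 3] ?_ ?_ s
    · intro i j; fin_cases i <;> fin_cases j <;> norm_num
    · intro k; fin_cases k
      · exact ha
      · exact hb
    · simp; omega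
  · refine lineP_eq_zero (t := ![0, 1, 2 / 4]) ?_ ![2, 2, 1] ?_ ?_ s
    · intro i j; fin_cases i <;> fin_cases j <;> norm_num
    · intro k; fin_cases k
      · exact ha.polyD _
      · exact hb.polyD _
      · exact vanOrd_one h2
    · have := totalDegree_polyD_le (rot d) p
      simp [Fin.sum_univ_three]; omega

end ConicSpline

namespace ConicSpline

/-! ### Unisolvence -/

/-- The point with barycentric coordinates `γ` with respect to the points `v`. -/
noncomputable def bary (v : Fin 3 → Plane) (γ : Fin 3 → ℝ) : Plane := ∑ i, γ i • v i

lemma exists_bary {v : Fin 3 → Plane} (hv : cross (v 1 - v 0) (v 2 - v 0) ≠ 0) (x : Plane) :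
    ∃ γ : Fin 3 → ℝ, ∑ i, γ i = 1 ∧ x = bary v γ := by
  have := exists_coords hv (x - v 0)
  set s := cross (x - v 0) (v 2 - v 0) / cross (v 1 - v 0) (v 2 - v 0)
  set t := cross (v 1 - v 0) (x - v 0) / cross (v 1 - v 0) (v 2 - v 0)
  refine ⟨![1 - s - t, s, t], by simp [Fin.sum_univ_three]; ring, ?_⟩
  rw [sub_eq_iff_eq_add'.1 this, bary, Fin.sum_univ_three]
  simp
  module

lemma bary_add_smul (v : Fin 3 → Plane) (c β : Fin 3 → ℝ) (t : ℝ) :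
    bary v c + t • bary v β = bary v (fun i => c i + t * β i) := by
  simp only [bary, Fin.sum_univ_three]; module

/-- Each of the finitely many affine functions excludes a single ε. -/
lemma infinite_of_linear_ne {ι : Type*} [Finite ι] (A B : ι → ℝ) (hB : ∀ k, B k ≠ 0) :
    {ε : ℝ | ∀ k, A k + ε * B k ≠ 0}.Infinite := by
  refine (Set.finite_range fun k => -A k / B k).infinite_compl.mono ?_
  intro ε hε k h
  refine hε ⟨k, ?_⟩
  have := hB k
  simp only
  field_simp
  linarith

/-- A direction that is in general position with respect to the sides of a triangle, seen from the
point with barycentric coordinates `c`. -/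
def GenericDir (c β : Fin 3 → ℝ) : Prop :=
  (∀ k, β k ≠ 0) ∧ ∀ i j, i ≠ j → c i * β j - c j * β i ≠ 0

lemma exists_genericDir {c : Fin 3 → ℝ} (hc : ∀ k, 0 < c k) :
    ∃ β, ∑ i, β i = 0 ∧ GenericDir c β := by
  have h0 := hc 0
  have h1 := hc 1
  have h2 := hc 2
  -- For β = (-1 - s, 1, s) the five affine functions of s are -β₀, β₂ and the three minors c₀β₁ -
  -- c₁β₀, c₀β₂ - c₂β₀, c₁β₂ - c₂β₁.
  obtain ⟨s, hs⟩ := (infinite_of_linear_ne ![1, 0, c 0 + c 1, c 2, - c 2]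
    ![1, 1, c 1, c 0 + c 2, c 1] (by intro k; fin_cases k <;> simp <;> positivity)).nonempty
  have a0 := hs 0
  have a1 := hs 1
  have a2 := hs 2
  have a3 := hs 3
  have a4 := hs 4
  simp at a0 a1 a2 a3 a4
  refine ⟨![-1 - s, 1, s], by simp [Fin.sum_univ_three]; ring, fun k => ?_, fun i j hij => ?_⟩
  · fin_cases k
    · exact fun h => a0 (by simp at h; linarith)
    · simp
    · exact a1
  · fin_cases i <;> fin_cases j <;> simp at hij ⊢
    · exact fun h => a2 (by linarith)
    · exact fun h => a3 (by linarith)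
    · exact fun h => a2 (by linarith)
    · exact fun h => a4 (by linarith)
    · exact fun h => a3 (by linarith)
    · exact fun h => a4 (by linarith)

/-- A polynomial that vanishes to high order on some sides of a triangle and at a point of its
interior is zero. -/
theorem eq_zero_of_vanOrd_sides {p : BiPoly} {v : Fin 3 → Plane}
    (hv : cross (v 1 - v 0) (v 2 - v 0) ≠ 0) {c : Fin 3 → ℝ} (hc : ∀ k, 0 < c k)
    (hc1 : ∑ i, c i = 1) (K : Finset (Fin 3)) (μ μ₀ : ℕ)
    (hline : ∀ k ∈ K, ∀ γ : Fin 3 → ℝ, ∑ i, γ i = 1 → γ k = 0 → VanOrd μ p (bary v γ))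
    (hpt : VanOrd μ₀ p (bary v c)) (hd : p.totalDegree < μ₀ + K.card * μ) : p = 0 := by
  have main : ∀ β, ∑ i, β i = 0 → GenericDir c β → ∀ s : ℝ,
      polyFun p (bary v c + s • bary v β) = 0 := by
    intro β hβ hg s
    -- The line meets the side γ_k = 0 at the parameter -c_k/β_k. These parameters are nonzero and
    -- distinct by genericity, so the zeros on the sides in `K` and the zero at the point `c` add
    -- up.
    refine lineP_eq_zero (ι := Option K) (t := fun o => o.elim 0 fun k => -c k / β k) ?_
      (fun o => o.elim μ₀ fun _ => μ) ?_ ?_ s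
    · rintro (_ | ⟨i, hi⟩) (_ | ⟨j, hj⟩) h
      · rfl
      · exact absurd h.symm (div_ne_zero (neg_ne_zero.2 (hc j).ne') (hg.1 j))
      · exact absurd h (div_ne_zero (neg_ne_zero.2 (hc i).ne') (hg.1 i))
      · by_contra hij
        have hij' : i ≠ j := fun h' => hij (by subst h'; rfl)
        have hi := hg.1 i
        have hj := hg.1 j
        refine hg.2 i j hij' ?_
        simp only [Option.elim_some] at h
        field_simp at h
        linarith
    · rintro (_ | ⟨k, hk⟩)
      · simpa using hpt
      · simp only [Option.elim_some]
        rw [bary_add_smul]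
        refine hline k hk _ ?_ ?_
        · rw [Finset.sum_add_distrib, ← Finset.mul_sum, hβ, hc1]; simp
        · have := hg.1 k
          field_simp; simp
    · simpa [Fintype.sum_option] using hd
  obtain ⟨β₀, hβ₀, hg₀⟩ := exists_genericDir hc
  refine eq_zero_of_polyFun fun x => ?_
  obtain ⟨γ, hγ, rfl⟩ := exists_bary hv x
  -- For an arbitrary point x move along x + εβ₀: for all but finitely many ε the direction from `c`
  -- to this point is generic and `p` vanishes there. A polynomial in ε with infinitely many zeros
  -- also vanishes at ε = 0.
  have hinf := infinite_of_linear_ne (ι := Fin 3 ⊕ {x : Fin 3 × Fin 3 // x.1 ≠ x.2})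
    (Sum.elim (fun k => γ k - c k)
      (fun x => c x.1.1 * (γ x.1.2 - c x.1.2) - c x.1.2 * (γ x.1.1 - c x.1.1)))
    (Sum.elim β₀ (fun x => c x.1.1 * β₀ x.1.2 - c x.1.2 * β₀ x.1.1)) (by
      rintro (k | x)
      · exact hg₀.1 k
      · exact hg₀.2 _ _ x.2)
  have := lineP_eq_zero_of_infinite (p := p) (a := bary v γ) (b := bary v β₀) hinf
    (fun ε hε => by
      have := main (fun i => (γ i - c i) + ε * β₀ i) (by
        rw [Finset.sum_add_distrib, ← Finset.mul_sum, hβ₀, Finset.sum_sub_distrib, hγ, hc1]; simp)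
        ⟨fun k => hε (Sum.inl k), fun i j hij => by
          have := hε (Sum.inr ⟨(i, j), hij⟩)
          simp only [Sum.elim_inr] at this
          intro h; exact this (by linarith)⟩ 1
      rw [bary_add_smul] at this ⊢
      rw [← this]; congr 2; ext i; ring) 0
  simpa using this

/-- The edge vector opposite to the vertex `k`. -/
def sideVec (v : Fin 3 → Plane) (k : Fin 3) : Plane := v (k + 2) - v (k + 1)

lemma sideVec_ne {v : Fin 3 → Plane} (hv : cross (v 1 - v 0) (v 2 - v 0) ≠ 0) (k : Fin 3) :
    sideVec v k ≠ 0 := by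
  intro h
  apply hv
  fin_cases k
  · have : v 2 = v 1 := sub_eq_zero.1 h
    simp [this, cross]; ring
  · have : v 0 = v 2 := sub_eq_zero.1 h
    simp [this, cross]
  · have : v 1 = v 0 := sub_eq_zero.1 h
    simp [this, cross]

lemma bary_side {v : Fin 3 → Plane} {γ : Fin 3 → ℝ} (hγ : ∑ i, γ i = 1) {k : Fin 3}
    (hk : γ k = 0) : bary v γ = v (k + 1) + γ (k + 2) • sideVec v k := by
  rw [Fin.sum_univ_three] at hγ
  rw [bary, Fin.sum_univ_three, sideVec]
  fin_cases k
  · have h : γ 0 = 0 := hk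
    have : γ 1 = 1 - γ 2 := by linarith
    change _ = v 1 + γ 2 • (v 2 - v 1)
    rw [h, this]; module
  · have h : γ 1 = 0 := hk
    have : γ 2 = 1 - γ 0 := by linarith
    change _ = v 2 + γ 0 • (v 0 - v 2)
    rw [h, this]; module
  · have h : γ 2 = 0 := hk
    have : γ 0 = 1 - γ 1 := by linarith
    change _ = v 0 + γ 1 • (v 1 - v 0)
    rw [h, this]; module

lemma add_sideVec (v : Fin 3 → Plane) (k : Fin 3) : v (k + 1) + sideVec v k = v (k + 2) := by
  simp [sideVec]

/-- The conditions give double zeros on all three sides, which is 3 · 2 = 6 zeros on generic lines,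
against degree five; no condition at an interior point is needed. -/
theorem unisolvent_argyris {p : BiPoly} {v : Fin 3 → Plane}
    (hv : cross (v 1 - v 0) (v 2 - v 0) ≠ 0) (hp : p.totalDegree ≤ 5)
    (hJ : ∀ i, VanOrd 3 p (v i))
    (hN : ∀ k, polyFun (polyD (rot (sideVec v k)) p) (v (k + 1) + (2 / 4 : ℝ) • sideVec v k) = 0) :
    p = 0 := by
  refine eq_zero_of_vanOrd_sides hv (c := fun _ => 1 / 3) (by intro; norm_num)
    (by norm_num) Finset.univ 2 0 ?_ (fun a b hab => absurd hab (by omega))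
    (by simp; omega)
  intro k _ γ hγ hk
  rw [bary_side hγ hk]
  exact vanOrd_edge_five (sideVec_ne hv k) hp (hJ _) (by rw [add_sideVec]; exact hJ _) (hN k) _

/-- Double zeros on three sides give only six zeros, against degree six. The value at the barycenter
supplies the seventh. -/
theorem unisolvent_buffer {p : BiPoly} {v : Fin 3 → Plane}
    (hv : cross (v 1 - v 0) (v 2 - v 0) ≠ 0) (hp : p.totalDegree ≤ 6)
    (hJ : ∀ i, VanOrd 3 p (v i))
    (hM : ∀ k, polyFun p (v (k + 1) + (2 / 4 : ℝ) • sideVec v k) = 0)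
    (h1 : ∀ k, polyFun (polyD (rot (sideVec v k)) p) (v (k + 1) + (1 / 4 : ℝ) • sideVec v k) = 0)
    (h3 : ∀ k, polyFun (polyD (rot (sideVec v k)) p) (v (k + 1) + (3 / 4 : ℝ) • sideVec v k) = 0)
    (hc : polyFun p ((1 / 3 : ℝ) • (v 0 + v 1 + v 2)) = 0) :
    p = 0 := by
  refine eq_zero_of_vanOrd_sides hv (c := fun _ => 1 / 3) (by intro; norm_num)
    (by norm_num) Finset.univ 2 1 ?_ (vanOrd_one ?_) (by simp; omega)
  · intro k _ γ hγ hk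
    rw [bary_side hγ hk]
    exact vanOrd_edge_six (sideVec_ne hv k) hp (hJ _) (by rw [add_sideVec]; exact hJ _)
      (hM k) (h1 k) (h3 k) _
  · rw [← hc]; congr 1
    simp only [bary, Fin.sum_univ_three]; module

lemma polyD_comm (σ τ : Plane) (p : BiPoly) : polyD σ (polyD τ p) = polyD τ (polyD σ p) := by
  simp only [polyD, map_add, MvPolynomial.pderiv_C_mul, pderiv_comm p 0 1]
  ring

lemma polyD_add_left (σ τ : Plane) (p : BiPoly) : polyD (σ + τ) p = polyD σ p + polyD τ p := by
  simp [polyD]; ring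

lemma polyD_smul_left (c : ℝ) (τ : Plane) (p : BiPoly) :
    polyD (c • τ) p = MvPolynomial.C c * polyD τ p := by
  simp [polyD]; ring

lemma polyD_add (τ : Plane) (p q : BiPoly) : polyD τ (p + q) = polyD τ p + polyD τ q := by
  simp [polyD]; ring

lemma polyD_C_mul (c : ℝ) (τ : Plane) (p : BiPoly) :
    polyD τ (MvPolynomial.C c * p) = MvPolynomial.C c * polyD τ p := by
  simp [polyD, MvPolynomial.pderiv_C_mul]; ring

/-- The quartic vanishes on the lines of the two straight edges, and along each line from the
interior node to a vertex. The second derivative at the node is thus a quadratic form in two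
variables with three pairwise independent isotropic directions, so it is zero. The triple zero and
one zero on each of the two lines make five. -/
theorem unisolvent_pie {p : BiPoly} {v : Fin 3 → Plane}
    (hv : cross (v 1 - v 0) (v 2 - v 0) ≠ 0) (hp : p.totalDegree ≤ 4) {c : Fin 3 → ℝ}
    (hc : ∀ k, 0 < c k) (hc1 : ∑ i, c i = 1)
    (h0 : VanOrd 3 p (v 0)) (h1 : VanOrd 2 p (v 1)) (h2 : VanOrd 2 p (v 2))
    (hcc : VanOrd 2 p (bary v c)) : p = 0 := by
  have line2 : ∀ t : ℝ, polyFun p (v 0 + t • (v 1 - v 0)) = 0 := fun t =>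
    lineP_eq_zero (t := ![0, 1]) (by intro i j; fin_cases i <;> fin_cases j <;> norm_num) ![3, 2]
      (by intro k; fin_cases k <;> simpa) (by simp; omega) t
  have line1 : ∀ t : ℝ, polyFun p (v 0 + t • (v 2 - v 0)) = 0 := fun t =>
    lineP_eq_zero (t := ![0, 1]) (by intro i j; fin_cases i <;> fin_cases j <;> norm_num) ![3, 2]
      (by intro k; fin_cases k <;> simpa) (by simp; omega) t
  have c0 := hc 0
  have c1 := hc 1
  have c2 := hc 2
  have hside : ∀ k ∈ ({1, 2} : Finset (Fin 3)), ∀ γ : Fin 3 → ℝ, ∑ i, γ i = 1 → γ k = 0 →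
      VanOrd 1 p (bary v γ) := by
    intro k hk γ hγ hγk
    refine vanOrd_one ?_
    rw [Fin.sum_univ_three] at hγ
    simp at hk
    rcases hk with rfl | rfl
    · rw [← line1 (γ 2)]; congr 1
      have : γ 0 = 1 - γ 2 := by linarith
      rw [bary, Fin.sum_univ_three, hγk, this]; module
    · rw [← line2 (γ 1)]; congr 1
      have : γ 0 = 1 - γ 1 := by linarith
      rw [bary, Fin.sum_univ_three, hγk, this]; module
  set z := bary v c with hz
  have hc0 : c 0 = 1 - c 1 - c 2 := by rw [Fin.sum_univ_three] at hc1; linarith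
  have second : ∀ {b : Plane}, (∀ t : ℝ, polyFun p (z + t • b) = 0) →
      polyFun (polyD b (polyD b p)) z = 0 := by
    intro b hb
    have h0 : lineP p z b = 0 := Polynomial.funext fun s => by rw [eval_lineP, hb]; simp
    have := eval_lineP (polyD b (polyD b p)) z b 0
    rw [← derivative_lineP, ← derivative_lineP, h0] at this
    simpa using this.symm
  -- Zeros of multiplicity 2 at the node and 3 at `v 0`, for degree four.
  have q0 := second (b := v 0 - z) fun t =>
    lineP_eq_zero (t := ![0, 1]) (by intro i j; fin_cases i <;> fin_cases j <;> norm_num) ![2, 3]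
      (by intro k; fin_cases k <;> simpa) (by simp; omega) t
  -- Multiplicities 2 at the node and 2 at the vertex leave one zero missing; it is where the line
  -- meets the opposite side, which is a straight edge for `k = 1` and `k = 2`.
  have spoke : ∀ k ∈ ({1, 2} : Finset (Fin 3)), VanOrd 2 p (v k) → ∀ t : ℝ,
      polyFun p (z + t • (v k - z)) = 0 := by
    intro k hk hvk t
    have hck : 0 < c k := hc k
    have hck1 : 1 - c k ≠ 0 := by
      simp at hk
      rcases hk with rfl | rfl <;> linarith
    have hsum : ∑ i, ((Pi.single k 1 : Fin 3 → ℝ) i - c i) = 0 := by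
      rw [Finset.sum_sub_distrib, hc1]; simp
    have hb : v k - z = bary v (fun i => (Pi.single k 1 : Fin 3 → ℝ) i - c i) := by
      simp [bary, hz, sub_smul, Finset.sum_sub_distrib, Pi.single_apply]
    refine lineP_eq_zero (t := ![0, 1, -c k / (1 - c k)]) ?_ ![2, 2, 1] ?_
      (by simp [Fin.sum_univ_three]; omega) t
    · have h0 : -c k / (1 - c k) ≠ 0 := div_ne_zero (neg_ne_zero.2 hck.ne') hck1
      have h1 : -c k / (1 - c k) ≠ 1 := by
        rw [Ne, div_eq_one_iff_eq hck1]; linarith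
      intro i j
      fin_cases i <;> fin_cases j <;> simp [h0, h1, h0.symm, h1.symm]
    · intro l; fin_cases l
      · simpa
      · simpa
      · have := hside k hk (fun i => c i + (-c k / (1 - c k)) * ((Pi.single k 1 : Fin 3 → ℝ) i - c i))
          (by rw [Finset.sum_add_distrib, ← Finset.mul_sum, hc1, hsum]; simp)
          (by simp; field_simp; ring)
        rw [← bary_add_smul, ← hb] at this
        exact this
  have q1 := second (b := v 1 - z) (spoke 1 (by simp) h1)
  have q2 := second (b := v 2 - z) (spoke 2 (by simp) h2)
  -- the second derivative is a quadratic form with three zeros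
  have hrel : v 0 - z = (-c 1 / c 0) • (v 1 - z) + (-c 2 / c 0) • (v 2 - z) := by
    have : c 0 • (v 0 - z) = -c 1 • (v 1 - z) + -c 2 • (v 2 - z) := by
      have e : z = c 0 • z + c 1 • z + c 2 • z := by rw [hc0]; module
      have e2 : z = c 0 • v 0 + c 1 • v 1 + c 2 • v 2 := by rw [hz, bary, Fin.sum_univ_three]
      have e3 := e.symm.trans e2
      have : c 0 • (v 0 - z) - (-c 1 • (v 1 - z) + -c 2 • (v 2 - z)) =
        (c 0 • v 0 + c 1 • v 1 + c 2 • v 2) - (c 0 • z + c 1 • z + c 2 • z) := by module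
      rw [← sub_eq_zero, this, ← e3, sub_self]
    rw [← inv_smul_smul₀ c0.ne' (v 0 - z), this]
    simp only [smul_add, smul_smul]
    congr 2 <;> field_simp
  -- Expanding the form at v₀ - z in terms of v₁ - z and v₂ - z leaves only the mixed term, whose
  -- coefficient 2c₁c₂/c₀² is positive.
  have q12 : polyFun (polyD (v 1 - z) (polyD (v 2 - z) p)) z = 0 := by
    rw [hrel] at q0
    simp only [polyD_add_left, polyD_smul_left, polyD_add, polyD_C_mul, polyFun_add, polyFun_mul,
      polyFun_C, q1, q2] at q0
    rw [polyD_comm (v 2 - z) (v 1 - z)] at q0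
    have : 2 * (c 1 * c 2 / (c 0 * c 0)) * polyFun (polyD (v 1 - z) (polyD (v 2 - z) p)) z = 0 := by
      rw [← q0]; field_simp; ring
    rcases mul_eq_zero.1 this with h | h
    · exact absurd h (by positivity)
    · exact h
  have hcr : cross (v 1 - z) (v 2 - z) ≠ 0 := by
    have : cross (v 1 - z) (v 2 - z) = c 0 * cross (v 1 - v 0) (v 2 - v 0) := by
      rw [hz, bary, Fin.sum_univ_three]
      simp only [cross, PiLp.sub_apply, PiLp.add_apply, PiLp.smul_apply, smul_eq_mul, hc0]
      ring
    rw [this]; exact mul_ne_zero c0.ne' hv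
  have h3 : VanOrd 3 p z := by
    refine vanOrd_of_polyD hcr hcc.eval
      (vanOrd_of_polyD hcr (hcc.polyD _).eval (vanOrd_one q1) (vanOrd_one ?_))
      (vanOrd_of_polyD hcr (hcc.polyD _).eval (vanOrd_one q12) (vanOrd_one q2))
    rw [polyD_comm]; exact q12
  exact eq_zero_of_vanOrd_sides hv hc hc1 {1, 2} 1 3 hside h3 (by simp; omega)

/-! ### Existence of interpolating polynomials -/

/-- The exponents of the monomials of degree at most `d`. -/
abbrev MonoIdx (d : ℕ) : Type := {x : Fin (d + 1) × Fin (d + 1) // x.1.val + x.2.val ≤ d}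

/-- The exponent belonging to an index. -/
noncomputable def expo {d : ℕ} (x : MonoIdx d) : Fin 2 →₀ ℕ :=
  Finsupp.single 0 x.1.1.val + Finsupp.single 1 x.1.2.val

lemma expo_injective {d : ℕ} : Function.Injective (expo (d := d)) := by
  intro x y h
  have h0 := DFunLike.congr_fun h 0
  have h1 := DFunLike.congr_fun h 1
  simp [expo] at h0 h1
  exact Subtype.ext (Prod.ext (Fin.ext h0) (Fin.ext h1))

/-- The polynomial with given coefficients. -/
noncomputable def ofCoeffs (d : ℕ) : (MonoIdx d → ℝ) →ₗ[ℝ] BiPoly where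
  toFun c := ∑ x, MvPolynomial.monomial (expo x) (c x)
  map_add' c c' := by simp [Finset.sum_add_distrib]
  map_smul' r c := by simp [Finset.smul_sum, MvPolynomial.smul_monomial]

lemma ofCoeffs_injective (d : ℕ) : Function.Injective (ofCoeffs d) := by
  rw [← LinearMap.ker_eq_bot, LinearMap.ker_eq_bot']
  intro c hc
  ext y
  have := congrArg (MvPolynomial.coeff (expo y)) hc
  simpa [ofCoeffs, MvPolynomial.coeff_sum, MvPolynomial.coeff_monomial, expo_injective.eq_iff]
    using this

lemma totalDegree_ofCoeffs_le (d : ℕ) (c : MonoIdx d → ℝ) : (ofCoeffs d c).totalDegree ≤ d := by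
  refine MvPolynomial.totalDegree_finsetSum_le fun x _ => ?_
  refine (MvPolynomial.totalDegree_monomial_le _ _).trans ?_
  rw [expo, Finsupp.sum_add_index' (by simp) (by simp)]
  simpa using x.2

/-- With as many conditions as monomials the linear system is square, so injectivity implies
surjectivity. -/
theorem exists_interpolant (d : ℕ) {κ : Type*} [Fintype κ]
    (hcard : Fintype.card κ = Fintype.card (MonoIdx d)) (F : κ → BiPoly → ℝ)
    (hF : ∀ k, IsLinearMap ℝ (F k))
    (hinj : ∀ p : BiPoly, p.totalDegree ≤ d → (∀ k, F k p = 0) → p = 0) (y : κ → ℝ) :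
    ∃ p : BiPoly, p.totalDegree ≤ d ∧ ∀ k, F k p = y k := by
  let L : (MonoIdx d → ℝ) →ₗ[ℝ] (κ → ℝ) :=
    (LinearMap.pi fun k => (hF k).mk' (F k)) ∘ₗ ofCoeffs d
  have hL : Function.Injective L := by
    rw [← LinearMap.ker_eq_bot, LinearMap.ker_eq_bot']
    intro c hc
    refine ofCoeffs_injective d ?_
    rw [map_zero]
    exact hinj _ (totalDegree_ofCoeffs_le d c) fun k => congrFun hc k
  have hS := (LinearMap.injective_iff_surjective_of_finrank_eq_finrank (by simp [hcard])).1 hL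
  obtain ⟨c, hc⟩ := hS y
  exact ⟨ofCoeffs d c, totalDegree_ofCoeffs_le d c, fun k => congrFun hc k⟩

lemma isLinearMap_partPoly (a b : ℕ) (v : Plane) :
    IsLinearMap ℝ fun p : BiPoly => polyFun (partPoly a b p) v := by
  constructor
  · intro p q; simp only [partPoly, iterate_map_add, polyFun_add]
  · intro c p
    have : ∀ (i : Fin 2) (n : ℕ) (q : BiPoly), (MvPolynomial.pderiv i)^[n] (c • q) =
        c • (MvPolynomial.pderiv i)^[n] q := by
      intro i n
      induction n with
      | zero => intro q; rfl
      | succ n ih =>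
        intro q; rw [Function.iterate_succ_apply, Derivation.map_smul, ih]; rfl
    simp only [partPoly, this, polyFun_smul, smul_eq_mul]

lemma isLinearMap_polyD (τ v : Plane) : IsLinearMap ℝ fun p : BiPoly => polyFun (polyD τ p) v := by
  constructor
  · intro p q; rw [polyD_add, polyFun_add]
  · intro c p; simp [polyD]; ring

/-- The exponents of the derivatives of order less than `k`. -/
abbrev JetIdx (k : ℕ) : Type := {x : Fin k × Fin k // x.1.val + x.2.val < k}

/-- The index of a derivative. -/
def jetIdx {k a b : ℕ} (h : a + b < k) : JetIdx k := ⟨(⟨a, by omega⟩, ⟨b, by omega⟩), h⟩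

theorem exists_argyris {v : Fin 3 → Plane} (hv : cross (v 1 - v 0) (v 2 - v 0) ≠ 0)
    (J : Fin 3 → ℕ → ℕ → ℝ) (N : Fin 3 → ℝ) :
    ∃ p : BiPoly, p.totalDegree ≤ 5 ∧
      (∀ i a b, a + b < 3 → polyFun (partPoly a b p) (v i) = J i a b) ∧
      ∀ k, polyFun (polyD (rot (sideVec v k)) p) (v (k + 1) + (2 / 4 : ℝ) • sideVec v k) = N k := by
  -- 3 · 6 + 3 = 21, the dimension of ℙ₅.
  obtain ⟨p, hp, h⟩ := exists_interpolant 5 (κ := (Fin 3 × JetIdx 3) ⊕ Fin 3) (by decide)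
    (Sum.elim (fun x p => polyFun (partPoly x.2.1.1 x.2.1.2 p) (v x.1))
      (fun k p => polyFun (polyD (rot (sideVec v k)) p) (v (k + 1) + (2 / 4 : ℝ) • sideVec v k)))
    (by
      rintro (x | k)
      · exact isLinearMap_partPoly _ _ _
      · exact isLinearMap_polyD _ _)
    (fun p hp h => unisolvent_argyris hv hp
      (fun i a b hab => h (Sum.inl (i, jetIdx hab))) (fun k => h (Sum.inr k)))
    (Sum.elim (fun x => J x.1 x.2.1.1 x.2.1.2) N)
  exact ⟨p, hp, fun i a b hab => h (Sum.inl (i, jetIdx hab)), fun k => h (Sum.inr k)⟩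

theorem exists_buffer {v : Fin 3 → Plane} (hv : cross (v 1 - v 0) (v 2 - v 0) ≠ 0)
    (J : Fin 3 → ℕ → ℕ → ℝ) (M N₁ N₃ : Fin 3 → ℝ) (c : ℝ) :
    ∃ p : BiPoly, p.totalDegree ≤ 6 ∧
      (∀ i a b, a + b < 3 → polyFun (partPoly a b p) (v i) = J i a b) ∧
      (∀ k, polyFun p (v (k + 1) + (2 / 4 : ℝ) • sideVec v k) = M k) ∧
      (∀ k, polyFun (polyD (rot (sideVec v k)) p) (v (k + 1) + (1 / 4 : ℝ) • sideVec v k) = N₁ k) ∧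
      (∀ k, polyFun (polyD (rot (sideVec v k)) p) (v (k + 1) + (3 / 4 : ℝ) • sideVec v k) = N₃ k) ∧
      polyFun p ((1 / 3 : ℝ) • (v 0 + v 1 + v 2)) = c := by
  -- 3 · 6 + 3 · 3 + 1 = 28, the dimension of ℙ₆.
  obtain ⟨p, hp, h⟩ := exists_interpolant 6
    (κ := (Fin 3 × JetIdx 3) ⊕ (Fin 3 ⊕ Fin 3 ⊕ Fin 3 ⊕ Unit)) (by decide)
    (Sum.elim (fun x p => polyFun (partPoly x.2.1.1 x.2.1.2 p) (v x.1))
      (Sum.elim (fun k p => polyFun p (v (k + 1) + (2 / 4 : ℝ) • sideVec v k))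
      (Sum.elim (fun k p => polyFun (polyD (rot (sideVec v k)) p)
        (v (k + 1) + (1 / 4 : ℝ) • sideVec v k))
      (Sum.elim (fun k p => polyFun (polyD (rot (sideVec v k)) p)
        (v (k + 1) + (3 / 4 : ℝ) • sideVec v k))
      (fun _ p => polyFun p ((1 / 3 : ℝ) • (v 0 + v 1 + v 2)))))))
    (by
      rintro (x | k | k | k | k)
      · exact isLinearMap_partPoly _ _ _
      · exact isLinearMap_partPoly 0 0 _
      · exact isLinearMap_polyD _ _
      · exact isLinearMap_polyD _ _
      · exact isLinearMap_partPoly 0 0 _)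
    (fun p hp h => unisolvent_buffer hv hp
      (fun i a b hab => h (Sum.inl (i, jetIdx hab))) (fun k => h (Sum.inr (Sum.inl k)))
      (fun k => h (Sum.inr (Sum.inr (Sum.inl k)))) (fun k => h (Sum.inr (Sum.inr (Sum.inr (Sum.inl k)))))
      (h (Sum.inr (Sum.inr (Sum.inr (Sum.inr ()))))))
    (Sum.elim (fun x => J x.1 x.2.1.1 x.2.1.2)
      (Sum.elim M (Sum.elim N₁ (Sum.elim N₃ fun _ => c))))
  exact ⟨p, hp, fun i a b hab => h (Sum.inl (i, jetIdx hab)), fun k => h (Sum.inr (Sum.inl k)),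
    fun k => h (Sum.inr (Sum.inr (Sum.inl k))), fun k => h (Sum.inr (Sum.inr (Sum.inr (Sum.inl k)))),
    h (Sum.inr (Sum.inr (Sum.inr (Sum.inr ()))))⟩

theorem exists_pie {v : Fin 3 → Plane} (hv : cross (v 1 - v 0) (v 2 - v 0) ≠ 0)
    {c : Fin 3 → ℝ} (hc : ∀ k, 0 < c k) (hc1 : ∑ i, c i = 1) (J₀ : ℕ → ℕ → ℝ)
    (J : Fin 3 → ℕ → ℕ → ℝ) :
    ∃ p : BiPoly, p.totalDegree ≤ 4 ∧
      (∀ a b, a + b < 3 → polyFun (partPoly a b p) (v 0) = J₀ a b) ∧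
      ∀ k a b, a + b < 2 → polyFun (partPoly a b p) (![bary v c, v 1, v 2] k) = J k a b := by
  -- 6 + 3 · 3 = 15, the dimension of ℙ₄. The nodes with 1-jets are listed with the interior node
  -- first.
  obtain ⟨p, hp, h⟩ := exists_interpolant 4 (κ := JetIdx 3 ⊕ (Fin 3 × JetIdx 2)) (by decide)
    (Sum.elim (fun x p => polyFun (partPoly x.1.1 x.1.2 p) (v 0))
      (fun x p => polyFun (partPoly x.2.1.1 x.2.1.2 p) (![bary v c, v 1, v 2] x.1)))
    (by rintro (x | k) <;> exact isLinearMap_partPoly _ _ _)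
    (fun p hp h => unisolvent_pie hv hp hc hc1 (fun a b hab => h (Sum.inl (jetIdx hab)))
      (fun a b hab => h (Sum.inr (1, jetIdx hab)))
      (fun a b hab => h (Sum.inr (2, jetIdx hab)))
      (fun a b hab => h (Sum.inr (0, jetIdx hab))))
    (Sum.elim (fun x => J₀ x.1.1 x.1.2) (fun x => J x.1 x.2.1.1 x.2.1.2))
  exact ⟨p, hp, fun a b hab => h (Sum.inl (jetIdx hab)),
    fun k a b hab => h (Sum.inr (k, jetIdx hab))⟩

end ConicSpline

namespace ConicSpline

/-! ### Conics -/

lemma polyFun_taylor_two {q : BiPoly} (hq : q.totalDegree ≤ 2) (x h : Plane) :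
    polyFun q (x + h) = polyFun q x + polyFun (polyD h q) x +
      polyFun (polyD h (polyD h q)) x / 2 := by
  have hd : (lineP q x h).natDegree < 3 := by have := natDegree_lineP_le q x h; omega
  have e0 := eval_lineP q x h 0
  have e1 := eval_lineP (polyD h q) x h 0
  have e2 := eval_lineP (polyD h (polyD h q)) x h 0
  have e3 := eval_lineP q x h 1
  rw [← derivative_lineP, ← derivative_lineP] at e2
  rw [← derivative_lineP] at e1
  rw [← Polynomial.coeff_zero_eq_eval_zero] at e0 e1 e2
  simp only [Polynomial.coeff_derivative] at e1 e2
  rw [Polynomial.eval_eq_sum_range' hd] at e3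
  simp [Finset.sum_range_succ] at e0 e1 e2 e3
  rw [← e3, ← e0, ← e1, ← e2]; ring

lemma polyFun_const_of_totalDegree {p : BiPoly} (hp : p.totalDegree = 0) (x y : Plane) :
    polyFun p x = polyFun p y := by
  rw [MvPolynomial.totalDegree_eq_zero_iff_eq_C.1 hp]; simp

lemma polyD_polyD_const {q : BiPoly} (hq : q.totalDegree ≤ 2) (a b x y : Plane) :
    polyFun (polyD a (polyD b q)) x = polyFun (polyD a (polyD b q)) y := by
  have h1 := totalDegree_polyD_le a (polyD b q)
  have h2 := totalDegree_polyD_le b q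
  exact polyFun_const_of_totalDegree (by omega) x y

lemma polyFun_isUnit {p : BiPoly} (hp : IsUnit p) (x : Plane) : polyFun p x ≠ 0 :=
  (hp.map (MvPolynomial.eval fun i => x i)).ne_zero

/-- An irreducible conic contains only finitely many points of a line. -/
lemma conic_not_infinite_line {q : BiPoly} (hi : Irreducible q) (hq : q.totalDegree = 2)
    {a b : Plane} (hb : b ≠ 0) {S : Set ℝ} (hS : S.Infinite)
    (h : ∀ t ∈ S, polyFun q (a + t • b) = 0) : False := by
  have hl := lineP_eq_zero_of_infinite hS h
  have hD := cross_rot_ne hb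
  set D := cross b (rot b) with hDdef
  set κ := polyFun (polyD (rot b) (polyD (rot b) q)) a with hκ
  -- The value of `l₁` at x = a + t b + s rot b is s, so `l₁` is the equation of the line.
  let l₁ : BiPoly := MvPolynomial.C (1 / D) * (MvPolynomial.C (b 0) *
    (MvPolynomial.X 1 - MvPolynomial.C (a 1)) - MvPolynomial.C (b 1) *
    (MvPolynomial.X 0 - MvPolynomial.C (a 0)))
  have hl₁ : ∀ x, polyFun l₁ x = cross b (x - a) / D := by
    intro x; simp [l₁, cross]; ring
  have hdeg : l₁.totalDegree ≤ 1 := by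
    have e : l₁ = MvPolynomial.C (b 0 / D) * MvPolynomial.X 1 +
        MvPolynomial.C (-b 1 / D) * MvPolynomial.X 0 +
        MvPolynomial.C ((b 1 * a 0 - b 0 * a 1) / D) := by
      apply sub_eq_zero.1; apply eq_zero_of_polyFun; intro x
      simp only [l₁, polyFun_sub, polyFun_add, polyFun_mul, polyFun_C, polyFun_X]; ring
    rw [e]
    refine (MvPolynomial.totalDegree_add _ _).trans (max_le ?_
      (by rw [MvPolynomial.totalDegree_C]; exact Nat.zero_le _))
    refine (MvPolynomial.totalDegree_add _ _).trans (max_le ?_ ?_) <;>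
    exact (MvPolynomial.totalDegree_mul _ _).trans (by simp)
  -- On the line q is zero. With n = rot b and y = a + t b, Taylor's formula gives q(x) = s D_n q(y)
  -- + s²κ/2, and D_n q(x) = D_n q(y) + sκ. Hence q(x) = s (D_n q(x) - sκ/2).
  have hfac : q = l₁ * (polyD (rot b) q - MvPolynomial.C (κ / 2) * l₁) := by
    apply sub_eq_zero.1; apply eq_zero_of_polyFun; intro x
    have hx := exists_coords hD (x - a)
    rw [← hDdef, ← hl₁] at hx
    generalize ht : cross (x - a) (rot b) / D = t at hx
    generalize hs : polyFun l₁ x = s at hx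
    have ex : x = (a + t • b) + s • rot b := by rw [add_assoc, ← hx]; abel
    have t1 := polyFun_taylor_two hq.le (a + t • b) (s • rot b)
    have t2 := polyFun_taylor_two (q := polyD (rot b) q)
      (by have := totalDegree_polyD_le (rot b) q; omega) (a + t • b) (s • rot b)
    rw [← ex] at t1 t2
    have e3 : polyFun (polyD (s • rot b) (polyD (s • rot b) (polyD (rot b) q))) (a + t • b) = 0 := by
      have h1 := totalDegree_polyD_le (rot b) q
      have h2 := totalDegree_polyD_le (s • rot b) (polyD (rot b) q)
      rw [MvPolynomial.totalDegree_eq_zero_iff_eq_C.1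
        (show (polyD (s • rot b) (polyD (rot b) q)).totalDegree = 0 by omega)]
      simp [polyD]
    rw [e3, polyD_smul, polyD_polyD_const hq.le _ _ _ a, ← hκ] at t2
    rw [hl t] at t1
    simp only [polyD_smul_left, polyD_C_mul, polyFun_mul, polyFun_C] at t1
    rw [polyD_polyD_const hq.le _ _ _ a, ← hκ] at t1
    simp only [polyFun_sub, polyFun_mul, polyFun_C, hs, t1, t2]
    ring
  rcases hi.isUnit_or_isUnit hfac with hu | hu
  · apply polyFun_isUnit hu a
    rw [hl₁]; simp [cross]
  -- A constant second factor would make q of degree at most one.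
  · rw [MvPolynomial.isUnit_iff_totalDegree_of_isReduced] at hu
    have := MvPolynomial.totalDegree_mul l₁ (polyD (rot b) q - MvPolynomial.C (κ / 2) * l₁)
    rw [← hfac] at this
    omega

/-- The gradient of a polynomial, as a vector. -/
noncomputable def gradV (p : BiPoly) (x : Plane) : Plane :=
  !₂[polyFun (MvPolynomial.pderiv 0 p) x, polyFun (MvPolynomial.pderiv 1 p) x]

lemma polyFun_polyD (p : BiPoly) (x τ : Plane) : polyFun (polyD τ p) x = inner ℝ (gradV p x) τ := by
  simp [inner_plane, polyD, gradV]; ring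

/-- At a zero with zero gradient the quadratic polynomial is homogeneous about that point; a second
zero then forces it to vanish on the line through both, which an irreducible conic does not allow.
-/
lemma conic_gradV_ne {q : BiPoly} (hi : Irreducible q) (hq : q.totalDegree = 2)
    {x y : Plane} (hxy : y ≠ x) (hx : polyFun q x = 0) (hy : polyFun q y = 0) :
    gradV q x ≠ 0 := by
  intro h0
  have key : ∀ t : ℝ, polyFun q (x + t • (y - x)) =
      t ^ 2 * (polyFun (polyD (y - x) (polyD (y - x) q)) x / 2) := by
    intro t
    rw [polyFun_taylor_two hq.le, hx, polyFun_polyD, h0]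
    simp only [polyD_smul_left, polyD_C_mul, polyFun_mul, polyFun_C, inner_zero_left]; ring
  have h1 := key 1
  rw [one_smul, add_sub_cancel, hy, one_pow, one_mul] at h1
  exact conic_not_infinite_line hi hq (sub_ne_zero.2 hxy) (a := x) infinite_univ
    fun t _ => by rw [key, ← h1, mul_zero]

/-! ### Moving along a line -/

lemma hasDerivAt_line {f : Plane → ℝ} {x m : Plane} {ρ : ℝ} {f' : Plane →L[ℝ] ℝ}
    (h : HasFDerivAt f f' (x + ρ • m)) : HasDerivAt (fun s : ℝ => f (x + s • m)) (f' m) ρ := by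
  have h2 : HasDerivAt (fun s : ℝ => x + s • m) m ρ := by
    simpa using ((hasDerivAt_id ρ).smul_const m).const_add x
  exact h.comp_hasDerivAt ρ h2

lemma polyFun_mvt (q : BiPoly) (x m : Plane) {s : ℝ} (hs : 0 < s) :
    ∃ ρ ∈ Ioo 0 s, polyFun q (x + s • m) - polyFun q x = s * polyFun (polyD m q) (x + ρ • m) := by
  obtain ⟨ρ, hρ, h⟩ := exists_hasDerivAt_eq_slope (fun s : ℝ => polyFun q (x + s • m))
    (fun s => polyFun (polyD m q) (x + s • m)) hs
    ((continuous_polyFun q).comp (by fun_prop)).continuousOn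
    (fun ρ _ => by rw [← polyGrad_apply]; exact hasDerivAt_line (hasFDerivAt_polyFun q _))
  refine ⟨ρ, hρ, ?_⟩
  rw [h]; simp; field_simp

/-- The first exit from an open set along a line. -/
lemma exists_first_exit {U : Set Plane} (hU : IsOpen U) {x m : Plane} (hx : x ∈ U) {s₁ : ℝ}
    (hs₁ : 0 ≤ s₁) (h : x + s₁ • m ∉ U) :
    ∃ s ∈ Ioc 0 s₁, (∀ ρ ∈ Ico 0 s, x + ρ • m ∈ U) ∧ x + s • m ∈ frontier U := by
  set A : Set ℝ := {s | s ∈ Icc 0 s₁ ∧ x + s • m ∉ U}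
  have hc : Continuous fun s : ℝ => x + s • m := by fun_prop
  have hA : IsClosed A := isClosed_Icc.inter (hU.isClosed_compl.preimage hc)
  have hne : A.Nonempty := ⟨s₁, ⟨hs₁, le_rfl⟩, h⟩
  have hbd : BddBelow A := ⟨0, fun s hs => hs.1.1⟩
  have hmem := hA.csInf_mem hne hbd
  set s := sInf A
  have hlt : ∀ ρ ∈ Ico 0 s, x + ρ • m ∈ U := by
    intro ρ hρ
    by_contra hcon
    exact absurd (csInf_le hbd ⟨⟨hρ.1, hρ.2.le.trans hmem.1.2⟩, hcon⟩) (not_le.2 hρ.2)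
  have h0 : 0 < s := by
    rcases hmem.1.1.eq_or_lt with h0 | h0
    · exfalso; apply hmem.2; rw [← h0]; simpa
    · exact h0
  refine ⟨s, ⟨h0, hmem.1.2⟩, hlt, ?_⟩
  rw [hU.frontier_eq]
  refine ⟨?_, hmem.2⟩
  have hcl : s ∈ closure (Ico 0 s) := by rw [closure_Ico h0.ne]; exact ⟨h0.le, le_rfl⟩
  exact closure_mono (image_subset_iff.2 hlt) (image_closure_subset_closure_image hc
    (mem_image_of_mem _ hcl))

/-- Moving in a direction in which `q` increases does not leave a set with `q ≤ 0` on the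
boundary. -/
lemma mem_of_polyD_pos {U : Set Plane} (hU : IsOpen U) {q : BiPoly} {B : Set Plane}
    {x m : Plane} {s : ℝ} (hs : 0 ≤ s) (hB : ∀ ρ ∈ Icc 0 s, x + ρ • m ∈ B)
    (hfr : ∀ y ∈ frontier U, y ∈ B → polyFun q y ≤ 0)
    (hm : ∀ y ∈ B, 0 < polyFun (polyD m q) y) (hx : x ∈ U) (hq : 0 ≤ polyFun q x) :
    x + s • m ∈ U := by
  by_contra hcon
  obtain ⟨t, ht, -, hfrt⟩ := exists_first_exit hU hx hs hcon
  obtain ⟨ρ, hρ, h⟩ := polyFun_mvt q x m ht.1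
  have h1 := hm _ (hB ρ ⟨hρ.1.le, hρ.2.le.trans ht.2⟩)
  have h2 := hfr _ hfrt (hB t ⟨ht.1.le, ht.2⟩)
  have := mul_pos ht.1 h1
  linarith

/-! ### The boundary of the domain -/

namespace ConicDomain

variable {n : ℕ} [NeZero n] (D : ConicDomain n)

lemma continuous_curve (j : Fin n) : Continuous (D.curve j) := (D.contDiff_curve j).continuous

lemma q_zero_closed (j : Fin n) {t : ℝ} (ht : t ∈ Icc (0 : ℝ) 1) :
    polyFun (D.q j) (D.curve j t) = 0 := by
  have h : Icc (0 : ℝ) 1 ⊆ {t | polyFun (D.q j) (D.curve j t) = 0} := by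
    rw [← closure_Ioo (zero_ne_one (α := ℝ))]
    exact closure_minimal (fun t ht => D.q_zero j t ht)
      (isClosed_eq ((continuous_polyFun _).comp (D.continuous_curve j)) continuous_const)
  exact h ht

/-- The parameter 1 has to be read as the parameter 0 of the next arc, since injectivity is assumed
on half-open intervals only. -/
lemma curve_eq_curve {j k : Fin n} {t t₀ : ℝ} (ht : t ∈ Icc (0 : ℝ) 1) (ht₀ : t₀ ∈ Ioo (0 : ℝ) 1)
    (h : D.curve k t = D.curve j t₀) : k = j ∧ t = t₀ := by
  rcases ht.2.lt_or_eq with h1 | h1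
  · exact D.curve_inj k j t ⟨ht.1, h1⟩ t₀ ⟨ht₀.1.le, ht₀.2⟩ h
  · rw [h1, D.curve_joint] at h
    have := D.curve_inj (k + 1) j 0 ⟨le_rfl, one_pos⟩ t₀ ⟨ht₀.1.le, ht₀.2⟩ h
    exact absurd this.2.symm ht₀.1.ne'

lemma arc_gradV_ne (j : Fin n) {t : ℝ} (ht : t ∈ Icc (0 : ℝ) 1) :
    gradV (D.q j) (D.curve j t) ≠ 0 := by
  obtain ⟨t', ht', hne⟩ : ∃ t' ∈ Ioo (0 : ℝ) 1, t ≠ t' := by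
    by_cases h : t = 1 / 2
    · exact ⟨1 / 4, by norm_num, by rw [h]; norm_num⟩
    · exact ⟨1 / 2, by norm_num, h⟩
  refine conic_gradV_ne (D.q_irreducible j) (D.q_degree j) (y := D.curve j t') ?_
    (D.q_zero_closed j ht) (D.q_zero j t' ht')
  intro h
  exact hne (D.curve_eq_curve ht ht' h.symm).2

lemma isClosed_closedArc (j : Fin n) : IsClosed (D.closedArc j) :=
  (isCompact_Icc.image (D.continuous_curve j)).isClosed

lemma curve_mem_frontier (j : Fin n) {t : ℝ} (ht : t ∈ Icc (0 : ℝ) 1) :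
    D.curve j t ∈ frontier (D.Ω : Set Plane) := by
  rw [D.frontier_eq]; exact mem_iUnion.2 ⟨j, t, ht, rfl⟩

/-- Near a point of an open arc the boundary is contained in this arc. -/
lemma exists_frontier_near_arc (j : Fin n) {t₀ : ℝ} (ht₀ : t₀ ∈ Ioo (0 : ℝ) 1) :
    ∃ r > 0, ∀ y ∈ frontier (D.Ω : Set Plane), y ∈ Metric.ball (D.curve j t₀) r →
      ∃ t ∈ Ioo (0 : ℝ) 1, y = D.curve j t := by
  set K : Set Plane := (⋃ k ∈ {k | k ≠ j}, D.closedArc k) ∪ {D.curve j 0, D.curve j 1}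
  have hK : IsClosed K := by
    refine IsClosed.union ?_ (Set.Finite.isClosed (by simp))
    exact Set.Finite.isClosed_biUnion (Set.toFinite _) fun k _ => D.isClosed_closedArc k
  have hx : D.curve j t₀ ∉ K := by
    rintro (h | h)
    · simp only [mem_iUnion] at h
      obtain ⟨k, hk, t, ht, h⟩ := h
      exact hk (D.curve_eq_curve ht ht₀ h).1
    · rcases h with h | h
      · exact ht₀.1.ne (D.curve_eq_curve ⟨le_rfl, zero_le_one⟩ ht₀ h.symm).2
      · exact ht₀.2.ne' (D.curve_eq_curve ⟨zero_le_one, le_rfl⟩ ht₀ h.symm).2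
  obtain ⟨r, hr, hball⟩ := Metric.isOpen_iff.1 hK.isOpen_compl _ hx
  refine ⟨r, hr, fun y hy hyr => ?_⟩
  have hyK := hball hyr
  rw [D.frontier_eq] at hy
  obtain ⟨k, t, ht, rfl⟩ := mem_iUnion.1 hy
  have hkj : k = j := by
    by_contra h
    exact hyK (Or.inl (mem_iUnion₂.2 ⟨k, h, t, ht, rfl⟩))
  subst hkj
  refine ⟨t, ⟨ht.1.lt_of_ne ?_, ht.2.lt_of_ne ?_⟩, rfl⟩
  · rintro rfl; exact hyK (Or.inr (Or.inl rfl))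
  · rintro rfl; exact hyK (Or.inr (Or.inr rfl))

/-- The sign of `q j` near a point of the open arc. -/
lemma exists_sign_near_arc (j : Fin n) {t₀ : ℝ} (ht₀ : t₀ ∈ Ioo (0 : ℝ) 1) :
    ∃ r > 0, (∀ y ∈ frontier (D.Ω : Set Plane), y ∈ Metric.ball (D.curve j t₀) r →
      ∃ t ∈ Ioo (0 : ℝ) 1, y = D.curve j t) ∧
      ∀ y ∈ D.Ω, y ∈ Metric.ball (D.curve j t₀) r → 0 < polyFun (D.q j) y := by
  obtain ⟨r, hr, h⟩ := D.exists_frontier_near_arc j ht₀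
  have := D.q_pos j t₀ ht₀
  rw [eventually_nhdsWithin_iff, Metric.eventually_nhds_iff_ball] at this
  obtain ⟨r', hr', h'⟩ := this
  exact ⟨min r r', lt_min hr hr',
    fun y hy hyr => h y hy (Metric.ball_subset_ball (min_le_left _ _) hyr),
    fun y hy hyr => h' y (Metric.ball_subset_ball (min_le_right _ _) hyr) hy⟩

lemma tendsto_polyD_pos {q : BiPoly} {x m : Plane} (h : 0 < inner ℝ (gradV q x) m) :
    ∀ᶠ y in 𝓝 x, inner ℝ (gradV q x) m / 2 < polyFun (polyD m q) y := by
  refine (continuous_polyFun (polyD m q)).continuousAt.eventually_const_lt ?_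
  rw [polyFun_polyD]; linarith

/-- Moving against the gradient makes q negative, whereas q is positive at all nearby points of Ω;
and q < 0 is an open condition, so such points are not even in the closure. -/
lemma arc_mem_closure_compl (j : Fin n) {t₀ : ℝ} (ht₀ : t₀ ∈ Ioo (0 : ℝ) 1) :
    D.curve j t₀ ∈ closure (closure (D.Ω : Set Plane))ᶜ := by
  obtain ⟨r, hr, -, hpos⟩ := D.exists_sign_near_arc j ht₀
  set x₀ := D.curve j t₀
  have hn : 0 < inner ℝ (gradV (D.q j) x₀) (gradV (D.q j) x₀) :=
    real_inner_self_pos.2 (D.arc_gradV_ne j ⟨ht₀.1.le, ht₀.2.le⟩)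
  have hev := tendsto_polyD_pos hn
  rw [Metric.eventually_nhds_iff_ball] at hev
  obtain ⟨r', hr', hD⟩ := hev
  have hneg : ∀ y ∈ Metric.ball x₀ r, polyFun (D.q j) y < 0 → y ∈ (closure (D.Ω : Set Plane))ᶜ := by
    intro y hy hqy hycl
    have hopen : IsOpen (Metric.ball x₀ r ∩ {y | polyFun (D.q j) y < 0}) :=
      Metric.isOpen_ball.inter (isOpen_lt (continuous_polyFun _) continuous_const)
    obtain ⟨z, ⟨hz, hqz⟩, hzΩ⟩ := mem_closure_iff.1 hycl _ hopen ⟨hy, hqy⟩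
    exact absurd (hpos z hzΩ hz) (not_lt.2 (le_of_lt hqz))
  have htend : Tendsto (fun s : ℝ => x₀ + s • (-gradV (D.q j) x₀)) (𝓝[>] 0) (𝓝 x₀) := by
    have : Continuous fun s : ℝ => x₀ + s • (-gradV (D.q j) x₀) := by fun_prop
    have := this.tendsto 0
    simp only [zero_smul, add_zero] at this
    exact this.mono_left nhdsWithin_le_nhds
  refine mem_closure_of_tendsto htend ?_
  filter_upwards [htend.eventually (Metric.ball_mem_nhds _ (lt_min hr hr')),
    self_mem_nhdsWithin] with s hs hs0
  refine hneg _ (Metric.ball_subset_ball (min_le_left _ _) hs) ?_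
  obtain ⟨ρ, hρ, h⟩ := polyFun_mvt (D.q j) (x₀ + s • (-gradV (D.q j) x₀)) (gradV (D.q j) x₀)
    (s := s) hs0
  rw [show x₀ + s • (-gradV (D.q j) x₀) + s • gradV (D.q j) x₀ = x₀ by module,
    D.q_zero j t₀ ht₀] at h
  have hy : x₀ + s • (-gradV (D.q j) x₀) + ρ • gradV (D.q j) x₀ ∈ Metric.ball x₀ r' := by
    have hs' : dist (x₀ + s • (-gradV (D.q j) x₀)) x₀ < r' := (lt_min_iff.1 hs).2
    rw [Metric.mem_ball, dist_eq_norm] at *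
    refine lt_of_le_of_lt ?_ hs'
    rw [show x₀ + s • (-gradV (D.q j) x₀) + ρ • gradV (D.q j) x₀ - x₀ =
      (ρ - s) • gradV (D.q j) x₀ by module,
      show x₀ + s • (-gradV (D.q j) x₀) - x₀ = (-s) • gradV (D.q j) x₀ by module,
      norm_smul, norm_smul]
    refine mul_le_mul_of_nonneg_right ?_ (norm_nonneg _)
    rw [Real.norm_eq_abs, Real.norm_eq_abs, abs_neg, abs_of_pos (show (0 : ℝ) < s from hs0), abs_le]
    constructor <;> linarith [hρ.1, hρ.2]
  have := mul_pos (show (0 : ℝ) < s from hs0) (lt_trans (by positivity) (hD _ hy))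
  linarith

/-- Every boundary point is a limit of exterior points. -/
lemma frontier_subset_closure_compl :
    frontier (D.Ω : Set Plane) ⊆ closure (closure (D.Ω : Set Plane))ᶜ := by
  rw [D.frontier_eq]
  refine iUnion_subset fun j => ?_
  rw [← closure_Ioo (zero_ne_one (α := ℝ))]
  refine (image_closure_subset_closure_image (D.continuous_curve j)).trans ?_
  refine closure_minimal ?_ isClosed_closure
  rintro _ ⟨t, ht, rfl⟩
  exact D.arc_mem_closure_compl j ht

/-- Excludes slits: a point with a neighbourhood covered by triangles belongs to Ω. -/
lemma interior_closure : interior (closure (D.Ω : Set Plane)) = D.Ω := by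
  refine Subset.antisymm (fun x hx => ?_) (interior_maximal subset_closure D.Ω.isOpen)
  by_contra hxΩ
  have hfr : x ∈ frontier (D.Ω : Set Plane) := by
    rw [D.Ω.isOpen.frontier_eq]; exact ⟨interior_subset hx, hxΩ⟩
  obtain ⟨y, hy, hy'⟩ := mem_closure_iff.1 (D.frontier_subset_closure_compl hfr) _
    isOpen_interior hx
  exact hy' (interior_subset hy)

end ConicDomain

/-! ### Boundary points near a joint -/

/-- Near `a` all chords have directions close to v = c'(a). If c(s) and c(t) have equal distance
from c(a), then c(s) - c(t) is orthogonal to (c(s) - c(a)) + (c(t) - c(a)); for s ≠ t on the same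
side of `a` both are nonzero and nearly parallel to v. -/
lemma exists_dist_injOn {c : ℝ → Plane} (hc : ContDiff ℝ 1 c) {a : ℝ} (ha : deriv c a ≠ 0) :
    ∃ δ > 0, ∀ s t, |s - a| < δ → |t - a| < δ → (a ≤ s ∧ a ≤ t ∨ s ≤ a ∧ t ≤ a) →
      dist (c s) (c a) = dist (c t) (c a) → s = t := by
  have hstrict : HasStrictDerivAt c (deriv c a) a :=
    hc.contDiffAt.hasStrictDerivAt one_ne_zero
  set v := deriv c a
  have hv : 0 < ‖v‖ := norm_pos_iff.2 ha
  have h1 := hstrict.isLittleO.def (c := ‖v‖ / 4) (by positivity)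
  rw [nhds_prod_eq, eventually_prod_iff] at h1
  obtain ⟨p, hp, p', hp', h1⟩ := h1
  obtain ⟨δ, hδ, h2⟩ := Metric.eventually_nhds_iff.1 (hp.and hp')
  have key : ∀ s t, |s - a| < δ → |t - a| < δ → ∃ e, c s - c t = (s - t) • (v + e) ∧
      ‖e‖ ≤ ‖v‖ / 4 := by
    intro s t hs ht
    have := h1 (h2 (y := s) (by rwa [Real.dist_eq])).1 (h2 (y := t) (by rwa [Real.dist_eq])).2
    by_cases hst : s = t
    · exact ⟨0, by simp [hst], by simp; positivity⟩
    have hst' : s - t ≠ 0 := sub_ne_zero.2 hst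
    refine ⟨(s - t)⁻¹ • (c s - c t) - v, by rw [add_sub_cancel, smul_inv_smul₀ hst'], ?_⟩
    simp only [ContinuousLinearMap.toSpanSingleton_apply] at this
    rw [show (s - t)⁻¹ • (c s - c t) - v = (s - t)⁻¹ • (c s - c t - (s - t) • v) by
      rw [smul_sub (s - t)⁻¹ (c s - c t), inv_smul_smul₀ hst'], norm_smul, norm_inv]
    rw [inv_mul_le_iff₀ (norm_pos_iff.2 hst')]
    linarith
  refine ⟨δ, hδ, fun s t hs ht hside hd => ?_⟩
  by_contra hst
  obtain ⟨e1, h1, he1⟩ := key s t hs ht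
  obtain ⟨e2, h2, he2⟩ := key s a hs (by simpa)
  obtain ⟨e3, h3, he3⟩ := key t a ht (by simpa)
  have hsq : inner ℝ (c s - c t) ((c s - c a) + (c t - c a)) = 0 := by
    rw [show c s - c t = (c s - c a) - (c t - c a) by abel]
    rw [real_inner_comm]
    rw [real_inner_add_sub_eq_zero_iff]
    rwa [← dist_eq_norm, ← dist_eq_norm]
  rw [h1, h2, h3, inner_smul_left, inner_add_right, inner_smul_right, inner_smul_right] at hsq
  -- With errors of at most ‖v‖/4 the inner product is at least (1 - 1/4 - 1/4 - 1/16)‖v‖².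
  have hpos : ∀ e e' : Plane, ‖e‖ ≤ ‖v‖ / 4 → ‖e'‖ ≤ ‖v‖ / 4 → 0 < inner ℝ (v + e) (v + e') := by
    intro e e' he he'
    rw [inner_add_left, inner_add_right, inner_add_right, real_inner_self_eq_norm_sq]
    have b1 := neg_le_of_abs_le (abs_real_inner_le_norm v e')
    have b2 := neg_le_of_abs_le (abs_real_inner_le_norm e v)
    have b3 := neg_le_of_abs_le (abs_real_inner_le_norm e e')
    have := norm_nonneg e
    have := norm_nonneg e'
    nlinarith [mul_le_mul he he' (norm_nonneg _) (by positivity),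
      mul_le_mul_of_nonneg_left he hv.le, mul_le_mul_of_nonneg_left he' hv.le]
  have p2 := hpos e1 e2 he1 he2
  have p3 := hpos e1 e3 he1 he3
  rcases mul_eq_zero.1 hsq with h | h
  · exact hst (sub_eq_zero.1 (by simpa using h))
  · rcases hside with ⟨h4, h5⟩ | ⟨h4, h5⟩
    · have e4 : (s - a) * inner ℝ (v + e1) (v + e2) = 0 := by
        nlinarith [mul_nonneg (sub_nonneg.2 h4) p2.le, mul_nonneg (sub_nonneg.2 h5) p3.le]
      have e5 : (t - a) * inner ℝ (v + e1) (v + e3) = 0 := by linarith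
      have := (mul_eq_zero.1 e4).resolve_right p2.ne'
      have := (mul_eq_zero.1 e5).resolve_right p3.ne'
      exact hst (by linarith)
    · have e4 : (s - a) * inner ℝ (v + e1) (v + e2) = 0 := by
        nlinarith [mul_nonneg (sub_nonneg.2 h4) p2.le, mul_nonneg (sub_nonneg.2 h5) p3.le]
      have e5 : (t - a) * inner ℝ (v + e1) (v + e3) = 0 := by linarith
      have := (mul_eq_zero.1 e4).resolve_right p2.ne'
      have := (mul_eq_zero.1 e5).resolve_right p3.ne'
      exact hst (by linarith)

namespace ConicDomain

variable {n : ℕ} [NeZero n] (D : ConicDomain n)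

/-- Small circles around a joint contain at most two boundary points. -/
lemma exists_two_frontier_points (k : Fin n) :
    ∃ r > 0, ∀ y₁ y₂ y₃, y₁ ∈ frontier (D.Ω : Set Plane) → y₂ ∈ frontier (D.Ω : Set Plane) →
      y₃ ∈ frontier (D.Ω : Set Plane) → y₁ ∈ Metric.ball (D.curve k 0) r →
      dist y₁ (D.curve k 0) = dist y₂ (D.curve k 0) →
      dist y₁ (D.curve k 0) = dist y₃ (D.curve k 0) → y₁ = y₂ ∨ y₁ = y₃ ∨ y₂ = y₃ := by
  obtain ⟨j, hj⟩ : ∃ j : Fin n, j + 1 = k := ⟨k - 1, by simp⟩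
  have hj1 : D.curve j 1 = D.curve k 0 := by rw [D.curve_joint, hj]
  obtain ⟨δ₀, hδ₀, h0⟩ := exists_dist_injOn (D.contDiff_curve k)
    (D.deriv_curve_ne k 0 ⟨le_rfl, zero_le_one⟩)
  obtain ⟨δ₁, hδ₁, h1⟩ := exists_dist_injOn (D.contDiff_curve j)
    (D.deriv_curve_ne j 1 ⟨zero_le_one, le_rfl⟩)
  -- The boundary without the beginning of the arc `k` and the end of the arc `j` that precedes it.
  -- This closed set does not contain the joint, so near the joint only these two pieces remain.
  set K : Set Plane := ⋃ i, D.curve i '' {t | t ∈ Icc (0 : ℝ) 1 ∧ (i = k → δ₀ ≤ t) ∧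
    (i = j → t ≤ 1 - δ₁)}
  have hK : IsClosed K := by
    refine isClosed_iUnion_of_finite fun i => (IsCompact.image ?_ (D.continuous_curve i)).isClosed
    refine isCompact_Icc.inter_right (IsClosed.and ?_ ?_)
    · by_cases h : i = k
      · simp only [h, forall_const]; exact isClosed_le continuous_const continuous_id
      · simp [h]
    · by_cases h : i = j
      · simp only [h, forall_const]; exact isClosed_le continuous_id continuous_const
      · simp [h]
  have hx : D.curve k 0 ∉ K := by
    intro h
    obtain ⟨i, t, ⟨ht, h2, h3⟩, h4⟩ := mem_iUnion.1 h
    rcases ht.2.lt_or_eq with h5 | h5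
    · have := D.curve_inj i k t ⟨ht.1, h5⟩ 0 ⟨le_rfl, one_pos⟩ h4
      linarith [h2 this.1, this.2]
    · rw [h5, D.curve_joint] at h4
      have := (D.curve_inj (i + 1) k 0 ⟨le_rfl, one_pos⟩ 0 ⟨le_rfl, one_pos⟩ h4).1
      rw [← hj] at this
      linarith [h3 (add_right_cancel this)]
  obtain ⟨r, hr, hball⟩ := Metric.isOpen_iff.1 hK.isOpen_compl _ hx
  have key : ∀ y ∈ frontier (D.Ω : Set Plane), y ∈ Metric.ball (D.curve k 0) r →
      (∃ t, 0 ≤ t ∧ |t - 0| < δ₀ ∧ y = D.curve k t) ∨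
      ∃ t, t ≤ 1 ∧ |t - 1| < δ₁ ∧ y = D.curve j t := by
    intro y hy hyr
    rw [D.frontier_eq] at hy
    obtain ⟨i, t, ht, rfl⟩ := mem_iUnion.1 hy
    have hyK := hball hyr
    by_contra hcon
    rw [not_or] at hcon
    refine hyK (mem_iUnion.2 ⟨i, t, ⟨ht, ?_, ?_⟩, rfl⟩)
    · rintro rfl
      by_contra hlt
      exact hcon.1 ⟨t, ht.1, by rw [sub_zero, abs_of_nonneg ht.1]; linarith, rfl⟩
    · rintro rfl
      by_contra hlt
      exact hcon.2 ⟨t, ht.2, by rw [abs_of_nonpos (by linarith [ht.2])]; linarith, rfl⟩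
  refine ⟨r, hr, fun y₁ y₂ y₃ f1 f2 f3 hy hd2 hd3 => ?_⟩
  have g1 := key y₁ f1 hy
  have g2 := key y₂ f2 (by rw [Metric.mem_ball, ← hd2]; exact hy)
  have g3 := key y₃ f3 (by rw [Metric.mem_ball, ← hd3]; exact hy)
  have c0 : ∀ {s t}, 0 ≤ s → |s - 0| < δ₀ → 0 ≤ t → |t - 0| < δ₀ →
      dist (D.curve k s) (D.curve k 0) = dist (D.curve k t) (D.curve k 0) →
      D.curve k s = D.curve k t := fun a b c d e => by rw [h0 _ _ b d (Or.inl ⟨a, c⟩) e]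
  have c1 : ∀ {s t}, s ≤ 1 → |s - 1| < δ₁ → t ≤ 1 → |t - 1| < δ₁ →
      dist (D.curve j s) (D.curve k 0) = dist (D.curve j t) (D.curve k 0) →
      D.curve j s = D.curve j t := fun a b c d e => by
    rw [← hj1] at e
    rw [h1 _ _ b d (Or.inr ⟨a, c⟩) e]
  -- Of three points two lie on the same piece, and each piece meets the circle at most once.
  rcases g1 with ⟨s1, a1, b1, rfl⟩ | ⟨s1, a1, b1, rfl⟩ <;>
  rcases g2 with ⟨s2, a2, b2, rfl⟩ | ⟨s2, a2, b2, rfl⟩ <;>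
  rcases g3 with ⟨s3, a3, b3, rfl⟩ | ⟨s3, a3, b3, rfl⟩
  · exact Or.inl (c0 a1 b1 a2 b2 hd2)
  · exact Or.inl (c0 a1 b1 a2 b2 hd2)
  · exact Or.inr (Or.inl (c0 a1 b1 a3 b3 hd3))
  · exact Or.inr (Or.inr (c1 a2 b2 a3 b3 (hd2.symm.trans hd3)))
  · exact Or.inr (Or.inr (c0 a2 b2 a3 b3 (hd2.symm.trans hd3)))
  · exact Or.inr (Or.inl (c1 a1 b1 a3 b3 hd3))
  · exact Or.inl (c1 a1 b1 a2 b2 hd2)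
  · exact Or.inl (c1 a1 b1 a2 b2 hd2)

end ConicDomain
end ConicSpline

namespace ConicSpline

/-! ### Segments -/

lemma segment_eq_segment {a b c d : Plane} (h : segment ℝ a b = segment ℝ c d) :
    (a = c ∧ b = d) ∨ (a = d ∧ b = c) := by
  by_cases hcd : c = d
  · subst hcd
    have ha := h ▸ left_mem_segment ℝ a b
    have hb := h ▸ right_mem_segment ℝ a b
    rw [segment_same] at ha hb
    exact Or.inl ⟨ha, hb⟩
  have ha := h ▸ left_mem_segment ℝ a b
  have hb := h ▸ right_mem_segment ℝ a b
  have hc := h.symm ▸ left_mem_segment ℝ c d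
  have hd := h.symm ▸ right_mem_segment ℝ c d
  rw [segment_eq_image'] at ha hb hc hd
  obtain ⟨t, ht, rfl⟩ := ha
  obtain ⟨s, hs, rfl⟩ := hb
  obtain ⟨t', ht', hc⟩ := hc
  obtain ⟨s', hs', hd⟩ := hd
  have hne : d - c ≠ 0 := sub_ne_zero.2 (Ne.symm hcd)
  have e1 : (t + t' * (s - t)) • (d - c) = 0 := by
    have : (t + t' * (s - t)) • (d - c) = (c + t • (d - c) +
      t' • (c + s • (d - c) - (c + t • (d - c)))) - c := by module
    rw [this]; simp only at hc; rw [hc, sub_self]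
  have e2 : (t + s' * (s - t) - 1) • (d - c) = 0 := by
    have : (t + s' * (s - t) - 1) • (d - c) = (c + t • (d - c) +
      s' • (c + s • (d - c) - (c + t • (d - c)))) - d := by module
    rw [this]; simp only at hd; rw [hd, sub_self]
  replace e1 := (smul_eq_zero.1 e1).resolve_right hne
  replace e2 := (smul_eq_zero.1 e2).resolve_right hne
  have p1 := mul_nonneg ht'.1 hs.1
  have p2 := mul_nonneg (sub_nonneg.2 ht'.2) ht.1
  have p3 := mul_nonneg hs'.1 (sub_nonneg.2 hs.2)
  have p4 := mul_nonneg (sub_nonneg.2 hs'.2) (sub_nonneg.2 ht.2)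
  rcases eq_or_lt_of_le ht.1 with h0 | h0
  · left
    subst h0
    have : s = 1 := by nlinarith [hs'.1, hs'.2, hs.1, hs.2]
    subst this; simp
  · right
    have ht'1 : t' = 1 := by
      have : (1 - t') * t = 0 := by nlinarith
      have := (mul_eq_zero.1 this).resolve_right h0.ne'
      linarith
    subst ht'1
    have hs0 : s = 0 := by linarith
    subst hs0
    have : t = 1 := by nlinarith [hs'.1, hs'.2, ht.2]
    subst this; simp

/-- Turns the knowledge that a disk, half disk or curve avoids a boundary into the alternative of
lying inside or outside. -/
lemma IsPreconnected.subset_interior_or {S A : Set Plane} (hS : IsPreconnected S)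
    (hA : IsClosed A) (h : ∀ x ∈ S, x ∉ frontier A) : S ⊆ interior A ∨ S ⊆ Aᶜ := by
  have hsub : S ⊆ interior A ∪ Aᶜ := by
    intro x hx
    by_cases hxA : x ∈ A
    · left; by_contra hcon
      exact h x hx (by rw [hA.frontier_eq]; exact ⟨hxA, hcon⟩)
    · exact Or.inr hxA
  refine isPreconnected_iff_subset_of_disjoint.1 hS _ _ isOpen_interior hA.isOpen_compl hsub ?_
  ext x
  simp only [mem_inter_iff, mem_compl_iff, mem_empty_iff_false, iff_false, not_and, not_not]
  exact fun _ hx => interior_subset hx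

/-! ### Incidence of vertices, edges and triangles -/

namespace CurvedTriangles

variable {n : ℕ} [NeZero n] {D : ConicDomain n} {ι : Type} {Δ : CurvedTriangles D ι}

lemma IsStraight.symm {T : ι} {i k : Fin 3} (h : Δ.IsStraight T i k) : Δ.IsStraight T k i :=
  ⟨h.1.symm, fun hT => (h.2 hT).symm⟩

lemma isStraight_of_notMem {T : ι} (hT : T ∉ Δ.pie) {i k : Fin 3} (h : i ≠ k) :
    Δ.IsStraight T i k := ⟨h, fun h' => absurd h' hT⟩

lemma isStraight_zero {T : ι} {i : Fin 3} (hi : i ≠ 0) : Δ.IsStraight T 0 i :=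
  ⟨hi.symm, fun _ => Or.inl rfl⟩

lemma exists_isStraight (T : ι) (i : Fin 3) : ∃ k, Δ.IsStraight T i k := by
  by_cases h : i = 0
  · exact ⟨1, h ▸ isStraight_zero (by decide)⟩
  · exact ⟨0, (isStraight_zero h).symm⟩

namespace IsTriangulation

variable (hΔ : Δ.IsTriangulation)
include hΔ

/-- The vertices of a triangle as an affine basis. -/
noncomputable def basis (T : ι) : AffineBasis (Fin 3) ℝ Plane :=
  ⟨Δ.vert T, hΔ.affineIndependent T, by
    rw [(hΔ.affineIndependent T).affineSpan_eq_top_iff_card_eq_finrank_add_one]; simp⟩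

lemma vert_injective (T : ι) : Function.Injective (Δ.vert T) := (hΔ.affineIndependent T).injective

lemma cross_ne (T : ι) : cross (Δ.vert T 1 - Δ.vert T 0) (Δ.vert T 2 - Δ.vert T 0) ≠ 0 :=
  cross_ne_of_affineIndependent (hΔ.affineIndependent T)

lemma coord_lineMap (T : ι) (l i k : Fin 3) (t : ℝ) :
    (hΔ.basis T).coord l (Δ.vert T i + t • (Δ.vert T k - Δ.vert T i)) =
      (1 - t) * (hΔ.basis T).coord l (Δ.vert T i) + t * (hΔ.basis T).coord l (Δ.vert T k) := by
  have : Δ.vert T i + t • (Δ.vert T k - Δ.vert T i) =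
      AffineMap.lineMap (Δ.vert T i) (Δ.vert T k) t := by
    simp [AffineMap.lineMap_apply, add_comm]
  rw [this, AffineMap.apply_lineMap, AffineMap.lineMap_apply]
  simp; ring

lemma coord_vert (T : ι) (l i : Fin 3) :
    (hΔ.basis T).coord l (Δ.vert T i) = if l = i then 1 else 0 :=
  (hΔ.basis T).coord_apply l i

lemma coord_segment {T : ι} {i k l : Fin 3} {x : Plane} (hx : x ∈ segment ℝ (Δ.vert T i) (Δ.vert T k))
    (hi : l ≠ i) (hk : l ≠ k) : (hΔ.basis T).coord l x = 0 := by
  rw [segment_eq_image'] at hx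
  obtain ⟨t, -, rfl⟩ := hx
  simp only
  rw [coord_lineMap, coord_vert, coord_vert]; simp [hi, hk]

lemma coord_openSegment {T : ι} {i k : Fin 3} {x : Plane}
    (hx : x ∈ openSegment ℝ (Δ.vert T i) (Δ.vert T k)) : 0 < (hΔ.basis T).coord i x := by
  rw [openSegment_eq_image'] at hx
  obtain ⟨t, ht, rfl⟩ := hx
  simp only
  rw [coord_lineMap, coord_vert, coord_vert]
  split_ifs <;> simp_all <;> linarith [ht.1, ht.2]

/-- At an inner point of an edge exactly the barycentric coordinates of its two endpoints are
positive, so the point determines the edge. -/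
lemma openSegment_pair {T : ι} {i k i' k' : Fin 3} (hik : i ≠ k) {x : Plane}
    (hx : x ∈ openSegment ℝ (Δ.vert T i) (Δ.vert T k))
    (hx' : x ∈ segment ℝ (Δ.vert T i') (Δ.vert T k')) :
    (i = i' ∧ k = k') ∨ (i = k' ∧ k = i') := by
  have h1 := hΔ.coord_openSegment hx
  have h2 := hΔ.coord_openSegment (openSegment_symm ℝ (Δ.vert T i) (Δ.vert T k) ▸ hx)
  have c1 : i = i' ∨ i = k' := by
    by_contra h; rw [not_or] at h
    rw [hΔ.coord_segment hx' h.1 h.2] at h1; exact lt_irrefl _ h1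
  have c2 : k = i' ∨ k = k' := by
    by_contra h; rw [not_or] at h
    rw [hΔ.coord_segment hx' h.1 h.2] at h2; exact lt_irrefl _ h2
  omega

lemma vert_notMem_openSegment {T : ι} {i k l : Fin 3} (hik : i ≠ k) :
    Δ.vert T l ∉ openSegment ℝ (Δ.vert T i) (Δ.vert T k) := fun h => by
  have := hΔ.openSegment_pair hik h (i' := l) (k' := l) (left_mem_segment ℝ _ _)
  omega

lemma vert_mem_segment {T : ι} {i k l : Fin 3}
    (h : Δ.vert T l ∈ segment ℝ (Δ.vert T i) (Δ.vert T k)) : l = i ∨ l = k := by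
  by_contra hcon; rw [not_or] at hcon
  have := hΔ.coord_segment h hcon.1 hcon.2
  rw [coord_vert] at this; simp at this

lemma straightened_eq (T : ι) : Δ.straightened T = {x | ∀ i, 0 ≤ (hΔ.basis T).coord i x} :=
  (hΔ.basis T).convexHull_eq_nonneg_coord

lemma interior_straightened (T : ι) :
    interior (Δ.straightened T) = {x | ∀ i, 0 < (hΔ.basis T).coord i x} :=
  (hΔ.basis T).interior_convexHull

lemma eq_bary (T : ι) (x : Plane) :
    x = bary (Δ.vert T) fun i => (hΔ.basis T).coord i x :=
  ((hΔ.basis T).linear_combination_coord_eq_self x).symm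

lemma sum_coord (T : ι) (x : Plane) : ∑ i, (hΔ.basis T).coord i x = 1 :=
  (hΔ.basis T).sum_coord_apply_eq_one x

lemma isCompact_cell (T : ι) : IsCompact (Δ.cell T) := by
  by_cases hT : T ∈ Δ.pie
  · exact hΔ.isCompact_pie T hT
  · rw [hΔ.cell_straight T hT]; exact (Set.finite_range _).isCompact_convexHull (𝕜 := ℝ)

lemma isClosed_cell (T : ι) : IsClosed (Δ.cell T) := (hΔ.isCompact_cell T).isClosed

lemma closure_interior_cell (T : ι) : closure (interior (Δ.cell T)) = Δ.cell T := by
  by_cases hT : T ∈ Δ.pie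
  · exact hΔ.closure_pie T hT
  · have h := hΔ.isClosed_cell T
    rw [hΔ.cell_straight T hT] at h ⊢
    have hne : (interior (Δ.straightened T)).Nonempty :=
      interior_convexHull_nonempty_iff_affineSpan_eq_top.2 (hΔ.basis T).tot
    have hc : Convex ℝ (Δ.straightened T) := convex_convexHull ℝ _
    rw [hc.closure_interior_eq_closure_of_nonempty_interior hne, h.closure_eq]

lemma frontier_cell {T : ι} {x : Plane} (hx : x ∈ frontier (Δ.cell T)) :
    (∃ i k, Δ.IsStraight T i k ∧ x ∈ segment ℝ (Δ.vert T i) (Δ.vert T k)) ∨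
      (T ∈ Δ.pie ∧ x ∈ Δ.curvedEdge T) := by
  by_cases hT : T ∈ Δ.pie
  · rw [hΔ.frontier_pie T hT] at hx
    rcases hx with (hx | hx) | hx
    · exact Or.inl ⟨0, 1, isStraight_zero (by decide), hx⟩
    · exact Or.inl ⟨0, 2, isStraight_zero (by decide), hx⟩
    · exact Or.inr ⟨hT, hx⟩
  · left
    rw [(hΔ.isClosed_cell T).frontier_eq, hΔ.cell_straight T hT, hΔ.interior_straightened,
      hΔ.straightened_eq] at hx
    obtain ⟨h1, h2⟩ := hx
    simp only [mem_ofPred_eq, not_forall, not_lt] at h1 h2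
    obtain ⟨l, hl⟩ := h2
    have hl0 : (hΔ.basis T).coord l x = 0 := le_antisymm hl (h1 l)
    refine ⟨l + 1, l + 2, isStraight_of_notMem hT (by omega), ?_⟩
    have hs := hΔ.sum_coord T x
    have hb := bary_side (v := Δ.vert T) hs hl0
    rw [← hΔ.eq_bary] at hb
    rw [segment_eq_image']
    refine ⟨_, ⟨h1 (l + 2), ?_⟩, hb.symm⟩
    rw [Fin.sum_univ_three] at hs
    have a0 := h1 0
    have a1 := h1 1
    have a2 := h1 2
    fin_cases l <;> simp <;> linarith

lemma segment_subset_frontier {T : ι} {i k : Fin 3} (h : Δ.IsStraight T i k) :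
    segment ℝ (Δ.vert T i) (Δ.vert T k) ⊆ frontier (Δ.cell T) := by
  by_cases hT : T ∈ Δ.pie
  · rw [hΔ.frontier_pie T hT]
    have key : ∀ l : Fin 3, l ≠ 0 → segment ℝ (Δ.vert T 0) (Δ.vert T l) ⊆
        segment ℝ (Δ.vert T 0) (Δ.vert T 1) ∪ segment ℝ (Δ.vert T 0) (Δ.vert T 2) ∪
        Δ.curvedEdge T := by
      intro l hl
      have : l = 1 ∨ l = 2 := by omega
      rcases this with rfl | rfl
      · exact fun x hx => Or.inl (Or.inl hx)
      · exact fun x hx => Or.inl (Or.inr hx)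
    rcases h.2 hT with rfl | rfl
    · exact key k h.1.symm
    · rw [segment_symm]; exact key i h.1
  · intro x hx
    rw [(hΔ.isClosed_cell T).frontier_eq, hΔ.cell_straight T hT]
    refine ⟨segment_subset_convexHull (mem_range_self i) (mem_range_self k) hx, ?_⟩
    rw [hΔ.interior_straightened]
    obtain ⟨l, hli, hlk⟩ : ∃ l : Fin 3, l ≠ i ∧ l ≠ k := by
      have := h.1
      fin_cases i <;> fin_cases k <;> simp at this ⊢ <;> decide
    intro hcon
    exact (hcon l).ne' (hΔ.coord_segment hx hli hlk)

lemma segment_subset_cell {T : ι} {i k : Fin 3} (h : Δ.IsStraight T i k) :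
    segment ℝ (Δ.vert T i) (Δ.vert T k) ⊆ Δ.cell T :=
  (hΔ.segment_subset_frontier h).trans (hΔ.isClosed_cell T).frontier_subset

lemma vert_mem_frontier (T : ι) (i : Fin 3) : Δ.vert T i ∈ frontier (Δ.cell T) := by
  obtain ⟨k, hk⟩ := Δ.exists_isStraight T i
  exact hΔ.segment_subset_frontier hk (left_mem_segment ℝ _ _)

lemma vert_mem_cell (T : ι) (i : Fin 3) : Δ.vert T i ∈ Δ.cell T :=
  (hΔ.isClosed_cell T).frontier_subset (hΔ.vert_mem_frontier T i)

lemma cell_subset_closure (T : ι) : Δ.cell T ⊆ closure (D.Ω : Set Plane) := by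
  rw [← hΔ.cover]; exact subset_iUnion _ T

lemma interior_cell_subset (T : ι) : interior (Δ.cell T) ⊆ D.Ω := by
  rw [← D.interior_closure]; exact interior_mono (hΔ.cell_subset_closure T)

lemma exists_cell {x : Plane} (hx : x ∈ closure (D.Ω : Set Plane)) : ∃ T, x ∈ Δ.cell T := by
  rw [← hΔ.cover] at hx; exact mem_iUnion.1 hx

/-- The way in which two triangles meet. -/
lemma meet {T T' : ι} (hne : T ≠ T') {x : Plane} (hx : x ∈ Δ.cell T) (hx' : x ∈ Δ.cell T') :
    (∃ i k, Δ.vert T i = x ∧ Δ.vert T' k = x ∧ Δ.cell T ∩ Δ.cell T' = {x}) ∨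
      ∃ i k a b, Δ.IsStraight T i k ∧ Δ.IsStraight T' a b ∧ Δ.vert T i = Δ.vert T' a ∧
        Δ.vert T k = Δ.vert T' b ∧
        Δ.cell T ∩ Δ.cell T' = segment ℝ (Δ.vert T i) (Δ.vert T k) ∧
        x ∈ segment ℝ (Δ.vert T i) (Δ.vert T k) := by
  have hmem : x ∈ Δ.cell T ∩ Δ.cell T' := ⟨hx, hx'⟩
  rcases hΔ.conforming T T' hne with h | ⟨i, k, h1, h2⟩ | ⟨⟨i, k, hik, h1⟩, ⟨a, b, hab, h2⟩⟩
  · rw [h] at hmem; exact absurd hmem (notMem_empty x)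
  · left
    rw [h2] at hmem
    obtain rfl : x = Δ.vert T i := hmem
    exact ⟨i, k, rfl, h1.symm, h2⟩
  · right
    rw [h1] at hmem
    rcases segment_eq_segment (h1.symm.trans h2) with ⟨e1, e2⟩ | ⟨e1, e2⟩
    · exact ⟨i, k, a, b, hik, hab, e1, e2, h1, hmem⟩
    · exact ⟨i, k, b, a, hik, hab.symm, e1, e2, h1, hmem⟩

lemma inter_subset_frontier {T T' : ι} (hne : T ≠ T') :
    Δ.cell T ∩ Δ.cell T' ⊆ frontier (Δ.cell T) := by
  rintro x ⟨hx, hx'⟩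
  rcases hΔ.meet hne hx hx' with ⟨i, k, rfl, -, -⟩ | ⟨i, k, a, b, hik, -, -, -, -, h⟩
  · exact hΔ.vert_mem_frontier T i
  · exact hΔ.segment_subset_frontier hik h

lemma interior_inter_cell {T T' : ι} (hne : T ≠ T') {x : Plane} (hx : x ∈ interior (Δ.cell T)) :
    x ∉ Δ.cell T' := fun hx' => by
  have := hΔ.inter_subset_frontier hne ⟨interior_subset hx, hx'⟩
  rw [(hΔ.isClosed_cell T).frontier_eq] at this
  exact this.2 hx

/-- There are no hanging vertices: a common edge has its endpoints at vertices of both triangles. -/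
lemma vert_of_mem_cell {T T' : ι} {i : Fin 3} (h : Δ.vert T i ∈ Δ.cell T') :
    ∃ k, Δ.vert T' k = Δ.vert T i := by
  by_cases hne : T = T'
  · exact ⟨i, hne ▸ rfl⟩
  rcases hΔ.meet hne (hΔ.vert_mem_cell T i) h with ⟨i', k, -, h2, -⟩ |
    ⟨i', k, a, b, -, -, h1, h2, -, h3⟩
  · exact ⟨k, h2⟩
  · rcases hΔ.vert_mem_segment h3 with rfl | rfl
    · exact ⟨a, h1.symm⟩
    · exact ⟨b, h2.symm⟩

lemma isClosed_curvedEdge (T : ι) : IsClosed (Δ.curvedEdge T) :=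
  (isCompact_Icc.image (D.continuous_curve _)).isClosed

lemma openSegment_notMem_curvedEdge {T : ι} (hT : T ∈ Δ.pie) {i k : Fin 3}
    (h : Δ.IsStraight T i k) {x : Plane} (hx : x ∈ openSegment ℝ (Δ.vert T i) (Δ.vert T k)) :
    x ∉ Δ.curvedEdge T := by
  have key : ∀ l : Fin 3, l ≠ 0 → x ∈ openSegment ℝ (Δ.vert T 0) (Δ.vert T l) →
      x ∉ Δ.curvedEdge T := by
    intro l hl hx hc
    have hmem : x ∈ ({Δ.vert T l} : Set Plane) := by
      rw [← hΔ.edge_inter_arc T hT l hl]; exact ⟨openSegment_subset_segment _ _ _ hx, hc⟩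
    rw [mem_singleton_iff.1 hmem] at hx
    exact hΔ.vert_notMem_openSegment hl.symm hx
  rcases h.2 hT with rfl | rfl
  · exact key k h.1.symm hx
  · rw [openSegment_symm] at hx; exact key i h.1 hx

/-- Near an interior point of a straight edge the boundary of a triangle is a straight line. -/
lemma exists_frontier_near_edge {T : ι} {i k : Fin 3} (h : Δ.IsStraight T i k) {x : Plane}
    (hx : x ∈ openSegment ℝ (Δ.vert T i) (Δ.vert T k)) :
    ∃ r > 0, ∀ y ∈ Metric.ball x r, y ∈ frontier (Δ.cell T) →
      cross (Δ.vert T k - Δ.vert T i) (y - Δ.vert T i) = 0 := by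
  set K : Set Plane := (⋃ p ∈ {p : Fin 3 × Fin 3 | ¬ ((i = p.1 ∧ k = p.2) ∨ (i = p.2 ∧ k = p.1))},
    segment ℝ (Δ.vert T p.1) (Δ.vert T p.2)) ∪ {y | T ∈ Δ.pie ∧ y ∈ Δ.curvedEdge T} with hKdef
  have hK : IsClosed K := by
    refine IsClosed.union ?_ ?_
    · refine Set.Finite.isClosed_biUnion (Set.toFinite _) fun p _ => ?_
      rw [← convexHull_pair]
      exact ((Set.toFinite _).isCompact_convexHull (𝕜 := ℝ)).isClosed
    · by_cases hT : T ∈ Δ.pie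
      · simpa [hT] using hΔ.isClosed_curvedEdge T
      · simp [hT]
  have hxK : x ∉ K := by
    rintro (h1 | ⟨hT, h1⟩)
    · simp only [mem_iUnion] at h1
      obtain ⟨p, hp, h1⟩ := h1
      exact hp (hΔ.openSegment_pair h.1 hx h1)
    · exact hΔ.openSegment_notMem_curvedEdge hT h hx h1
  obtain ⟨r, hr, hball⟩ := Metric.isOpen_iff.1 hK.isOpen_compl _ hxK
  refine ⟨r, hr, fun y hy hfr => ?_⟩
  have hyK := hball hy
  rcases hΔ.frontier_cell hfr with ⟨i', k', -, h1⟩ | h1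
  · by_cases hc : (i = i' ∧ k = k') ∨ (i = k' ∧ k = i')
    · have h2 : y ∈ segment ℝ (Δ.vert T i) (Δ.vert T k) := by
        rcases hc with ⟨rfl, rfl⟩ | ⟨rfl, rfl⟩
        · exact h1
        · rw [segment_symm]; exact h1
      rw [segment_eq_image'] at h2
      obtain ⟨t, -, rfl⟩ := h2
      simp [cross]; ring
    · exact absurd (Or.inl (mem_iUnion₂.2 ⟨(i', k'), hc, h1⟩)) hyK
  · exact absurd (Or.inr h1) hyK

end IsTriangulation
end CurvedTriangles

/-- One of the two open halves of a disk that is cut by a line. -/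
def halfDisk (x : Plane) (r : ℝ) (a e : Plane) (s : ℝ) : Set Plane :=
  Metric.ball x r ∩ {y | 0 < s * cross e (y - a)}

lemma convex_halfDisk (x : Plane) (r : ℝ) (a e : Plane) (s : ℝ) : Convex ℝ (halfDisk x r a e s) := by
  refine (convex_ball x r).inter ?_
  intro y hy z hz α β hα hβ hαβ
  simp only [mem_ofPred_eq] at *
  have : s * cross e (α • y + β • z - a) = α * (s * cross e (y - a)) + β * (s * cross e (z - a)) := by
    obtain rfl : β = 1 - α := by linarith
    simp [cross]; ring
  rw [this]
  rcases hα.eq_or_lt with h | h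
  · subst h; simp at hαβ; subst hαβ; simpa
  · have := mul_pos h hy
    have := mul_nonneg hβ hz.le
    linarith

lemma mem_closure_halfDisk {x y : Plane} {r : ℝ} {a e : Plane} {s : ℝ} (hs : s ≠ 0) (he : e ≠ 0)
    (hy : y ∈ Metric.ball x r) (hc : 0 ≤ s * cross e (y - a)) : y ∈ closure (halfDisk x r a e s) := by
  have htend : Tendsto (fun t : ℝ => y + t • (s • rot e)) (𝓝[>] 0) (𝓝 y) := by
    have : Continuous fun t : ℝ => y + t • (s • rot e) := by fun_prop
    have := this.tendsto 0
    simp only [zero_smul, add_zero] at this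
    exact this.mono_left nhdsWithin_le_nhds
  refine mem_closure_of_tendsto htend ?_
  filter_upwards [htend.eventually (Metric.isOpen_ball.mem_nhds hy), self_mem_nhdsWithin]
    with t ht ht0
  refine ⟨ht, ?_⟩
  have ht0 : (0 : ℝ) < t := ht0
  have hp := normSq_pos_of_ne he
  have : s * cross e (y + t • (s • rot e) - a) =
      s * cross e (y - a) + t * (s * s) * (e 0 * e 0 + e 1 * e 1) := by simp [cross]; ring
  rw [mem_ofPred_eq, this]
  have := mul_pos (mul_pos ht0 (mul_self_pos.2 hs)) hp
  linarith

lemma halfDisk_mono {x : Plane} {r r' : ℝ} (h : r ≤ r') (a e : Plane) (s : ℝ) :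
    halfDisk x r a e s ⊆ halfDisk x r' a e s :=
  inter_subset_inter_left _ (Metric.ball_subset_ball h)

/-! ### The two sides of a straight edge -/

namespace CurvedTriangles

variable {n : ℕ} [NeZero n] {D : ConicDomain n} {ι : Type} {Δ : CurvedTriangles D ι}

namespace IsTriangulation

variable (hΔ : Δ.IsTriangulation)
include hΔ

lemma edge_ne {T : ι} {i k : Fin 3} (h : i ≠ k) : Δ.vert T k - Δ.vert T i ≠ 0 :=
  sub_ne_zero.2 fun h' => h (hΔ.vert_injective T h').symm

/-- Near an interior point of a straight edge, a triangle contains a half disk. -/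
lemma exists_halfDisk {T : ι} {i k : Fin 3} (h : Δ.IsStraight T i k) {x : Plane}
    (hx : x ∈ openSegment ℝ (Δ.vert T i) (Δ.vert T k)) :
    ∃ r > 0, ∃ s : ℝ, (s = 1 ∨ s = -1) ∧
      halfDisk x r (Δ.vert T i) (Δ.vert T k - Δ.vert T i) s ⊆ interior (Δ.cell T) := by
  obtain ⟨r, hr, hfr⟩ := hΔ.exists_frontier_near_edge h hx
  refine ⟨r, hr, ?_⟩
  set e := Δ.vert T k - Δ.vert T i
  have hdich : ∀ s : ℝ, halfDisk x r (Δ.vert T i) e s ⊆ interior (Δ.cell T) ∨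
      halfDisk x r (Δ.vert T i) e s ⊆ (Δ.cell T)ᶜ := fun s =>
    IsPreconnected.subset_interior_or (convex_halfDisk x r _ e s).isPreconnected
      (hΔ.isClosed_cell T) fun y hy hyf => by
        have := hy.2
        rw [mem_ofPred_eq, hfr y hy.1 hyf] at this; simp at this
  by_contra hcon
  push Not at hcon
  -- If neither half disk were inside, the triangle would be contained in the line of the edge near
  -- x, although it is the closure of its interior.
  have h1 := (hdich 1).resolve_left (hcon 1 (Or.inl rfl))
  have h2 := (hdich (-1)).resolve_left (hcon (-1) (Or.inr rfl))
  have hxT : x ∈ closure (interior (Δ.cell T)) := by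
    rw [hΔ.closure_interior_cell]
    exact hΔ.segment_subset_cell h (openSegment_subset_segment _ _ _ hx)
  obtain ⟨y, hy, hyT⟩ := mem_closure_iff.1 hxT _ Metric.isOpen_ball (Metric.mem_ball_self hr)
  have hline : cross e (y - Δ.vert T i) = 0 := by
    rcases lt_trichotomy (cross e (y - Δ.vert T i)) 0 with h0 | h0 | h0
    · exact absurd (interior_subset hyT) (h2 ⟨hy, by rw [mem_ofPred_eq]; linarith⟩)
    · exact h0
    · exact absurd (interior_subset hyT) (h1 ⟨hy, by rw [mem_ofPred_eq]; linarith⟩)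
  have hcl := mem_closure_halfDisk (a := Δ.vert T i) (s := 1) one_ne_zero (hΔ.edge_ne h.1) hy
    (by rw [hline]; simp)
  obtain ⟨z, hz, hz'⟩ := mem_closure_iff.1 hcl _ isOpen_interior hyT
  exact h1 hz' (interior_subset hz)

lemma exists_ball_cells [Finite ι] (x : Plane) :
    ∃ r > 0, ∀ T, ∀ y ∈ Metric.ball x r, y ∈ Δ.cell T → x ∈ Δ.cell T := by
  have hK : IsClosed (⋃ T ∈ {T | x ∉ Δ.cell T}, Δ.cell T) :=
    Set.Finite.isClosed_biUnion (Set.toFinite _) fun T _ => hΔ.isClosed_cell T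
  obtain ⟨r, hr, hball⟩ := Metric.isOpen_iff.1 hK.isOpen_compl x (by
    simp only [mem_compl_iff, mem_iUnion]; rintro ⟨T, hT, h⟩; exact hT h)
  refine ⟨r, hr, fun T y hy hyT => ?_⟩
  by_contra hcon
  exact hball hy (mem_iUnion₂.2 ⟨T, hcon, hyT⟩)

/-- Two different triangles that contain an interior point of a straight edge of the first one share
this edge. -/
lemma share_edge {T T' : ι} (hne : T ≠ T') {i k : Fin 3} (h : i ≠ k) {x : Plane}
    (hxT : x ∈ Δ.cell T) (hx : x ∈ openSegment ℝ (Δ.vert T i) (Δ.vert T k)) (hx' : x ∈ Δ.cell T') :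
    ∃ a b, Δ.IsStraight T' a b ∧ Δ.vert T i = Δ.vert T' a ∧ Δ.vert T k = Δ.vert T' b ∧
      Δ.cell T ∩ Δ.cell T' = segment ℝ (Δ.vert T i) (Δ.vert T k) := by
  rcases hΔ.meet hne hxT hx' with ⟨i', k', rfl, -, -⟩ | ⟨i', k', a, b, -, hab, h1, h2, h3, h4⟩
  · exact absurd hx (hΔ.vert_notMem_openSegment h)
  · rcases hΔ.openSegment_pair h hx h4 with ⟨rfl, rfl⟩ | ⟨rfl, rfl⟩
    · exact ⟨a, b, hab, h1, h2, h3⟩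
    · exact ⟨b, a, hab.symm, h2, h1, by rw [h3, segment_symm]⟩

/-- Two different triangles with a common edge cover a neighbourhood of its interior points, from
different sides. -/
lemma opposite_sides {T T' : ι} (hne : T ≠ T') {i k a b : Fin 3} (h : Δ.IsStraight T i k)
    (h' : Δ.IsStraight T' a b) (hi : Δ.vert T i = Δ.vert T' a) (hk : Δ.vert T k = Δ.vert T' b)
    {x : Plane} (hx : x ∈ openSegment ℝ (Δ.vert T i) (Δ.vert T k)) :
    ∃ r > 0, ∃ s : ℝ, (s = 1 ∨ s = -1) ∧
      halfDisk x r (Δ.vert T i) (Δ.vert T k - Δ.vert T i) s ⊆ interior (Δ.cell T) ∧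
      halfDisk x r (Δ.vert T i) (Δ.vert T k - Δ.vert T i) (-s) ⊆ interior (Δ.cell T') := by
  obtain ⟨r, hr, s, hs, hH⟩ := hΔ.exists_halfDisk h hx
  obtain ⟨r', hr', s', hs', hH'⟩ := hΔ.exists_halfDisk h' (x := x) (by rwa [← hi, ← hk])
  rw [← hi, ← hk] at hH'
  refine ⟨min r r', lt_min hr hr', s, hs, (halfDisk_mono (min_le_left _ _) _ _ _).trans hH, ?_⟩
  have : s' = -s := by
    by_contra hcon
    have : s' = s := by rcases hs with rfl | rfl <;> rcases hs' with rfl | rfl <;> simp_all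
    subst this
    have hs0 : s' ≠ 0 := by rcases hs with rfl | rfl <;> norm_num
    have hx0 : cross (Δ.vert T k - Δ.vert T i) (x - Δ.vert T i) = 0 := by
      rw [openSegment_eq_image'] at hx
      obtain ⟨t, -, rfl⟩ := hx
      simp [cross]; ring
    have hcl := mem_closure_halfDisk (x := x) (r := min r r') (a := Δ.vert T i) hs0 (hΔ.edge_ne h.1)
      (Metric.mem_ball_self (lt_min hr hr')) (by rw [hx0]; simp)
    obtain ⟨y, hy⟩ := closure_nonempty_iff.1 ⟨x, hcl⟩
    exact hΔ.interior_inter_cell hne (hH (halfDisk_mono (min_le_left _ _) _ _ _ hy))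
      (interior_subset (hH' (halfDisk_mono (min_le_right _ _) _ _ _ hy)))
  rw [← this]
  exact (halfDisk_mono (min_le_right _ _) _ _ _).trans hH'


/-- The interior points of straight edges are in the domain. -/
lemma openSegment_subset [Finite ι] {T : ι} {i k : Fin 3} (h : Δ.IsStraight T i k) :
    openSegment ℝ (Δ.vert T i) (Δ.vert T k) ⊆ D.Ω := by
  intro x hx
  have hxT := hΔ.segment_subset_cell h (openSegment_subset_segment _ _ _ hx)
  by_cases hcase : ∃ T', T ≠ T' ∧ x ∈ Δ.cell T'
  · obtain ⟨T', hne, hxT'⟩ := hcase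
    obtain ⟨a, b, hab, hi, hk, -⟩ := hΔ.share_edge hne h.1 hxT hx hxT'
    obtain ⟨r, hr, s, hs, hH, hH'⟩ := hΔ.opposite_sides hne h hab hi hk hx
    have hs0 : s ≠ 0 := by rcases hs with rfl | rfl <;> norm_num
    rw [← D.interior_closure]
    refine mem_interior.2 ⟨Metric.ball x r, fun y hy => ?_, Metric.isOpen_ball,
      Metric.mem_ball_self hr⟩
    rcases le_total 0 (s * cross (Δ.vert T k - Δ.vert T i) (y - Δ.vert T i)) with h0 | h0
    · have := closure_mono hH (mem_closure_halfDisk hs0 (hΔ.edge_ne h.1) hy h0)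
      rw [hΔ.closure_interior_cell] at this
      exact hΔ.cell_subset_closure T this
    · have := closure_mono hH' (mem_closure_halfDisk (neg_ne_zero.2 hs0) (hΔ.edge_ne h.1) hy
        (by linarith))
      rw [hΔ.closure_interior_cell] at this
      exact hΔ.cell_subset_closure T' this
  · push Not at hcase
    exfalso
    obtain ⟨r, hr, hball⟩ := hΔ.exists_ball_cells x
    set e := Δ.vert T k - Δ.vert T i with he
    -- If `T` is the only triangle at x, it fills Ω near x, so its edge would be part of ∂Ω.
    have hfr : ∀ y ∈ Metric.ball x r, y ∈ frontier (Δ.cell T) → y ∈ frontier (D.Ω : Set Plane) := by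
      intro y hy hyf
      rw [D.Ω.isOpen.frontier_eq]
      refine ⟨hΔ.cell_subset_closure T ((hΔ.isClosed_cell T).frontier_subset hyf), fun hyΩ => ?_⟩
      rw [(hΔ.isClosed_cell T).frontier_eq] at hyf
      refine hyf.2 (mem_interior.2 ⟨Metric.ball x r ∩ D.Ω, ?_, Metric.isOpen_ball.inter D.Ω.isOpen,
        hy, hyΩ⟩)
      rintro z ⟨hz, hzΩ⟩
      obtain ⟨T', hT'⟩ := hΔ.exists_cell (subset_closure hzΩ)
      by_cases hTT : T = T'
      · rw [hTT]; exact hT'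
      · exact absurd (hball T' z hz hT') (hcase T' hTT)
    rw [openSegment_eq_image'] at hx
    obtain ⟨t₀, ht₀, rfl⟩ := hx
    simp only at *
    have hcont : ContinuousAt (fun t : ℝ => Δ.vert T i + t • e) t₀ := by fun_prop
    have hev : ∀ᶠ t in 𝓝 t₀, t ∈ Ioo (0 : ℝ) 1 ∧ Δ.vert T i + t • e ∈
        Metric.ball (Δ.vert T i + t₀ • e) r :=
      Filter.Eventually.and (isOpen_Ioo.mem_nhds ht₀) (hcont.eventually (Metric.ball_mem_nhds _ hr))
    have hinf := infinite_of_mem_nhds t₀ hev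
    have hsub : {t | t ∈ Ioo (0 : ℝ) 1 ∧ Δ.vert T i + t • e ∈ Metric.ball (Δ.vert T i + t₀ • e) r} ⊆
        ⋃ j, {t | polyFun (D.q j) (Δ.vert T i + t • e) = 0} := by
      rintro t ⟨ht, hb⟩
      have hseg : Δ.vert T i + t • e ∈ segment ℝ (Δ.vert T i) (Δ.vert T k) := by
        rw [segment_eq_image']; exact ⟨t, ⟨ht.1.le, ht.2.le⟩, rfl⟩
      have := hfr _ hb (hΔ.segment_subset_frontier h hseg)
      rw [D.frontier_eq] at this
      obtain ⟨j, s, hs, hjs⟩ := mem_iUnion.1 this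
      exact mem_iUnion.2 ⟨j, by rw [mem_ofPred_eq, ← hjs]; exact D.q_zero_closed j hs⟩
    have := hinf.mono hsub
    -- Infinitely many points of the edge lie on finitely many conics, hence infinitely many on one
    -- of them, which is impossible for an irreducible conic.
    obtain ⟨j, hj⟩ : ∃ j, {t | polyFun (D.q j) (Δ.vert T i + t • e) = 0}.Infinite := by
      by_contra hcon
      push Not at hcon
      exact this (Set.finite_iUnion hcon)
    exact conic_not_infinite_line (D.q_irreducible j) (D.q_degree j) (hΔ.edge_ne h.1) hj
      fun t ht => ht

/-- The triangle on the other side of a straight edge. -/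
lemma exists_neighbor [Finite ι] {T : ι} {i k : Fin 3} (h : Δ.IsStraight T i k) :
    ∃ T', T ≠ T' ∧ ∃ a b, Δ.IsStraight T' a b ∧ Δ.vert T i = Δ.vert T' a ∧
      Δ.vert T k = Δ.vert T' b := by
  obtain ⟨x, hx⟩ : (openSegment ℝ (Δ.vert T i) (Δ.vert T k)).Nonempty :=
    ⟨_, 1 / 2, 1 / 2, by norm_num, by norm_num, by norm_num, rfl⟩
  have hxT := hΔ.segment_subset_frontier h (openSegment_subset_segment _ _ _ hx)
  have hxc := (hΔ.isClosed_cell T).frontier_subset hxT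
  have hxΩ := hΔ.openSegment_subset h hx
  by_cases hcase : ∃ T', T ≠ T' ∧ x ∈ Δ.cell T'
  · obtain ⟨T', hne, hxT'⟩ := hcase
    obtain ⟨a, b, hab, hi, hk, -⟩ := hΔ.share_edge hne h.1 hxc hx hxT'
    exact ⟨T', hne, a, b, hab, hi, hk⟩
  · exfalso
    push Not at hcase
    obtain ⟨r, hr, hball⟩ := hΔ.exists_ball_cells x
    rw [(hΔ.isClosed_cell T).frontier_eq] at hxT
    refine hxT.2 (mem_interior.2 ⟨Metric.ball x r ∩ D.Ω, ?_, Metric.isOpen_ball.inter D.Ω.isOpen,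
      Metric.mem_ball_self hr, hxΩ⟩)
    rintro z ⟨hz, hzΩ⟩
    obtain ⟨T', hT'⟩ := hΔ.exists_cell (subset_closure hzΩ)
    by_cases hTT : T = T'
    · rw [hTT]; exact hT'
    · exact absurd (hball T' z hz hT') (hcase T' hTT)

/-- Both neighbours lie on the side of the edge opposite to `T`, so two different ones would have a
half disk of interior points in common. -/
lemma neighbor_unique {T T₁ T₂ : ι} (h₁ : T ≠ T₁) (h₂ : T ≠ T₂) {i k a b c d : Fin 3}
    (h : Δ.IsStraight T i k) (hab : Δ.IsStraight T₁ a b) (hcd : Δ.IsStraight T₂ c d)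
    (hi₁ : Δ.vert T i = Δ.vert T₁ a) (hk₁ : Δ.vert T k = Δ.vert T₁ b)
    (hi₂ : Δ.vert T i = Δ.vert T₂ c) (hk₂ : Δ.vert T k = Δ.vert T₂ d) : T₁ = T₂ := by
  by_contra hne
  obtain ⟨x, hx⟩ : (openSegment ℝ (Δ.vert T i) (Δ.vert T k)).Nonempty :=
    ⟨_, 1 / 2, 1 / 2, by norm_num, by norm_num, by norm_num, rfl⟩
  have hx0 : cross (Δ.vert T k - Δ.vert T i) (x - Δ.vert T i) = 0 := by
    rw [openSegment_eq_image'] at hx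
    obtain ⟨t, -, rfl⟩ := hx
    simp [cross]; ring
  have main : ∀ {A B : ι}, A ≠ B → ∀ {r r' s : ℝ}, 0 < r → 0 < r' → s ≠ 0 →
      halfDisk x r (Δ.vert T i) (Δ.vert T k - Δ.vert T i) s ⊆ interior (Δ.cell A) →
      halfDisk x r' (Δ.vert T i) (Δ.vert T k - Δ.vert T i) s ⊆ interior (Δ.cell B) → False := by
    intro A B hAB r r' s hr hr' hs h1 h2
    have hcl := mem_closure_halfDisk (x := x) (r := min r r') (a := Δ.vert T i) hs (hΔ.edge_ne h.1)
      (Metric.mem_ball_self (lt_min hr hr')) (by rw [hx0]; simp)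
    obtain ⟨y, hy⟩ := closure_nonempty_iff.1 ⟨x, hcl⟩
    exact hΔ.interior_inter_cell hAB (h1 (halfDisk_mono (min_le_left _ _) _ _ _ hy))
      (interior_subset (h2 (halfDisk_mono (min_le_right _ _) _ _ _ hy)))
  obtain ⟨r, hr, s, hs, -, hH⟩ := hΔ.opposite_sides h₁ h hab hi₁ hk₁ hx
  obtain ⟨r', hr', s', hs', hG, hG'⟩ := hΔ.opposite_sides h₂ h hcd hi₂ hk₂ hx
  have hs0 : s ≠ 0 := by rcases hs with rfl | rfl <;> norm_num
  have hs0' : s' ≠ 0 := by rcases hs' with rfl | rfl <;> norm_num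
  by_cases hss : s = s'
  · subst hss; exact main hne hr hr' (neg_ne_zero.2 hs0) hH hG'
  · have : s' = -s := by rcases hs with rfl | rfl <;> rcases hs' with rfl | rfl <;> simp_all
    rw [this] at hG
    exact main h₁ hr' hr (neg_ne_zero.2 hs0) hG hH

/-- The points of a triangle on the boundary of the domain. -/
lemma mem_frontier_cases [Finite ι] {T : ι} {x : Plane} (hx : x ∈ Δ.cell T)
    (hfr : x ∈ frontier (D.Ω : Set Plane)) :
    (∃ i, x = Δ.vert T i) ∨ (T ∈ Δ.pie ∧ x ∈ Δ.curvedEdge T) := by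
  rw [D.Ω.isOpen.frontier_eq] at hfr
  have hxf : x ∈ frontier (Δ.cell T) := by
    rw [(hΔ.isClosed_cell T).frontier_eq]
    exact ⟨hx, fun h => hfr.2 (hΔ.interior_cell_subset T h)⟩
  rcases hΔ.frontier_cell hxf with ⟨i, k, hik, h⟩ | h
  · left
    rw [← insert_endpoints_openSegment] at h
    rcases h with h | h | h
    · exact ⟨i, h⟩
    · exact ⟨k, h⟩
    · exact absurd (hΔ.openSegment_subset hik h) hfr.2
  · exact Or.inr h

lemma curvedEdge_subset_frontier {T : ι} (hT : T ∈ Δ.pie) :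
    Δ.curvedEdge T ⊆ frontier (D.Ω : Set Plane) := by
  rintro _ ⟨t, ht, rfl⟩
  have := hΔ.arc_param T hT
  exact D.curve_mem_frontier _ ⟨this.1.trans ht.1, ht.2.trans this.2.2⟩

lemma curvedEdge_subset_closedArc {T : ι} (hT : T ∈ Δ.pie) :
    Δ.curvedEdge T ⊆ D.closedArc (Δ.arc T) := by
  have := hΔ.arc_param T hT
  exact image_mono (Icc_subset_Icc this.1 this.2.2)

lemma vert_one_mem {T : ι} (hT : T ∈ Δ.pie) : Δ.vert T 1 ∈ Δ.curvedEdge T :=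
  ⟨Δ.lo T, left_mem_Icc.2 (hΔ.arc_param T hT).2.1.le, hΔ.arc_lo T hT⟩

lemma vert_two_mem {T : ι} (hT : T ∈ Δ.pie) : Δ.vert T 2 ∈ Δ.curvedEdge T :=
  ⟨Δ.hi T, right_mem_Icc.2 (hΔ.arc_param T hT).2.1.le, hΔ.arc_hi T hT⟩

lemma vert_mem_curvedEdge {T : ι} (hT : T ∈ Δ.pie) {i : Fin 3} (hi : i ≠ 0) :
    Δ.vert T i ∈ Δ.curvedEdge T := by
  have : i = 1 ∨ i = 2 := by omega
  rcases this with rfl | rfl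
  · exact hΔ.vert_one_mem hT
  · exact hΔ.vert_two_mem hT

lemma conic_closedArc {T : ι} {x : Plane} (hx : x ∈ D.closedArc (Δ.arc T)) :
    polyFun (Δ.conic T) x = 0 := by
  obtain ⟨t, ht, rfl⟩ := hx
  exact D.q_zero_closed _ ht

lemma closedArc_subset_frontier (j : Fin n) : D.closedArc j ⊆ frontier (D.Ω : Set Plane) := by
  rintro _ ⟨t, ht, rfl⟩; exact D.curve_mem_frontier _ ht

lemma notMem_of_mem_frontier {x : Plane} (hx : x ∈ frontier (D.Ω : Set Plane)) : x ∉ D.Ω := by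
  rw [D.Ω.isOpen.frontier_eq] at hx; exact hx.2

lemma mem_of_notMem_frontier {x : Plane} {T : ι} (hx : x ∈ Δ.cell T)
    (h : x ∉ frontier (D.Ω : Set Plane)) : x ∈ D.Ω := by
  by_contra hcon
  exact h (by rw [D.Ω.isOpen.frontier_eq]; exact ⟨hΔ.cell_subset_closure T hx, hcon⟩)

end IsTriangulation

/-! ### Signs of the conic on a pie-shaped triangle -/

section Admissible

variable (hΔ : Δ.IsTriangulation) (hAF : Δ.IsAdmissible)
include hΔ hAF

lemma conic_pos_of_mem {T : ι} (hT : T ∈ Δ.pie) {x : Plane} (hx : x ∈ Δ.cell T) (hxΩ : x ∈ D.Ω) :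
    0 < polyFun (Δ.conic T) x :=
  hAF.condE T hT x ⟨hx, fun h => hΔ.notMem_of_mem_frontier (hΔ.closedArc_subset_frontier _ h) hxΩ⟩

lemma conic_nonneg_of_mem {T : ι} (hT : T ∈ Δ.pie) {x : Plane} (hx : x ∈ Δ.cell T) :
    0 ≤ polyFun (Δ.conic T) x := by
  by_cases h : x ∈ D.closedArc (Δ.arc T)
  · rw [hΔ.conic_closedArc h]
  · exact (hAF.condE T hT x ⟨hx, h⟩).le

lemma vert_zero_mem {T : ι} (hT : T ∈ Δ.pie) : Δ.vert T 0 ∈ D.Ω := by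
  refine hΔ.mem_of_notMem_frontier (hΔ.vert_mem_cell T 0) fun h => ?_
  exact hAF.condB T 0 1 (isStraight_zero (by decide))
    ⟨h, hΔ.curvedEdge_subset_frontier hT (hΔ.vert_one_mem hT)⟩

end Admissible

end CurvedTriangles
end ConicSpline

namespace ConicSpline

/-! ### Convolutions -/

/-- The convolution of real functions on the plane. -/
noncomputable def conv (f g : Plane → ℝ) : Plane → ℝ :=
  convolution f g (ContinuousLinearMap.lsmul ℝ ℝ) volume

lemma conv_apply (f g : Plane → ℝ) (x : Plane) : conv f g x = ∫ t, f t * g (x - t) := rfl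

lemma conv_comm (f g : Plane → ℝ) : conv f g = conv g f := by
  ext x
  rw [conv_apply, conv_apply, ← integral_sub_left_eq_self _ _ x]
  refine integral_congr_ae (Eventually.of_forall fun t => ?_)
  simp only [sub_sub_cancel]; ring

/-- Approximate the integrable factor in L¹ by continuous functions with compact support; a bounded
kernel turns this into uniform approximation of the convolutions. -/
lemma continuous_conv {K g : Plane → ℝ} (hK : AEStronglyMeasurable K volume) {C : ℝ}
    (hC : ∀ x, |K x| ≤ C) (hg : Integrable g) : Continuous (conv K g) := by
  have hC0 : 0 ≤ C := (abs_nonneg _).trans (hC 0)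
  have hKl : LocallyIntegrable K volume := by
    refine (MeasureTheory.locallyIntegrable_const (C : ℝ)).mono hK (Eventually.of_forall fun x => ?_)
    rw [Real.norm_eq_abs, Real.norm_eq_abs, abs_of_nonneg hC0]; exact hC x
  have hex : ∀ {f : Plane → ℝ}, Integrable f → ∀ x, Integrable fun t => K t * f (x - t) := by
    intro f hf x
    exact (hf.comp_sub_left x).bdd_mul hK (Eventually.of_forall hC)
  refine continuous_of_uniform_approx_of_continuous fun u hu => ?_
  obtain ⟨ε, hε, hεu⟩ := Metric.mem_uniformity_dist.1 hu
  obtain ⟨f, hfc, hfi, hfcont, hfint⟩ := hg.exists_hasCompactSupport_integral_sub_le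
    (ε := ε / (2 * (C + 1))) (by positivity)
  refine ⟨conv K f, hfc.continuous_convolution_right _ hKl hfcont, fun x => hεu ?_⟩
  rw [Real.dist_eq, conv_apply, conv_apply, ← integral_sub (hex hg x) (hex hfint x)]
  calc |∫ t, (K t * g (x - t) - K t * f (x - t))|
      ≤ ∫ t, |K t * g (x - t) - K t * f (x - t)| := abs_integral_le_integral_abs
    _ ≤ ∫ t, C * ‖g (x - t) - f (x - t)‖ := by
        refine integral_mono ((hex hg x).sub (hex hfint x)).abs
          (((hg.sub hfint).norm.comp_sub_left x).const_mul C) fun t => ?_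
        simp only
        rw [← mul_sub, abs_mul]
        exact mul_le_mul_of_nonneg_right (hC t) (abs_nonneg _)
    _ = C * ∫ t, ‖g t - f t‖ := by
        rw [integral_const_mul, integral_sub_left_eq_self (fun t => ‖g t - f t‖)]
    _ ≤ C * (ε / (2 * (C + 1))) := mul_le_mul_of_nonneg_left hfi hC0
    _ < ε := by
        rw [mul_div_assoc', div_lt_iff₀ (by positivity)]; nlinarith

lemma convolutionExists_of_cont {ρ f : Plane → ℝ} (hρ : Continuous ρ) (hρc : HasCompactSupport ρ)
    (hf : LocallyIntegrable f volume) :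
    ConvolutionExists ρ f (ContinuousLinearMap.lsmul ℝ ℝ) volume :=
  hρc.convolutionExists_left _ hρ hf

lemma conv_add {ρ f g : Plane → ℝ} (hρ : Continuous ρ) (hρc : HasCompactSupport ρ)
    (hf : LocallyIntegrable f volume) (hg : LocallyIntegrable g volume) (x : Plane) :
    conv ρ (fun y => f y + g y) x = conv ρ f x + conv ρ g x := by
  have h1 : Integrable fun t => ρ t * f (x - t) := convolutionExists_of_cont hρ hρc hf x
  have h2 : Integrable fun t => ρ t * g (x - t) := convolutionExists_of_cont hρ hρc hg x
  rw [conv_apply, conv_apply, conv_apply, ← integral_add h1 h2]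
  simp only [mul_add]

lemma conv_const_mul (ρ f : Plane → ℝ) (c : ℝ) (x : Plane) :
    conv ρ (fun y => c * f y) x = c * conv ρ f x := by
  rw [conv_apply, conv_apply, ← integral_const_mul]
  congr 1; ext t; ring

/-- Mollification commutes with the averaging kernels, so identities for smooth regularizations
carry over to averages of weak derivatives. -/
lemma conv_left_comm {ρ K f : Plane → ℝ} (hρ : Continuous ρ) (hρc : HasCompactSupport ρ)
    (hK : Integrable K) (hf : Integrable f) : conv ρ (conv K f) = conv K (conv ρ f) := by
  ext x
  rw [conv_comm K f, conv_comm K (conv ρ f)]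
  symm
  refine convolution_assoc _ _ _ _ (fun x y z => by simp [mul_assoc])
    hρ.aestronglyMeasurable hf.aestronglyMeasurable hK.aestronglyMeasurable
    (Eventually.of_forall (convolutionExists_of_cont hρ hρc hf.locallyIntegrable))
    (Integrable.ae_convolution_exists _ hf.norm hK.norm)
    ((hρc.norm).convolutionExists_left _ hρ.norm
      (Integrable.integrable_convolution _ hf.norm hK.norm).locallyIntegrable x)

/-! ### Averaging over parallelograms -/

/-- The unit square. -/
def unitSquare : Set (ℝ × ℝ) := Icc 0 1 ×ˢ Icc 0 1

/-- The averages over translates of a parallelogram, as convolutions. -/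
lemma exists_kernel {p₁ p₂ : Plane} (hp : cross p₁ p₂ ≠ 0) {k : ℝ × ℝ → ℝ} (hk : Continuous k) :
    ∃ K : Plane → ℝ, Integrable K ∧ (∃ C, ∀ y, |K y| ≤ C) ∧ ∀ (h : Plane → ℝ) (x : Plane),
      conv K h x = ∫ z in unitSquare, k z * h (x + z.1 • p₁ + z.2 • p₂) := by
  let L₀ : (ℝ × ℝ) ≃ₗ[ℝ] Plane :=
    { toFun := fun z => z.1 • p₁ + z.2 • p₂
      map_add' := fun z z' => by simp only [Prod.fst_add, Prod.snd_add]; module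
      map_smul' := fun c z => by simp only [Prod.smul_fst, Prod.smul_snd, RingHom.id_apply]; module
      invFun := fun y => (cross y p₂ / cross p₁ p₂, cross p₁ y / cross p₁ p₂)
      left_inv := fun z => by
        ext
        · simp only; rw [div_eq_iff hp]; simp [cross]; ring
        · simp only; rw [div_eq_iff hp]; simp [cross]; ring
      right_inv := fun y => (exists_coords hp y).symm }
  let L : (ℝ × ℝ) ≃L[ℝ] Plane := L₀.toContinuousLinearEquiv
  have hL : ∀ z, L z = z.1 • p₁ + z.2 • p₂ := fun z => rfl
  have hQ : IsCompact unitSquare := isCompact_Icc.prod isCompact_Icc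
  have hQm : MeasurableSet unitSquare := hQ.measurableSet
  -- The image of Lebesgue measure under `L` is a Haar measure, hence a multiple of the volume. The
  -- factor is absorbed in the kernel, so its value does not matter.
  obtain ⟨c, hc⟩ : ∃ c : ℝ, ∀ F : Plane → ℝ, ∫ z : ℝ × ℝ, F (L z) = c * ∫ y, F y := by
    have : (Measure.map L (volume : Measure (ℝ × ℝ))).IsAddHaarMeasure :=
      L.isAddHaarMeasure_map _
    obtain ⟨c', he⟩ : ∃ c' : NNReal, Measure.map L (volume : Measure (ℝ × ℝ)) =
        c' • (volume : Measure Plane) := ⟨_, Measure.isAddLeftInvariant_eq_smul _ _⟩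
    refine ⟨c', fun F => ?_⟩
    have := L.toHomeomorph.toMeasurableEquiv.measurableEmbedding.integral_map
      (μ := (volume : Measure (ℝ × ℝ))) F
    rw [show (fun z => F (L z)) = fun z => F (L.toHomeomorph.toMeasurableEquiv z) from rfl, ← this,
      show ⇑L.toHomeomorph.toMeasurableEquiv = ⇑L from rfl, he, integral_smul_nnreal_measure]
    rfl
  obtain ⟨M, hM⟩ := hQ.exists_bound_of_continuousOn hk.continuousOn
  have hM0 : 0 ≤ M := (norm_nonneg _).trans (hM (0, 0) ⟨by simp, by simp⟩)
  -- The sign -y compensates for the convolution evaluating the other factor at x - t.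
  let K : Plane → ℝ := fun y => c * unitSquare.indicator k (L.symm (-y))
  have hKm : Measurable K := by
    refine Measurable.const_mul ?_ c
    exact (hk.measurable.indicator hQm).comp (L.symm.continuous.comp continuous_neg).measurable
  have hbd : ∀ y, |K y| ≤ |c| * M := by
    intro y
    rw [abs_mul]
    refine mul_le_mul_of_nonneg_left ?_ (abs_nonneg _)
    by_cases h : L.symm (-y) ∈ unitSquare
    · rw [indicator_of_mem h]; exact hM _ h
    · rw [indicator_of_notMem h]; simpa
  refine ⟨K, ?_, ⟨|c| * M, hbd⟩, fun h x => ?_⟩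
  · have hS : IsCompact ((fun z => -L z) '' unitSquare) :=
      hQ.image (by fun_prop)
    have hsupp : Function.support K ⊆ (fun z => -L z) '' unitSquare := by
      intro y hy
      by_contra hcon
      refine hy ?_
      have : L.symm (-y) ∉ unitSquare := fun h => hcon ⟨_, h, by simp⟩
      show c * _ = 0
      rw [indicator_of_notMem this, mul_zero]
    rw [← integrableOn_iff_integrable_of_support_subset hsupp]
    exact Measure.integrableOn_of_bounded hS.measure_lt_top.ne hKm.aestronglyMeasurable
      (Eventually.of_forall hbd)
  · rw [conv_apply, ← integral_neg_eq_self]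
    have := hc fun y => unitSquare.indicator k (L.symm y) * h (x + y)
    simp only [K, neg_neg, sub_neg_eq_add, mul_assoc]
    rw [integral_const_mul, ← this, ← integral_indicator hQm]
    congr 1; ext z
    show unitSquare.indicator k (L.symm (L z)) * h (x + L z) = _
    rw [L.symm_apply_apply, hL, ← add_assoc]
    by_cases hz : z ∈ unitSquare
    · rw [indicator_of_mem hz, indicator_of_mem hz]
    · rw [indicator_of_notMem hz, indicator_of_notMem hz, zero_mul]

/-! ### Families of derivatives -/

/-- The linear form with given coordinates. -/
noncomputable def linForm (c d : ℝ) : Plane →L[ℝ] ℝ :=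
  c • EuclideanSpace.proj 0 + d • EuclideanSpace.proj 1

@[simp] lemma linForm_apply (c d : ℝ) (p : Plane) : linForm c d p = c * p 0 + d * p 1 := by
  simp [linForm]

/-- The directional derivatives belonging to a family of partial derivatives. -/
def dirFamily (p : Plane) (h : ℕ → ℕ → Plane → ℝ) : ℕ → ℕ → Plane → ℝ :=
  fun a b x => p 0 * h (a + 1) b x + p 1 * h a (b + 1) x

/-- The functions `h a b`, `a + b ≤ N + 1`, are the partial derivatives of `h 0 0` on `S`. -/
def IsDerivFamily (N : ℕ) (S : Set Plane) (h : ℕ → ℕ → Plane → ℝ) : Prop :=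
  ∀ a b, a + b ≤ N → ∀ x ∈ S, HasFDerivAt (h a b) (linForm (h (a + 1) b x) (h a (b + 1) x)) x

lemma IsDerivFamily.dirFamily {N : ℕ} {S : Set Plane} {h : ℕ → ℕ → Plane → ℝ}
    (H : IsDerivFamily (N + 1) S h) (p : Plane) : IsDerivFamily N S (dirFamily p h) := by
  intro a b hab x hx
  have h1 := H (a + 1) b (by omega) x hx
  have h2 := H a (b + 1) (by omega) x hx
  refine ((h1.const_mul (p 0)).add (h2.const_mul (p 1))).congr_fderiv ?_
  ext τ
  simp [ConicSpline.dirFamily]; ring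

lemma IsDerivFamily.hasDerivAt {N : ℕ} {S : Set Plane} {h : ℕ → ℕ → Plane → ℝ}
    (H : IsDerivFamily N S h) {a b : ℕ} (hab : a + b ≤ N) {x p : Plane} {t : ℝ}
    (hx : x + t • p ∈ S) :
    HasDerivAt (fun s : ℝ => h a b (x + s • p)) (ConicSpline.dirFamily p h a b (x + t • p)) t := by
  have := hasDerivAt_line (H a b hab _ hx)
  convert this using 1
  simp [ConicSpline.dirFamily]; ring

/-- The integrand is the derivative of (s - 1) F(s). The weight vanishes at s = 1, so only the
corner s = 0 contributes. -/
lemma integral_average {F F' : ℝ → ℝ} (hF : ∀ s ∈ Icc (0 : ℝ) 1, HasDerivAt F (F' s) s)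
    (hFc : Continuous F) (hF' : Continuous F') :
    ∫ s in Icc (0 : ℝ) 1, (F s - (1 - s) * F' s) = F 0 := by
  rw [integral_Icc_eq_integral_Ioc, ← intervalIntegral.integral_of_le zero_le_one]
  rw [intervalIntegral.integral_eq_sub_of_hasDerivAt (f := fun s => (s - 1) * F s)]
  · simp
  · intro s hs
    rw [uIcc_of_le zero_le_one] at hs
    have h1 : HasDerivAt (fun s : ℝ => s - 1) 1 s := (hasDerivAt_id s).sub_const 1
    refine (h1.mul (hF s hs)).congr_deriv (by ring)
  · exact (by fun_prop : Continuous fun s => F s - (1 - s) * F' s).intervalIntegrable _ _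

/-- The representation of a function by averages of its derivatives. -/
lemma average_eq {S : Set Plane} {V : ℕ → ℕ → Plane → ℝ} {a b : ℕ}
    (H : IsDerivFamily (a + b + 1) S V) (hc : ∀ a b, Continuous (V a b)) {p₁ p₂ x : Plane}
    (hx : ∀ s ∈ Icc (0 : ℝ) 1, ∀ t ∈ Icc (0 : ℝ) 1, x + s • p₁ + t • p₂ ∈ S) :
    ∫ z in unitSquare, (V a b (x + z.1 • p₁ + z.2 • p₂)
      - (1 - z.1) * dirFamily p₁ V a b (x + z.1 • p₁ + z.2 • p₂)
      - (1 - z.2) * dirFamily p₂ V a b (x + z.1 • p₁ + z.2 • p₂)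
      + (1 - z.1) * (1 - z.2) * dirFamily p₂ (dirFamily p₁ V) a b (x + z.1 • p₁ + z.2 • p₂))
      = V a b x := by
  have hc1 : ∀ p a b, Continuous (dirFamily p V a b) := fun p a b => by
    unfold dirFamily; have := hc (a + 1) b; have := hc a (b + 1); fun_prop
  have hc2 : ∀ p q a b, Continuous (dirFamily p (dirFamily q V) a b) := fun p q a b => by
    have h1 := hc1 q (a + 1) b; have h2 := hc1 q a (b + 1)
    have : dirFamily p (dirFamily q V) a b = fun x => p 0 * dirFamily q V (a + 1) b x +
      p 1 * dirFamily q V a (b + 1) x := rfl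
    rw [this]; fun_prop
  have c0 := hc a b
  have c1 := hc1 p₁ a b
  have c2 := hc1 p₂ a b
  have c3 := hc2 p₂ p₁ a b
  rw [unitSquare, Measure.volume_eq_prod, setIntegral_prod _ (ContinuousOn.integrableOn_compact
    (isCompact_Icc.prod isCompact_Icc) (by fun_prop))]
  -- Averaging in t collapses the expression to the side t = 0, where a one-dimensional average in s
  -- remains.
  have inner : ∀ s ∈ Icc (0 : ℝ) 1, ∫ t in Icc (0 : ℝ) 1, (V a b (x + s • p₁ + t • p₂)
      - (1 - s) * dirFamily p₁ V a b (x + s • p₁ + t • p₂)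
      - (1 - t) * dirFamily p₂ V a b (x + s • p₁ + t • p₂)
      + (1 - s) * (1 - t) * dirFamily p₂ (dirFamily p₁ V) a b (x + s • p₁ + t • p₂))
      = V a b (x + s • p₁) - (1 - s) * dirFamily p₁ V a b (x + s • p₁) := by
    intro s hs
    have := integral_average
      (F := fun t => V a b (x + s • p₁ + t • p₂) -
        (1 - s) * dirFamily p₁ V a b (x + s • p₁ + t • p₂))
      (F' := fun t => dirFamily p₂ V a b (x + s • p₁ + t • p₂) -
        (1 - s) * dirFamily p₂ (dirFamily p₁ V) a b (x + s • p₁ + t • p₂))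
      (fun t ht => (H.hasDerivAt (by omega) (hx s hs t ht)).sub
        (((H.dirFamily p₁).hasDerivAt (by omega) (hx s hs t ht)).const_mul _))
      (by fun_prop) (by fun_prop)
    simp only [zero_smul, add_zero] at this
    rw [← this]
    congr 1; ext t; ring
  rw [setIntegral_congr_fun measurableSet_Icc inner]
  have := integral_average (F := fun s => V a b (x + s • p₁))
    (F' := fun s => dirFamily p₁ V a b (x + s • p₁))
    (fun s hs => H.hasDerivAt (by omega) (by
      have := hx s hs 0 (by simp); simpa using this)) (by fun_prop) (by fun_prop)
  simpa using this

end ConicSpline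

namespace ConicSpline

/-! ### Regularization -/

lemma contDiff_dirDeriv {f : Plane → ℝ} (hf : ContDiff ℝ ∞ f) (τ : Plane) :
    ContDiff ℝ ∞ (dirDeriv τ f) :=
  (hf.fderiv_right (m := ∞) le_rfl).clm_apply contDiff_const

lemma contDiff_dirDeriv_iterate {f : Plane → ℝ} (hf : ContDiff ℝ ∞ f) (τ : Plane) (k : ℕ) :
    ContDiff ℝ ∞ ((dirDeriv τ)^[k] f) := by
  induction k with
  | zero => exact hf
  | succ k ih => rw [Function.iterate_succ_apply']; exact contDiff_dirDeriv ih τ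

lemma tsupport_dirDeriv_subset (f : Plane → ℝ) (τ : Plane) :
    tsupport (dirDeriv τ f) ⊆ tsupport f := by
  refine (closure_mono ?_).trans (tsupport_fderiv_subset ℝ (f := f))
  intro x hx h
  exact hx (by simp [dirDeriv, h])

lemma dirDeriv_comm {f : Plane → ℝ} (hf : ContDiff ℝ ∞ f) (σ τ : Plane) :
    dirDeriv σ (dirDeriv τ f) = dirDeriv τ (dirDeriv σ f) := by
  ext x
  have h2 : ∀ ν, HasFDerivAt (dirDeriv ν f)
      ((ContinuousLinearMap.apply ℝ ℝ ν).comp (fderiv ℝ (fderiv ℝ f) x)) x := fun ν =>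
    (ContinuousLinearMap.hasFDerivAt (ContinuousLinearMap.apply ℝ ℝ ν)).comp x
      (((hf.fderiv_right (m := ∞) le_rfl).differentiable (by simp)) x).hasFDerivAt
  have hs : IsSymmSndFDerivAt ℝ f x := hf.contDiffAt.isSymmSndFDerivAt (by
    rw [minSmoothness_of_isRCLikeNormedField]; exact WithTop.coe_le_coe.2 le_top)
  show fderiv ℝ (dirDeriv τ f) x σ = fderiv ℝ (dirDeriv σ f) x τ
  rw [(h2 τ).fderiv, (h2 σ).fderiv]
  exact hs.eq σ τ

lemma dirDeriv_iterate_comm {f : Plane → ℝ} (hf : ContDiff ℝ ∞ f) (σ τ : Plane) (k : ℕ) :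
    dirDeriv σ ((dirDeriv τ)^[k] f) = (dirDeriv τ)^[k] (dirDeriv σ f) := by
  induction k with
  | zero => rfl
  | succ k ih =>
    rw [Function.iterate_succ_apply', dirDeriv_comm (contDiff_dirDeriv_iterate hf τ k), ih]
    exact (Function.iterate_succ_apply' _ _ _).symm

/-- The locally integrable functions `fx`, `fy` are the weak partial derivatives of `f` when tested
with `ψ`. -/
def WeakGradAt (f fx fy ψ : Plane → ℝ) : Prop :=
  ∫ y, f y * dirDeriv (unitVec 0) ψ y = -∫ y, fx y * ψ y ∧
    ∫ y, f y * dirDeriv (unitVec 1) ψ y = -∫ y, fy y * ψ y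

/-- The derivative falls on the mollifier, and y ↦ ρ(x - y) is the only test function that enters;
thus weak derivatives are needed only as far as the support of this function reaches. -/
lemma hasFDerivAt_conv {ρ f fx fy : Plane → ℝ} (hρ : ContDiff ℝ ∞ ρ) (hρc : HasCompactSupport ρ)
    (hf : LocallyIntegrable f volume) (x : Plane) (H : WeakGradAt f fx fy fun y => ρ (x - y)) :
    HasFDerivAt (conv ρ f) (linForm (conv ρ fx x) (conv ρ fy x)) x := by
  have h := hρc.hasFDerivAt_convolution_right (ContinuousLinearMap.lsmul ℝ ℝ) hf
    (hρ.of_le (by exact_mod_cast le_top)) x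
  have h' : HasFDerivAt (conv f ρ) _ x := h
  rw [conv_comm]
  refine h'.congr_fderiv ?_
  have hd : ∀ τ y, dirDeriv τ (fun y => ρ (x - y)) y = -(fderiv ℝ ρ (x - y) τ) := by
    intro τ y
    have h1 : HasFDerivAt (fun y => ρ (x - y)) ((fderiv ℝ ρ (x - y)).comp
        (-ContinuousLinearMap.id ℝ Plane)) y :=
      (hρ.differentiable (by simp) (x - y)).hasFDerivAt.comp y ((hasFDerivAt_id y).const_sub x)
    simp [dirDeriv, h1.fderiv]
  have key : ∀ τ, (convolution f (fderiv ℝ ρ)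
      (ContinuousLinearMap.precompR Plane (ContinuousLinearMap.lsmul ℝ ℝ)) volume x) τ =
      -∫ y, f y * dirDeriv τ (fun y => ρ (x - y)) y := by
    intro τ
    rw [convolution_precompR_apply (ContinuousLinearMap.lsmul ℝ ℝ) hf (hρc.fderiv ℝ)
      (hρ.continuous_fderiv (by simp)), ← integral_neg]
    refine integral_congr_ae (Eventually.of_forall fun y => ?_)
    simp [hd]
  have hc : ∀ g, conv ρ g x = ∫ y, g y * ρ (x - y) := fun g => by rw [conv_comm]; rfl
  have e0 := key (unitVec 0)
  have e1 := key (unitVec 1)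
  rw [H.1, neg_neg, ← hc] at e0
  rw [H.2, neg_neg, ← hc] at e1
  ext τ
  rw [plane_eq τ, map_add, map_smul, map_smul, e0, e1]
  simp; ring

/-- The functions `h a b`, `a + b ≤ N + 1`, are integrable functions, which are weak derivatives of
`h 0 0` in `Ω`. -/
structure IsWeakFamily (Ω : Set Plane) (N : ℕ) (h : ℕ → ℕ → Plane → ℝ) : Prop where
  integrable : ∀ a b, Integrable (h a b)
  weak : ∀ a b, a + b ≤ N → ∀ ψ : Plane → ℝ, ContDiff ℝ ∞ ψ → HasCompactSupport ψ →
    tsupport ψ ⊆ Ω → WeakGradAt (h a b) (h (a + 1) b) (h a (b + 1)) ψ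

/-- The weak derivatives all refer to `u`. Testing one of order (a, b) with a first derivative of ψ
and the next one with ψ itself yields the same integral of `u`, with opposite signs. -/
lemma HasWeakDeriv.weakGradAt {Ω : Opens Plane} {a b : ℕ} {u g gx gy ψ : Plane → ℝ}
    (hg : HasWeakDeriv Ω a b u g) (hx : HasWeakDeriv Ω (a + 1) b u gx)
    (hy : HasWeakDeriv Ω a (b + 1) u gy) (hψ : ContDiff ℝ ∞ ψ) (hc : HasCompactSupport ψ)
    (hs : tsupport ψ ⊆ Ω) :
    WeakGradAt ((Ω : Set Plane).indicator g) ((Ω : Set Plane).indicator gx)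
      ((Ω : Set Plane).indicator gy) ψ := by
  have hm : MeasurableSet (Ω : Set Plane) := Ω.isOpen.measurableSet
  have hi : ∀ k φ : Plane → ℝ, ∫ y, (Ω : Set Plane).indicator k y * φ y =
      ∫ y in (Ω : Set Plane), k y * φ y := fun k φ => by
    rw [← integral_indicator hm]
    congr 1; ext y
    by_cases h : y ∈ (Ω : Set Plane) <;> simp [h]
  let Ψ : 𝓓(Ω, ℝ) := ⟨ψ, hψ, hc, hs⟩
  let Φ : ∀ τ : Plane, 𝓓(Ω, ℝ) := fun τ => ⟨dirDeriv τ ψ, contDiff_dirDeriv hψ τ,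
    hc.of_isClosed_subset (isClosed_tsupport _) (tsupport_dirDeriv_subset ψ τ),
    (tsupport_dirDeriv_subset ψ τ).trans hs⟩
  have e0 : partialDeriv a b (Φ (unitVec 0)) = partialDeriv (a + 1) b Ψ := by
    show (dirDeriv (unitVec 0))^[a] ((dirDeriv (unitVec 1))^[b] (dirDeriv (unitVec 0) ψ)) =
      (dirDeriv (unitVec 0))^[a + 1] ((dirDeriv (unitVec 1))^[b] ψ)
    rw [Function.iterate_succ_apply, dirDeriv_iterate_comm hψ]
  have e1 : partialDeriv a b (Φ (unitVec 1)) = partialDeriv a (b + 1) Ψ := by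
    show (dirDeriv (unitVec 0))^[a] ((dirDeriv (unitVec 1))^[b] (dirDeriv (unitVec 1) ψ)) =
      (dirDeriv (unitVec 0))^[a] ((dirDeriv (unitVec 1))^[b + 1] ψ)
    rw [Function.iterate_succ_apply]
  have hsg : ((-1 : ℝ) ^ (a + b)) ≠ 0 := pow_ne_zero _ (by norm_num)
  constructor
  · rw [hi, hi]
    have h1 := hg (Φ (unitVec 0))
    have h2 := hx Ψ
    rw [e0, h2, show a + 1 + b = a + b + 1 by ring, pow_succ] at h1
    have h3 : (-1 : ℝ) ^ (a + b) * (-∫ y in (Ω : Set Plane), gx y * ψ y) =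
      (-1) ^ (a + b) * ∫ y in (Ω : Set Plane), g y * dirDeriv (unitVec 0) ψ y := by
      rw [← show _ = (-1) ^ (a + b) * ∫ y in (Ω : Set Plane), g y * dirDeriv (unitVec 0) ψ y from h1]
      show _ = (-1) ^ (a + b) * -1 * ∫ y in (Ω : Set Plane), gx y * ψ y
      ring
    exact (mul_left_cancel₀ hsg h3).symm
  · rw [hi, hi]
    have h1 := hg (Φ (unitVec 1))
    have h2 := hy Ψ
    rw [e1, h2, show a + (b + 1) = a + b + 1 by ring, pow_succ] at h1
    have h3 : (-1 : ℝ) ^ (a + b) * (-∫ y in (Ω : Set Plane), gy y * ψ y) =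
      (-1) ^ (a + b) * ∫ y in (Ω : Set Plane), g y * dirDeriv (unitVec 1) ψ y := by
      rw [← show _ = (-1) ^ (a + b) * ∫ y in (Ω : Set Plane), g y * dirDeriv (unitVec 1) ψ y from h1]
      show _ = (-1) ^ (a + b) * -1 * ∫ y in (Ω : Set Plane), gy y * ψ y
      ring
    exact (mul_left_cancel₀ hsg h3).symm

lemma tsupport_sub_left_subset {ρ : Plane → ℝ} {R : ℝ} (h : tsupport ρ ⊆ Metric.closedBall 0 R)
    (x : Plane) : tsupport (fun y => ρ (x - y)) ⊆ Metric.closedBall x R := by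
  refine closure_minimal (fun y hy => ?_) Metric.isClosed_closedBall
  have : x - y ∈ Metric.closedBall (0 : Plane) R := h (subset_tsupport _ hy)
  rw [mem_closedBall_zero_iff] at this
  rwa [Metric.mem_closedBall, dist_comm, dist_eq_norm]

lemma hasCompactSupport_sub_left {ρ : Plane → ℝ} (h : HasCompactSupport ρ) (x : Plane) :
    HasCompactSupport (fun y => ρ (x - y)) :=
  h.comp_homeomorph (Homeomorph.subLeft x)

lemma IsWeakFamily.isDerivFamily {Ω : Set Plane} {N : ℕ} {h : ℕ → ℕ → Plane → ℝ}
    (H : IsWeakFamily Ω N h) {ρ : Plane → ℝ} (hρ : ContDiff ℝ ∞ ρ) (hρc : HasCompactSupport ρ)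
    {R : ℝ} (hR : tsupport ρ ⊆ Metric.closedBall 0 R) :
    IsDerivFamily N {x | Metric.closedBall x R ⊆ Ω} fun a b => conv ρ (h a b) := by
  intro a b hab x hx
  exact hasFDerivAt_conv hρ hρc (H.integrable a b).locallyIntegrable x
    (H.weak a b hab _ (hρ.comp (contDiff_const.sub contDiff_id))
      (hasCompactSupport_sub_left hρc x) ((tsupport_sub_left_subset hR x).trans hx))

lemma dirFamily_conv {h : ℕ → ℕ → Plane → ℝ} (hi : ∀ a b, Integrable (h a b)) {ρ : Plane → ℝ}
    (hρ : Continuous ρ) (hρc : HasCompactSupport ρ) (p : Plane) :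
    (dirFamily p fun a b => conv ρ (h a b)) = fun a b => conv ρ (dirFamily p h a b) := by
  ext a b x
  show p 0 * conv ρ (h (a + 1) b) x + p 1 * conv ρ (h a (b + 1)) x =
    conv ρ (fun x => p 0 * h (a + 1) b x + p 1 * h a (b + 1) x) x
  rw [conv_add hρ hρc ((hi _ _).const_mul _).locallyIntegrable
    ((hi _ _).const_mul _).locallyIntegrable, conv_const_mul, conv_const_mul]

lemma integrable_dirFamily {h : ℕ → ℕ → Plane → ℝ} (hi : ∀ a b, Integrable (h a b)) (p : Plane)
    (a b : ℕ) : Integrable (dirFamily p h a b) :=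
  ((hi _ _).const_mul _).add ((hi _ _).const_mul _)

/-- The regularizations of a function with weak derivatives are the regularizations of a continuous
function, at the points `x` where the parallelogram with the corner `x` and the sides `p₁`, `p₂` is
contained in `Ω`. -/
lemma IsWeakFamily.exists_continuous {Ω : Set Plane} {N : ℕ} {h : ℕ → ℕ → Plane → ℝ}
    (H : IsWeakFamily Ω N h) {p₁ p₂ : Plane} (hp : cross p₁ p₂ ≠ 0) {a b : ℕ} (hab : a + b + 1 ≤ N) :
    ∃ G : Plane → ℝ, Continuous G ∧ ∀ ρ : Plane → ℝ, ContDiff ℝ ∞ ρ → HasCompactSupport ρ →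
      ∀ R, tsupport ρ ⊆ Metric.closedBall 0 R → ∀ x, (∀ s ∈ Icc (0 : ℝ) 1, ∀ t ∈ Icc (0 : ℝ) 1,
        Metric.closedBall (x + s • p₁ + t • p₂) R ⊆ Ω) → conv ρ (h a b) x = conv ρ G x := by
  obtain ⟨K₀, i₀, ⟨C₀, b₀⟩, e₀⟩ := exists_kernel hp (k := fun _ => 1) (by fun_prop)
  obtain ⟨K₁, i₁, ⟨C₁, b₁⟩, e₁⟩ := exists_kernel hp (k := fun z => -(1 - z.1)) (by fun_prop)
  obtain ⟨K₂, i₂, ⟨C₂, b₂⟩, e₂⟩ := exists_kernel hp (k := fun z => -(1 - z.2)) (by fun_prop)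
  obtain ⟨K₃, i₃, ⟨C₃, b₃⟩, e₃⟩ := exists_kernel hp (k := fun z => (1 - z.1) * (1 - z.2))
    (by fun_prop)
  have j₀ := H.integrable a b
  have j₁ := integrable_dirFamily H.integrable p₁ a b
  have j₂ := integrable_dirFamily H.integrable p₂ a b
  have j₃ := integrable_dirFamily (integrable_dirFamily H.integrable p₁) p₂ a b
  have c₀ := continuous_conv i₀.aestronglyMeasurable b₀ j₀
  have c₁ := continuous_conv i₁.aestronglyMeasurable b₁ j₁
  have c₂ := continuous_conv i₂.aestronglyMeasurable b₂ j₂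
  have c₃ := continuous_conv i₃.aestronglyMeasurable b₃ j₃
  -- The four terms of `average_eq`, applied to the weak derivatives themselves. The mixed term uses
  -- order a + b + 2 ≤ N + 1.
  refine ⟨fun x => conv K₀ (h a b) x + conv K₁ (dirFamily p₁ h a b) x +
    conv K₂ (dirFamily p₂ h a b) x + conv K₃ (dirFamily p₂ (dirFamily p₁ h) a b) x,
    by fun_prop, fun ρ hρ hρc R hR x hx => ?_⟩
  have hρ' := hρ.continuous
  have hV := H.isDerivFamily hρ hρc hR
  have hVc : ∀ a b, Continuous (conv ρ (h a b)) := fun a b =>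
    hρc.continuous_convolution_left _ hρ' (H.integrable a b).locallyIntegrable
  -- For the mollified family the averaging identity is classical. Commuting the mollifier with the
  -- kernels then compares the weak derivative with `G`.
  have hav := average_eq (a := a) (b := b) (V := fun a b => conv ρ (h a b))
    (fun a' b' h' => hV a' b' (h'.trans hab)) hVc (p₁ := p₁) (p₂ := p₂) (x := x) hx
  rw [dirFamily_conv H.integrable hρ' hρc p₁, dirFamily_conv H.integrable hρ' hρc p₂,
    dirFamily_conv (integrable_dirFamily H.integrable p₁) hρ' hρc p₂] at hav
  have hint : ∀ (k : ℝ × ℝ → ℝ) (f : Plane → ℝ), Continuous k → Integrable f →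
      IntegrableOn (fun z : ℝ × ℝ => k z * conv ρ f (x + z.1 • p₁ + z.2 • p₂)) unitSquare := by
    intro k f hk hf
    have : Continuous (conv ρ f) := hρc.continuous_convolution_left _ hρ' hf.locallyIntegrable
    exact ContinuousOn.integrableOn_compact (isCompact_Icc.prod isCompact_Icc)
      (by fun_prop)
  have hcomm : ∀ {K f : Plane → ℝ}, Integrable K → Integrable f →
      conv ρ (conv K f) x = conv K (conv ρ f) x := fun hK hf => by
    rw [conv_left_comm hρ' hρc hK hf]
  have hsum : ∀ f₀ f₁ f₂ f₃ : ℝ × ℝ → ℝ, IntegrableOn f₀ unitSquare → IntegrableOn f₁ unitSquare →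
      IntegrableOn f₂ unitSquare → IntegrableOn f₃ unitSquare →
      (∫ z in unitSquare, f₀ z) + (∫ z in unitSquare, f₁ z) + (∫ z in unitSquare, f₂ z) +
        (∫ z in unitSquare, f₃ z) = ∫ z in unitSquare, (f₀ z + f₁ z + f₂ z + f₃ z) := by
    intro f₀ f₁ f₂ f₃ I₀ I₁ I₂ I₃
    rw [integral_add (f := fun z => f₀ z + f₁ z + f₂ z) ((I₀.add I₁).add I₂) I₃,
      integral_add (f := fun z => f₀ z + f₁ z) (I₀.add I₁) I₂, integral_add I₀ I₁]
  rw [conv_add hρ' hρc (f := fun x => conv K₀ (h a b) x + conv K₁ (dirFamily p₁ h a b) x +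
    conv K₂ (dirFamily p₂ h a b) x) ((c₀.add c₁).add c₂).locallyIntegrable c₃.locallyIntegrable,
    conv_add hρ' hρc (f := fun x => conv K₀ (h a b) x + conv K₁ (dirFamily p₁ h a b) x)
      (c₀.add c₁).locallyIntegrable c₂.locallyIntegrable,
    conv_add hρ' hρc c₀.locallyIntegrable c₁.locallyIntegrable,
    hcomm i₀ j₀, hcomm i₁ j₁, hcomm i₂ j₂, hcomm i₃ j₃, e₀, e₁, e₂, e₃,
    hsum _ _ _ _ (hint _ _ (by fun_prop) j₀) (hint _ _ (by fun_prop) j₁)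
      (hint _ _ (by fun_prop) j₂) (hint _ _ (by fun_prop) j₃), ← hav]
  refine integral_congr_ae (Eventually.of_forall fun z => ?_)
  simp only
  ring

/-- A sequence of bump functions. -/
noncomputable def bump (n : ℕ) : ContDiffBump (0 : Plane) :=
  ⟨1 / (2 * (n + 1)), 1 / (n + 1), by positivity, by
    rw [div_lt_div_iff₀ (by positivity) (by positivity)]; linarith [n.cast_nonneg (α := ℝ)]⟩

lemma tendsto_bump_rOut : Tendsto (fun n => (bump n).rOut) atTop (𝓝 0) :=
  tendsto_one_div_add_atTop_nhds_zero_nat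

/-- The normalized bump functions. -/
noncomputable def mollifier (n : ℕ) : Plane → ℝ := (bump n).normed volume

lemma contDiff_mollifier (n : ℕ) : ContDiff ℝ ∞ (mollifier n) := (bump n).contDiff_normed

lemma hasCompactSupport_mollifier (n : ℕ) : HasCompactSupport (mollifier n) :=
  (bump n).hasCompactSupport_normed

lemma tsupport_mollifier (n : ℕ) : tsupport (mollifier n) = Metric.closedBall 0 (bump n).rOut :=
  (bump n).tsupport_normed_eq

/-- The convergence is joint in the index and the point, that is, locally uniform; this is what
makes the limits differentiable below. -/
lemma tendsto_conv_mollifier {G : Plane → ℝ} (hG : Continuous G) (x : Plane) :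
    Tendsto (fun z : ℕ × Plane => conv (mollifier z.1) G z.2) (atTop ×ˢ 𝓝 x) (𝓝 (G x)) :=
  ContDiffBump.convolution_tendsto_right (φ := fun z : ℕ × Plane => bump z.1)
    (g := fun _ => G) (k := fun z => z.2) (tendsto_bump_rOut.comp tendsto_fst)
    (Eventually.of_forall fun _ => hG.aestronglyMeasurable)
    ((hG.tendsto x).comp tendsto_snd) tendsto_snd

lemma ae_tendsto_conv_mollifier {f : Plane → ℝ} (hf : LocallyIntegrable f volume) :
    ∀ᵐ x, Tendsto (fun n => conv (mollifier n) f x) atTop (𝓝 (f x)) := by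
  refine ContDiffBump.ae_convolution_tendsto_right_of_locallyIntegrable (K := 2) tendsto_bump_rOut
    (Eventually.of_forall fun n => ?_) hf
  show 1 / ((n : ℝ) + 1) ≤ 2 * (1 / (2 * (n + 1)))
  have : (n : ℝ) + 1 ≠ 0 := by positivity
  apply le_of_eq; field_simp

/-- The precise representative of a locally integrable function. -/
noncomputable def preciseRep (f : Plane → ℝ) (x : Plane) : ℝ :=
  limUnder atTop fun n => conv (mollifier n) f x

lemma preciseRep_ae {f : Plane → ℝ} (hf : LocallyIntegrable f volume) : preciseRep f =ᵐ[volume] f :=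
  (ae_tendsto_conv_mollifier hf).mono fun _ h => h.limUnder_eq

/-- The points `x` such that the parallelogram with the corner `x` and the sides `p₁`, `p₂` is
contained in `Ω`. -/
def parallelogramSet (Ω : Set Plane) (p₁ p₂ : Plane) : Set Plane :=
  {x | ∀ s ∈ Icc (0 : ℝ) 1, ∀ t ∈ Icc (0 : ℝ) 1, x + s • p₁ + t • p₂ ∈ Ω}

/-- The closed parallelogram is compact, so a thickening of it is still in Ω; half of the room is
for moving the corner, half for the support of the mollifier. -/
lemma eventually_closedBall_subset {Ω : Set Plane} (hΩ : IsOpen Ω) {p₁ p₂ x : Plane}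
    (hx : x ∈ parallelogramSet Ω p₁ p₂) :
    ∀ᶠ z : ℕ × Plane in atTop ×ˢ 𝓝 x, ∀ s ∈ Icc (0 : ℝ) 1, ∀ t ∈ Icc (0 : ℝ) 1,
      Metric.closedBall (z.2 + s • p₁ + t • p₂) (bump z.1).rOut ⊆ Ω := by
  have hK : IsCompact ((fun z : ℝ × ℝ => x + z.1 • p₁ + z.2 • p₂) '' unitSquare) :=
    (isCompact_Icc.prod isCompact_Icc).image (by fun_prop)
  obtain ⟨δ, hδ, hsub⟩ := hK.exists_thickening_subset_open hΩ (by
    rintro _ ⟨z, hz, rfl⟩; exact hx _ hz.1 _ hz.2)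
  have h1 : ∀ᶠ n : ℕ in atTop, (bump n).rOut < δ / 2 :=
    tendsto_bump_rOut.eventually (gt_mem_nhds (by positivity))
  have h2 : ∀ᶠ y in 𝓝 x, dist y x < δ / 2 := Metric.ball_mem_nhds x (by positivity)
  filter_upwards [h1.prod_mk h2] with z hz s hs t ht y hy
  refine hsub (Metric.mem_thickening_iff.2 ⟨x + s • p₁ + t • p₂, ⟨(s, t), ⟨hs, ht⟩, rfl⟩, ?_⟩)
  calc dist y (x + s • p₁ + t • p₂) ≤ dist y (z.2 + s • p₁ + t • p₂) +
        dist (z.2 + s • p₁ + t • p₂) (x + s • p₁ + t • p₂) := dist_triangle _ _ _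
    _ = dist y (z.2 + s • p₁ + t • p₂) + dist z.2 x := by rw [dist_add_right, dist_add_right]
    _ < δ / 2 + δ / 2 := add_lt_add_of_le_of_lt (le_trans hy hz.1.le) hz.2
    _ = δ := by ring

lemma isOpen_parallelogramSet {Ω : Set Plane} (hΩ : IsOpen Ω) (p₁ p₂ : Plane) :
    IsOpen (parallelogramSet Ω p₁ p₂) := by
  refine isOpen_iff_mem_nhds.2 fun x hx => ?_
  obtain ⟨n, hn⟩ := (eventually_closedBall_subset hΩ hx).curry.exists
  filter_upwards [hn] with y hy s hs t ht
  exact hy s hs t ht (Metric.mem_closedBall_self (bump n).rOut_pos.le)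

lemma exists_mem_parallelogramSet {Ω : Set Plane} (hΩ : IsOpen Ω) {x : Plane} (hx : x ∈ Ω) :
    ∃ p₁ p₂, cross p₁ p₂ ≠ 0 ∧ x ∈ parallelogramSet Ω p₁ p₂ := by
  obtain ⟨r, hr, hsub⟩ := Metric.isOpen_iff.1 hΩ x hx
  refine ⟨(r / 3) • unitVec 0, (r / 3) • unitVec 1, by simp [cross]; positivity, ?_⟩
  intro s hs t ht
  refine hsub ?_
  have e0 : ‖unitVec 0‖ = 1 := by simp [unitVec]
  have e1 : ‖unitVec 1‖ = 1 := by simp [unitVec]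
  rw [Metric.mem_ball, dist_eq_norm, add_assoc, add_sub_cancel_left]
  calc ‖s • (r / 3) • unitVec 0 + t • (r / 3) • unitVec 1‖
      ≤ ‖s • (r / 3) • unitVec 0‖ + ‖t • (r / 3) • unitVec 1‖ := norm_add_le _ _
    _ = s * (r / 3) + t * (r / 3) := by
        rw [norm_smul, norm_smul, norm_smul, norm_smul, e0, e1, Real.norm_of_nonneg hs.1,
          Real.norm_of_nonneg ht.1, Real.norm_of_nonneg (by positivity)]; ring
    _ < r := by nlinarith [hs.2, ht.2]

lemma tendsto_section {F : ℕ × Plane → ℝ} {x : Plane} {c : ℝ}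
    (h : Tendsto F (atTop ×ˢ 𝓝 x) (𝓝 c)) : Tendsto (fun n => F (n, x)) atTop (𝓝 c) :=
  h.comp (tendsto_id.prodMk (tendsto_const_nhds (x := x)))

/-- A Sobolev embedding: the precise representatives of the weak derivatives of a function are
continuous, with limits at the boundary points `x` such that a parallelogram with a corner at `x`
is contained in `Ω`. -/
lemma IsWeakFamily.exists_continuous_rep {Ω : Set Plane} (hΩ : IsOpen Ω) {N : ℕ}
    {h : ℕ → ℕ → Plane → ℝ} (H : IsWeakFamily Ω N h) {p₁ p₂ : Plane} (hp : cross p₁ p₂ ≠ 0)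
    {a b : ℕ} (hab : a + b + 1 ≤ N) :
    ∃ G : Plane → ℝ, Continuous G ∧ ∀ x ∈ parallelogramSet Ω p₁ p₂, preciseRep (h a b) x = G x ∧
      Tendsto (fun z : ℕ × Plane => conv (mollifier z.1) (h a b) z.2) (atTop ×ˢ 𝓝 x) (𝓝 (G x)) := by
  obtain ⟨G, hG, he⟩ := H.exists_continuous hp hab
  refine ⟨G, hG, fun x hx => ?_⟩
  have ht : Tendsto (fun z : ℕ × Plane => conv (mollifier z.1) (h a b) z.2)
      (atTop ×ˢ 𝓝 x) (𝓝 (G x)) := by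
    refine (tendsto_conv_mollifier hG x).congr' ?_
    filter_upwards [eventually_closedBall_subset hΩ hx] with z hz
    exact (he _ (contDiff_mollifier z.1) (hasCompactSupport_mollifier z.1) _
      (tsupport_mollifier z.1).subset _ hz).symm
  refine ⟨?_, ht⟩
  exact (tendsto_section ht).limUnder_eq

/-- Joint convergence and continuity of the limits at x amount to uniform convergence of the
derivatives on the neighbourhood filter, which permits differentiating the limit. -/
lemma hasFDerivAt_of_tendsto_prod {f fx fy : ℕ → Plane → ℝ} {g gx gy : Plane → ℝ} {x : Plane}
    (tx : Tendsto (fun z : ℕ × Plane => fx z.1 z.2) (atTop ×ˢ 𝓝 x) (𝓝 (gx x)))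
    (ty : Tendsto (fun z : ℕ × Plane => fy z.1 z.2) (atTop ×ˢ 𝓝 x) (𝓝 (gy x)))
    (cx : ContinuousAt gx x) (cy : ContinuousAt gy x)
    (hf : ∀ᶠ z : ℕ × Plane in atTop ×ˢ 𝓝 x,
      HasFDerivAt (f z.1) (linForm (fx z.1 z.2) (fy z.1 z.2)) z.2)
    (hfg : ∀ᶠ y in 𝓝 x, Tendsto (fun n => f n y) atTop (𝓝 (g y))) :
    HasFDerivAt g (linForm (gx x) (gy x)) x := by
  have hlin : Continuous fun z : ℝ × ℝ => linForm z.1 z.2 := by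
    unfold linForm; fun_prop
  have hl := hlin.tendsto (gx x, gy x)
  refine hasFDerivAt_of_tendstoUniformlyOnFilter (l := atTop)
    (f' := fun n y => linForm (fx n y) (fy n y)) (g' := fun y => linForm (gx y) (gy y)) ?_ hf hfg
  rw [tendstoUniformlyOnFilter_iff_tendsto]
  have c1 : Tendsto (fun z : ℕ × Plane => (gx z.2, gy z.2)) (atTop ×ˢ 𝓝 x) (𝓝 (gx x, gy x)) :=
    (cx.tendsto.comp tendsto_snd).prodMk_nhds (cy.tendsto.comp tendsto_snd)
  exact ((hl.comp c1).prodMk_nhds (hl.comp (tx.prodMk_nhds ty))).mono_right (nhds_le_uniformity _)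

/-- Continuous representatives cost two derivatives: from orders up to N + 3 one obtains those of
order N + 1, which are the derivatives of the ones of order N. -/
lemma IsWeakFamily.isDerivFamily_rep {Ω : Set Plane} (hΩ : IsOpen Ω) {N : ℕ}
    {h : ℕ → ℕ → Plane → ℝ} (H : IsWeakFamily Ω (N + 2) h) :
    IsDerivFamily N Ω fun a b => preciseRep (h a b) := by
  intro a b hab x hx
  obtain ⟨p₁, p₂, hp, hxp⟩ := exists_mem_parallelogramSet hΩ hx
  have hnear : ∀ᶠ y in 𝓝 x, y ∈ parallelogramSet Ω p₁ p₂ :=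
    (isOpen_parallelogramSet hΩ p₁ p₂).mem_nhds hxp
  have hcont : ∀ a b, a + b ≤ N + 1 → ContinuousAt (preciseRep (h a b)) x ∧
      Tendsto (fun z : ℕ × Plane => conv (mollifier z.1) (h a b) z.2) (atTop ×ˢ 𝓝 x)
        (𝓝 (preciseRep (h a b) x)) ∧
      ∀ᶠ y in 𝓝 x, Tendsto (fun n => conv (mollifier n) (h a b) y) atTop
        (𝓝 (preciseRep (h a b) y)) := by
    intro a b hab
    obtain ⟨G, hG, he⟩ := H.exists_continuous_rep hΩ hp (a := a) (b := b) (by omega)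
    have h1 : ContinuousAt (preciseRep (h a b)) x :=
      hG.continuousAt.congr (hnear.mono fun y hy => (he y hy).1.symm)
    have h2 : ∀ y ∈ parallelogramSet Ω p₁ p₂, Tendsto (fun z : ℕ × Plane =>
        conv (mollifier z.1) (h a b) z.2) (atTop ×ˢ 𝓝 y) (𝓝 (preciseRep (h a b) y)) := by
      intro y hy
      rw [(he y hy).1]
      exact (he y hy).2
    exact ⟨h1, h2 x hxp, hnear.mono fun y hy => tendsto_section (h2 y hy)⟩
  obtain ⟨cx, tx, -⟩ := hcont (a + 1) b (by omega)
  obtain ⟨cy, ty, -⟩ := hcont a (b + 1) (by omega)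
  refine hasFDerivAt_of_tendsto_prod (f := fun n => conv (mollifier n) (h a b))
    (fx := fun n => conv (mollifier n) (h (a + 1) b))
    (fy := fun n => conv (mollifier n) (h a (b + 1))) tx ty cx cy ?_ (hcont a b (by omega)).2.2
  filter_upwards [eventually_closedBall_subset hΩ hxp] with z hz
  have h1 : Metric.closedBall z.2 (bump z.1).rOut ⊆ Ω := by
    have := hz 0 (by simp) 0 (by simp)
    rwa [zero_smul, zero_smul, add_zero, add_zero] at this
  have h2 := H.isDerivFamily (contDiff_mollifier z.1) (hasCompactSupport_mollifier z.1)
    (tsupport_mollifier z.1).subset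
  exact h2 a b (by omega) z.2 h1

end ConicSpline

namespace ConicSpline

/-! ### Functions that vanish on the boundary -/

/-- On a finite measure space convergence in L² implies convergence in L¹, and the factor χ is
bounded. -/
lemma tendsto_setIntegral_mul {μ : Measure Plane} [IsFiniteMeasure μ] {F : ℕ → Plane → ℝ}
    {f χ : Plane → ℝ} (hF : ∀ k, MemLp (F k) 2 μ) (hf : MemLp f 2 μ) (hχ : Continuous χ)
    (hχc : HasCompactSupport χ)
    (h : Tendsto (fun k => eLpNorm (fun x => F k x - f x) 2 μ) atTop (𝓝 0)) :
    Tendsto (fun k => ∫ x, F k x * χ x ∂μ) atTop (𝓝 (∫ x, f x * χ x ∂μ)) := by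
  obtain ⟨C, hC⟩ := hχ.bounded_above_of_compact_support hχc
  have hi : ∀ g : Plane → ℝ, MemLp g 2 μ → Integrable (fun x => g x * χ x) μ := fun g hg =>
    (hg.integrable one_le_two).mul_bdd hχ.aestronglyMeasurable (Eventually.of_forall hC)
  refine tendsto_integral_of_L1' _ (hi f hf).aestronglyMeasurable (Eventually.of_forall fun k => hi _ (hF k)) ?_
  have hb : ∀ k, eLpNorm ((fun x => F k x * χ x) - fun x => f x * χ x) 1 μ ≤
      ENNReal.ofReal C * (eLpNorm (fun x => F k x - f x) 2 μ *
        μ univ ^ (1 / (1 : ℝ≥0∞).toReal - 1 / (2 : ℝ≥0∞).toReal)) := by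
    intro k
    refine (eLpNorm_le_mul_eLpNorm_of_ae_le_mul (g := fun x => F k x - f x) (c := C)
      (Eventually.of_forall fun x => ?_) 1).trans (mul_le_mul_right (eLpNorm_le_eLpNorm_mul_rpow_measure_univ
        one_le_two ((hF k).sub hf).aestronglyMeasurable) _)
    simp only [Pi.sub_apply]
    rw [← sub_mul, norm_mul, mul_comm]
    exact mul_le_mul_of_nonneg_right (hC x) (norm_nonneg _)
  refine tendsto_of_tendsto_of_tendsto_of_le_of_le tendsto_const_nhds ?_ (fun _ => bot_le) hb
  have hfin : μ univ ^ (1 / (1 : ℝ≥0∞).toReal - 1 / (2 : ℝ≥0∞).toReal) ≠ ⊤ :=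
    ENNReal.rpow_ne_top_of_nonneg (by norm_num) (measure_ne_top μ _)
  have := ENNReal.Tendsto.const_mul (a := ENNReal.ofReal C)
    (ENNReal.Tendsto.mul_const h (Or.inr hfin)) (Or.inr ENNReal.ofReal_ne_top)
  simpa using this

lemma integral_mul_dirDeriv {φ ψ : Plane → ℝ} (hφ : ContDiff ℝ ∞ φ) (hφc : HasCompactSupport φ)
    (hψ : ContDiff ℝ ∞ ψ) (τ : Plane) :
    ∫ x, φ x * dirDeriv τ ψ x = -∫ x, dirDeriv τ φ x * ψ x := by
  have hc : ∀ f g : Plane → ℝ, Continuous f → Continuous g → HasCompactSupport f →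
      Integrable fun x => f x * g x := fun f g hf hg hfc =>
    (hf.mul hg).integrable_of_hasCompactSupport hfc.mul_right
  have hφ' : HasCompactSupport (dirDeriv τ φ) :=
    hφc.of_isClosed_subset (isClosed_tsupport _) (tsupport_dirDeriv_subset φ τ)
  exact integral_mul_fderiv_eq_neg_fderiv_mul_of_integrable
    (hc _ _ (contDiff_dirDeriv hφ τ).continuous hψ.continuous hφ')
    (hc _ _ hφ.continuous (contDiff_dirDeriv hψ τ).continuous hφc)
    (hc _ _ hφ.continuous hψ.continuous hφc) (fun x _ => hφ.differentiable (by simp) x)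
    (fun x _ => hψ.differentiable (by simp) x)

lemma integral_indicator_mul {Ω : Set Plane} (hΩ : MeasurableSet Ω) (f ψ : Plane → ℝ) :
    ∫ y, Ω.indicator f y * ψ y = ∫ y in Ω, f y * ψ y := by
  rw [← integral_indicator hΩ]
  congr 1; ext y
  by_cases h : y ∈ Ω <;> simp [h]

/-- The zero extension of a function in `H^1_0(Ω)` has weak derivatives on the plane. -/
lemma exists_isWeakFamily {Ω : Opens Plane} (hb : Bornology.IsBounded (Ω : Set Plane)) {m : ℕ}
    {u : Plane → ℝ} (hu : MemH Ω (m + 1) u) (hu₀ : MemH10 Ω u) :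
    ∃ h, IsWeakFamily (Ω : Set Plane) m h ∧ h 0 0 = (Ω : Set Plane).indicator u ∧
      (∀ a b, ∀ x ∉ (Ω : Set Plane), h a b x = 0) ∧
      ∀ ψ, ContDiff ℝ ∞ ψ → HasCompactSupport ψ → WeakGradAt (h 0 0) (h 1 0) (h 0 1) ψ := by
  obtain ⟨gx, gy, hu2, hgx, hgy, hwx, hwy, φ, h0, h1, h2⟩ := hu₀
  have hm : MeasurableSet (Ω : Set Plane) := Ω.isOpen.measurableSet
  have : IsFiniteMeasure (volume.restrict (Ω : Set Plane)) :=
    isFiniteMeasure_restrict.2 hb.measure_lt_top.ne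
  have hint : ∀ g, MemL2 Ω g → Integrable ((Ω : Set Plane).indicator g) := fun g hg =>
    (integrable_indicator_iff hm).2 (hg.integrable one_le_two)
  -- The first derivatives must be those in the definition of H¹₀, for which the approximating test
  -- functions converge. Beyond order m + 1 the value zero keeps all members integrable.
  have hex : ∀ a b : ℕ, ∃ g, MemL2 Ω g ∧ (a + b ≤ m + 1 → HasWeakDeriv Ω a b u g) ∧
      (a = 0 ∧ b = 0 → g = u) ∧ (a = 1 ∧ b = 0 → g = gx) ∧ (a = 0 ∧ b = 1 → g = gy) := by
    intro a b
    by_cases c0 : a = 0 ∧ b = 0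
    · obtain ⟨rfl, rfl⟩ := c0
      refine ⟨u, hu2, fun _ φ => ?_, by simp, by simp, by simp⟩
      simp [partialDeriv, mixedDeriv]
    by_cases c1 : a = 1 ∧ b = 0
    · obtain ⟨rfl, rfl⟩ := c1
      exact ⟨gx, hgx, fun _ => hwx, by simp, by simp, by simp⟩
    by_cases c2 : a = 0 ∧ b = 1
    · obtain ⟨rfl, rfl⟩ := c2
      exact ⟨gy, hgy, fun _ => hwy, by simp, by simp, by simp⟩
    by_cases hab : a + b ≤ m + 1
    · obtain ⟨g, hg, hg'⟩ := hu.2 a b hab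
      exact ⟨g, hg, fun _ => hg', fun h => (c0 h).elim, fun h => (c1 h).elim,
        fun h => (c2 h).elim⟩
    · exact ⟨0, MemLp.zero, fun h => (hab h).elim, fun h => (c0 h).elim, fun h => (c1 h).elim,
        fun h => (c2 h).elim⟩
  choose g hg hw e0 e1 e2 using hex
  refine ⟨fun a b => (Ω : Set Plane).indicator (g a b), ⟨fun a b => hint _ (hg a b),
    fun a b hab ψ hψ hc hs => (hw a b (by omega)).weakGradAt (hw _ _ (by omega))
      (hw _ _ (by omega)) hψ hc hs⟩, by simp only; rw [e0 0 0 ⟨rfl, rfl⟩],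
      fun a b x hx => indicator_of_notMem hx _, fun ψ hψ hc => ?_⟩
  simp only
  rw [e0 0 0 ⟨rfl, rfl⟩, e1 1 0 ⟨rfl, rfl⟩, e2 0 1 ⟨rfl, rfl⟩]
  have hφ2 : ∀ k, MemL2 Ω (φ k) := fun k =>
    ((φ k).continuous.memLp_of_hasCompactSupport (φ k).hasCompactSupport).restrict _
  have hcd : ∀ k, ContDiff ℝ ∞ (φ k) := fun k => (φ k).contDiff
  have hφd : ∀ k τ, MemL2 Ω (dirDeriv τ (φ k)) := fun k τ =>
    ((contDiff_dirDeriv (hcd k) τ).continuous.memLp_of_hasCompactSupport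
      ((φ k).hasCompactSupport.of_isClosed_subset (isClosed_tsupport _)
        (tsupport_dirDeriv_subset _ τ))).restrict _
  have hz : ∀ k, ∀ x ∉ (Ω : Set Plane), φ k x = 0 := fun k x hx =>
    image_eq_zero_of_notMem_tsupport fun h => hx ((φ k).tsupport_subset h)
  have hdz : ∀ k τ, ∀ x ∉ (Ω : Set Plane), dirDeriv τ (φ k) x = 0 := fun k τ x hx =>
    image_eq_zero_of_notMem_tsupport fun h => hx ((φ k).tsupport_subset
      (tsupport_dirDeriv_subset _ τ h))
  have key : ∀ (τ : Plane) (gτ : Plane → ℝ), MemL2 Ω gτ →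
      Tendsto (fun k => eLpNorm (fun x => dirDeriv τ (φ k) x - gτ x) 2
        (volume.restrict (Ω : Set Plane))) atTop (𝓝 0) →
      ∫ y, (Ω : Set Plane).indicator u y * dirDeriv τ ψ y =
        -∫ y, (Ω : Set Plane).indicator gτ y * ψ y := by
    intro τ gτ hgτ ht
    rw [integral_indicator_mul hm, integral_indicator_mul hm]
    have l1 := tendsto_setIntegral_mul hφ2 hu2 (contDiff_dirDeriv hψ τ).continuous
      (hc.of_isClosed_subset (isClosed_tsupport _) (tsupport_dirDeriv_subset ψ τ)) h0
    have l2 := (tendsto_setIntegral_mul (fun k => hφd k τ) hgτ hψ.continuous hc ht).neg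
    -- For functions with compact support in Ω integration by parts has no boundary terms, whatever
    -- ψ does at the boundary; both sides converge.
    refine tendsto_nhds_unique l1 (l2.congr fun k => ?_)
    rw [setIntegral_eq_integral_of_forall_compl_eq_zero (fun x hx => by rw [hdz k τ x hx, zero_mul]),
      setIntegral_eq_integral_of_forall_compl_eq_zero (fun x hx => by rw [hz k x hx, zero_mul]),
      integral_mul_dirDeriv (hcd k) (φ k).hasCompactSupport hψ]
  exact ⟨key _ gx hgx h1, key _ gy hgy h2⟩

lemma abs_conv_le {n : ℕ} {f : Plane → ℝ} {C : ℝ} (hC : ∀ᵐ x, |f x| ≤ C)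
    (x : Plane) : |conv (mollifier n) f x| ≤ C := by
  rw [conv_comm, conv_apply]
  have hi : Integrable fun t => C * mollifier n (x - t) :=
    ((bump n).integrable_normed.comp_sub_left x).const_mul C
  rw [← Real.norm_eq_abs]
  refine (norm_integral_le_of_norm_le hi (hC.mono fun t ht => ?_)).trans_eq ?_
  · have h0 : 0 ≤ mollifier n (x - t) := (bump n).nonneg_normed _
    rw [norm_mul, Real.norm_eq_abs, Real.norm_of_nonneg h0]
    exact mul_le_mul_of_nonneg_right ht h0
  · rw [integral_const_mul, integral_sub_left_eq_self (mollifier n)]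
    show C * ∫ t, (bump n).normed volume t = C
    rw [(bump n).integral_normed, mul_one]

lemma norm_linForm_le (c d : ℝ) : ‖linForm c d‖ ≤ |c| + |d| := by
  refine ContinuousLinearMap.opNorm_le_bound _ (by positivity) fun x => ?_
  rw [linForm_apply]
  have h0 := EuclideanSpace.norm_eq x
  have hx : ∀ i, |x i| ≤ ‖x‖ := fun i => by
    have := PiLp.norm_apply_le x i
    simpa using this
  calc ‖c * x 0 + d * x 1‖ ≤ |c| * |x 0| + |d| * |x 1| := by
        rw [← abs_mul, ← abs_mul]; exact abs_add_le _ _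
    _ ≤ |c| * ‖x‖ + |d| * ‖x‖ := by gcongr <;> exact hx _
    _ = _ := by ring

/-- Limits of regularizations of a function with bounded weak derivatives are Lipschitz
continuous. -/
lemma abs_sub_le_of_weakGrad {f fx fy : Plane → ℝ} (hf : Integrable f)
    (hw : ∀ ψ, ContDiff ℝ ∞ ψ → HasCompactSupport ψ → WeakGradAt f fx fy ψ) {C : ℝ}
    (hx : ∀ᵐ x, |fx x| ≤ C) (hy : ∀ᵐ x, |fy x| ≤ C) {x y : Plane} {a b : ℝ}
    (ha : Tendsto (fun n => conv (mollifier n) f x) atTop (𝓝 a))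
    (hb : Tendsto (fun n => conv (mollifier n) f y) atTop (𝓝 b)) : |a - b| ≤ (C + C) * ‖x - y‖ := by
  refine le_of_tendsto ((ha.sub hb).abs) (Eventually.of_forall fun n => ?_)
  have hd : ∀ z, HasFDerivAt (conv (mollifier n) f)
      (linForm (conv (mollifier n) fx z) (conv (mollifier n) fy z)) z := fun z =>
    hasFDerivAt_conv (contDiff_mollifier n) (hasCompactSupport_mollifier n) hf.locallyIntegrable z
      (hw _ ((contDiff_mollifier n).comp (contDiff_const.sub contDiff_id))
        (hasCompactSupport_sub_left (hasCompactSupport_mollifier n) z))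
  refine convex_univ.norm_image_sub_le_of_norm_hasFDerivWithin_le (f := conv (mollifier n) f)
    (fun z _ => (hd z).hasFDerivWithinAt) (fun z _ => ?_) (mem_univ y) (mem_univ x)
  exact (norm_linForm_le _ _).trans (add_le_add (abs_conv_le hx z) (abs_conv_le hy z))

lemma tendsto_conv_of_notMem_closure {Ω : Set Plane} {f : Plane → ℝ} (hf : ∀ x ∉ Ω, f x = 0)
    {y : Plane} (hy : y ∉ closure Ω) : Tendsto (fun n => conv (mollifier n) f y) atTop (𝓝 0) := by
  obtain ⟨r, hr, hsub⟩ := Metric.isOpen_iff.1 isClosed_closure.isOpen_compl y hy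
  refine tendsto_const_nhds.congr' ?_
  filter_upwards [tendsto_bump_rOut.eventually (gt_mem_nhds hr)] with n hn
  rw [conv_apply]
  symm
  refine integral_eq_zero_of_ae (Eventually.of_forall fun t => ?_)
  show mollifier n t * f (y - t) = 0
  by_cases ht : t ∈ Metric.closedBall (0 : Plane) (bump n).rOut
  · rw [hf (y - t) (fun h => hsub ?_ (subset_closure h)), mul_zero]
    rw [Metric.mem_ball, dist_eq_norm, sub_sub_cancel_left, norm_neg]
    exact (mem_closedBall_zero_iff.1 ht).trans_lt hn
  · rw [← tsupport_mollifier] at ht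
    rw [image_eq_zero_of_notMem_tsupport ht, zero_mul]

end ConicSpline

/-! ### Parallelograms at boundary vertices -/

namespace ConicSpline
namespace CurvedTriangles
variable {n : ℕ} [NeZero n] {D : ConicDomain n} {ι : Type} {Δ : CurvedTriangles D ι}
namespace IsTriangulation

section Cones
variable (hΔ : Δ.IsTriangulation)
include hΔ

lemma coord_add_smul (T : ι) (l i k : Fin 3) (x : Plane) (t : ℝ) :
    (hΔ.basis T).coord l (x + t • (Δ.vert T k - Δ.vert T i)) = (hΔ.basis T).coord l x +
      t * ((if l = k then 1 else 0) - if l = i then 1 else 0) := by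
  have h1 : x + t • (Δ.vert T k - Δ.vert T i) = t • (Δ.vert T k -ᵥ Δ.vert T i) +ᵥ x := by
    rw [vsub_eq_sub, vadd_eq_add, add_comm]
  rw [h1, AffineMap.map_vadd, map_smul, AffineMap.linearMap_vsub, hΔ.coord_vert, hΔ.coord_vert,
    vsub_eq_sub, vadd_eq_add, smul_eq_mul, add_comm]

lemma cross_ne_of_ne {T : ι} {i j k : Fin 3} (hij : i ≠ j) (hik : i ≠ k) (hjk : j ≠ k) :
    cross (Δ.vert T j - Δ.vert T i) (Δ.vert T k - Δ.vert T i) ≠ 0 := by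
  have h := hΔ.cross_ne T
  have h' : cross (Δ.vert T j - Δ.vert T i) (Δ.vert T k - Δ.vert T i) =
      cross (Δ.vert T 1 - Δ.vert T 0) (Δ.vert T 2 - Δ.vert T 0) ∨
      cross (Δ.vert T j - Δ.vert T i) (Δ.vert T k - Δ.vert T i) =
      -cross (Δ.vert T 1 - Δ.vert T 0) (Δ.vert T 2 - Δ.vert T 0) := by
    fin_cases i <;> fin_cases j <;> fin_cases k <;> first
      | exact (hij rfl).elim
      | exact (hik rfl).elim
      | exact (hjk rfl).elim
      | (left; simp [cross]; done)
      | (left; simp [cross]; ring; done)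
      | (right; simp [cross]; ring)
  rcases h' with h' | h' <;> rw [h']
  · exact h
  · exact neg_ne_zero.2 h

/-- The shift raises the coordinates of `j` and `k` by positive amounts and takes them from that of
`i`, which is large enough. -/
lemma cone_subset_interior {T : ι} (hT : T ∉ Δ.pie) {i j k : Fin 3} (hij : i ≠ j) (hik : i ≠ k)
    (hjk : j ≠ k) {x : Plane} (hx : x ∈ Δ.cell T) {α β : ℝ} (hα : 0 < α) (hβ : 0 < β)
    (h : α + β < (hΔ.basis T).coord i x) :
    x + α • (Δ.vert T j - Δ.vert T i) + β • (Δ.vert T k - Δ.vert T i) ∈ interior (Δ.cell T) := by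
  rw [hΔ.cell_straight T hT] at hx ⊢
  rw [hΔ.straightened_eq] at hx
  rw [hΔ.interior_straightened]
  intro l
  rw [hΔ.coord_add_smul, hΔ.coord_add_smul]
  have hl : l = i ∨ l = j ∨ l = k := by omega
  rcases hl with rfl | rfl | rfl
  · rw [if_neg hij, if_neg hik, if_pos rfl]; linarith
  · rw [if_pos rfl, if_neg hjk, if_neg hij.symm]; linarith [hx l]
  · rw [if_pos rfl, if_neg hjk.symm, if_neg hik.symm]; linarith [hx l]

lemma continuous_coord (T : ι) (l : Fin 3) : Continuous fun x => (hΔ.basis T).coord l x :=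
  continuous_barycentric_coord (hΔ.basis T) l

lemma eventually_coord_lt (T : ι) (i : Fin 3) {c : ℝ} (hc : c < 1) :
    ∀ᶠ x in 𝓝 (Δ.vert T i), c < (hΔ.basis T).coord i x := by
  refine (hΔ.continuous_coord T i).continuousAt.eventually (lt_mem_nhds ?_)
  simp only
  rw [hΔ.coord_vert, if_pos rfl]; exact hc

/-- Near a vertex of a straight triangle `T` there is a parallelogram such that all its translates
with corner in `T` are contained in `Ω`. -/
lemma exists_parallelogram_straight {T : ι} (hT : T ∉ Δ.pie) (i : Fin 3) :
    ∃ p₁ p₂, cross p₁ p₂ ≠ 0 ∧ ∀ᶠ x in 𝓝 (Δ.vert T i), x ∈ Δ.cell T → x ∈ D.Ω →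
      x ∈ parallelogramSet (D.Ω : Set Plane) p₁ p₂ := by
  obtain ⟨j, k, hij, hik, hjk⟩ : ∃ j k : Fin 3, i ≠ j ∧ i ≠ k ∧ j ≠ k := by
    revert i; decide
  set e₁ := Δ.vert T j - Δ.vert T i
  set e₂ := Δ.vert T k - Δ.vert T i
  -- Both sides point strictly into the triangle, so that every point of the parallelogram other
  -- than the corner is in the interior. The factor 1/12 bounds the total shift by 1/2, less than
  -- the coordinate 3/4 kept near the vertex.
  refine ⟨(1 / 12 : ℝ) • ((2 : ℝ) • e₁ + e₂), (1 / 12 : ℝ) • (e₁ + (2 : ℝ) • e₂), ?_, ?_⟩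
  · have h := hΔ.cross_ne_of_ne (T := T) hij hik hjk
    have h' : cross ((1 / 12 : ℝ) • ((2 : ℝ) • e₁ + e₂)) ((1 / 12 : ℝ) • (e₁ + (2 : ℝ) • e₂)) =
        1 / 48 * cross e₁ e₂ := by simp [cross]; ring
    rw [h']
    exact mul_ne_zero (by norm_num) h
  · filter_upwards [hΔ.eventually_coord_lt T i (c := 3 / 4) (by norm_num)] with x hx hxT hxΩ s hs t ht
    by_cases h0 : s = 0 ∧ t = 0
    · rw [h0.1, h0.2, zero_smul, zero_smul, add_zero, add_zero]; exact hxΩ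
    have hst : 0 < s + t := by
      rcases hs.1.lt_or_eq with h | h
      · linarith [ht.1]
      · rcases ht.1.lt_or_eq with h' | h'
        · linarith
        · exact (h0 ⟨h.symm, h'.symm⟩).elim
    have := hΔ.cone_subset_interior hT hij hik hjk hxT (α := (2 * s + t) / 12)
      (β := (s + 2 * t) / 12) (by linarith [hs.1]) (by linarith [ht.1]) (by linarith [hs.2, ht.2])
    refine hΔ.interior_cell_subset T ?_
    convert this using 1
    module

end Cones

section Admissible
variable (hΔ : Δ.IsTriangulation) (hAF : Δ.IsAdmissible)
include hΔ

lemma conic_vert {T : ι} (hT : T ∈ Δ.pie) {i : Fin 3} (hi : i ≠ 0) :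
    polyFun (Δ.conic T) (Δ.vert T i) = 0 :=
  hΔ.conic_closedArc (hΔ.curvedEdge_subset_closedArc hT (hΔ.vert_mem_curvedEdge hT hi))

lemma gradV_vert_ne {T : ι} (hT : T ∈ Δ.pie) {i : Fin 3} (hi : i ≠ 0) :
    gradV (Δ.conic T) (Δ.vert T i) ≠ 0 := by
  obtain ⟨t, ht, he⟩ := hΔ.curvedEdge_subset_closedArc hT (hΔ.vert_mem_curvedEdge hT hi)
  rw [← he]
  exact D.arc_gradV_ne _ ht

lemma exists_frontier_near_vert {T : ι} (hT : T ∈ Δ.pie) {i : Fin 3} (hi : i ≠ 0) :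
    ∃ r > 0, ∀ y ∈ Metric.ball (Δ.vert T i) r, y ∈ frontier (Δ.cell T) →
      (∃ t ∈ Icc (0 : ℝ) 1, y = Δ.vert T i + t • (Δ.vert T 0 - Δ.vert T i)) ∨
        y ∈ Δ.curvedEdge T := by
  obtain ⟨j, hj0, hji⟩ : ∃ j : Fin 3, j ≠ 0 ∧ j ≠ i := by revert i; decide
  have hcl : IsClosed (segment ℝ (Δ.vert T 0) (Δ.vert T j)) := by
    rw [segment_eq_image']; exact (isCompact_Icc.image (by fun_prop)).isClosed
  have hx : Δ.vert T i ∉ segment ℝ (Δ.vert T 0) (Δ.vert T j) := fun h =>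
    (hΔ.vert_mem_segment h).elim hi hji.symm
  obtain ⟨r, hr, hsub⟩ := Metric.isOpen_iff.1 hcl.isOpen_compl _ hx
  refine ⟨r, hr, fun y hy hfr => ?_⟩
  have hfr' := hfr
  rw [hΔ.frontier_pie T hT] at hfr'
  have hij : (i = 1 ∧ j = 2) ∨ (i = 2 ∧ j = 1) := by omega
  have hseg : y ∈ segment ℝ (Δ.vert T 0) (Δ.vert T i) →
      ∃ t ∈ Icc (0 : ℝ) 1, y = Δ.vert T i + t • (Δ.vert T 0 - Δ.vert T i) := by
    intro h
    rw [segment_symm, segment_eq_image'] at h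
    obtain ⟨t, ht, rfl⟩ := h
    exact ⟨t, ht, rfl⟩
  rcases hij with ⟨rfl, rfl⟩ | ⟨rfl, rfl⟩
  · rcases hfr' with (h | h) | h
    · exact Or.inl (hseg h)
    · exact (hsub hy h).elim
    · exact Or.inr h
  · rcases hfr' with (h | h) | h
    · exact (hsub hy h).elim
    · exact Or.inl (hseg h)
    · exact Or.inr h

include hAF

lemma conic_pos_edge [Finite ι] {T : ι} (hT : T ∈ Δ.pie) {i : Fin 3} (hi : i ≠ 0) {t : ℝ}
    (h0 : 0 < t) (h1 : t ≤ 1) :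
    0 < polyFun (Δ.conic T) (Δ.vert T i + t • (Δ.vert T 0 - Δ.vert T i)) := by
  have hs : Δ.IsStraight T i 0 := (isStraight_zero hi).symm
  have hm : Δ.vert T i + t • (Δ.vert T 0 - Δ.vert T i) ∈ segment ℝ (Δ.vert T i) (Δ.vert T 0) := by
    rw [segment_eq_image']; exact ⟨t, ⟨h0.le, h1⟩, rfl⟩
  refine CurvedTriangles.conic_pos_of_mem hΔ hAF hT (hΔ.segment_subset_cell hs hm) ?_
  rcases h1.lt_or_eq with h1 | rfl
  · refine hΔ.openSegment_subset hs ?_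
    rw [openSegment_eq_image']; exact ⟨t, ⟨h0, h1⟩, rfl⟩
  · rw [one_smul, add_sub_cancel]; exact CurvedTriangles.vert_zero_mem hΔ hAF hT

/-- The conic polynomial is zero at the vertex and positive on the rest of the edge, so it cannot
decrease initially along the edge. -/
lemma inner_gradV_edge_nonneg [Finite ι] {T : ι} (hT : T ∈ Δ.pie) {i : Fin 3} (hi : i ≠ 0) :
    0 ≤ inner ℝ (gradV (Δ.conic T) (Δ.vert T i)) (Δ.vert T 0 - Δ.vert T i) := by
  by_contra! hneg
  have h1 : 0 < inner ℝ (gradV (Δ.conic T) (Δ.vert T i)) (-(Δ.vert T 0 - Δ.vert T i)) := by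
    rw [inner_neg_right]; linarith
  obtain ⟨r, hr, hball⟩ := Metric.eventually_nhds_iff_ball.1 (ConicDomain.tendsto_polyD_pos h1)
  have hc : Tendsto (fun t : ℝ => Δ.vert T i + t • (Δ.vert T 0 - Δ.vert T i)) (𝓝 0)
      (𝓝 (Δ.vert T i)) := by
    have : Continuous fun t : ℝ => Δ.vert T i + t • (Δ.vert T 0 - Δ.vert T i) := by fun_prop
    simpa using this.tendsto 0
  obtain ⟨δ, hδ, hδb⟩ := Metric.eventually_nhds_iff.1 (hc.eventually (Metric.ball_mem_nhds _ hr))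
  set s := min (δ / 2) 1
  have hs0 : 0 < s := by positivity
  obtain ⟨ρ, hρ, he⟩ := polyFun_mvt (Δ.conic T) (Δ.vert T i) (Δ.vert T 0 - Δ.vert T i) hs0
  have h2 := hΔ.conic_pos_edge hAF hT hi hs0 (min_le_right _ _)
  have h3 := hball _ (hδb (y := ρ) (by
    rw [Real.dist_eq, sub_zero, abs_of_pos hρ.1]
    linarith [hρ.2, min_le_left (δ / 2) (1 : ℝ)]))
  rw [polyFun_polyD, inner_neg_right, inner_neg_right] at h3
  rw [hΔ.conic_vert hT hi, sub_zero, polyFun_polyD] at he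
  have h4 := mul_neg_of_pos_of_neg hs0 (lt_of_neg_lt_neg (by linarith) :
    inner ℝ (gradV (Δ.conic T) (Δ.vert T i + ρ • (Δ.vert T 0 - Δ.vert T i)))
      (Δ.vert T 0 - Δ.vert T i) < 0)
  linarith

/-- If the straight edge of a pie-shaped triangle is tangential to the curved edge, then the
triangle is, near the common point, on the other side of the tangent. -/
lemma exists_halfPlane_notMem [Finite ι] {T : ι} (hT : T ∈ Δ.pie) {i : Fin 3} (hi : i ≠ 0)
    (h0 : inner ℝ (gradV (Δ.conic T) (Δ.vert T i)) (Δ.vert T 0 - Δ.vert T i) = 0) :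
    ∃ r > 0, ∀ y ∈ Metric.ball (Δ.vert T i) r,
      0 < inner ℝ (gradV (Δ.conic T) (Δ.vert T i)) (y - Δ.vert T i) → y ∉ Δ.cell T := by
  have hn := hΔ.gradV_vert_ne hT hi
  have hqx := hΔ.conic_vert hT hi
  have hqd : (Δ.conic T).totalDegree ≤ 2 := (D.q_degree _).le
  set x₀ := Δ.vert T i with hx₀
  set e := Δ.vert T 0 - x₀ with he
  set q := Δ.conic T with hq
  set nv := gradV q x₀ with hnv
  have hqe := hΔ.conic_pos_edge hAF hT hi one_pos le_rfl
  have hene : e ≠ 0 := hΔ.edge_ne hi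
  set N : ℝ := inner ℝ nv nv with hN
  have hNpos : 0 < N := real_inner_self_pos.2 hn
  have hcr : cross e nv ≠ 0 := by
    obtain ⟨κ, hκ⟩ := eq_smul_rot hene h0
    have hκ0 : κ ≠ 0 := fun h => hn (by rw [hκ, h, zero_smul])
    have : cross e nv = κ * cross e (rot e) := by rw [hκ]; simp [cross]; ring
    rw [this]; exact mul_ne_zero hκ0 (cross_rot_ne hene)
  set A := polyFun (polyD e (polyD e q)) x₀ / 2 with hA
  set B := polyFun (polyD e (polyD nv q)) x₀ with hB
  set C := polyFun (polyD nv (polyD nv q)) x₀ / 2 with hC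
  -- Coordinates along the edge and along the gradient; the term linear in α is absent because the
  -- edge is tangential.
  have hTay : ∀ α β : ℝ, polyFun q (x₀ + (α • e + β • nv)) =
      β * N + α ^ 2 * A + α * β * B + β ^ 2 * C := by
    intro α β
    rw [polyFun_taylor_two hqd, hqx, polyFun_polyD, ← hnv, inner_add_right, inner_smul_right,
      inner_smul_right, h0]
    simp only [polyD_add_left, polyD_smul_left, polyD_add, polyD_C_mul, polyFun_add, polyFun_mul,
      polyFun_C]
    rw [polyD_comm nv e, hA, hB, hC]
    ring
  -- At the other end of the edge (α = 1, β = 0) the polynomial has the value A. So near the vertex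
  -- q > 0 whenever β > 0.
  have hApos : 0 < A := by
    have := hTay 1 0
    rw [zero_smul, add_zero] at this
    rw [this] at hqe
    linarith
  have hcont : Tendsto (fun y => |cross (y - x₀) nv / cross e nv| * |B| +
      |cross e (y - x₀) / cross e nv| * |C|) (𝓝 x₀) (𝓝 0) := by
    have : Continuous fun y => |cross (y - x₀) nv / cross e nv| * |B| +
      |cross e (y - x₀) / cross e nv| * |C| := by unfold cross; fun_prop
    have h := this.tendsto x₀
    simpa [cross] using h
  obtain ⟨r, hr, hball⟩ := Metric.eventually_nhds_iff_ball.1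
    (hcont.eventually (gt_mem_nhds hNpos))
  have hposH : ∀ y ∈ Metric.ball x₀ r, 0 < inner ℝ nv (y - x₀) → 0 < polyFun q y := by
    intro y hy hpos
    have hb := hball y hy
    have hc := exists_coords hcr (y - x₀)
    set α := cross (y - x₀) nv / cross e nv
    set β := cross e (y - x₀) / cross e nv
    have hβ : 0 < β := by
      rw [hc, inner_add_right, inner_smul_right, inner_smul_right, h0] at hpos
      have : 0 < β * N := by linarith
      exact pos_of_mul_pos_left this hNpos.le
    have hy' : y = x₀ + (α • e + β • nv) := by rw [← hc]; abel
    rw [hy', hTay]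
    have h1 : -(|α| * |B|) ≤ α * B := by rw [← abs_mul]; exact neg_abs_le _
    have h2 : -(|β| * |C|) ≤ β * C := by rw [← abs_mul]; exact neg_abs_le _
    have h3 : 0 < β * (N + α * B + β * C) := mul_pos hβ (by linarith)
    have h4 : 0 ≤ α ^ 2 * A := mul_nonneg (sq_nonneg _) hApos.le
    linarith [h3]
  obtain ⟨r₂, hr₂, hfr⟩ := hΔ.exists_frontier_near_vert hT hi
  set r' := min r r₂ with hr'
  have hr'0 : 0 < r' := lt_min hr hr₂
  refine ⟨r', hr'0, ?_⟩
  set H : Set Plane := Metric.ball x₀ r' ∩ {y | 0 < inner ℝ nv (y - x₀)} with hH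
  have hHc : Convex ℝ H := by
    refine (convex_ball _ _).inter ?_
    intro y hy z hz a b ha hb hab
    have : a • y + b • z - x₀ = a • (y - x₀) + b • (z - x₀) := by
      rw [smul_sub, smul_sub]
      have : x₀ = a • x₀ + b • x₀ := by rw [← add_smul, hab, one_smul]
      nth_rw 1 [this]; abel
    show 0 < inner ℝ nv (a • y + b • z - x₀)
    rw [this, inner_add_right, inner_smul_right, inner_smul_right]
    have hy : 0 < inner ℝ nv (y - x₀) := hy
    have hz : 0 < inner ℝ nv (z - x₀) := hz
    rcases ha.lt_or_eq with h | h
    · have := mul_pos h hy; have := mul_nonneg hb hz.le; linarith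
    · rw [← h] at hab ⊢
      rw [zero_add] at hab; rw [hab]; linarith
  have hHfr : ∀ y ∈ H, y ∉ frontier (Δ.cell T) := by
    intro y hy hyf
    rcases hfr y (Metric.ball_subset_ball (min_le_right _ _) hy.1) hyf with ⟨t, -, h⟩ | h
    · have : 0 < inner ℝ nv (y - x₀) := hy.2
      rw [h, add_sub_cancel_left, inner_smul_right, h0, mul_zero] at this
      exact this.ne rfl
    · have := hposH y (Metric.ball_subset_ball (min_le_left _ _) hy.1) hy.2
      rw [hΔ.conic_closedArc (hΔ.curvedEdge_subset_closedArc hT h)] at this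
      exact this.ne rfl
  intro y hy hpos
  rcases IsPreconnected.subset_interior_or hHc.isPreconnected (hΔ.isClosed_cell T) hHfr with hsub | hsub
  swap
  · exact hsub ⟨hy, hpos⟩
  exfalso
  -- a point on the extension of the edge beyond the vertex, in the interior of the triangle
  have ht1 : ∀ᶠ t : ℝ in 𝓝[>] 0, x₀ - t • e ∈ Metric.ball x₀ r' := by
    have : Continuous fun t : ℝ => x₀ - t • e := by fun_prop
    have h := this.tendsto 0
    rw [zero_smul, sub_zero] at h
    exact (h.eventually (Metric.ball_mem_nhds _ hr'0)).filter_mono nhdsWithin_le_nhds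
  obtain ⟨t, htb, ht⟩ := (ht1.and self_mem_nhdsWithin).exists
  have ht : 0 < t := ht
  set z := x₀ - t • e with hz
  have hzT : z ∈ Δ.cell T := by
    have hc : Continuous fun δ : ℝ => z + δ • nv := by fun_prop
    have hl := hc.tendsto 0
    rw [zero_smul, add_zero] at hl
    refine (hΔ.isClosed_cell T).mem_of_tendsto (hl.mono_left (nhdsWithin_le_nhds (s := Ioi 0))) ?_
    filter_upwards [(hl.eventually (Metric.isOpen_ball.mem_nhds htb)).filter_mono nhdsWithin_le_nhds,
      self_mem_nhdsWithin] with δ hδ hδ0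
    refine interior_subset (hsub ⟨hδ, ?_⟩)
    show 0 < inner ℝ nv (x₀ - t • e + δ • nv - x₀)
    rw [show x₀ - t • e + δ • nv - x₀ = δ • nv - t • e by abel, inner_sub_right,
      inner_smul_right, inner_smul_right, h0, mul_zero, sub_zero]
    exact mul_pos hδ0 hNpos
  have hqz : 0 < polyFun q z := by
    have := hTay (-t) 0
    rw [zero_smul, add_zero, neg_smul, ← sub_eq_add_neg] at this
    rw [this]; nlinarith [mul_pos (mul_pos ht ht) hApos]
  -- The point is not on the edge, being on the other side of the vertex, nor on the curve, where q
  -- = 0 while q(z) = t²A.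
  have hzi : z ∈ interior (Δ.cell T) := by
    by_contra hcon
    have hzf : z ∈ frontier (Δ.cell T) := ⟨subset_closure hzT, hcon⟩
    rcases hfr z (Metric.ball_subset_ball (min_le_right _ _) htb) hzf with ⟨s, hs, h⟩ | h
    · have : (s + t) • e = 0 := by
        rw [hz, sub_eq_add_neg] at h
        have := add_left_cancel h
        rw [add_smul, ← this]; abel
      rcases smul_eq_zero.1 this with h | h
      · linarith [hs.1]
      · exact hene h
    · rw [hΔ.conic_closedArc (hΔ.curvedEdge_subset_closedArc hT h)] at hqz
      exact hqz.ne rfl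
  have hε1 : ∀ᶠ ε : ℝ in 𝓝[>] 0, z - ε • nv ∈ Δ.cell T := by
    have : Continuous fun ε : ℝ => z - ε • nv := by fun_prop
    have h := this.tendsto 0
    rw [zero_smul, sub_zero] at h
    exact (h.eventually (mem_interior_iff_mem_nhds.1 hzi)).filter_mono nhdsWithin_le_nhds
  have hε2 : ∀ᶠ ε : ℝ in 𝓝[>] 0, ε / (1 + t) * C < N := by
    have : Continuous fun ε : ℝ => ε / (1 + t) * C := by fun_prop
    have h := this.tendsto 0
    rw [zero_div, zero_mul] at h
    exact (h.eventually (gt_mem_nhds hNpos)).filter_mono nhdsWithin_le_nhds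
  obtain ⟨ε, ⟨hεT, hεN⟩, hε⟩ := ((hε1.and hε2).and self_mem_nhdsWithin).exists
  have hε : 0 < ε := hε
  have h1t : (0 : ℝ) < 1 + t := by linarith
  -- By star-shapedness the segment from the interior vertex x₀ + e to z - ε nv lies in `T`. It
  -- passes through x₀ - (ε/(1 + t)) nv, where the linear term makes q negative, contrary to (E).
  have hw : x₀ + ((0 : ℝ) • e + (-(ε / (1 + t))) • nv) ∈ Δ.cell T := by
    refine (hAF.condD T hT).segment_subset hεT ?_
    rw [segment_eq_image']
    refine ⟨1 / (1 + t), ⟨by positivity, by rw [div_le_one h1t]; linarith⟩, ?_⟩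
    have h1 : Δ.vert T 0 = x₀ + e := by rw [he]; abel
    simp only
    rw [h1, hz]
    have h2 : x₀ - t • e - ε • nv - (x₀ + e) = -((1 + t) • e) - ε • nv := by module
    rw [h2, smul_sub, smul_neg, smul_smul, one_div_mul_cancel h1t.ne', smul_smul]
    have h3 : 1 / (1 + t) * ε = ε / (1 + t) := by ring
    rw [h3]; module
  have hq0 := CurvedTriangles.conic_nonneg_of_mem hΔ hAF hT hw
  rw [← hq, hTay] at hq0
  have hβ : 0 < ε / (1 + t) := by positivity
  nlinarith [mul_pos hβ (sub_pos.2 hεN)]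

end Admissible
end IsTriangulation
end CurvedTriangles
end ConicSpline

namespace ConicSpline
namespace CurvedTriangles
variable {n : ℕ} [NeZero n] {D : ConicDomain n} {ι : Type} {Δ : CurvedTriangles D ι}
namespace IsTriangulation
variable (hΔ : Δ.IsTriangulation) (hAF : Δ.IsAdmissible)
include hΔ hAF

/-- The straight triangle on the other side of a straight edge of a pie-shaped triangle. -/
lemma exists_straight_neighbor [Finite ι] {T : ι} (hT : T ∈ Δ.pie) {i : Fin 3} (hi : i ≠ 0) :
    ∃ T' a b c, T ≠ T' ∧ T' ∉ Δ.pie ∧ Δ.IsStraight T' a b ∧ Δ.vert T i = Δ.vert T' a ∧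
      Δ.vert T 0 = Δ.vert T' b ∧ a ≠ b ∧ a ≠ c ∧ b ≠ c := by
  obtain ⟨T', hne, a, b, hab, ha, hb⟩ := hΔ.exists_neighbor (isStraight_zero (Δ := Δ) (T := T) hi).symm
  have hT' : T' ∉ Δ.pie := fun h => by
    have := hAF.condC T hT T' h hne
    have hm : segment ℝ (Δ.vert T i) (Δ.vert T 0) ∈ Δ.edges T ∩ Δ.edges T' :=
      ⟨⟨i, 0, (isStraight_zero hi).symm, rfl⟩, ⟨a, b, hab, by rw [ha, hb]⟩⟩
    rw [this] at hm; exact hm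
  obtain ⟨c, hc⟩ : ∃ c : Fin 3, a ≠ c ∧ b ≠ c :=
    (by decide : ∀ a b : Fin 3, ∃ c : Fin 3, a ≠ c ∧ b ≠ c) a b
  exact ⟨T', a, b, c, hne, hT', hab, ha, hb, hab.1, hc⟩

/-- In the tangential case the pie-shaped triangle lies on the negative side of the edge, so its
neighbour lies on the positive side, and so does the third vertex of the neighbour. -/
lemma inner_gradV_neighbor_pos [Finite ι] {T : ι} (hT : T ∈ Δ.pie) {i : Fin 3} (hi : i ≠ 0)
    (h0 : inner ℝ (gradV (Δ.conic T) (Δ.vert T i)) (Δ.vert T 0 - Δ.vert T i) = 0)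
    {T' : ι} {a b c : Fin 3} (hne : T ≠ T') (hT' : T' ∉ Δ.pie) (hab : Δ.IsStraight T' a b)
    (ha : Δ.vert T i = Δ.vert T' a) (hb : Δ.vert T 0 = Δ.vert T' b) (hac : a ≠ c) (hbc : b ≠ c) :
    0 < inner ℝ (gradV (Δ.conic T) (Δ.vert T i)) (Δ.vert T' c - Δ.vert T i) := by
  obtain ⟨r, hr, hnot⟩ := hΔ.exists_halfPlane_notMem hAF hT hi h0
  have hn := hΔ.gradV_vert_ne hT hi
  set x₀ := Δ.vert T i with hx₀
  set e := Δ.vert T 0 - x₀ with he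
  set nv := gradV (Δ.conic T) x₀
  have hene : e ≠ 0 := hΔ.edge_ne hi
  obtain ⟨κ, hκ⟩ := eq_smul_rot hene h0
  have hκ0 : κ ≠ 0 := fun h => hn (by rw [hκ, h, zero_smul])
  have hinner : ∀ y, inner ℝ nv y = κ * cross e y := by
    intro y; rw [hκ, inner_plane]; simp [cross]; ring
  -- a point of the edge near the vertex
  have hc : Tendsto (fun t : ℝ => x₀ + t • e) (𝓝[>] 0) (𝓝 x₀) := by
    have : Continuous fun t : ℝ => x₀ + t • e := by fun_prop
    have h := this.tendsto 0
    rw [zero_smul, add_zero] at h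
    exact h.mono_left nhdsWithin_le_nhds
  obtain ⟨t, htb, ht0, ht1⟩ := ((hc.eventually (Metric.ball_mem_nhds _ hr)).and
    (Ioo_mem_nhdsGT (zero_lt_one (α := ℝ)))).exists
  have hx : x₀ + t • e ∈ openSegment ℝ (Δ.vert T i) (Δ.vert T 0) := by
    rw [openSegment_eq_image']; exact ⟨t, ⟨ht0, ht1⟩, rfl⟩
  obtain ⟨r', hr', s, hs, h1, h2⟩ := hΔ.opposite_sides hne (isStraight_zero hi).symm hab ha hb hx
  have hex : ∀ σ : ℝ, σ ≠ 0 → ∃ y ∈ halfDisk (x₀ + t • e) r' (Δ.vert T i) (Δ.vert T 0 - Δ.vert T i) σ,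
      y ∈ Metric.ball x₀ r := by
    intro σ hσ
    have hm := mem_closure_halfDisk (x := x₀ + t • e) (r := r') (a := Δ.vert T i) hσ hene
      (Metric.mem_ball_self hr') (by
        have : cross e (x₀ + t • e - Δ.vert T i) = 0 := by simp [cross, ← hx₀]; ring
        rw [this, mul_zero])
    obtain ⟨y, hy, hy'⟩ := mem_closure_iff.1 hm _ Metric.isOpen_ball htb
    exact ⟨y, hy', hy⟩
  have hs0 : s ≠ 0 := by rcases hs with rfl | rfl <;> norm_num
  -- the pie-shaped triangle is on the negative side
  have hκs : κ * s < 0 := by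
    by_contra! hcon
    obtain ⟨y, hy, hyb⟩ := hex s hs0
    have hyc : 0 < s * cross e (y - x₀) := hy.2
    refine hnot y hyb ?_ (interior_subset (h1 hy))
    rw [hinner]
    have hss : s * s = 1 := by rcases hs with rfl | rfl <;> norm_num
    have hpos : 0 < κ * s := lt_of_le_of_ne hcon (mul_ne_zero hκ0 hs0).symm
    have := mul_pos hpos hyc
    calc (0 : ℝ) < κ * s * (s * cross e (y - x₀)) := this
      _ = (s * s) * (κ * cross e (y - x₀)) := by ring
      _ = _ := by rw [hss, one_mul]
  obtain ⟨y, hy, -⟩ := hex (-s) (neg_ne_zero.2 hs0)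
  have hyc : 0 < -s * cross e (y - x₀) := hy.2
  have hyi := h2 hy
  rw [hΔ.cell_straight T' hT', hΔ.interior_straightened] at hyi
  have hγ := hyi c
  have hcr := hΔ.cross_ne_of_ne (T := T') hab.1 hac hbc
  rw [← ha, ← hb] at hcr
  have hco := exists_coords hcr (y - x₀)
  set α := cross (y - x₀) (Δ.vert T' c - x₀) / cross (Δ.vert T 0 - x₀) (Δ.vert T' c - x₀)
  set γ := cross (Δ.vert T 0 - x₀) (y - x₀) / cross (Δ.vert T 0 - x₀) (Δ.vert T' c - x₀) with hγd
  have hyeq : y = Δ.vert T' a + α • (Δ.vert T' b - Δ.vert T' a) +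
      γ • (Δ.vert T' c - Δ.vert T' a) := by
    rw [← ha, ← hb, add_assoc, ← hco]; abel
  have hγ0 : 0 < γ := by
    rw [hyeq, hΔ.coord_add_smul, hΔ.coord_add_smul, hΔ.coord_vert] at hγ
    rw [if_neg hac.symm, if_neg hbc.symm, if_pos rfl] at hγ
    linarith
  have hcy : cross e (y - x₀) = γ * cross e (Δ.vert T' c - x₀) := by
    rw [hγd, div_mul_cancel₀ _ hcr]
  rw [hinner]
  rw [hcy] at hyc
  have h3 : 0 < -s * cross e (Δ.vert T' c - x₀) := by
    by_contra! hcon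
    have := mul_nonpos_of_nonneg_of_nonpos hγ0.le hcon
    linarith
  rcases hs with rfl | rfl
  · nlinarith
  · nlinarith

set_option maxHeartbeats 1000000 in
/-- Near a boundary vertex of a pie-shaped triangle `T` there is a parallelogram such that all its
translates with corner in `T` are contained in `Ω`. -/
lemma exists_parallelogram_pie [Finite ι] {T : ι} (hT : T ∈ Δ.pie) {i : Fin 3} (hi : i ≠ 0) :
    ∃ p₁ p₂, cross p₁ p₂ ≠ 0 ∧ ∀ᶠ x in 𝓝 (Δ.vert T i), x ∈ Δ.cell T → x ∈ D.Ω →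
      x ∈ parallelogramSet (D.Ω : Set Plane) p₁ p₂ := by
  obtain ⟨T', a, b, c, hne, hT', hab', ha, hb, hab, hac, hbc⟩ := hΔ.exists_straight_neighbor hAF hT hi
  have he0 := hΔ.inner_gradV_edge_nonneg hAF hT hi
  have hcr := hΔ.cross_ne_of_ne (T := T') hab hac hbc
  set x₀ := Δ.vert T i with hx₀
  set q := Δ.conic T with hq
  set e := Δ.vert T 0 - x₀ with he
  set e' := Δ.vert T' c - x₀ with he'
  rw [← ha, ← hb] at hcr
  -- Directions from the edge into the neighbour in which the conic increases. A small δ suffices if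
  -- it increases along the edge; in the tangential case e' alone makes it increase.
  obtain ⟨δ, hδ0, h1, h2⟩ : ∃ δ : ℝ, 0 < δ ∧ 0 < inner ℝ (gradV q x₀) (e + δ • e') ∧
      0 < inner ℝ (gradV q x₀) (e + (2 * δ) • e') := by
    rcases he0.lt_or_eq with hpos | hzero
    · have hc : ∀ k : ℝ, ∀ᶠ δ : ℝ in 𝓝[>] 0, 0 < inner ℝ (gradV q x₀) (e + (k * δ) • e') := by
        intro k
        have hc : Continuous fun δ : ℝ => (inner ℝ (gradV q x₀) (e + (k * δ) • e') : ℝ) := by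
          fun_prop
        have h := hc.tendsto 0
        rw [mul_zero, zero_smul, add_zero] at h
        exact (h.eventually (lt_mem_nhds hpos)).filter_mono nhdsWithin_le_nhds
      obtain ⟨δ, ⟨h1, h2⟩, h3⟩ := (((hc 1).and (hc 2)).and self_mem_nhdsWithin).exists
      rw [one_mul] at h1
      exact ⟨δ, h3, h1, h2⟩
    · have h := hΔ.inner_gradV_neighbor_pos hAF hT hi hzero.symm hne hT' hab' ha hb hac hbc
      refine ⟨1, one_pos, ?_, ?_⟩ <;> rw [inner_add_right, inner_smul_right, ← hzero] <;>
        simpa using h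
  -- a ball in which the conic increases in the directions of the parallelogram
  obtain ⟨r₁, hr₁, hb₁⟩ := Metric.eventually_nhds_iff_ball.1 (ConicDomain.tendsto_polyD_pos h1)
  obtain ⟨r₂, hr₂, hb₂⟩ := Metric.eventually_nhds_iff_ball.1 (ConicDomain.tendsto_polyD_pos h2)
  obtain ⟨r₃, hr₃, hfr⟩ := hΔ.exists_frontier_near_vert hT hi
  obtain ⟨r₄, hr₄, hb₄⟩ := Metric.eventually_nhds_iff_ball.1
    (hΔ.eventually_coord_lt T' a (c := 3 / 4) (by norm_num))
  have hvfin : ∃ r₅ > 0, ∀ k, Δ.vert T k ∈ Metric.ball x₀ r₅ → Δ.vert T k = x₀ := by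
    have : ∀ k, ∀ᶠ r : ℝ in 𝓝[>] 0, Δ.vert T k ∈ Metric.ball x₀ r → Δ.vert T k = x₀ := by
      intro k
      by_cases hk : Δ.vert T k = x₀
      · exact Eventually.of_forall fun _ _ => hk
      · filter_upwards [Ioo_mem_nhdsGT (dist_pos.2 hk)] with r hr h
        exact (lt_asymm hr.2 h).elim
    obtain ⟨r, hr, hr0⟩ := ((eventually_all.2 this).and self_mem_nhdsWithin).exists
    exact ⟨r, hr0, hr⟩
  obtain ⟨r₅, hr₅, hb₅⟩ := hvfin
  obtain ⟨r, hr, hr1, hr2, hr3, hr4, hr5⟩ : ∃ r > 0, r ≤ r₁ ∧ r ≤ r₂ ∧ r ≤ r₃ ∧ r ≤ r₄ ∧ r ≤ r₅ :=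
    ⟨min r₁ (min r₂ (min r₃ (min r₄ r₅))), by positivity, by simp, by simp, by simp, by simp,
      by simp⟩
  -- the size of the parallelogram
  have hM : 0 < ‖e‖ + ‖e'‖ + 1 := by positivity
  set ε := min (r / (8 * ((1 + δ) * (‖e‖ + ‖e'‖ + 1)))) (1 / (16 * (1 + δ))) with hε
  have hε0 : 0 < ε := by positivity
  have hε1 : ε * ((1 + δ) * (‖e‖ + ‖e'‖ + 1)) ≤ r / 8 := by
    have h := min_le_left (r / (8 * ((1 + δ) * (‖e‖ + ‖e'‖ + 1)))) (1 / (16 * (1 + δ)))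
    calc _ ≤ r / (8 * ((1 + δ) * (‖e‖ + ‖e'‖ + 1))) * ((1 + δ) * (‖e‖ + ‖e'‖ + 1)) :=
          mul_le_mul_of_nonneg_right h (by positivity)
      _ = r / 8 := by field_simp
  have hε2 : ε * (1 + δ) ≤ 1 / 16 := by
    have h := min_le_right (r / (8 * ((1 + δ) * (‖e‖ + ‖e'‖ + 1)))) (1 / (16 * (1 + δ)))
    calc _ ≤ 1 / (16 * (1 + δ)) * (1 + δ) := mul_le_mul_of_nonneg_right h (by positivity)
      _ = 1 / 16 := by field_simp
  refine ⟨ε • (e + δ • e'), ε • (e + (2 * δ) • e'), ?_, ?_⟩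
  · have h' : cross (ε • (e + δ • e')) (ε • (e + (2 * δ) • e')) = ε ^ 2 * δ * cross e e' := by
      simp [cross]; ring
    rw [h']
    exact mul_ne_zero (mul_pos (pow_pos hε0 2) hδ0).ne' hcr
  filter_upwards [Metric.ball_mem_nhds x₀ (half_pos hr)] with x hx hxT hxΩ s hs t ht
  by_cases h0 : s = 0 ∧ t = 0
  · rw [h0.1, h0.2, zero_smul, zero_smul, add_zero, add_zero]; exact hxΩ
  have hst : 0 < s + t := by
    rcases hs.1.lt_or_eq with h | h
    · linarith [ht.1]
    · rcases ht.1.lt_or_eq with h' | h'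
      · linarith
      · exact (h0 ⟨h.symm, h'.symm⟩).elim
  set A := ε * (s + t) with hA
  set B := ε * δ * (s + 2 * t) with hB
  have hA0 : 0 < A := mul_pos hε0 hst
  have hB0 : 0 < B := mul_pos (mul_pos hε0 hδ0) (by linarith [ht.1])
  have hAB : A + B ≤ 4 * (ε * (1 + δ)) := by
    have e1 : A ≤ ε * 2 := mul_le_mul_of_nonneg_left (by linarith [hs.2, ht.2]) hε0.le
    have e2 : B ≤ ε * δ * 3 := mul_le_mul_of_nonneg_left (by linarith [hs.2, ht.2])
      (mul_pos hε0 hδ0).le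
    nlinarith [mul_pos hε0 hδ0]
  set P := A • e + B • e' with hP
  have hPeq : x + s • ε • (e + δ • e') + t • ε • (e + (2 * δ) • e') = x + P := by
    rw [hP, hA, hB]; module
  rw [hPeq]
  have hPn : ‖P‖ ≤ r / 2 := by
    calc ‖P‖ ≤ A * ‖e‖ + B * ‖e'‖ := by
          refine (norm_add_le _ _).trans_eq ?_
          rw [norm_smul, norm_smul, Real.norm_of_nonneg hA0.le, Real.norm_of_nonneg hB0.le]
      _ ≤ (A + B) * (‖e‖ + ‖e'‖ + 1) := by
          have j1 := mul_nonneg hA0.le (norm_nonneg e')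
          have j2 := mul_nonneg hB0.le (norm_nonneg e)
          linarith
      _ ≤ 4 * (ε * (1 + δ)) * (‖e‖ + ‖e'‖ + 1) := mul_le_mul_of_nonneg_right hAB hM.le
      _ = 4 * (ε * ((1 + δ) * (‖e‖ + ‖e'‖ + 1))) := by ring
      _ ≤ r / 2 := by linarith
  have hball : ∀ σ ∈ Icc (0 : ℝ) 1, x + σ • P ∈ Metric.ball x₀ r := by
    intro σ hσ
    rw [Metric.mem_ball, dist_eq_norm] at hx ⊢
    calc ‖x + σ • P - x₀‖ = ‖(x - x₀) + σ • P‖ := by congr 1; abel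
      _ ≤ ‖x - x₀‖ + ‖σ • P‖ := norm_add_le _ _
      _ ≤ ‖x - x₀‖ + ‖P‖ := by
          rw [norm_smul, Real.norm_of_nonneg hσ.1]
          nlinarith [norm_nonneg P, hσ.2]
      _ < r := by linarith
  have hmono : ∀ y ∈ Metric.ball x₀ r, 0 ≤ polyFun (polyD P q) y := by
    intro y hy
    have i1 := hb₁ y (Metric.ball_subset_ball hr1 hy)
    have i2 := hb₂ y (Metric.ball_subset_ball hr2 hy)
    rw [polyFun_polyD] at i1 i2 ⊢
    have hPP : P = (ε * s) • (e + δ • e') + (ε * t) • (e + (2 * δ) • e') := by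
      rw [hP, hA, hB]; module
    rw [hPP, inner_add_right, inner_smul_right _ _ (ε * s), inner_smul_right _ _ (ε * t)]
    have j1 := mul_nonneg (mul_nonneg hε0.le hs.1) ((half_pos h1).trans i1).le
    have j2 := mul_nonneg (mul_nonneg hε0.le ht.1) ((half_pos h2).trans i2).le
    exact add_nonneg j1 j2
  have hqx := CurvedTriangles.conic_pos_of_mem hΔ hAF hT hxT hxΩ
  have hqpos : ∀ σ ∈ Icc (0 : ℝ) 1, 0 < polyFun q (x + σ • P) := by
    intro σ hσ
    rcases hσ.1.lt_or_eq with h | h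
    · obtain ⟨ρ, hρ, heq⟩ := polyFun_mvt q x P h
      have := mul_nonneg h.le (hmono _ (hball ρ ⟨hρ.1.le, hρ.2.le.trans hσ.2⟩))
      rw [← heq] at this; linarith
    · rw [← h, zero_smul, add_zero]; exact hqx
  -- The shift does not lower q, so q > 0 at its end, while q is zero at the points of `T` on ∂Ω
  -- near the vertex.
  by_cases hxP : x + P ∈ Δ.cell T
  · refine hΔ.mem_of_notMem_frontier hxP fun hcon => ?_
    have hq1 := hqpos 1 (by simp)
    have hb1 := hball 1 (by simp)
    rw [one_smul] at hq1 hb1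
    have hzero : polyFun q (x + P) = 0 := by
      rcases hΔ.mem_frontier_cases hxP hcon with ⟨k, hk⟩ | ⟨-, hk⟩
      · rw [hk, hb₅ k (by rw [← hk]; exact Metric.ball_subset_ball hr5 hb1)]
        exact hΔ.conic_vert hT hi
      · exact hΔ.conic_closedArc (hΔ.curvedEdge_subset_closedArc hT hk)
    exact hq1.ne' hzero
  · -- the last point of the segment in the triangle
    have hcomp : IsCompact {σ : ℝ | σ ∈ Icc (0 : ℝ) 1 ∧ x + σ • P ∈ Δ.cell T} := by
      have : IsClosed {σ : ℝ | x + σ • P ∈ Δ.cell T} :=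
        (hΔ.isClosed_cell T).preimage (by fun_prop : Continuous fun σ : ℝ => x + σ • P)
      exact isCompact_Icc.inter_right this
    obtain ⟨σ, ⟨hσ, hσT⟩, hmax⟩ := hcomp.exists_isGreatest
      ⟨0, ⟨by simp, by rw [zero_smul, add_zero]; exact hxT⟩⟩
    have hσ1 : σ < 1 := by
      refine lt_of_le_of_ne hσ.2 ?_
      rintro rfl
      rw [one_smul] at hσT; exact hxP hσT
    have hσf : x + σ • P ∈ frontier (Δ.cell T) := by
      refine ⟨subset_closure hσT, fun hint => ?_⟩
      have hc : Tendsto (fun σ' : ℝ => x + σ' • P) (𝓝[>] σ) (𝓝 (x + σ • P)) :=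
        ((by fun_prop : Continuous fun σ' : ℝ => x + σ' • P).tendsto σ).mono_left
          nhdsWithin_le_nhds
      obtain ⟨σ', h1, h2⟩ := ((hc.eventually (mem_interior_iff_mem_nhds.1 hint)).and
        (Ioo_mem_nhdsGT hσ1)).exists
      exact h2.1.not_ge (hmax ⟨⟨hσ.1.trans h2.1.le, h2.2.le⟩, h1⟩)
    have hzb := hball σ hσ
    rcases hfr _ (Metric.ball_subset_ball hr3 hzb) hσf with ⟨τ, hτ, hz⟩ | hz
    -- The curve cannot be crossed since q > 0 there; after crossing the straight edge, the rest of
    -- the shift stays in the cone of the neighbour.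
    · have hzT' : x + σ • P ∈ Δ.cell T' := by
        refine hΔ.segment_subset_cell hab' ?_
        rw [← ha, ← hb, hz, segment_eq_image']
        exact ⟨τ, hτ, rfl⟩
      have h1σ : 0 < 1 - σ := by linarith
      have := hΔ.cone_subset_interior hT' hab hac hbc hzT' (mul_pos h1σ hA0) (mul_pos h1σ hB0) (by
        have h4 := hb₄ (x + σ • P) (by rw [← ha]; exact Metric.ball_subset_ball hr4 hzb)
        nlinarith [hσ.1, mul_nonneg hσ.1 (add_pos hA0 hB0).le])
      refine hΔ.interior_cell_subset T' ?_
      convert this using 1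
      rw [← ha, ← hb, hP]
      module
    · exact ((hqpos σ hσ).ne' (hΔ.conic_closedArc (hΔ.curvedEdge_subset_closedArc hT hz))).elim

lemma exists_parallelogram_vert [Finite ι] {T : ι} {i : Fin 3}
    (hfr : Δ.vert T i ∈ frontier (D.Ω : Set Plane)) :
    ∃ p₁ p₂, cross p₁ p₂ ≠ 0 ∧ ∀ᶠ x in 𝓝 (Δ.vert T i), x ∈ Δ.cell T → x ∈ D.Ω →
      x ∈ parallelogramSet (D.Ω : Set Plane) p₁ p₂ := by
  by_cases hT : T ∈ Δ.pie
  · refine hΔ.exists_parallelogram_pie hAF hT ?_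
    rintro rfl
    exact hΔ.notMem_of_mem_frontier hfr (CurvedTriangles.vert_zero_mem hΔ hAF hT)
  · exact hΔ.exists_parallelogram_straight hT i

end IsTriangulation
end CurvedTriangles

namespace ConicDomain
variable {n : ℕ} [NeZero n] (D : ConicDomain n)

/-- Near a point of an open arc there is a parallelogram such that all its translates with corner in
`Ω` are contained in `Ω`. -/
lemma exists_parallelogram_arc (j : Fin n) {t₀ : ℝ} (ht₀ : t₀ ∈ Ioo (0 : ℝ) 1) :
    ∃ p₁ p₂, cross p₁ p₂ ≠ 0 ∧ ∀ᶠ x in 𝓝 (D.curve j t₀), x ∈ D.Ω →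
      x ∈ parallelogramSet (D.Ω : Set Plane) p₁ p₂ := by
  have hn := D.arc_gradV_ne j (Ioo_subset_Icc_self ht₀)
  obtain ⟨r₀, hr₀, hfr, hpos⟩ := D.exists_sign_near_arc j ht₀
  set x₀ := D.curve j t₀
  set nv := gradV (D.q j) x₀
  -- Adding a tangential component does not change the product with the gradient, so independent
  -- directions of increase are available.
  have hin : ∀ c : ℝ, 0 < inner ℝ nv (nv + c • rot nv) := fun c => by
    rw [inner_add_right, inner_smul_right, show inner ℝ nv (rot nv) = 0 by
      rw [inner_plane]; simp; ring, mul_zero, add_zero]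
    exact real_inner_self_pos.2 hn
  obtain ⟨r₁, hr₁, hb₁⟩ := Metric.eventually_nhds_iff_ball.1 (tendsto_polyD_pos (hin 0))
  obtain ⟨r₂, hr₂, hb₂⟩ := Metric.eventually_nhds_iff_ball.1 (tendsto_polyD_pos (hin 1))
  set p₁ := nv + (0 : ℝ) • rot nv with hp₁
  set p₂ := nv + (1 : ℝ) • rot nv with hp₂
  set r := min r₀ (min r₁ r₂) with hr
  have hr0 : 0 < r := by positivity
  set ε := r / (4 * (‖p₁‖ + ‖p₂‖ + 1)) with hε
  have hε0 : 0 < ε := by positivity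
  have hεr : ε * (‖p₁‖ + ‖p₂‖ + 1) = r / 4 := by rw [hε]; field_simp
  refine ⟨ε • p₁, ε • p₂, ?_, ?_⟩
  · have : cross (ε • p₁) (ε • p₂) = ε ^ 2 * cross nv (rot nv) := by
      rw [hp₁, hp₂]; simp [cross]; ring
    rw [this]; exact mul_ne_zero (pow_pos hε0 2).ne' (cross_rot_ne hn)
  filter_upwards [Metric.ball_mem_nhds x₀ (half_pos hr0)] with x hx hxΩ s hs t ht
  by_cases h0 : s = 0 ∧ t = 0
  · rw [h0.1, h0.2, zero_smul, zero_smul, add_zero, add_zero]; exact hxΩ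
  set P := (ε * s) • p₁ + (ε * t) • p₂ with hP
  have hPeq : x + s • ε • p₁ + t • ε • p₂ = x + (1 : ℝ) • P := by rw [hP]; module
  rw [hPeq]
  have hεs := mul_nonneg hε0.le hs.1
  have hεt := mul_nonneg hε0.le ht.1
  have hPn : ‖P‖ ≤ r / 4 := by
    calc ‖P‖ ≤ ε * s * ‖p₁‖ + ε * t * ‖p₂‖ := by
          refine (norm_add_le _ _).trans_eq ?_
          rw [norm_smul, norm_smul, Real.norm_of_nonneg hεs, Real.norm_of_nonneg hεt]
      _ ≤ ε * 1 * ‖p₁‖ + ε * 1 * ‖p₂‖ := by gcongr; exacts [hs.2, ht.2]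
      _ ≤ r / 4 := by rw [← hεr]; nlinarith
  refine mem_of_polyD_pos D.Ω.isOpen (q := D.q j) (B := Metric.ball x₀ r) zero_le_one ?_ ?_ ?_ hxΩ
    (hpos x hxΩ (Metric.ball_subset_ball (by linarith [min_le_left r₀ (min r₁ r₂)]) hx)).le
  · intro ρ hρ
    rw [Metric.mem_ball, dist_eq_norm] at hx ⊢
    calc ‖x + ρ • P - x₀‖ = ‖(x - x₀) + ρ • P‖ := by congr 1; abel
      _ ≤ ‖x - x₀‖ + ‖ρ • P‖ := norm_add_le _ _
      _ ≤ ‖x - x₀‖ + ‖P‖ := by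
          rw [norm_smul, Real.norm_of_nonneg hρ.1]
          nlinarith [norm_nonneg P, hρ.2]
      _ < r := by linarith
  · intro y hy hyB
    obtain ⟨t', ht', rfl⟩ := hfr y hy (Metric.ball_subset_ball (min_le_left _ _) hyB)
    exact (D.q_zero j t' ht').le
  · intro y hy
    have i1 := (half_pos (hin 0)).trans (hb₁ y (Metric.ball_subset_ball
      ((min_le_right _ _).trans (min_le_left _ _)) hy))
    have i2 := (half_pos (hin 1)).trans (hb₂ y (Metric.ball_subset_ball
      ((min_le_right _ _).trans (min_le_right _ _)) hy))
    rw [polyFun_polyD] at i1 i2 ⊢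
    rw [hP, inner_add_right, inner_smul_right _ _ (ε * s), inner_smul_right _ _ (ε * t)]
    rcases hs.1.lt_or_eq with h | h
    · exact add_pos_of_pos_of_nonneg (mul_pos (mul_pos hε0 h) i1) (mul_nonneg hεt i2.le)
    · rcases ht.1.lt_or_eq with h' | h'
      · exact add_pos_of_nonneg_of_pos (mul_nonneg hεs i1.le) (mul_pos (mul_pos hε0 h') i2)
      · exact (h0 ⟨h.symm, h'.symm⟩).elim

end ConicDomain
end ConicSpline

namespace ConicSpline

/-! ### Continuity up to the boundary -/

/-- The parametrization of a circle. -/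
noncomputable def circ (x : Plane) (ρ θ : ℝ) : Plane :=
  x + ((ρ * Real.cos θ) • unitVec 0 + (ρ * Real.sin θ) • unitVec 1)

lemma continuous_circ (x : Plane) (ρ : ℝ) : Continuous (circ x ρ) := by
  unfold circ; fun_prop

lemma dist_eq_sqrt_coords (y x : Plane) :
    dist y x = Real.sqrt ((y 0 - x 0) ^ 2 + (y 1 - x 1) ^ 2) := by
  rw [EuclideanSpace.dist_eq]; simp [Real.dist_eq, sq_abs]

lemma dist_circ (x : Plane) {ρ : ℝ} (hρ : 0 ≤ ρ) (θ : ℝ) : dist (circ x ρ θ) x = ρ := by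
  rw [dist_eq_sqrt_coords]
  simp only [circ, PiLp.add_apply, PiLp.smul_apply, unitVec_zero_zero, unitVec_zero_one,
    unitVec_one_zero, unitVec_one_one, smul_eq_mul, mul_one, mul_zero, add_zero, zero_add,
    add_sub_cancel_left]
  rw [show (ρ * Real.cos θ) ^ 2 + (ρ * Real.sin θ) ^ 2 =
    ρ ^ 2 * (Real.sin θ ^ 2 + Real.cos θ ^ 2) by ring, Real.sin_sq_add_cos_sq, mul_one,
    Real.sqrt_sq hρ]

lemma exists_circ {x y : Plane} {ρ : ℝ} (h : dist y x = ρ) : ∃ θ, circ x ρ θ = y := by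
  set z : ℂ := ⟨y 0 - x 0, y 1 - x 1⟩ with hz
  have hn : ‖z‖ = ρ := by
    rw [← h, dist_eq_sqrt_coords, Complex.norm_eq_sqrt_sq_add_sq]
  refine ⟨z.arg, ?_⟩
  have h1 := Complex.norm_mul_cos_arg z
  have h2 := Complex.norm_mul_sin_arg z
  rw [hn] at h1 h2
  rw [circ, h1, h2]
  apply plane_ext <;> simp [hz]

lemma circ_injOn (x : Plane) {ρ : ℝ} (hρ : ρ ≠ 0) {θ θ' : ℝ} (h : circ x ρ θ = circ x ρ θ')
    (h1 : -(2 * Real.pi) < θ - θ') (h2 : θ - θ' < 2 * Real.pi) : θ = θ' := by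
  have e := add_left_cancel h
  have e0 := congrFun (congrArg (fun v : Plane => v.ofLp) e) 0
  have e1 := congrFun (congrArg (fun v : Plane => v.ofLp) e) 1
  simp at e0 e1
  have c := e0.resolve_right hρ
  have s := e1.resolve_right hρ
  have : Real.cos (θ - θ') = 1 := by
    rw [Real.cos_sub, c, s]; nlinarith [Real.sin_sq_add_cos_sq θ']
  linarith [(Real.cos_eq_one_iff_of_lt_of_lt h1 h2).1 this]

lemma exists_frontier_Ioo {Ω : Set Plane} (hΩ : IsOpen Ω) {γ : ℝ → Plane} (hγ : Continuous γ)
    {α β : ℝ} (hαβ : α ≤ β)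
    (h : (γ α ∈ Ω ∧ γ β ∉ closure Ω) ∨ (γ α ∉ closure Ω ∧ γ β ∈ Ω)) :
    ∃ θ ∈ Ioo α β, γ θ ∈ frontier Ω := by
  have hp : IsPreconnected (γ '' Icc α β) := isPreconnected_Icc.image _ hγ.continuousOn
  have hα : γ α ∈ γ '' Icc α β := mem_image_of_mem _ (left_mem_Icc.2 hαβ)
  have hβ : γ β ∈ γ '' Icc α β := mem_image_of_mem _ (right_mem_Icc.2 hαβ)
  have hne : ∀ z, z ∈ Ω → z ∉ frontier Ω := fun z hz hf => by
    rw [hΩ.frontier_eq] at hf; exact hf.2 hz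
  have hne' : ∀ z, z ∉ closure Ω → z ∉ frontier Ω := fun z hz hf => hz (frontier_subset_closure hf)
  obtain ⟨_, ⟨θ, hθ, rfl⟩, hf⟩ : (γ '' Icc α β ∩ frontier Ω).Nonempty := by
    by_contra hcon
    have hno : ∀ y ∈ γ '' Icc α β, y ∉ frontier (closure Ω) := fun y hy hf =>
      hcon ⟨y, hy, frontier_closure_subset hf⟩
    rcases h with ⟨h1, h2⟩ | ⟨h1, h2⟩ <;>
      rcases IsPreconnected.subset_interior_or hp isClosed_closure hno with hs | hs
    · exact h2 (interior_subset (hs hβ))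
    · exact hs hα (subset_closure h1)
    · exact h1 (interior_subset (hs hα))
    · exact hs hβ (subset_closure h2)
  refine ⟨θ, ⟨hθ.1.lt_of_ne ?_, hθ.2.lt_of_ne ?_⟩, hf⟩
  · rintro rfl
    rcases h with ⟨h1, -⟩ | ⟨h1, -⟩
    · exact hne _ h1 hf
    · exact hne' _ h1 hf
  · rintro rfl
    rcases h with ⟨-, h1⟩ | ⟨-, h1⟩
    · exact hne' _ h1 hf
    · exact hne _ h1 hf

/-- A curve that stays in the closure of Ω would be covered by two closed sets, which are disjoint
on it and both met by it, contrary to connectedness. -/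
lemma exists_gap {Ω A B : Set Plane} (hA : IsClosed A) (hB : IsClosed B) {γ : ℝ → Plane}
    (hγ : Continuous γ) {α β : ℝ} (hαβ : α ≤ β)
    (hcov : ∀ θ, γ θ ∈ closure Ω → γ θ ∈ A ∨ γ θ ∈ B) (hdisj : ∀ θ, γ θ ∈ A → γ θ ∉ B)
    (h : (γ α ∈ A ∧ γ β ∈ B) ∨ (γ α ∈ B ∧ γ β ∈ A)) : ∃ θ ∈ Icc α β, γ θ ∉ closure Ω := by
  by_contra! hcon
  have hp : IsPreconnected (γ '' Icc α β) := isPreconnected_Icc.image _ hγ.continuousOn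
  have hα : γ α ∈ γ '' Icc α β := mem_image_of_mem _ (left_mem_Icc.2 hαβ)
  have hβ : γ β ∈ γ '' Icc α β := mem_image_of_mem _ (right_mem_Icc.2 hαβ)
  have hsub : γ '' Icc α β ⊆ A ∪ B := by
    rintro _ ⟨θ, hθ, rfl⟩; exact hcov θ (hcon θ hθ)
  obtain ⟨_, ⟨θ, -, rfl⟩, h1, h2⟩ : (γ '' Icc α β ∩ (A ∩ B)).Nonempty := by
    rcases h with ⟨h1, h2⟩ | ⟨h1, h2⟩
    · exact isPreconnected_closed_iff.1 hp A B hA hB hsub ⟨_, hα, h1⟩ ⟨_, hβ, h2⟩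
    · exact isPreconnected_closed_iff.1 hp A B hA hB hsub ⟨_, hβ, h2⟩ ⟨_, hα, h1⟩
  exact hdisj θ h1 h2

namespace ConicDomain
variable {n : ℕ} [NeZero n] (D : ConicDomain n)

/-- Near a joint of two arcs, small circles about the joint meet the domain in an arc. -/
lemma exists_not_separated (k : Fin n) : ∃ r > 0, ∀ ρ, 0 < ρ → ρ < r → ∀ A B : Set Plane,
    IsClosed A → IsClosed B →
    (∀ y, dist y (D.curve k 0) = ρ → y ∈ closure (D.Ω : Set Plane) → y ∈ A ∨ y ∈ B) →
    (∀ y, dist y (D.curve k 0) = ρ → y ∈ A → y ∉ B) →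
    (∃ y, dist y (D.curve k 0) = ρ ∧ y ∈ D.Ω ∧ y ∈ A) →
    ¬ ∃ y, dist y (D.curve k 0) = ρ ∧ y ∈ D.Ω ∧ y ∈ B := by
  obtain ⟨r, hr, htwo⟩ := D.exists_two_frontier_points k
  refine ⟨r, hr, fun ρ hρ hρr A B hA hB hcov hdisj => ?_⟩
  set x₀ := D.curve k 0
  rintro ⟨a, ha, haΩ, haA⟩ ⟨b, hb, hbΩ, hbB⟩
  obtain ⟨θa, rfl⟩ := exists_circ ha
  have hb' : ∃ θb, circ x₀ ρ θb = b ∧ θa < θb ∧ θb < θa + 2 * Real.pi := by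
    obtain ⟨θ, hθ⟩ := exists_circ hb
    have hper : ∀ m : ℤ, circ x₀ ρ (θ - m * (2 * Real.pi)) = b := fun m => by
      rw [← hθ, circ, circ, Real.cos_sub_int_mul_two_pi, Real.sin_sub_int_mul_two_pi]
    set m := ⌊(θ - θa) / (2 * Real.pi)⌋ with hm
    have hpi := Real.two_pi_pos
    have h1 : (m : ℝ) * (2 * Real.pi) ≤ θ - θa := (le_div_iff₀ hpi).1 (Int.floor_le _)
    have h2 : θ - θa < (m + 1) * (2 * Real.pi) := (div_lt_iff₀ hpi).1 (Int.lt_floor_add_one _)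
    refine ⟨_, hper m, lt_of_le_of_ne (by linarith) fun h => ?_, by linarith⟩
    rw [← hper m, ← h] at hbB
    exact hdisj _ ha haA hbB
  obtain ⟨θb, rfl, hab, hab'⟩ := hb'
  have hγ := continuous_circ x₀ ρ
  have hd : ∀ θ, dist (circ x₀ ρ θ) x₀ = ρ := dist_circ x₀ hρ.le
  have hper : circ x₀ ρ (θa + 2 * Real.pi) = circ x₀ ρ θa := by
    rw [circ, circ, Real.cos_add_two_pi, Real.sin_add_two_pi]
  -- Each of the two circular arcs between `a` and `b` has a point outside the closure of Ω. Going
  -- from Ω to a gap, back to Ω and into the other gap crosses ∂Ω at three different points.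
  obtain ⟨g₁, hg₁, hn₁⟩ := exists_gap hA hB hγ hab.le (fun θ => hcov _ (hd θ))
    (fun θ => hdisj _ (hd θ)) (Or.inl ⟨haA, hbB⟩)
  obtain ⟨g₂, hg₂, hn₂⟩ := exists_gap hA hB hγ hab'.le (fun θ => hcov _ (hd θ))
    (fun θ => hdisj _ (hd θ)) (Or.inr ⟨hbB, hper ▸ haA⟩)
  obtain ⟨t₁, ht₁, hf₁⟩ := exists_frontier_Ioo D.Ω.isOpen hγ hg₁.1 (Or.inl ⟨haΩ, hn₁⟩)
  obtain ⟨t₂, ht₂, hf₂⟩ := exists_frontier_Ioo D.Ω.isOpen hγ hg₁.2 (Or.inr ⟨hn₁, hbΩ⟩)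
  obtain ⟨t₃, ht₃, hf₃⟩ := exists_frontier_Ioo D.Ω.isOpen hγ hg₂.1 (Or.inl ⟨hbΩ, hn₂⟩)
  have hpi := Real.two_pi_pos
  have hg := hg₂.2
  rcases htwo _ _ _ hf₁ hf₂ hf₃ (by rw [Metric.mem_ball, hd]; exact hρr) (by rw [hd, hd])
    (by rw [hd, hd]) with h | h | h
  · have := circ_injOn x₀ hρ.ne' h (by linarith [ht₁.1, ht₁.2, ht₂.1, ht₂.2])
      (by linarith [ht₁.1, ht₁.2, ht₂.1, ht₂.2])
    linarith [ht₁.2, ht₂.1]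
  · have := circ_injOn x₀ hρ.ne' h (by linarith [ht₁.1, ht₁.2, ht₃.1, ht₃.2])
      (by linarith [ht₁.1, ht₁.2, ht₃.1, ht₃.2, hg₁.2])
    linarith [ht₁.2, ht₃.1, hg₁.2]
  · have := circ_injOn x₀ hρ.ne' h (by linarith [ht₂.1, ht₂.2, ht₃.1, ht₃.2, hg₁.1])
      (by linarith [ht₂.1, ht₂.2, ht₃.1, ht₃.2])
    linarith [ht₂.2, ht₃.1]

end ConicDomain

/-- The function `f` has a continuous extension from each of the sets of the points `x` such that
the parallelogram with the corner `x` and given sides is contained in `Ω`. -/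
def ExtendsAlongParallelograms (Ω : Set Plane) (f : Plane → ℝ) : Prop :=
  ∀ p₁ p₂, cross p₁ p₂ ≠ 0 → ∃ G : Plane → ℝ, Continuous G ∧ EqOn f G (parallelogramSet Ω p₁ p₂)

lemma tendsto_of_eventually_eqOn {Ω S : Set Plane} {f : Plane → ℝ} (p₁ p₂ : Plane)
    (hf : ExtendsAlongParallelograms Ω f) (hp : cross p₁ p₂ ≠ 0) {x₀ : Plane}
    (h : ∀ᶠ x in 𝓝 x₀, x ∈ S → x ∈ parallelogramSet Ω p₁ p₂) :
    ∃ c, Tendsto f (𝓝[S] x₀) (𝓝 c) := by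
  obtain ⟨G, hG, he⟩ := hf p₁ p₂ hp
  refine ⟨G x₀, (hG.continuousAt.mono_left nhdsWithin_le_nhds).congr' ?_⟩
  filter_upwards [h.filter_mono nhdsWithin_le_nhds, self_mem_nhdsWithin] with x hx hxS
  exact (he (hx hxS)).symm

/-! ### Limits at the joints and continuous extension -/

namespace CurvedTriangles.IsTriangulation
variable {n : ℕ} [NeZero n] {D : ConicDomain n} {ι : Type} {Δ : CurvedTriangles D ι}
variable (hΔ : Δ.IsTriangulation) (hAF : Δ.IsAdmissible)
include hΔ

lemma isClosed_iUnion_cell [Finite ι] (p : ι → Prop) : IsClosed (⋃ T, ⋃ (_ : p T), Δ.cell T) :=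
  isClosed_iUnion_of_finite fun T => isClosed_iUnion_of_finite fun _ => hΔ.isClosed_cell T

lemma exists_mem_sphere [Finite ι] {T : ι} (i : Fin 3) : ∃ δ > 0, ∀ ρ, 0 < ρ → ρ < δ →
    ∃ y, dist y (Δ.vert T i) = ρ ∧ y ∈ D.Ω ∧ y ∈ Δ.cell T := by
  obtain ⟨k, hk⟩ := exists_isStraight (Δ := Δ) T i
  have hne : Δ.vert T k - Δ.vert T i ≠ 0 := hΔ.edge_ne hk.1
  have hpos := norm_pos_iff.2 hne
  refine ⟨_, hpos, fun ρ h0 h1 => ?_⟩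
  have hm : Δ.vert T i + (ρ / ‖Δ.vert T k - Δ.vert T i‖) • (Δ.vert T k - Δ.vert T i) ∈
      openSegment ℝ (Δ.vert T i) (Δ.vert T k) := by
    rw [openSegment_eq_image']
    exact ⟨_, ⟨by positivity, (div_lt_one hpos).2 h1⟩, rfl⟩
  refine ⟨_, ?_, hΔ.openSegment_subset hk hm,
    hΔ.segment_subset_cell hk (openSegment_subset_segment _ _ _ hm)⟩
  rw [dist_eq_norm, add_sub_cancel_left, norm_smul, Real.norm_of_nonneg (by positivity),
    div_mul_cancel₀ _ hpos.ne']

include hAF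

/-- Each triangle at the joint provides a limit. Grouping the triangles by whether their limit is
that of `T₀` gives two closed sets that meet only at the joint; both groups would have points in Ω
on every small circle, and this is excluded. -/
lemma exists_tendsto_joint [Finite ι] {f : Plane → ℝ}
    (hf : ExtendsAlongParallelograms (D.Ω : Set Plane) f) (k : Fin n) :
    ∃ c, Tendsto f (𝓝[(D.Ω : Set Plane)] (D.curve k 0)) (𝓝 c) := by
  obtain ⟨r, hr, hsep⟩ := D.exists_not_separated k
  have hxfr : D.curve k 0 ∈ frontier (D.Ω : Set Plane) := D.curve_mem_frontier k (by simp)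
  obtain ⟨T₀, i₀, hT₀⟩ := hAF.condA k
  set x₀ := D.curve k 0
  have hvert : ∀ T, x₀ ∈ Δ.cell T → ∃ i, Δ.vert T i = x₀ := fun T hT => by
    rw [← hT₀] at hT ⊢; exact hΔ.vert_of_mem_cell hT
  have hlim : ∀ T, ∃ c, x₀ ∈ Δ.cell T → Tendsto f (𝓝[Δ.cell T ∩ D.Ω] x₀) (𝓝 c) := by
    intro T
    by_cases hT : x₀ ∈ Δ.cell T
    · obtain ⟨i, hi⟩ := hvert T hT
      obtain ⟨p₁, p₂, hp, he⟩ := hΔ.exists_parallelogram_vert hAF (T := T) (i := i) (hi ▸ hxfr)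
      rw [hi] at he
      obtain ⟨c, hc⟩ := tendsto_of_eventually_eqOn p₁ p₂ hf hp (S := Δ.cell T ∩ D.Ω)
        (he.mono fun x hx h => hx h.1 h.2)
      exact ⟨c, fun _ => hc⟩
    · exact ⟨0, fun h => (hT h).elim⟩
  choose c hc using hlim
  -- Along a common edge, whose inner points are in Ω, both limits are approached.
  have hshare : ∀ T T', x₀ ∈ Δ.cell T → x₀ ∈ Δ.cell T' → c T ≠ c T' →
      Δ.cell T ∩ Δ.cell T' = {x₀} := by
    intro T T' hT hT' hne
    have hTT : T ≠ T' := fun h => hne (by rw [h])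
    rcases hΔ.meet hTT hT hT' with ⟨-, -, -, -, h⟩ | ⟨i, j, a, b, hs, -, -, -, hcap, hx⟩
    · exact h
    exfalso
    have hcl : x₀ ∈ closure (openSegment ℝ (Δ.vert T i) (Δ.vert T j)) := by
      rw [closure_openSegment]; exact hx
    have hsub : openSegment ℝ (Δ.vert T i) (Δ.vert T j) ⊆ Δ.cell T ∩ Δ.cell T' := by
      rw [hcap]; exact openSegment_subset_segment _ _ _
    have hΩ := hΔ.openSegment_subset hs
    have : (𝓝[openSegment ℝ (Δ.vert T i) (Δ.vert T j)] x₀).NeBot :=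
      mem_closure_iff_nhdsWithin_neBot.1 hcl
    exact hne (tendsto_nhds_unique
      ((hc T hT).mono_left (nhdsWithin_mono _ fun y hy => ⟨(hsub hy).1, hΩ hy⟩))
      ((hc T' hT').mono_left (nhdsWithin_mono _ fun y hy => ⟨(hsub hy).2, hΩ hy⟩)))
  have hT₀x : x₀ ∈ Δ.cell T₀ := hT₀ ▸ hΔ.vert_mem_cell T₀ i₀
  have hall : ∀ T, x₀ ∈ Δ.cell T → c T = c T₀ := by
    intro T hT
    by_contra hne
    obtain ⟨i, hi⟩ := hvert T hT
    obtain ⟨r₁, hr₁, hb₁⟩ := hΔ.exists_ball_cells x₀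
    obtain ⟨δ₁, hδ₁, h₁⟩ := hΔ.exists_mem_sphere (T := T₀) i₀
    obtain ⟨δ₂, hδ₂, h₂⟩ := hΔ.exists_mem_sphere (T := T) i
    rw [hT₀] at h₁
    rw [hi] at h₂
    obtain ⟨ρ, hρ, hρr, hρ1, hρ2, hρ3⟩ : ∃ ρ > 0, ρ < r ∧ ρ < r₁ ∧ ρ < δ₁ ∧ ρ < δ₂ := by
      refine ⟨min r (min r₁ (min δ₁ δ₂)) / 2, by positivity, ?_, ?_, ?_, ?_⟩ <;>
        refine (half_lt_self (by positivity)).trans_le ?_ <;> simp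
    refine hsep ρ hρ hρr (⋃ S, ⋃ (_ : x₀ ∈ Δ.cell S ∧ c S = c T₀), Δ.cell S)
      (⋃ S, ⋃ (_ : x₀ ∈ Δ.cell S ∧ c S ≠ c T₀), Δ.cell S) (hΔ.isClosed_iUnion_cell _)
      (hΔ.isClosed_iUnion_cell _) ?_ ?_ ?_ ?_
    · intro y hy hyc
      obtain ⟨S, hS⟩ := hΔ.exists_cell hyc
      have hx := hb₁ S y (by rw [Metric.mem_ball, hy]; exact hρ1) hS
      by_cases h : c S = c T₀
      · exact Or.inl (mem_iUnion₂.2 ⟨S, ⟨hx, h⟩, hS⟩)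
      · exact Or.inr (mem_iUnion₂.2 ⟨S, ⟨hx, h⟩, hS⟩)
    · intro y hy hyA hyB
      obtain ⟨S, ⟨hS, hSc⟩, hyS⟩ := mem_iUnion₂.1 hyA
      obtain ⟨S', ⟨hS', hSc'⟩, hyS'⟩ := mem_iUnion₂.1 hyB
      have := hshare S S' hS hS' (by rw [hSc]; exact Ne.symm hSc')
      have hyx : y ∈ ({x₀} : Set Plane) := this ▸ ⟨hyS, hyS'⟩
      rw [mem_singleton_iff.1 hyx, dist_self] at hy
      exact hρ.ne hy
    · obtain ⟨y, hy, hyΩ, hyT⟩ := h₁ ρ hρ hρ2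
      exact ⟨y, hy, hyΩ, mem_iUnion₂.2 ⟨T₀, ⟨hT₀x, rfl⟩, hyT⟩⟩
    · obtain ⟨y, hy, hyΩ, hyT⟩ := h₂ ρ hρ hρ3
      exact ⟨y, hy, hyΩ, mem_iUnion₂.2 ⟨T, ⟨hT, hne⟩, hyT⟩⟩
  refine ⟨c T₀, ?_⟩
  have hΩ : (D.Ω : Set Plane) = ⋃ T, Δ.cell T ∩ D.Ω := by
    rw [← iUnion_inter, hΔ.cover]
    exact (inter_eq_right.2 subset_closure).symm
  rw [hΩ, nhdsWithin_iUnion, tendsto_iSup]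
  intro T
  by_cases hT : x₀ ∈ Δ.cell T
  · rw [← hall T hT]; exact hc T hT
  · have : 𝓝[Δ.cell T ∩ D.Ω] x₀ = ⊥ := by
      refine notMem_closure_iff_nhdsWithin_eq_bot.1 fun h => hT ?_
      exact (hΔ.isClosed_cell T).closure_subset (closure_mono inter_subset_left h)
    rw [this]; exact tendsto_bot

/-- Interior points and open arcs have one parallelogram that works for all of Ω nearby; only joints
require the comparison of triangles. -/
lemma exists_tendsto [Finite ι] {f : Plane → ℝ}
    (hf : ExtendsAlongParallelograms (D.Ω : Set Plane) f) {x₀ : Plane}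
    (hx₀ : x₀ ∈ closure (D.Ω : Set Plane)) :
    ∃ c, Tendsto f (𝓝[(D.Ω : Set Plane)] x₀) (𝓝 c) := by
  by_cases hx : x₀ ∈ D.Ω
  · obtain ⟨p₁, p₂, hp, hxp⟩ := exists_mem_parallelogramSet D.Ω.isOpen hx
    exact tendsto_of_eventually_eqOn p₁ p₂ hf hp
      (((isOpen_parallelogramSet D.Ω.isOpen p₁ p₂).eventually_mem hxp).mono fun _ h _ => h)
  have hfr : x₀ ∈ frontier (D.Ω : Set Plane) := by
    rw [D.Ω.isOpen.frontier_eq]; exact ⟨hx₀, hx⟩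
  rw [D.frontier_eq] at hfr
  obtain ⟨j, t, ht, rfl⟩ := mem_iUnion.1 hfr
  rcases ht.1.lt_or_eq with h0 | h0
  · rcases ht.2.lt_or_eq with h1 | h1
    · obtain ⟨p₁, p₂, hp, he⟩ := D.exists_parallelogram_arc j ⟨h0, h1⟩
      exact tendsto_of_eventually_eqOn p₁ p₂ hf hp he
    · rw [h1, D.curve_joint]; exact hΔ.exists_tendsto_joint hAF hf (j + 1)
  · rw [← h0]; exact hΔ.exists_tendsto_joint hAF hf j

/-- Functions that extend continuously along parallelograms extend continuously to the closure. -/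
lemma exists_continuousOn [Finite ι] {f : Plane → ℝ}
    (hf : ExtendsAlongParallelograms (D.Ω : Set Plane) f) :
    ∃ g, ContinuousOn g (closure (D.Ω : Set Plane)) ∧ EqOn g f D.Ω := by
  have hlim := fun x (hx : x ∈ closure (D.Ω : Set Plane)) => hΔ.exists_tendsto hAF hf hx
  refine ⟨extendFrom D.Ω f, continuousOn_extendFrom subset_rfl hlim, fun x hx => ?_⟩
  refine extendFrom_eq (subset_closure hx) ?_
  obtain ⟨p₁, p₂, hp, hxp⟩ := exists_mem_parallelogramSet D.Ω.isOpen hx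
  obtain ⟨G, hG, he⟩ := hf p₁ p₂ hp
  have hev := (isOpen_parallelogramSet D.Ω.isOpen p₁ p₂).eventually_mem hxp
  exact (hG.continuousAt.congr (hev.mono fun y hy => (he hy).symm)).mono_left nhdsWithin_le_nhds

end CurvedTriangles.IsTriangulation
end ConicSpline

/-! ### The representative in C³ and its zero boundary values -/

namespace ConicSpline

lemma IsDerivFamily.congr {N : ℕ} {S : Set Plane} (hS : IsOpen S) {h g : ℕ → ℕ → Plane → ℝ}
    (H : IsDerivFamily N S h) (he : ∀ a b, a + b ≤ N + 1 → EqOn (g a b) (h a b) S) :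
    IsDerivFamily N S g := by
  intro a b hab x hx
  have h1 := (H a b hab x hx).congr_of_eventuallyEq
    ((he a b (by omega)).eventuallyEq_of_mem (hS.mem_nhds hx))
  rwa [← he (a + 1) b (by omega) hx, ← he a (b + 1) (by omega) hx] at h1

lemma IsDerivFamily.dirDeriv_eqOn {N : ℕ} {S : Set Plane} (hS : IsOpen S) {h : ℕ → ℕ → Plane → ℝ}
    (H : IsDerivFamily N S h) {f : Plane → ℝ} {a b : ℕ} (hab : a + b ≤ N) (he : EqOn f (h a b) S)
    (τ : Plane) : EqOn (dirDeriv τ f) (ConicSpline.dirFamily τ h a b) S := by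
  intro x hx
  have h1 := (H a b hab x hx).congr_of_eventuallyEq (he.eventuallyEq_of_mem (hS.mem_nhds hx))
  show fderiv ℝ f x τ = _
  rw [h1.fderiv, linForm_apply, ConicSpline.dirFamily]; ring

lemma IsDerivFamily.partialDeriv_eqOn {N : ℕ} {S : Set Plane} (hS : IsOpen S)
    {h : ℕ → ℕ → Plane → ℝ} (H : IsDerivFamily N S h) {f : Plane → ℝ} (he : EqOn f (h 0 0) S)
    {a b : ℕ} (hab : a + b ≤ N + 1) :
    EqOn (mixedDeriv (unitVec 0) (unitVec 1) a b f) (h a b) S := by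
  have h1 : ∀ b, b ≤ N + 1 → EqOn ((dirDeriv (unitVec 1))^[b] f) (h 0 b) S := by
    intro b
    induction b with
    | zero => exact fun _ => he
    | succ b ih =>
      intro hb x hx
      rw [Function.iterate_succ_apply', H.dirDeriv_eqOn hS (a := 0) (b := b) (by omega)
        (ih (by omega)) _ hx]
      simp [ConicSpline.dirFamily]
  induction a with
  | zero => exact h1 b (by omega)
  | succ a ih =>
    intro x hx
    rw [mixedDeriv, Function.iterate_succ_apply']
    refine (H.dirDeriv_eqOn hS (a := a) (b := b) (by omega) (ih (by omega)) _ hx).trans ?_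
    simp [ConicSpline.dirFamily]

lemma IsDerivFamily.contDiffOn {N : ℕ} {S : Set Plane} (hS : IsOpen S)
    {h : ℕ → ℕ → Plane → ℝ} (H : IsDerivFamily N S h)
    (hc : ∀ a b, a + b ≤ N + 1 → ContinuousOn (h a b) S) (k : ℕ) :
    ∀ a b, a + b + k ≤ N + 1 → ContDiffOn ℝ k (h a b) S := by
  induction k with
  | zero => intro a b hab; exact contDiffOn_zero.2 (hc a b hab)
  | succ k ih =>
    intro a b hab
    rw [show ((k + 1 : ℕ) : ℕ∞ω) = (k : ℕ∞ω) + 1 by push_cast; rfl,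
      contDiffOn_succ_iff_fderiv_of_isOpen hS]
    refine ⟨fun x hx => (H a b (by omega) x hx).differentiableAt.differentiableWithinAt,
      by simp, ?_⟩
    have h1 : ContDiffOn ℝ k (fun x => linForm (h (a + 1) b x) (h a (b + 1) x)) S := by
      unfold linForm
      exact ((ih (a + 1) b (by omega)).smul contDiffOn_const).add
        ((ih a (b + 1) (by omega)).smul contDiffOn_const)
    exact h1.congr fun x hx => (H a b (by omega) x hx).fderiv

/-- The partial derivatives of order at most three of a function in `C^3(Ω̄)` that vanishes on the
boundary. -/
structure IsC3Family (Ω : Set Plane) (g : ℕ → ℕ → Plane → ℝ) : Prop where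
  isDerivFamily : IsDerivFamily 2 Ω g
  continuousOn : ∀ a b, a + b ≤ 3 → ContinuousOn (g a b) (closure Ω)
  frontier_eq_zero : ∀ x ∈ frontier Ω, g 0 0 x = 0

lemma IsC3Family.isC3Representative {Ω : Opens Plane} {g : ℕ → ℕ → Plane → ℝ}
    (H : IsC3Family (Ω : Set Plane) g) {u : Plane → ℝ}
    (h : g 0 0 =ᵐ[volume.restrict (Ω : Set Plane)] u) : IsC3Representative Ω u (g 0 0) where
  ae_eq := h
  contDiffOn := H.isDerivFamily.contDiffOn Ω.isOpen
    (fun a b hab => (H.continuousOn a b hab).mono subset_closure) 3 0 0 (by norm_num)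
  extends_closure a b hab := ⟨g a b, H.continuousOn a b hab, fun x hx =>
    (H.isDerivFamily.partialDeriv_eqOn Ω.isOpen (fun _ _ => rfl) hab hx).symm⟩

lemma IsC3Representative.eqOn {Ω : Opens Plane} {u w w' : Plane → ℝ}
    (h : IsC3Representative Ω u w) (h' : IsC3Representative Ω u w') : EqOn w w' Ω :=
  Measure.eqOn_open_of_ae_eq (h.ae_eq.trans h'.ae_eq.symm) Ω.isOpen h.contDiffOn.continuousOn
    h'.contDiffOn.continuousOn

/-- Functions in `H^5(Ω) ∩ H^1_0(Ω)` have a representative in `C^3(Ω̄)`, which vanishes on the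
boundary. -/
theorem CurvedTriangles.IsTriangulation.exists_isC3Family {n : ℕ} [NeZero n] {D : ConicDomain n}
    {ι : Type} [Finite ι] {Δ : CurvedTriangles D ι} (hΔ : Δ.IsTriangulation)
    (hAF : Δ.IsAdmissible) {u : Plane → ℝ} (hu : MemH D.Ω 5 u) (hu₀ : MemH10 D.Ω u) :
    ∃ g, IsC3Family (D.Ω : Set Plane) g ∧ g 0 0 =ᵐ[volume.restrict (D.Ω : Set Plane)] u := by
  -- With m = 4 the family contains the orders up to five; two are spent, so the orders up to three
  -- become continuous.
  obtain ⟨h, hW, hh0, hout, hgrad⟩ := exists_isWeakFamily D.isBounded (m := 4) hu hu₀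
  have hΩ := D.Ω.isOpen
  have hm : MeasurableSet (D.Ω : Set Plane) := hΩ.measurableSet
  have hex : ∀ a b, ∃ g, a + b ≤ 3 → ContinuousOn g (closure (D.Ω : Set Plane)) ∧
      EqOn g (preciseRep (h a b)) D.Ω := by
    intro a b
    by_cases hab : a + b ≤ 3
    · obtain ⟨g, hg⟩ := hΔ.exists_continuousOn hAF (f := preciseRep (h a b)) fun p₁ p₂ hp => by
        obtain ⟨G, hG, he⟩ := hW.exists_continuous_rep hΩ hp (a := a) (b := b) (by omega)
        exact ⟨G, hG, fun x hx => (he x hx).1⟩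
      exact ⟨g, fun _ => hg⟩
    · exact ⟨0, fun h => (hab h).elim⟩
  choose g hg using hex
  have hae : ∀ a b, preciseRep (h a b) =ᵐ[volume] h a b := fun a b =>
    preciseRep_ae (hW.integrable a b).locallyIntegrable
  have hcomp : IsCompact (closure (D.Ω : Set Plane)) := D.isBounded.isCompact_closure
  have hbd : ∀ a b, a + b ≤ 3 → ∃ C, ∀ᵐ x, |h a b x| ≤ C := by
    intro a b hab
    obtain ⟨C, hC⟩ := hcomp.exists_bound_of_continuousOn (hg a b hab).1
    refine ⟨max C 0, (hae a b).mono fun x hx => ?_⟩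
    by_cases hxΩ : x ∈ (D.Ω : Set Plane)
    · rw [← hx, ← (hg a b hab).2 hxΩ]
      exact (hC x (subset_closure hxΩ)).trans (le_max_left _ _)
    · rw [hout a b x hxΩ, abs_zero]; exact le_max_right _ _
  refine ⟨g, ⟨(IsWeakFamily.isDerivFamily_rep hΩ (N := 2) hW).congr hΩ
    fun a b hab => (hg a b hab).2, fun a b hab => (hg a b hab).1, ?_⟩, ?_⟩
  · obtain ⟨C₁, hC₁⟩ := hbd 1 0 (by norm_num)
    obtain ⟨C₂, hC₂⟩ := hbd 0 1 (by norm_num)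
    set C := max C₁ C₂
    -- The zero extension has bounded weak derivatives on the whole plane, so the Lipschitz estimate
    -- holds even if the segment from x to y leaves and re-enters Ω; at y the value is zero.
    have hlip : ∀ x ∈ D.Ω, ∀ y ∉ closure (D.Ω : Set Plane), |g 0 0 x| ≤ (C + C) * ‖x - y‖ := by
      intro x hx y hy
      obtain ⟨p₁, p₂, hp, hxp⟩ := exists_mem_parallelogramSet hΩ hx
      obtain ⟨G, hG, he⟩ := hW.exists_continuous_rep hΩ hp (a := 0) (b := 0) (by norm_num)
      have ht := tendsto_section (he x hxp).2
      rw [← (he x hxp).1, ← (hg 0 0 (by norm_num)).2 hx] at ht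
      have := abs_sub_le_of_weakGrad (hW.integrable 0 0) hgrad
        (hC₁.mono fun z hz => hz.trans (le_max_left C₁ C₂))
        (hC₂.mono fun z hz => hz.trans (le_max_right C₁ C₂)) ht
        (tendsto_conv_of_notMem_closure (hout 0 0) hy)
      rwa [sub_zero] at this
    intro z hz
    have hlip' : ∀ x ∈ D.Ω, |g 0 0 x| ≤ (C + C) * ‖x - z‖ := by
      intro x hx
      have hcl : IsClosed {y : Plane | |g 0 0 x| ≤ (C + C) * ‖x - y‖} :=
        isClosed_le continuous_const (by fun_prop)
      exact hcl.closure_subset (closure_mono (fun y hy => hlip x hx y hy)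
        (D.frontier_subset_closure_compl hz))
    have hzc : z ∈ closure (D.Ω : Set Plane) := frontier_subset_closure hz
    have : (𝓝[(D.Ω : Set Plane)] z).NeBot := mem_closure_iff_nhdsWithin_neBot.1 hzc
    have h1 : Tendsto (fun x => |g 0 0 x|) (𝓝[(D.Ω : Set Plane)] z) (𝓝 |g 0 0 z|) :=
      (((hg 0 0 (by norm_num)).1 z hzc).mono subset_closure).abs
    have h2 : Tendsto (fun x => (C + C) * ‖x - z‖) (𝓝[(D.Ω : Set Plane)] z) (𝓝 0) := by
      have hc : Continuous fun x => (C + C) * ‖x - z‖ := by fun_prop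
      have := hc.tendsto z
      rw [sub_self, norm_zero, mul_zero] at this
      exact this.mono_left nhdsWithin_le_nhds
    have := le_of_tendsto_of_tendsto h1 h2 (eventually_mem_nhdsWithin.mono hlip')
    exact abs_nonpos_iff.1 this
  · refine (ae_restrict_iff' hm).2 ((hae 0 0).mono fun x hx hxΩ => ?_)
    rw [(hg 0 0 (by norm_num)).2 hxΩ, hx, hh0, indicator_of_mem hxΩ]

end ConicSpline

namespace ConicSpline

/-! ### Quotients of functions that vanish on an arc -/

/-- `F` is a continuous function on the closure of `Ω` whose derivative in `Ω` is `F'`, which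
extends continuously to the closure. -/
structure C1On (Ω : Set Plane) (F : Plane → ℝ) (F' : Plane → Plane →L[ℝ] ℝ) : Prop where
  continuousOn : ContinuousOn F (closure Ω)
  continuousOn_deriv : ContinuousOn F' (closure Ω)
  hasFDerivAt : ∀ x ∈ Ω, HasFDerivAt F (F' x) x

lemma C1On.sub {Ω : Set Plane} {F G : Plane → ℝ} {F' G' : Plane → Plane →L[ℝ] ℝ}
    (hF : C1On Ω F F') (hG : C1On Ω G G') :
    C1On Ω (fun x => F x - G x) (fun x => F' x - G' x) where
  continuousOn := hF.continuousOn.sub hG.continuousOn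
  continuousOn_deriv := hF.continuousOn_deriv.sub hG.continuousOn_deriv
  hasFDerivAt x hx := (hF.hasFDerivAt x hx).sub (hG.hasFDerivAt x hx)

lemma C1On.mul {Ω : Set Plane} {F G : Plane → ℝ} {F' G' : Plane → Plane →L[ℝ] ℝ}
    (hF : C1On Ω F F') (hG : C1On Ω G G') :
    C1On Ω (fun x => F x * G x) (fun x => F x • G' x + G x • F' x) where
  continuousOn := hF.continuousOn.mul hG.continuousOn
  continuousOn_deriv := (hF.continuousOn.smul hG.continuousOn_deriv).add
    (hG.continuousOn.smul hF.continuousOn_deriv)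
  hasFDerivAt x hx := (hF.hasFDerivAt x hx).mul (hG.hasFDerivAt x hx)

lemma c1On_polyFun (Ω : Set Plane) (p : BiPoly) : C1On Ω (polyFun p) (polyGrad p) where
  continuousOn := (continuous_polyFun p).continuousOn
  continuousOn_deriv := (continuous_polyGrad p).continuousOn
  hasFDerivAt x _ := hasFDerivAt_polyFun p x

lemma C1On.mono {Ω U : Set Plane} {F : Plane → ℝ} {F' : Plane → Plane →L[ℝ] ℝ}
    (hF : C1On Ω F F') (h : U ⊆ Ω) : C1On U F F' where
  continuousOn := hF.continuousOn.mono (closure_mono h)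
  continuousOn_deriv := hF.continuousOn_deriv.mono (closure_mono h)
  hasFDerivAt x hx := hF.hasFDerivAt x (h hx)

lemma C1On.tendsto_deriv {Ω U : Set Plane} {F : Plane → ℝ} {F' : Plane → Plane →L[ℝ] ℝ}
    (hF : C1On Ω F F') (h : U ⊆ Ω) {x : Plane} (hx : x ∈ closure Ω) (m : Plane) :
    Tendsto (fun y => F' y m) (𝓝[U] x) (𝓝 (F' x m)) := by
  have h1 : Tendsto F' (𝓝[U] x) (𝓝 (F' x)) :=
    (hF.continuousOn_deriv x hx).mono_left (nhdsWithin_mono _ (h.trans subset_closure))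
  exact ((ContinuousLinearMap.apply ℝ ℝ m).continuous.tendsto _).comp h1

/-- From the points of `U` near `x`, one hits `Z` near `x` when moving in the direction `-m`. -/
def HitsAlong (U Z : Set Plane) (m x : Plane) : Prop :=
  ∀ r : ℝ, 0 < r → ∀ᶠ y in 𝓝[U] x, ∃ s : ℝ, 0 < s ∧ y - s • m ∈ Z ∧
    ∀ ρ ∈ Ico (0 : ℝ) s, y - ρ • m ∈ U ∧ dist (y - ρ • m) x < r

/-- A version of the rule of L'Hôpital. -/
lemma HitsAlong.lhopital {U Z : Set Plane} {m x : Plane} (h : HitsAlong U Z m x)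
    {F H : Plane → ℝ} {F' H' : Plane → Plane →L[ℝ] ℝ} (hF : C1On U F F') (hH : C1On U H H')
    (hFZ : ∀ z ∈ Z, F z = 0) (hHZ : ∀ z ∈ Z, H z = 0) (hH0 : ∀ᶠ y in 𝓝[U] x, H y ≠ 0)
    (hH0' : ∀ᶠ y in 𝓝[U] x, H' y m ≠ 0) {L : ℝ}
    (hL : Tendsto (fun y => F' y m / H' y m) (𝓝[U] x) (𝓝 L)) :
    Tendsto (fun y => F y / H y) (𝓝[U] x) (𝓝 L) := by
  rw [Metric.tendsto_nhds] at hL ⊢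
  intro ε hε
  obtain ⟨r, hr, hsub⟩ := Metric.mem_nhdsWithin_iff.1 ((hL ε hε).and hH0')
  filter_upwards [h r hr, hH0] with y ⟨s, hs, hz, hρ⟩ hy0
  set z := y - s • m with hzd
  have hy : y = z + s • m := by rw [hzd]; abel
  have hU : ∀ σ ∈ Ioc 0 s, z + σ • m ∈ U ∧ dist (z + σ • m) x < r := by
    intro σ hσ
    have := hρ (s - σ) ⟨by linarith [hσ.2], by linarith [hσ.1]⟩
    rwa [show y - (s - σ) • m = z + σ • m by rw [hzd, sub_smul]; abel] at this
  have hline : Continuous fun σ : ℝ => z + σ • m := by fun_prop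
  have hzc : z ∈ closure U := by
    have ht := hline.tendsto 0
    rw [zero_smul, add_zero] at ht
    refine mem_closure_of_tendsto (ht.mono_left (nhdsWithin_le_nhds (s := Ioi 0))) ?_
    filter_upwards [Ioo_mem_nhdsGT hs] with σ hσ
    exact (hU σ ⟨hσ.1, hσ.2.le⟩).1
  have hmem : ∀ σ ∈ Icc 0 s, z + σ • m ∈ closure U := by
    intro σ hσ
    rcases hσ.1.lt_or_eq with h | h
    · exact subset_closure (hU σ ⟨h, hσ.2⟩).1
    · rw [← h, zero_smul, add_zero]; exact hzc
  have hcomp : ∀ G : Plane → ℝ, ContinuousOn G (closure U) →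
      ContinuousOn (fun σ : ℝ => G (z + σ • m)) (Icc 0 s) := fun G hG =>
    hG.comp hline.continuousOn hmem
  -- Cauchy's mean value theorem between the point of `Z` and y. The intermediate point is within
  -- distance r of x, where the quotient of the derivatives is close to `L`.
  obtain ⟨c, hc, heq⟩ := exists_ratio_hasDerivAt_eq_ratio_slope
    (fun σ : ℝ => F (z + σ • m)) (fun σ => F' (z + σ • m) m) hs (hcomp F hF.continuousOn)
    (fun σ hσ => hasDerivAt_line (hF.hasFDerivAt _ (hU σ ⟨hσ.1, hσ.2.le⟩).1))
    (fun σ : ℝ => H (z + σ • m)) (fun σ => H' (z + σ • m) m) (hcomp H hH.continuousOn)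
    (fun σ hσ => hasDerivAt_line (hH.hasFDerivAt _ (hU σ ⟨hσ.1, hσ.2.le⟩).1))
  simp only [zero_smul, add_zero, hFZ z hz, hHZ z hz, sub_zero, ← hy] at heq
  obtain ⟨hcU, hcr⟩ := hU c ⟨hc.1, hc.2.le⟩
  obtain ⟨hd, hne⟩ := hsub ⟨hcr, hcU⟩
  have : F y / H y = F' (z + c • m) m / H' (z + c • m) m := by
    rw [div_eq_div_iff hy0 hne]; linarith
  rw [this]; exact hd

/-- Backwards along m the polynomial falls at a rate of at least κ, but it is positive in `U`. So
the line leaves `U` after a length that tends to zero as y → x. -/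
lemma hitsAlong_of_polyD_pos {U Z : Set Plane} (hU : IsOpen U) {q : BiPoly} {m x : Plane}
    (hq : ∀ᶠ y in 𝓝[U] x, 0 < polyFun q y) (hqx : polyFun q x = 0)
    (hm : 0 < inner ℝ (gradV q x) m)
    (hZ : ∃ r > 0, ∀ y ∈ U, dist y x < r → ∀ s : ℝ, 0 < s → y - s • m ∈ frontier U →
      dist (y - s • m) x < r → y - s • m ∈ Z) : HitsAlong U Z m x := by
  intro r hr
  obtain ⟨r₁, hr₁, hZ⟩ := hZ
  obtain ⟨r₂, hr₂, hb₂⟩ := Metric.eventually_nhds_iff_ball.1 (ConicDomain.tendsto_polyD_pos hm)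
  obtain ⟨r₃, hr₃, hb₃⟩ := Metric.mem_nhdsWithin_iff.1 hq
  set κ := inner ℝ (gradV q x) m / 2 with hκ
  have hκ0 : 0 < κ := half_pos hm
  obtain ⟨R, hR, hRr, hR1, hR2, hR3⟩ : ∃ R > 0, R ≤ r ∧ R ≤ r₁ ∧ R ≤ r₂ ∧ R ≤ r₃ :=
    ⟨min r (min r₁ (min r₂ r₃)), by positivity, by simp, by simp, by simp, by simp⟩
  have hqt : Tendsto (fun y => 2 * polyFun q y / κ * ‖m‖) (𝓝 x) (𝓝 0) := by
    have hc : Continuous fun y => 2 * polyFun q y / κ * ‖m‖ := by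
      have := continuous_polyFun q; fun_prop
    have := hc.tendsto x
    rwa [hqx, mul_zero, zero_div, zero_mul] at this
  filter_upwards [self_mem_nhdsWithin, nhdsWithin_le_nhds (Metric.ball_mem_nhds x (half_pos hR)),
    nhdsWithin_le_nhds (hqt.eventually (gt_mem_nhds (half_pos hR)))] with y hyU hyb hys
  have hyb : dist y x < R / 2 := hyb
  have hqy : 0 < polyFun q y := hb₃ ⟨(show dist y x < r₃ by linarith), hyU⟩
  -- Twice the length q(y)/κ, after which q would be negative.
  set s₁ := 2 * polyFun q y / κ with hs₁
  have hs₁0 : 0 < s₁ := by positivity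
  have hball : ∀ ρ ∈ Icc 0 s₁, dist (y - ρ • m) x < R := by
    intro ρ hρ
    calc dist (y - ρ • m) x ≤ dist (y - ρ • m) y + dist y x := dist_triangle _ _ _
      _ = ρ * ‖m‖ + dist y x := by
          rw [dist_eq_norm, sub_sub_cancel_left, norm_neg, norm_smul, Real.norm_of_nonneg hρ.1]
      _ < R := by nlinarith [mul_le_mul_of_nonneg_right hρ.2 (norm_nonneg m)]
  have hout : y + s₁ • (-m) ∉ U := by
    intro hin
    rw [smul_neg, ← sub_eq_add_neg] at hin
    have hb := hball s₁ ⟨hs₁0.le, le_rfl⟩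
    have hpos : 0 < polyFun q (y - s₁ • m) := hb₃ ⟨(show dist _ x < r₃ by linarith), hin⟩
    obtain ⟨ρ, hρ, heq⟩ := polyFun_mvt q (y - s₁ • m) m hs₁0
    rw [sub_add_cancel] at heq
    have hb' := hball (s₁ - ρ) ⟨by linarith [hρ.2], by linarith [hρ.1]⟩
    have hD := hb₂ (y - s₁ • m + ρ • m) (by
      rw [show y - s₁ • m + ρ • m = y - (s₁ - ρ) • m by rw [sub_smul]; abel]
      exact lt_of_lt_of_le hb' hR2)
    have h1 := mul_lt_mul_of_pos_left hD hs₁0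
    have h2 : s₁ * κ = 2 * polyFun q y := by rw [hs₁]; field_simp
    linarith
  obtain ⟨s, hs, hin, hfr⟩ := exists_first_exit hU hyU hs₁0.le hout
  have hneg : ∀ ρ : ℝ, y + ρ • (-m) = y - ρ • m := fun ρ => by rw [smul_neg, sub_eq_add_neg]
  rw [hneg] at hfr
  refine ⟨s, hs.1, hZ y hyU (by linarith) s hs.1 hfr
    ((hball s ⟨hs.1.le, hs.2⟩).trans_le hR1), fun ρ hρ => ⟨?_, ?_⟩⟩
  · rw [← hneg]; exact hin ρ hρ
  · exact (hball ρ ⟨hρ.1, hρ.2.le.trans hs.2⟩).trans_le hRr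

lemma eventually_polyD_ne {q : BiPoly} {m x : Plane} (hm : 0 < inner ℝ (gradV q x) m)
    (U : Set Plane) : ∀ᶠ y in 𝓝[U] x, 0 < polyFun (polyD m q) y :=
  nhdsWithin_le_nhds ((ConicDomain.tendsto_polyD_pos hm).mono fun _ h => (half_pos hm).trans h)

/-- The limit of the quotient of a function that vanishes on an arc and the polynomial of the
arc. -/
lemma HitsAlong.tendsto_div {Ω U Z : Set Plane} {m x : Plane} (h : HitsAlong U Z m x)
    (hUΩ : U ⊆ Ω) (hx : x ∈ closure Ω) {q : BiPoly} (hq : ∀ᶠ y in 𝓝[U] x, 0 < polyFun q y)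
    (hm : 0 < inner ℝ (gradV q x) m) (hqZ : ∀ z ∈ Z, polyFun q z = 0)
    {F : Plane → ℝ} {F' : Plane → Plane →L[ℝ] ℝ} (hF : C1On Ω F F') (hFZ : ∀ z ∈ Z, F z = 0) :
    Tendsto (fun y => F y / polyFun q y) (𝓝[U] x) (𝓝 (F' x m / polyFun (polyD m q) x)) := by
  have hne : polyFun (polyD m q) x ≠ 0 := by rw [polyFun_polyD]; exact hm.ne'
  refine h.lhopital (hF.mono hUΩ) (c1On_polyFun U q) hFZ hqZ (hq.mono fun _ h => h.ne')
    ((eventually_polyD_ne hm U).mono fun y hy => ?_) ?_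
  · rw [polyGrad_apply]; exact hy.ne'
  · simp only [polyGrad_apply]
    exact (hF.tendsto_deriv hUΩ hx m).div
      ((continuous_polyFun _).continuousAt.mono_left nhdsWithin_le_nhds) hne

namespace ConicDomain
variable {n : ℕ} [NeZero n] (D : ConicDomain n)

lemma hitsAlong_arc (j : Fin n) {t : ℝ} (ht : t ∈ Ioo (0 : ℝ) 1) {m : Plane}
    (hm : 0 < inner ℝ (gradV (D.q j) (D.curve j t)) m) :
    HitsAlong (D.Ω : Set Plane) (D.curve j '' Ioo 0 1) m (D.curve j t) := by
  obtain ⟨r, hr, hfr⟩ := D.exists_frontier_near_arc j ht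
  refine hitsAlong_of_polyD_pos D.Ω.isOpen (D.q_pos j t ht) (D.q_zero j t ht) hm
    ⟨r, hr, fun y _ _ s _ hf hd => ?_⟩
  obtain ⟨t', ht', he⟩ := hfr _ hf hd
  exact ⟨t', ht', he.symm⟩

/-- At the points of an open arc, the gradient of a function that vanishes on the arc is a multiple
of the gradient of the polynomial of the arc. -/
lemma deriv_eq_mul_of_eq_zero (j : Fin n) {F : Plane → ℝ} {F' : Plane → Plane →L[ℝ] ℝ}
    (hF : C1On (D.Ω : Set Plane) F F') (hF0 : ∀ t ∈ Ioo (0 : ℝ) 1, F (D.curve j t) = 0)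
    {t : ℝ} (ht : t ∈ Ioo (0 : ℝ) 1) : ∃ L : ℝ, ∀ τ : Plane,
      F' (D.curve j t) τ = L * polyFun (polyD τ (D.q j)) (D.curve j t) := by
  set x := D.curve j t
  have hx : x ∈ closure (D.Ω : Set Plane) :=
    frontier_subset_closure (D.curve_mem_frontier j (Ioo_subset_Icc_self ht))
  have : (𝓝[(D.Ω : Set Plane)] x).NeBot := mem_closure_iff_nhdsWithin_neBot.1 hx
  set nv := gradV (D.q j) x
  have hn : 0 < inner ℝ nv nv := real_inner_self_pos.2 (D.arc_gradV_ne j (Ioo_subset_Icc_self ht))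
  have hlim : ∀ m, 0 < inner ℝ nv m → Tendsto (fun y => F y / polyFun (D.q j) y)
      (𝓝[(D.Ω : Set Plane)] x) (𝓝 (F' x m / polyFun (polyD m (D.q j)) x)) := fun m hm =>
    (D.hitsAlong_arc j ht hm).tendsto_div subset_rfl hx (D.q_pos j t ht) hm
      (by rintro _ ⟨t', ht', rfl⟩; exact D.q_zero j t' ht') hF
      (by rintro _ ⟨t', ht', rfl⟩; exact hF0 t' ht')
  set L := F' x nv / polyFun (polyD nv (D.q j)) x with hL
  -- The limit of F/q does not depend on the direction of approach, so the ratio of the directional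
  -- derivatives of F and q is the same for all admissible m.
  have hpos : ∀ m, 0 < inner ℝ nv m → F' x m = L * inner ℝ nv m := by
    intro m hm
    have := tendsto_nhds_unique (hlim m hm) (hlim nv hn)
    rw [← hL, polyFun_polyD, div_eq_iff hm.ne'] at this
    exact this
  refine ⟨L, fun τ => ?_⟩
  rw [polyFun_polyD]
  -- A multiple of the gradient makes any direction admissible, and both sides are linear.
  obtain ⟨c, hc⟩ : ∃ c : ℝ, 0 < inner ℝ nv (τ + c • nv) := by
    refine ⟨(1 - inner ℝ nv τ) / inner ℝ nv nv, ?_⟩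
    rw [inner_add_right, inner_smul_right, div_mul_cancel₀ _ hn.ne']; linarith
  have h1 := hpos _ hc
  rw [map_add, map_smul, hpos nv hn, inner_add_right, inner_smul_right, smul_eq_mul] at h1
  linarith

lemma eq_on_closedArc (j : Fin n) {A B : Plane → ℝ}
    (hA : ContinuousOn A (closure (D.Ω : Set Plane)))
    (hB : ContinuousOn B (closure (D.Ω : Set Plane)))
    (h : ∀ t ∈ Ioo (0 : ℝ) 1, A (D.curve j t) = B (D.curve j t)) {t : ℝ}
    (ht : t ∈ Icc (0 : ℝ) 1) : A (D.curve j t) = B (D.curve j t) := by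
  have hmem : MapsTo (D.curve j) (Icc 0 1) (closure (D.Ω : Set Plane)) := fun t ht =>
    frontier_subset_closure (D.curve_mem_frontier j ht)
  have hc := (D.continuous_curve j).continuousOn (s := Icc (0 : ℝ) 1)
  exact EqOn.of_subset_closure (f := fun t => A (D.curve j t)) (g := fun t => B (D.curve j t))
    (s := Ioo 0 1) (t := Icc 0 1) h (hA.comp hc hmem) (hB.comp hc hmem) Ioo_subset_Icc_self
    (by rw [closure_Ioo zero_ne_one]) ht

/-- Without the factor `L` the collinearity of the gradients becomes an identity between continuous
functions, which extends to the endpoints of the arc. -/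
lemma deriv_mul_comm_of_eq_zero (j : Fin n) {F : Plane → ℝ} {F' : Plane → Plane →L[ℝ] ℝ}
    (hF : C1On (D.Ω : Set Plane) F F') (hF0 : ∀ t ∈ Ioo (0 : ℝ) 1, F (D.curve j t) = 0)
    {t : ℝ} (ht : t ∈ Icc (0 : ℝ) 1) (σ τ : Plane) :
    F' (D.curve j t) σ * polyFun (polyD τ (D.q j)) (D.curve j t) =
      F' (D.curve j t) τ * polyFun (polyD σ (D.q j)) (D.curve j t) := by
  have hc : ∀ σ τ, ContinuousOn (fun x => F' x σ * polyFun (polyD τ (D.q j)) x)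
      (closure (D.Ω : Set Plane)) := fun σ τ =>
    (hF.continuousOn_deriv.clm_apply continuousOn_const).mul (continuous_polyFun _).continuousOn
  refine D.eq_on_closedArc j (hc σ τ) (hc τ σ) (fun t ht => ?_) ht
  obtain ⟨L, hL⟩ := D.deriv_eq_mul_of_eq_zero j hF hF0 ht
  simp only [hL]; ring

end ConicDomain

namespace CurvedTriangles.IsTriangulation
variable {n : ℕ} [NeZero n] {D : ConicDomain n} {ι : Type} {Δ : CurvedTriangles D ι}
variable (hΔ : Δ.IsTriangulation) (hAF : Δ.IsAdmissible)
include hΔ hAF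

/-- Going back must not lead out through the straight edge. If the conic increases along the edge,
the edge direction serves, since parallel lines do not cross it. In the tangential case the gradient
serves, because the triangle lies on the other side of the edge. -/
lemma exists_hitsAlong [Finite ι] {T : ι} (hT : T ∈ Δ.pie) {i : Fin 3} (hi : i ≠ 0) :
    ∃ m, 0 < inner ℝ (gradV (Δ.conic T) (Δ.vert T i)) m ∧
      HitsAlong (interior (Δ.cell T)) (Δ.curvedEdge T) m (Δ.vert T i) := by
  obtain ⟨r, hr, hfr⟩ := hΔ.exists_frontier_near_vert hT hi
  have hn := hΔ.gradV_vert_ne hT hi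
  have hqx := hΔ.conic_vert hT hi
  have hq : ∀ᶠ y in 𝓝[interior (Δ.cell T)] (Δ.vert T i), 0 < polyFun (Δ.conic T) y :=
    eventually_mem_nhdsWithin.mono fun y hy =>
      CurvedTriangles.conic_pos_of_mem hΔ hAF hT (interior_subset hy) (hΔ.interior_cell_subset T hy)
  have hcl : frontier (interior (Δ.cell T)) ⊆ frontier (Δ.cell T) := frontier_interior_subset
  rcases (hΔ.inner_gradV_edge_nonneg hAF hT hi).lt_or_eq with hpos | hzero
  · have hene : 0 < ‖Δ.vert T 0 - Δ.vert T i‖ := norm_pos_iff.2 (hΔ.edge_ne hi)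
    refine ⟨_, hpos, hitsAlong_of_polyD_pos isOpen_interior hq hqx hpos
      ⟨min r ‖Δ.vert T 0 - Δ.vert T i‖, lt_min hr hene, fun y hy hyd s hs hf hd => ?_⟩⟩
    rcases hfr _ (hd.trans_le (min_le_left _ _)) (hcl hf) with ⟨t, ht, he⟩ | h
    · exfalso
      have hyeq : y = Δ.vert T i + (t + s) • (Δ.vert T 0 - Δ.vert T i) := by
        rw [add_smul, ← add_assoc, ← he]; abel
      have hts : t + s < 1 := by
        have h1 := hyd.trans_le (min_le_right _ _)
        rw [hyeq, dist_eq_norm, add_sub_cancel_left, norm_smul,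
          Real.norm_of_nonneg (by linarith [ht.1])] at h1
        by_contra! hcon
        nlinarith
      have hmem : y ∈ segment ℝ (Δ.vert T i) (Δ.vert T 0) := by
        rw [segment_eq_image', hyeq]; exact ⟨t + s, ⟨by linarith [ht.1], hts.le⟩, rfl⟩
      exact (hΔ.segment_subset_frontier (isStraight_zero hi).symm hmem).2 hy
    · exact h
  · obtain ⟨r', hr', hnot⟩ := hΔ.exists_halfPlane_notMem hAF hT hi hzero.symm
    have hpos := real_inner_self_pos.2 hn
    refine ⟨_, hpos, hitsAlong_of_polyD_pos isOpen_interior hq hqx hpos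
      ⟨min r r', lt_min hr hr', fun y hy hyd s hs hf hd => ?_⟩⟩
    rcases hfr _ (hd.trans_le (min_le_left _ _)) (hcl hf) with ⟨t, ht, he⟩ | h
    · refine (hnot y (hyd.trans_le (min_le_right _ _)) ?_ (interior_subset hy)).elim
      have : y - Δ.vert T i = t • (Δ.vert T 0 - Δ.vert T i) +
          s • gradV (Δ.conic T) (Δ.vert T i) := by
        rw [sub_eq_iff_eq_add] at he; rw [he]; abel
      rw [this, inner_add_right, inner_smul_right, inner_smul_right, ← hzero, mul_zero, zero_add]
      exact mul_pos hs hpos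
    · exact h

end CurvedTriangles.IsTriangulation
end ConicSpline

namespace ConicSpline

/-! ### The quotient of the function and the polynomial of an arc -/

lemma forall_add_lt_three {P : ℕ → ℕ → Prop} (h00 : P 0 0) (h10 : P 1 0) (h01 : P 0 1)
    (h20 : P 2 0) (h11 : P 1 1) (h02 : P 0 2) : ∀ a b, a + b < 3 → P a b := by
  intro a b hab
  have ha : a < 3 := by omega
  have hb : b < 3 := by omega
  interval_cases a <;> interval_cases b <;> first | assumption | omega

lemma forall_add_lt_two {P : ℕ → ℕ → Prop} (h00 : P 0 0) (h10 : P 1 0) (h01 : P 0 1) :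
    ∀ a b, a + b < 2 → P a b := by
  intro a b hab
  have ha : a < 2 := by omega
  have hb : b < 2 := by omega
  interval_cases a <;> interval_cases b <;> first | assumption | omega

lemma polyD_mul (τ : Plane) (p q : BiPoly) : polyD τ (p * q) = polyD τ p * q + p * polyD τ q := by
  simp only [polyD, Derivation.leibniz, smul_eq_mul]; ring

/-- The second derivative in two directions belonging to a family of partial derivatives. -/
def dirFamilyTwo (g : ℕ → ℕ → Plane → ℝ) (σ τ : Plane) : Plane → ℝ :=
  dirFamily τ (dirFamily σ g) 0 0

lemma dirFamilyTwo_comm (g : ℕ → ℕ → Plane → ℝ) (σ τ : Plane) :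
    dirFamilyTwo g σ τ = dirFamilyTwo g τ σ := by
  ext x; simp only [dirFamilyTwo, dirFamily]; ring

namespace IsC3Family
variable {Ω : Set Plane} {g : ℕ → ℕ → Plane → ℝ} (H : IsC3Family Ω g)
include H

lemma c1On : C1On Ω (g 0 0) fun x => linForm (g 1 0 x) (g 0 1 x) where
  continuousOn := H.continuousOn 0 0 (by norm_num)
  continuousOn_deriv := by
    have h1 := H.continuousOn 1 0 (by norm_num)
    have h2 := H.continuousOn 0 1 (by norm_num)
    unfold linForm; fun_prop
  hasFDerivAt x hx := H.isDerivFamily 0 0 (by norm_num) x hx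

lemma c1On_dirFamily (σ : Plane) : C1On Ω (dirFamily σ g 0 0)
    fun x => linForm (dirFamily σ g 1 0 x) (dirFamily σ g 0 1 x) where
  continuousOn := by
    have h1 := H.continuousOn 1 0 (by norm_num)
    have h2 := H.continuousOn 0 1 (by norm_num)
    unfold dirFamily; fun_prop
  continuousOn_deriv := by
    have h1 := H.continuousOn 1 1 (by norm_num)
    have h2 := H.continuousOn 2 0 (by norm_num)
    have h3 := H.continuousOn 0 2 (by norm_num)
    unfold linForm dirFamily; fun_prop
  hasFDerivAt x hx := (H.isDerivFamily.dirFamily σ) 0 0 (by norm_num) x hx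

lemma continuousOn_dirFamilyTwo (σ τ : Plane) : ContinuousOn (dirFamilyTwo g σ τ) (closure Ω) := by
  have h1 := H.continuousOn 1 1 (by norm_num)
  have h2 := H.continuousOn 2 0 (by norm_num)
  have h3 := H.continuousOn 0 2 (by norm_num)
  unfold dirFamilyTwo dirFamily; fun_prop

end IsC3Family

lemma linForm_dirFamily (h : ℕ → ℕ → Plane → ℝ) (x σ : Plane) :
    linForm (h 1 0 x) (h 0 1 x) σ = dirFamily σ h 0 0 x := by
  rw [linForm_apply, dirFamily]; ring

lemma linForm_dirFamilyTwo (g : ℕ → ℕ → Plane → ℝ) (x σ τ : Plane) :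
    linForm (dirFamily σ g 1 0 x) (dirFamily σ g 0 1 x) τ = dirFamilyTwo g σ τ x :=
  linForm_dirFamily _ _ _

lemma hasFDerivAt_div_polyFun {F : Plane → ℝ} {F' : Plane →L[ℝ] ℝ} {q : BiPoly} {x : Plane}
    (hF : HasFDerivAt F F' x) (hq : polyFun q x ≠ 0) :
    HasFDerivAt (fun y => F y / polyFun q y)
      ((polyFun q x)⁻¹ • (F' - (F x / polyFun q x) • polyGrad q x)) x := by
  have h := hF.mul ((hasDerivAt_inv hq).comp_hasFDerivAt x (hasFDerivAt_polyFun q x))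
  simp only [div_eq_mul_inv]
  refine h.congr_fderiv ?_
  ext τ
  simp; field_simp; ring

/-- The first derivatives of the quotient. -/
lemma dirDeriv_div_eqOn {Ω : Set Plane} {g : ℕ → ℕ → Plane → ℝ} (H : IsC3Family Ω g) {q : BiPoly}
    {S : Set Plane} (hSΩ : S ⊆ Ω) (hq : ∀ y ∈ S, polyFun q y ≠ 0) (σ : Plane) :
    EqOn (dirDeriv σ fun y => g 0 0 y / polyFun q y)
      (fun y => (dirFamily σ g 0 0 y - g 0 0 y / polyFun q y * polyFun (polyD σ q) y) /
        polyFun q y) S := by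
  intro y hy
  show fderiv ℝ _ y σ = _
  rw [(hasFDerivAt_div_polyFun (H.c1On.hasFDerivAt y (hSΩ hy)) (hq y hy)).fderiv]
  simp only [smul_apply, sub_apply, linForm_dirFamily,
    polyGrad_apply, smul_eq_mul]
  rw [inv_mul_eq_div]

/-- The second derivatives of the quotient. -/
lemma dirDeriv_dirDeriv_div_eqOn {Ω : Set Plane} {g : ℕ → ℕ → Plane → ℝ} (H : IsC3Family Ω g)
    {q : BiPoly} {S : Set Plane} (hS : IsOpen S) (hSΩ : S ⊆ Ω) (hq : ∀ y ∈ S, polyFun q y ≠ 0)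
    (σ τ : Plane) {v : Plane → ℝ} (hv : v = fun y => g 0 0 y / polyFun q y) :
    EqOn (dirDeriv τ (dirDeriv σ v))
      (fun y => (dirFamilyTwo g σ τ y - dirDeriv τ v y * polyFun (polyD σ q) y -
        dirDeriv σ v y * polyFun (polyD τ q) y - v y * polyFun (polyD τ (polyD σ q)) y) /
        polyFun q y) S := by
  intro y hy
  have hvd : HasFDerivAt v (fderiv ℝ v y) y := by
    rw [hv]
    exact (hasFDerivAt_div_polyFun (H.c1On.hasFDerivAt y (hSΩ hy))
      (hq y hy)).differentiableAt.hasFDerivAt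
  have h1 := ((H.c1On_dirFamily σ).hasFDerivAt y (hSΩ hy)).sub
    (hvd.mul (hasFDerivAt_polyFun (polyD σ q) y))
  have h2 := (hasFDerivAt_div_polyFun h1 (hq y hy)).congr_of_eventuallyEq
    (((dirDeriv_div_eqOn H hSΩ hq σ).eventuallyEq_of_mem (hS.mem_nhds hy)).trans
      (by rw [hv]; exact .rfl))
  rw [← hv] at h2
  have h3 : dirDeriv σ v y =
      (dirFamily σ g 0 0 y - v y * polyFun (polyD σ q) y) / polyFun q y := by
    rw [hv]; exact dirDeriv_div_eqOn H hSΩ hq σ hy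
  show fderiv ℝ _ y τ = _
  rw [h2.fderiv]
  simp only [smul_apply, sub_apply,
    add_apply, linForm_dirFamilyTwo, polyGrad_apply, smul_eq_mul]
  simp only [Pi.sub_apply, Pi.mul_apply, ← h3]
  rw [inv_mul_eq_div]
  simp only [dirDeriv]
  ring

/-- The interpolation of the quotient at a point in the interior yields the derivatives of the
function itself. -/
lemma exists_jet_div_interior {Ω : Set Plane} (hΩ : IsOpen Ω) {g : ℕ → ℕ → Plane → ℝ}
    (H : IsC3Family Ω g) {q : BiPoly} {x : Plane} (hx : x ∈ Ω) (hq : polyFun q x ≠ 0) :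
    ∃ J : ℕ → ℕ → ℝ,
      (∀ a b, a + b < 3 → Tendsto (mixedDeriv (unitVec 0) (unitVec 1) a b
        fun y => g 0 0 y / polyFun q y) (𝓝 x) (𝓝 (J a b))) ∧
      ∀ p, (∀ a b, a + b < 3 → polyFun (partPoly a b p) x = J a b) →
        ∀ a b, a + b < 3 → polyFun (partPoly a b (p * q)) x = g a b x := by
  set v := fun y => g 0 0 y / polyFun q y with hv
  set S := Ω ∩ {y | polyFun q y ≠ 0} with hSd
  have hS : IsOpen S := hΩ.inter (isOpen_ne_fun (continuous_polyFun q) continuous_const)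
  have hSΩ : S ⊆ Ω := inter_subset_left
  have hxS : x ∈ S := ⟨hx, hq⟩
  have hqS : ∀ y ∈ S, polyFun q y ≠ 0 := fun y hy => hy.2
  have hn : S ∈ 𝓝 x := hS.mem_nhds hxS
  have hcl : closure Ω ∈ 𝓝 x := Filter.mem_of_superset (hΩ.mem_nhds hx) subset_closure
  have cq : ∀ r : BiPoly, ContinuousAt (polyFun r) x := fun r => (continuous_polyFun r).continuousAt
  have c0 : ContinuousAt v x := ((H.c1On.continuousOn).continuousAt hcl).div (cq q) hq
  have c1 : ∀ σ, ContinuousAt (dirDeriv σ v) x := by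
    intro σ
    refine ContinuousAt.congr ?_ ((dirDeriv_div_eqOn H hSΩ hqS σ).eventuallyEq_of_mem hn).symm
    exact ((((H.c1On_dirFamily σ).continuousOn).continuousAt hcl).sub (c0.mul (cq _))).div (cq q) hq
  have c2 : ∀ σ τ, ContinuousAt (dirDeriv τ (dirDeriv σ v)) x := by
    intro σ τ
    refine ContinuousAt.congr ?_
      ((dirDeriv_dirDeriv_div_eqOn H hS hSΩ hqS σ τ hv).eventuallyEq_of_mem hn).symm
    exact (((((H.continuousOn_dirFamilyTwo σ τ).continuousAt hcl).sub ((c1 τ).mul (cq _))).sub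
      ((c1 σ).mul (cq _))).sub (c0.mul (cq _))).div (cq q) hq
  refine ⟨fun a b => mixedDeriv (unitVec 0) (unitVec 1) a b v x,
    forall_add_lt_three c0 (c1 _) (c1 _) (c2 _ _) (c2 _ _) (c2 _ _), fun p hp => ?_⟩
  have p0 : polyFun p x = v x := hp 0 0 (by norm_num)
  have p1 : ∀ σ, polyFun (polyD σ p) x = dirDeriv σ v x := by
    intro σ
    have h1 : polyFun (MvPolynomial.pderiv 0 p) x = fderiv ℝ v x (unitVec 0) :=
      hp 1 0 (by norm_num)
    have h2 : polyFun (MvPolynomial.pderiv 1 p) x = fderiv ℝ v x (unitVec 1) :=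
      hp 0 1 (by norm_num)
    rw [polyD, polyFun_add, polyFun_mul, polyFun_mul, polyFun_C, polyFun_C, h1, h2, dirDeriv]
    conv_rhs => rw [plane_eq σ, map_add, map_smul, map_smul]
    rfl
  have hd : ∀ σ τ, polyFun q x * dirDeriv τ (dirDeriv σ v) x =
      dirFamilyTwo g σ τ x - dirDeriv τ v x * polyFun (polyD σ q) x -
        dirDeriv σ v x * polyFun (polyD τ q) x - v x * polyFun (polyD τ (polyD σ q)) x := by
    intro σ τ
    rw [dirDeriv_dirDeriv_div_eqOn H hS hSΩ hqS σ τ hv hxS]; field_simp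
  have hd1 : ∀ σ, polyFun q x * dirDeriv σ v x =
      dirFamily σ g 0 0 x - v x * polyFun (polyD σ q) x := by
    intro σ
    rw [hv, dirDeriv_div_eqOn H hSΩ hqS σ hxS]; field_simp
  have hd0 : polyFun q x * v x = g 0 0 x := by rw [hv]; field_simp
  have e1 : ∀ i, polyFun (polyD (unitVec i) (p * q)) x = dirFamily (unitVec i) g 0 0 x := by
    intro i
    rw [polyD_mul, polyFun_add, polyFun_mul, polyFun_mul, p1, p0]
    linarith [hd1 (unitVec i)]
  have e2 : ∀ i k, polyFun (polyD (unitVec k) (polyD (unitVec i) p)) x =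
        dirDeriv (unitVec k) (dirDeriv (unitVec i) v) x →
      polyFun (polyD (unitVec k) (polyD (unitVec i) (p * q))) x =
        dirFamilyTwo g (unitVec i) (unitVec k) x := by
    intro i k h
    simp only [polyD_mul, polyD_add, polyFun_add, polyFun_mul, p1, p0, h]
    linarith [hd (unitVec i) (unitVec k)]
  have q00 := e2 0 0 (by rw [polyD_unitVec]; exact hp 2 0 (by norm_num))
  have q10 := e2 1 0 (by rw [polyD_unitVec, polyD_unitVec]; exact hp 1 1 (by norm_num))
  have q11 := e2 1 1 (by rw [polyD_unitVec]; exact hp 0 2 (by norm_num))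
  have q0 := e1 0
  have q1 := e1 1
  simp only [polyD_unitVec, dirFamilyTwo, dirFamily, unitVec_zero_zero, unitVec_zero_one,
    unitVec_one_zero, unitVec_one_one, one_mul, zero_mul, add_zero, zero_add] at q00 q10 q11 q0 q1
  refine forall_add_lt_three ?_ q0 q1 q00 q10 q11
  show polyFun (p * q) x = _
  rw [polyFun_mul, p0, mul_comm, hd0]

lemma HitsAlong.mono {U Z Z' : Set Plane} {m x : Plane} (h : HitsAlong U Z m x) (hZ : Z ⊆ Z') :
    HitsAlong U Z' m x := fun r hr =>
  (h r hr).mono fun _ ⟨s, hs, hz, hρ⟩ => ⟨s, hs, hZ hz, hρ⟩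

/-- The interpolation of the quotient at a point on the boundary yields the derivatives of the
function itself. -/
lemma exists_jet_div_boundary {Ω U Z : Set Plane} {g : ℕ → ℕ → Plane → ℝ} (H : IsC3Family Ω g)
    {q : BiPoly} {m x : Plane} (hit : HitsAlong U Z m x) (hUΩ : U ⊆ Ω)
    (hx : x ∈ closure Ω)
    (hxZ : x ∈ Z) (hq : ∀ y ∈ U, 0 < polyFun q y) (hm : 0 < inner ℝ (gradV q x) m)
    (hqZ : ∀ z ∈ Z, polyFun q z = 0) (hgZ : ∀ z ∈ Z, g 0 0 z = 0)
    (hcomm : ∀ F F', C1On Ω F F' → (∀ z ∈ Z, F z = 0) → ∀ z ∈ Z, ∀ σ τ,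
      F' z σ * polyFun (polyD τ q) z = F' z τ * polyFun (polyD σ q) z) :
    ∃ J : ℕ → ℕ → ℝ,
      (∀ a b, a + b < 2 → Tendsto (mixedDeriv (unitVec 0) (unitVec 1) a b
        fun y => g 0 0 y / polyFun q y) (𝓝[U] x) (𝓝 (J a b))) ∧
      ∀ p, (∀ a b, a + b < 2 → polyFun (partPoly a b p) x = J a b) →
        ∀ a b, a + b < 3 → polyFun (partPoly a b (p * q)) x = g a b x := by
  have hqU : ∀ᶠ y in 𝓝[U] x, 0 < polyFun q y := eventually_mem_nhdsWithin.mono hq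
  have hq0 : ∀ y ∈ U, polyFun q y ≠ 0 := fun y hy => (hq y hy).ne'
  have hqm : polyFun (polyD m q) x ≠ 0 := by rw [polyFun_polyD]; exact hm.ne'
  have hqm' : ∀ᶠ y in 𝓝[U] x, 0 < polyFun (polyD m q) y := eventually_polyD_ne hm U
  have tq : ∀ r : BiPoly, Tendsto (polyFun r) (𝓝[U] x) (𝓝 (polyFun r x)) := fun r =>
    (continuous_polyFun r).continuousAt.mono_left nhdsWithin_le_nhds
  have tcl : ∀ F : Plane → ℝ, ContinuousOn F (closure Ω) → Tendsto F (𝓝[U] x) (𝓝 (F x)) :=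
    fun F hF => (hF x hx).mono_left (nhdsWithin_mono _ (hUΩ.trans subset_closure))
  have hw := H.c1On
  have hcw : ∀ z ∈ Z, ∀ σ τ, dirFamily σ g 0 0 z * polyFun (polyD τ q) z =
      dirFamily τ g 0 0 z * polyFun (polyD σ q) z := by
    intro z hz σ τ
    have := hcomm _ _ hw hgZ z hz σ τ
    rwa [linForm_dirFamily, linForm_dirFamily] at this
  set v := fun y => g 0 0 y / polyFun q y with hv
  -- The limit of w/q at x by the rule of L'Hôpital in the direction m.
  set v0 := dirFamily m g 0 0 x / polyFun (polyD m q) x with hv0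
  have t0 : Tendsto v (𝓝[U] x) (𝓝 v0) := by
    have := hit.tendsto_div hUΩ hx hqU hm hqZ hw hgZ
    rwa [linForm_dirFamily] at this
  have w1 : ∀ σ, dirFamily σ g 0 0 x = v0 * polyFun (polyD σ q) x := by
    intro σ
    rw [hv0, div_mul_eq_mul_div, eq_div_iff hqm, hcw x hxZ σ m]
  -- the derivative in the direction `m`
  set A := (dirFamilyTwo g m m x - v0 * polyFun (polyD m (polyD m q)) x) /
    (2 * polyFun (polyD m q) x) with hA
  -- The fraction is D_m(w/q). Differentiating numerator and denominator along m, the products of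
  -- first derivatives cancel; after division by q there remains (D_m²w - (w/q) D_m²q)/(2 D_m q).
  have tA : Tendsto (fun y => (dirFamily m g 0 0 y * polyFun q y -
      g 0 0 y * polyFun (polyD m q) y) / (polyFun q y * polyFun q y)) (𝓝[U] x) (𝓝 A) := by
    have hF := ((H.c1On_dirFamily m).mul (c1On_polyFun Ω q)).sub
      (hw.mul (c1On_polyFun Ω (polyD m q)))
    have hH := (c1On_polyFun Ω q).mul (c1On_polyFun Ω q)
    refine hit.lhopital (hF.mono hUΩ) (hH.mono hUΩ) (fun z hz => ?_) (fun z hz => ?_)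
      (hqU.mono fun y hy => ?_) ?_ ?_
    · rw [hqZ z hz, hgZ z hz]; ring
    · rw [hqZ z hz]; ring
    · positivity
    · filter_upwards [hqU, hqm'] with y h1 h2
      simp only [add_apply, smul_apply, polyGrad_apply,
        smul_eq_mul]
      positivity
    · have ht : Tendsto (fun y => (dirFamilyTwo g m m y - v y * polyFun (polyD m (polyD m q)) y) /
          (2 * polyFun (polyD m q) y)) (𝓝[U] x) (𝓝 A) :=
        ((tcl _ (H.continuousOn_dirFamilyTwo m m)).sub (t0.mul (tq _))).div
          ((tq _).const_mul 2) (mul_ne_zero two_ne_zero hqm)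
      refine ht.congr' ?_
      filter_upwards [hqU, hqm'] with y h1 h2
      simp only [add_apply, sub_apply,
        smul_apply, polyGrad_apply, smul_eq_mul, linForm_dirFamily, dirFamilyTwo, hv]
      field_simp
      ring
  -- derivatives in arbitrary directions
  set E := fun σ τ => dirFamilyTwo g σ τ x - v0 * polyFun (polyD τ (polyD σ q)) x with hE
  have hEcomm : ∀ σ τ, E σ τ = E τ σ := fun σ τ => by
    simp only [hE, dirFamilyTwo_comm g σ τ, polyD_comm σ τ]
  -- N_σ = D_σw D_mq - D_mw D_σq vanishes on the arc by collinearity, so N_σ/q has a limit; and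
  -- D_σ(w/q) = N_σ/(q D_mq) + (D_σq/D_mq) D_m(w/q).
  have hN := fun σ => ((H.c1On_dirFamily σ).mul (c1On_polyFun Ω (polyD m q))).sub
    ((H.c1On_dirFamily m).mul (c1On_polyFun Ω (polyD σ q)))
  have hNZ : ∀ σ, ∀ z ∈ Z, dirFamily σ g 0 0 z * polyFun (polyD m q) z -
      dirFamily m g 0 0 z * polyFun (polyD σ q) z = 0 := fun σ z hz => by
    rw [hcw z hz σ m, sub_self]
  -- Collinearity once more, now for the gradients of N_σ and q, with ∇w = v0 ∇q at x.
  have hE2 : ∀ σ τ, (E σ τ * polyFun (polyD m q) x - E m τ * polyFun (polyD σ q) x) *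
      polyFun (polyD m q) x =
      (E σ m * polyFun (polyD m q) x - E m m * polyFun (polyD σ q) x) * polyFun (polyD τ q) x := by
    intro σ τ
    have := hcomm _ _ (hN σ) (hNZ σ) x hxZ τ m
    simp only [add_apply, sub_apply,
      smul_apply, polyGrad_apply, smul_eq_mul,
      linForm_dirFamilyTwo, w1] at this
    simp only [hE]
    linear_combination this
  set L := fun σ => (E σ m * polyFun (polyD m q) x - E m m * polyFun (polyD σ q) x) /
    (polyFun (polyD m q) x * polyFun (polyD m q) x) +
    polyFun (polyD σ q) x / polyFun (polyD m q) x * A with hL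
  have tL : ∀ σ, Tendsto (dirDeriv σ v) (𝓝[U] x) (𝓝 (L σ)) := by
    intro σ
    have hB := hit.tendsto_div hUΩ hx hqU hm hqZ (hN σ) (hNZ σ)
    have hB' := (hB.div (tq (polyD m q)) hqm).add
      (((tq (polyD σ q)).div (tq (polyD m q)) hqm).mul tA)
    have hB2 : Tendsto (dirDeriv σ v) (𝓝[U] x) _ := hB'.congr' (by
      filter_upwards [hqU, hqm', self_mem_nhdsWithin] with y h1 h2 hy
      rw [hv, dirDeriv_div_eqOn H hUΩ hq0 σ hy]
      simp only [Pi.div_apply]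
      field_simp
      ring)
    convert hB2 using 2
    simp only [hL, add_apply, sub_apply, smul_apply, polyGrad_apply, smul_eq_mul,
      linForm_dirFamilyTwo, w1, hE]
    rw [div_div]
    congr 2
    ring
  -- Since q(x) = 0, the second derivative of pq in the directions σ, τ is D_σp D_τq + D_τp D_σq + p
  -- D_τD_σq. The identity says that it is that of `w` as soon as p has the limits as its 1-jet.
  have hfin : ∀ σ τ, L σ * polyFun (polyD τ q) x + L τ * polyFun (polyD σ q) x = E σ τ := by
    intro σ τ
    have h := hE2 σ τ
    rw [hEcomm m τ] at h
    have hA' : A = E m m / (2 * polyFun (polyD m q) x) := rfl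
    simp only [hL, hA']
    field_simp
    linear_combination (-2) * h
  refine ⟨fun a b => if a = 0 ∧ b = 0 then v0 else if b = 0 then L (unitVec 0) else
    L (unitVec 1), forall_add_lt_two (by simpa [mixedDeriv] using t0)
      (by simpa [mixedDeriv] using tL (unitVec 0))
      (by simpa [mixedDeriv] using tL (unitVec 1)), fun p hp => ?_⟩
  have p0 : polyFun p x = v0 := by simpa [partPoly] using hp 0 0 (by norm_num)
  have p1 : ∀ i, polyFun (polyD (unitVec i) p) x = L (unitVec i) := by
    intro i
    rw [polyD_unitVec]
    fin_cases i
    · simpa [partPoly] using hp 1 0 (by norm_num)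
    · simpa [partPoly] using hp 0 1 (by norm_num)
  have e1 : ∀ i, polyFun (polyD (unitVec i) (p * q)) x = dirFamily (unitVec i) g 0 0 x := by
    intro i
    rw [polyD_mul, polyFun_add, polyFun_mul, polyFun_mul, p0, hqZ x hxZ, w1]; ring
  have e2 : ∀ i k, polyFun (polyD (unitVec k) (polyD (unitVec i) (p * q))) x =
        dirFamilyTwo g (unitVec i) (unitVec k) x := by
    intro i k
    simp only [polyD_mul, polyD_add, polyFun_add, polyFun_mul, p1, p0, hqZ x hxZ]
    have := hfin (unitVec i) (unitVec k)
    simp only [hE] at this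
    linear_combination this
  have q00 := e2 0 0
  have q10 := e2 1 0
  have q11 := e2 1 1
  have q0 := e1 0
  have q1 := e1 1
  simp only [polyD_unitVec, dirFamilyTwo, dirFamily, unitVec_zero_zero, unitVec_zero_one,
    unitVec_one_zero, unitVec_one_one, one_mul, zero_mul, add_zero, zero_add] at q00 q10 q11 q0 q1
  refine forall_add_lt_three ?_ q0 q1 q00 q10 q11
  show polyFun (p * q) x = _
  rw [polyFun_mul, hqZ x hxZ, mul_zero, hgZ x hxZ]

end ConicSpline

namespace ConicSpline

/-! ### Nodal values -/

lemma dirDeriv_congr_of_isOpen {S : Set Plane} (hS : IsOpen S) {f f' : Plane → ℝ}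
    (h : EqOn f f' S) (τ : Plane) : EqOn (dirDeriv τ f) (dirDeriv τ f') S := fun x hx => by
  rw [dirDeriv, dirDeriv, (h.eventuallyEq_of_mem (hS.mem_nhds hx)).fderiv_eq]

lemma mixedDeriv_congr_of_isOpen {S : Set Plane} (hS : IsOpen S) {f f' : Plane → ℝ}
    (h : EqOn f f' S) (σ τ : Plane) (a b : ℕ) :
    EqOn (mixedDeriv σ τ a b f) (mixedDeriv σ τ a b f') S := by
  have h1 : ∀ (c : ℕ) (ρ : Plane) (f f' : Plane → ℝ), EqOn f f' S →
      EqOn ((dirDeriv ρ)^[c] f) ((dirDeriv ρ)^[c] f') S := by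
    intro c ρ
    induction c with
    | zero => exact fun _ _ h => h
    | succ c ih =>
      intro f f' h
      exact ih _ _ (dirDeriv_congr_of_isOpen hS h ρ)
  exact h1 a σ _ _ (h1 b τ _ _ h)

lemma hasValue_congr {K : Set Plane} {f f' : Plane → ℝ} (h : EqOn f f' (interior K))
    (η : NodalFunctional) (c : ℝ) : η.HasValue K f c ↔ η.HasValue K f' c :=
  tendsto_congr' ((mixedDeriv_congr_of_isOpen isOpen_interior h _ _ _ _).eventuallyEq_of_mem
    self_mem_nhdsWithin)

lemma poly_jet (z : Plane) (a b : ℕ) (p : BiPoly) :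
    (⟨z, unitVec 0, unitVec 1, a, b⟩ : NodalFunctional).poly p = polyFun (partPoly a b p) z := by
  rw [NodalFunctional.poly, mixedDeriv_polyFun]

lemma poly_normal (z τ : Plane) (p : BiPoly) :
    (⟨z, τ, τ, 1, 0⟩ : NodalFunctional).poly p = polyFun (polyD τ p) z :=
  congrFun (dirDeriv_polyFun τ p) z

/-- Normals to the edge are multiples of `rot d`, so the two unit normals and the unnormalized one
impose the same condition. -/
lemma forall_normal_iff (l l' : Plane →L[ℝ] ℝ) {d : Plane} (hd : d ≠ 0) :
    (∀ τ : Plane, ‖τ‖ = 1 → inner ℝ τ d = 0 → l τ = l' τ) ↔ l (rot d) = l' (rot d) := by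
  constructor
  · intro h
    have hr : rot d ≠ 0 := (ne_of_cross_ne (cross_rot_ne hd)).2
    have hn : ‖rot d‖ ≠ 0 := norm_ne_zero_iff.2 hr
    have h1 := h (‖rot d‖⁻¹ • rot d) (by rw [norm_smul, norm_inv, norm_norm, inv_mul_cancel₀ hn])
      (by rw [real_inner_smul_left, inner_plane]; simp; right; ring)
    rw [map_smul, map_smul] at h1
    exact smul_right_injective ℝ (inv_ne_zero hn) h1
  · intro h τ _ hτ
    obtain ⟨c, rfl⟩ := eq_smul_rot hd hτ
    rw [map_smul, map_smul, h]

lemma edgePoint_one (a b : Plane) : edgePoint a b 1 = a + (1 / 4 : ℝ) • (b - a) := by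
  simp [edgePoint]
lemma edgePoint_two (a b : Plane) : edgePoint a b 2 = a + (2 / 4 : ℝ) • (b - a) := by
  simp [edgePoint]
lemma edgePoint_three (a b : Plane) : edgePoint a b 3 = a + (3 / 4 : ℝ) • (b - a) := by
  simp [edgePoint]

lemma polyD_rot_sub (r : BiPoly) (a b x : Plane) :
    polyFun (polyD (rot (a - b)) r) x = -polyFun (polyD (rot (b - a)) r) x := by
  have : rot (a - b) = (-1 : ℝ) • rot (b - a) := by
    apply plane_ext <;> simp
  rw [this, polyD_smul, neg_one_mul]

/-- `r` has the value zero at the midpoint of an edge, and zero normal derivatives at the points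
which divide it in the ratios `1 : 3` and `3 : 1`. -/
def VanishesOnEdge (r : BiPoly) (a b : Plane) : Prop :=
  polyFun r (a + (2 / 4 : ℝ) • (b - a)) = 0 ∧
    polyFun (polyD (rot (b - a)) r) (a + (1 / 4 : ℝ) • (b - a)) = 0 ∧
    polyFun (polyD (rot (b - a)) r) (a + (3 / 4 : ℝ) • (b - a)) = 0

lemma VanishesOnEdge.symm {r : BiPoly} {a b : Plane} (h : VanishesOnEdge r a b) :
    VanishesOnEdge r b a := by
  obtain ⟨h2, h1, h3⟩ := h
  have e : ∀ t : ℝ, b + t • (a - b) = a + (1 - t) • (b - a) := fun t => by module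
  refine ⟨?_, ?_, ?_⟩
  · rw [e]; norm_num at h2 ⊢; exact h2
  · rw [e, polyD_rot_sub, neg_eq_zero]; norm_num at h3 ⊢; exact h3
  · rw [e, polyD_rot_sub, neg_eq_zero]; norm_num at h1 ⊢; exact h1

lemma forall_normalNodes_iff {p p' : BiPoly} {a b : Plane} (hab : a ≠ b) (z : Plane) :
    (∀ η ∈ normalNodes a b z, η.poly p = η.poly p') ↔
      polyFun (polyD (rot (b - a)) (p - p')) z = 0 := by
  rw [polyD_sub, polyFun_sub, sub_eq_zero, ← polyGrad_apply, ← polyGrad_apply,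
    ← forall_normal_iff _ _ (sub_ne_zero.2 hab.symm)]
  constructor
  · intro h τ h1 h2
    have := h _ ⟨τ, h1, h2, rfl⟩
    rwa [poly_normal, poly_normal, ← polyGrad_apply, ← polyGrad_apply] at this
  · rintro h _ ⟨τ, h1, h2, rfl⟩
    rw [poly_normal, poly_normal, ← polyGrad_apply, ← polyGrad_apply]
    exact h τ h1 h2

lemma forall_jetNodes_iff {p p' : BiPoly} {z : Plane} {k : ℕ} :
    (∀ η ∈ jetNodes z k, η.poly p = η.poly p') ↔
      ∀ a b, a + b ≤ k → polyFun (partPoly a b p) z = polyFun (partPoly a b p') z := by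
  constructor
  · intro h a b hab
    rw [← poly_jet, ← poly_jet]; exact h _ ⟨a, b, hab, rfl⟩
  · rintro h _ ⟨a, b, hab, rfl⟩
    rw [poly_jet, poly_jet]; exact h a b hab

lemma forall_edgeNodes_iff {p p' : BiPoly} {a b : Plane} (hab : a ≠ b) :
    (∀ η ∈ edgeNodes a b, η.poly p = η.poly p') ↔ VanishesOnEdge (p - p') a b := by
  have h0 : (∀ η ∈ jetNodes (edgePoint a b 2) 0, η.poly p = η.poly p') ↔
      polyFun (p - p') (a + (2 / 4 : ℝ) • (b - a)) = 0 := by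
    rw [forall_jetNodes_iff, polyFun_sub, sub_eq_zero, edgePoint_two]
    constructor
    · intro h; exact h 0 0 le_rfl
    · intro h c d hcd
      obtain ⟨rfl, rfl⟩ : c = 0 ∧ d = 0 := by omega
      exact h
  rw [VanishesOnEdge, ← h0, ← edgePoint_one, ← edgePoint_three, ← forall_normalNodes_iff hab,
    ← forall_normalNodes_iff hab]
  simp only [edgeNodes, mem_union]
  constructor
  · exact fun h => ⟨fun η hη => h η (.inl (.inl hη)), fun η hη => h η (.inl (.inr hη)),
      fun η hη => h η (.inr hη)⟩
  · rintro ⟨h1, h2, h3⟩ η ((hη | hη) | hη)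
    exacts [h1 η hη, h2 η hη, h3 η hη]

lemma vanOrd_sub_iff {k : ℕ} {p p' : BiPoly} {z : Plane} :
    VanOrd k (p - p') z ↔
      ∀ a b, a + b < k → polyFun (partPoly a b p) z = polyFun (partPoly a b p') z := by
  simp only [VanOrd, partPoly_sub, polyFun_sub, sub_eq_zero]

lemma vanOrd_two_of_vanishesOnEdge {r : BiPoly} {a b : Plane} (hab : a ≠ b)
    (hr : r.totalDegree ≤ 6) (ha : VanOrd 3 r a) (hb : VanOrd 3 r b) (h : VanishesOnEdge r a b)
    {x : Plane} (hx : x ∈ segment ℝ a b) : VanOrd 2 r x := by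
  rw [segment_eq_image'] at hx
  obtain ⟨t, -, rfl⟩ := hx
  exact vanOrd_edge_six (sub_ne_zero.2 hab.symm) hr ha (by rwa [add_sub_cancel]) h.1 h.2.1 h.2.2 t

/-- `p` has the normal derivative given by the family `g` at the midpoint of an edge. -/
def MatchesNormal (g : ℕ → ℕ → Plane → ℝ) (p : BiPoly) (a b : Plane) : Prop :=
  polyFun (polyD (rot (b - a)) p) (a + (2 / 4 : ℝ) • (b - a)) =
    dirFamily (rot (b - a)) g 0 0 (a + (2 / 4 : ℝ) • (b - a))

lemma MatchesNormal.symm {g : ℕ → ℕ → Plane → ℝ} {p : BiPoly} {a b : Plane}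
    (h : MatchesNormal g p a b) : MatchesNormal g p b a := by
  unfold MatchesNormal at h ⊢
  have e : b + (2 / 4 : ℝ) • (a - b) = a + (2 / 4 : ℝ) • (b - a) := by module
  have e' : ∀ x, dirFamily (rot (a - b)) g 0 0 x = -dirFamily (rot (b - a)) g 0 0 x := fun x => by
    simp [dirFamily]; ring
  rw [e, polyD_rot_sub, e', h]

namespace CurvedTriangles.IsTriangulation
variable {n : ℕ} [NeZero n] {D : ConicDomain n} {ι : Type} {Δ : CurvedTriangles D ι}
variable (hΔ : Δ.IsTriangulation)
include hΔ

/-- A triangle is the closure of its interior, so limits from the interior are unique, and nodal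
conditions become equations. -/
lemma hasValue_iff {T : ι} {η : NodalFunctional} {f : Plane → ℝ} {c c' : ℝ}
    (hz : η.point ∈ Δ.cell T) (h : η.HasValue (Δ.cell T) f c') :
    η.HasValue (Δ.cell T) f c ↔ c = c' := by
  have : (𝓝[interior (Δ.cell T)] η.point).NeBot :=
    mem_closure_iff_nhdsWithin_neBot.1 (by rwa [hΔ.closure_interior_cell])
  exact ⟨fun h' => tendsto_nhds_unique h' h, by rintro rfl; exact h⟩

variable {g : ℕ → ℕ → Plane → ℝ} (H : IsC3Family (D.Ω : Set Plane) g) {w : Plane → ℝ}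
  (hw : EqOn w (g 0 0) D.Ω)
include H hw

lemma hasValue_jet_iff {T : ι} {z : Plane} (hz : z ∈ Δ.cell T) {a b : ℕ} (hab : a + b ≤ 3)
    {c : ℝ} : (⟨z, unitVec 0, unitVec 1, a, b⟩ : NodalFunctional).HasValue (Δ.cell T) w c ↔
      c = g a b z := by
  refine hΔ.hasValue_iff hz ?_
  have h1 : Tendsto (g a b) (𝓝[interior (Δ.cell T)] z) (𝓝 (g a b z)) :=
    (H.continuousOn a b hab z (hΔ.cell_subset_closure T hz)).mono_left
      (nhdsWithin_mono _ ((hΔ.interior_cell_subset T).trans subset_closure))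
  refine h1.congr' (eventually_mem_nhdsWithin.mono fun y hy => ?_)
  exact (H.isDerivFamily.partialDeriv_eqOn D.Ω.isOpen hw hab (hΔ.interior_cell_subset T hy)).symm

lemma hasValue_normal_iff {T : ι} {z : Plane} (hz : z ∈ Δ.cell T) {τ : Plane}
    {c : ℝ} : (⟨z, τ, τ, 1, 0⟩ : NodalFunctional).HasValue (Δ.cell T) w c ↔
      c = dirFamily τ g 0 0 z := by
  refine hΔ.hasValue_iff hz ?_
  have h1 : Tendsto (dirFamily τ g 0 0) (𝓝[interior (Δ.cell T)] z) (𝓝 (dirFamily τ g 0 0 z)) :=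
    ((H.c1On_dirFamily τ).continuousOn z (hΔ.cell_subset_closure T hz)).mono_left
      (nhdsWithin_mono _ ((hΔ.interior_cell_subset T).trans subset_closure))
  refine h1.congr' (eventually_mem_nhdsWithin.mono fun y hy => ?_)
  exact (H.isDerivFamily.dirDeriv_eqOn D.Ω.isOpen (by norm_num) hw τ
    (hΔ.interior_cell_subset T hy)).symm

lemma forall_hasValue_jetNodes_iff {T : ι} {z : Plane} (hz : z ∈ Δ.cell T) {k : ℕ} (hk : k ≤ 3)
    {p : BiPoly} : (∀ η ∈ jetNodes z k, η.HasValue (Δ.cell T) w (η.poly p)) ↔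
      ∀ a b, a + b ≤ k → polyFun (partPoly a b p) z = g a b z := by
  constructor
  · intro h a b hab
    rw [← poly_jet]; exact (hΔ.hasValue_jet_iff H hw hz (hab.trans hk)).1 (h _ ⟨a, b, hab, rfl⟩)
  · rintro h _ ⟨a, b, hab, rfl⟩
    rw [poly_jet, hΔ.hasValue_jet_iff H hw hz (hab.trans hk)]; exact h a b hab

lemma forall_hasValue_normalNodes_iff {T : ι} {z : Plane} (hz : z ∈ Δ.cell T) {v v' : Plane}
    (hv : v ≠ v') {p : BiPoly} :
    (∀ η ∈ normalNodes v v' z, η.HasValue (Δ.cell T) w (η.poly p)) ↔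
      polyFun (polyD (rot (v' - v)) p) z = dirFamily (rot (v' - v)) g 0 0 z := by
  rw [← polyGrad_apply, ← linForm_dirFamily, ← forall_normal_iff _ _ (sub_ne_zero.2 hv.symm)]
  constructor
  · intro h τ h1 h2
    have := h _ ⟨τ, h1, h2, rfl⟩
    rwa [hΔ.hasValue_normal_iff H hw hz, poly_normal, ← polyGrad_apply, ← linForm_dirFamily] at this
  · rintro h _ ⟨τ, h1, h2, rfl⟩
    rw [hΔ.hasValue_normal_iff H hw hz, poly_normal, ← polyGrad_apply, ← linForm_dirFamily]
    exact h τ h1 h2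

/-- The conditions for the local interpolant of an ordinary triangle. -/
lemma forall_nodesOrdinary_iff {T : ι} (hT : T ∉ Δ.pie) {p : BiPoly} :
    (∀ η ∈ Δ.nodesOrdinary T, η.HasValue (Δ.cell T) w (η.poly p)) ↔
      (∀ i a b, a + b < 3 → polyFun (partPoly a b p) (Δ.vert T i) = g a b (Δ.vert T i)) ∧
      ∀ i k, i ≠ k → MatchesNormal g p (Δ.vert T i) (Δ.vert T k) := by
  have hjet := fun i => hΔ.forall_hasValue_jetNodes_iff H hw (hΔ.vert_mem_cell T i)
    (k := 2) (by norm_num) (p := p)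
  have hnorm : ∀ i k, i ≠ k → ((∀ η ∈ normalNodes (Δ.vert T i) (Δ.vert T k)
      (edgePoint (Δ.vert T i) (Δ.vert T k) 2), η.HasValue (Δ.cell T) w (η.poly p)) ↔
      MatchesNormal g p (Δ.vert T i) (Δ.vert T k)) := by
    intro i k hik
    rw [edgePoint_two]
    refine hΔ.forall_hasValue_normalNodes_iff H hw ?_ fun h => hik (hΔ.vert_injective T h)
    refine hΔ.segment_subset_cell (isStraight_of_notMem hT hik) ?_
    rw [segment_eq_image']
    exact ⟨2 / 4, by norm_num, rfl⟩
  constructor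
  · intro h
    refine ⟨fun i a b hab => (hjet i).1 (fun η hη => h η (.inl (mem_iUnion.2 ⟨i, hη⟩))) a b
      (by omega), ?_⟩
    have hlt : ∀ i k, i < k → MatchesNormal g p (Δ.vert T i) (Δ.vert T k) := fun i k hik =>
      (hnorm i k hik.ne).1 fun η hη => h η (.inr (by
        simp only [mem_iUnion]; exact ⟨i, k, hik, hη⟩))
    intro i k hik
    rcases hik.lt_or_gt with h | h
    · exact hlt i k h
    · exact (hlt k i h).symm
  · rintro ⟨h1, h2⟩ η (hη | hη)
    · obtain ⟨i, hη⟩ := mem_iUnion.1 hη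
      exact (hjet i).2 (fun a b hab => h1 i a b (by omega)) η hη
    · simp only [mem_iUnion] at hη
      obtain ⟨i, k, hik, hη⟩ := hη
      exact (hnorm i k hik.ne).2 (h2 i k hik.ne) η hη

end CurvedTriangles.IsTriangulation

/-! ### Interpolation data on pie-shaped triangles -/

namespace CurvedTriangles.IsTriangulation
variable {n : ℕ} [NeZero n] {D : ConicDomain n} {ι : Type} {Δ : CurvedTriangles D ι}
variable (hΔ : Δ.IsTriangulation)
include hΔ

lemma center_mem_interior {T : ι} (hT : T ∈ Δ.pie) :
    Δ.center T ∈ interior (Δ.cell T) ∧ Δ.center T ∈ interior (Δ.straightened T) := by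
  rw [← mem_inter_iff, ← interior_inter]
  exact mem_interior.2 ⟨_, Metric.ball_subset_closedBall.trans (hΔ.disk_subset T hT),
    Metric.isOpen_ball, Metric.mem_ball_self (hΔ.radius_pos T hT)⟩

variable [Finite ι] (hAF : Δ.IsAdmissible) {g : ℕ → ℕ → Plane → ℝ}
  (H : IsC3Family (D.Ω : Set Plane) g)
include hAF H

/-- The data of the quotient at a boundary vertex of a pie-shaped triangle. -/
lemma exists_jet_pie {T : ι} (hT : T ∈ Δ.pie) {i : Fin 3} (hi : i ≠ 0) :
    ∃ J : ℕ → ℕ → ℝ,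
      (∀ a b, a + b < 2 → Tendsto (mixedDeriv (unitVec 0) (unitVec 1) a b
        fun y => g 0 0 y / polyFun (Δ.conic T) y) (𝓝[interior (Δ.cell T)] (Δ.vert T i))
          (𝓝 (J a b))) ∧
      ∀ p, (∀ a b, a + b < 2 → polyFun (partPoly a b p) (Δ.vert T i) = J a b) →
        ∀ a b, a + b < 3 →
          polyFun (partPoly a b (p * Δ.conic T)) (Δ.vert T i) = g a b (Δ.vert T i) := by
  obtain ⟨m, hm, hit⟩ := hΔ.exists_hitsAlong hAF hT hi
  have hsub := hΔ.curvedEdge_subset_closedArc hT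
  refine exists_jet_div_boundary H (hit.mono hsub) (hΔ.interior_cell_subset T)
    (hΔ.cell_subset_closure T (hΔ.vert_mem_cell T i)) (hsub (hΔ.vert_mem_curvedEdge hT hi))
    (fun y hy => conic_pos_of_mem hΔ hAF hT (interior_subset hy) (hΔ.interior_cell_subset T hy)) hm
    ?_ (fun z hz => H.frontier_eq_zero z (hΔ.closedArc_subset_frontier _ hz)) ?_
  · rintro _ ⟨t, ht, rfl⟩
    exact D.q_zero_closed _ ht
  · rintro F F' hF hF0 _ ⟨t, ht, rfl⟩ σ τ
    exact D.deriv_mul_comm_of_eq_zero _ hF (fun t ht => hF0 _ ⟨t, Ioo_subset_Icc_self ht, rfl⟩)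
      ht σ τ

/-- The conditions for the local interpolant of a pie-shaped triangle. -/
lemma exists_data_pie {T : ι} (hT : T ∈ Δ.pie) :
    ∃ (J₀ : ℕ → ℕ → ℝ) (J : Fin 3 → ℕ → ℕ → ℝ), ∀ p : BiPoly,
      (∀ w : Plane → ℝ, EqOn w (g 0 0) D.Ω →
        ((∀ η ∈ Δ.nodesPie T,
          η.HasValue (Δ.cell T) (fun x => w x / polyFun (Δ.conic T) x) (η.poly p)) ↔
        (∀ a b, a + b < 3 → polyFun (partPoly a b p) (Δ.vert T 0) = J₀ a b) ∧
        ∀ k a b, a + b < 2 → polyFun (partPoly a b p)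
          (![Δ.center T, Δ.vert T 1, Δ.vert T 2] k) = J k a b)) ∧
      ((∀ a b, a + b < 3 → polyFun (partPoly a b p) (Δ.vert T 0) = J₀ a b) →
        (∀ k a b, a + b < 2 → polyFun (partPoly a b p)
          (![Δ.center T, Δ.vert T 1, Δ.vert T 2] k) = J k a b) →
        ∀ i a b, a + b < 3 →
          polyFun (partPoly a b (p * Δ.conic T)) (Δ.vert T i) = g a b (Δ.vert T i)) := by
  have h0Ω := vert_zero_mem hΔ hAF hT
  have hcI := (hΔ.center_mem_interior hT).1
  have hcΩ := hΔ.interior_cell_subset T hcI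
  have hcm := interior_subset hcI
  obtain ⟨J₀, hJ₀, hp₀⟩ := exists_jet_div_interior D.Ω.isOpen H h0Ω
    (conic_pos_of_mem hΔ hAF hT (hΔ.vert_mem_cell T 0) h0Ω).ne'
  -- At the center only the limits are needed: it is not a vertex, so no jet of the product is
  -- compared there.
  obtain ⟨Jc, hJc, -⟩ := exists_jet_div_interior D.Ω.isOpen H hcΩ
    (conic_pos_of_mem hΔ hAF hT hcm hcΩ).ne'
  obtain ⟨J₁, hJ₁, hp₁⟩ := hΔ.exists_jet_pie hAF H hT (i := 1) (by decide)
  obtain ⟨J₂, hJ₂, hp₂⟩ := hΔ.exists_jet_pie hAF H hT (i := 2) (by decide)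
  refine ⟨J₀, ![Jc, J₁, J₂], fun p => ⟨fun w hw => ?_, fun h0 h i => ?_⟩⟩
  · have hiff : ∀ (z : Plane) (k : ℕ) (J : ℕ → ℕ → ℝ), z ∈ Δ.cell T →
        (∀ a b, a + b < k + 1 → Tendsto (mixedDeriv (unitVec 0) (unitVec 1) a b
          fun y => g 0 0 y / polyFun (Δ.conic T) y) (𝓝[interior (Δ.cell T)] z) (𝓝 (J a b))) →
        ((∀ η ∈ jetNodes z k, η.HasValue (Δ.cell T)
          (fun x => w x / polyFun (Δ.conic T) x) (η.poly p)) ↔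
        ∀ a b, a + b < k + 1 → polyFun (partPoly a b p) z = J a b) := by
      intro z k J hz hJ
      have hc : EqOn (fun x => w x / polyFun (Δ.conic T) x)
          (fun x => g 0 0 x / polyFun (Δ.conic T) x) (interior (Δ.cell T)) := fun y hy => by
        simp only [hw (hΔ.interior_cell_subset T hy)]
      constructor
      · intro h a b hab
        rw [← poly_jet]
        exact (hΔ.hasValue_iff (η := ⟨z, unitVec 0, unitVec 1, a, b⟩) hz (hJ a b hab)).1
          ((hasValue_congr hc _ _).1 (h _ ⟨a, b, by omega, rfl⟩))
      · rintro h _ ⟨a, b, hab, rfl⟩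
        rw [poly_jet, hasValue_congr hc, h a b (by omega)]
        exact hJ a b (by omega)
    have i0 := hiff (Δ.vert T 0) 2 J₀ (hΔ.vert_mem_cell T 0) fun a b hab =>
      (hJ₀ a b hab).mono_left nhdsWithin_le_nhds
    have i1 := hiff (Δ.vert T 1) 1 J₁ (hΔ.vert_mem_cell T 1) hJ₁
    have i2 := hiff (Δ.vert T 2) 1 J₂ (hΔ.vert_mem_cell T 2) hJ₂
    have ic := hiff (Δ.center T) 1 Jc hcm fun a b hab =>
      (hJc a b (by omega)).mono_left nhdsWithin_le_nhds
    rw [Fin.forall_fin_succ, Fin.forall_fin_two]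
    simp only [nodesPie, mem_union]
    constructor
    · intro h
      exact ⟨i0.1 fun η hη => h η (.inl (.inl (.inl hη))), ic.1 fun η hη => h η (.inr hη),
        i1.1 fun η hη => h η (.inl (.inl (.inr hη))), i2.1 fun η hη => h η (.inl (.inr hη))⟩
    · rintro ⟨h0, hc, h1, h2⟩ η (((hη | hη) | hη) | hη)
      exacts [i0.2 h0 η hη, i1.2 h1 η hη, i2.2 h2 η hη, ic.2 hc η hη]
  · fin_cases i
    · exact hp₀ p h0
    · exact hp₁ p (h 1)
    · exact hp₂ p (h 2)

end CurvedTriangles.IsTriangulation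
end ConicSpline

namespace ConicSpline

/-! ### The local interpolants -/

namespace CurvedTriangles
variable {n : ℕ} [NeZero n] {D : ConicDomain n} {ι : Type} {Δ : CurvedTriangles D ι}

lemma cases_triangle (T : ι) : Δ.IsOrdinary T ∨ T ∈ Δ.pie ∨ Δ.IsBuffer T := by
  by_cases h1 : T ∈ Δ.pie
  · exact .inr (.inl h1)
  · by_cases h2 : Δ.IsBuffer T
    · exact .inr (.inr h2)
    · exact .inl ⟨h1, h2⟩

/-- The triangles `T` and `T'` share the edge that joins the vertices `i` and `k` of `T`. -/
def SharesEdge (Δ : CurvedTriangles D ι) (T T' : ι) (i k : Fin 3) : Prop :=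
  T ≠ T' ∧ Δ.IsStraight T i k ∧
    ∃ a b, Δ.IsStraight T' a b ∧ Δ.vert T i = Δ.vert T' a ∧ Δ.vert T k = Δ.vert T' b

namespace SharesEdge
variable {T T' : ι} {i k : Fin 3}

lemma symm (h : Δ.SharesEdge T T' i k) : Δ.SharesEdge T T' k i := by
  obtain ⟨h1, h2, a, b, h3, h4, h5⟩ := h
  exact ⟨h1, h2.symm, b, a, h3.symm, h5, h4⟩

lemma segment_mem (h : Δ.SharesEdge T T' i k) :
    segment ℝ (Δ.vert T i) (Δ.vert T k) ∈ Δ.edges T' := by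
  obtain ⟨h1, h2, a, b, h3, h4, h5⟩ := h
  exact ⟨a, b, h3, by rw [h4, h5]⟩

lemma nonempty (h : Δ.SharesEdge T T' i k) : (Δ.edges T ∩ Δ.edges T').Nonempty :=
  ⟨_, ⟨i, k, h.2.1, rfl⟩, h.segment_mem⟩

lemma of_segment_mem (hne : T ≠ T') (h : Δ.IsStraight T i k)
    (hs : segment ℝ (Δ.vert T i) (Δ.vert T k) ∈ Δ.edges T') : Δ.SharesEdge T T' i k := by
  obtain ⟨a, b, hab, he⟩ := hs
  rcases segment_eq_segment he with ⟨h1, h2⟩ | ⟨h1, h2⟩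
  · exact ⟨hne, h, a, b, hab, h1, h2⟩
  · exact ⟨hne, h, b, a, hab.symm, h1, h2⟩

lemma notBuffer (hAF : Δ.IsAdmissible) (h : Δ.SharesEdge T T' i k) (hT : Δ.IsBuffer T) :
    ¬ Δ.IsBuffer T' := fun h' =>
  h.nonempty.ne_empty (hAF.condF T T' hT h' h.1)

/-- Of two neighbours, both are ordinary, or one is a buffer triangle. -/
lemma cases (hAF : Δ.IsAdmissible) (h : Δ.SharesEdge T T' i k) :
    (Δ.IsOrdinary T ∧ Δ.IsOrdinary T') ∨ Δ.IsBuffer T ∨ Δ.IsBuffer T' := by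
  by_cases hB : Δ.IsBuffer T
  · exact .inr (.inl hB)
  by_cases hB' : Δ.IsBuffer T'
  · exact .inr (.inr hB')
  by_cases hP : T ∈ Δ.pie
  · by_cases hP' : T' ∈ Δ.pie
    · exact (h.nonempty.ne_empty (hAF.condC T hP T' hP' h.1)).elim
    · exact (hB' ⟨hP', T, hP, by rw [inter_comm]; exact h.nonempty⟩).elim
  · by_cases hP' : T' ∈ Δ.pie
    · exact (hB ⟨hP, T', hP', h.nonempty⟩).elim
    · exact .inl ⟨⟨hP, hB⟩, hP', hB'⟩

end SharesEdge

/-- The conditions on the edges of a buffer triangle. -/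
lemma vanishesOnEdge_of_buffer {w : Plane → ℝ} {P : ι → BiPoly}
    (hΔ : Δ.IsTriangulation) (hP : Δ.IsLocalInterpolants w P) {T T' : ι} (hT : Δ.IsBuffer T)
    {i k : Fin 3} (h : Δ.SharesEdge T T' i k) :
    VanishesOnEdge (P T - P T') (Δ.vert T i) (Δ.vert T k) := by
  obtain ⟨h1, h2, h3⟩ := (hP.buffer T hT).2.2 T' h.1.symm
  have hne : ∀ i k : Fin 3, i ≠ k → Δ.vert T i ≠ Δ.vert T k := fun i k hik he =>
    hik (hΔ.vert_injective T he)
  have key : ∀ i k : Fin 3, i < k → Δ.SharesEdge T T' i k →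
      VanishesOnEdge (P T - P T') (Δ.vert T i) (Δ.vert T k) := by
    intro i k hik h
    refine (forall_edgeNodes_iff (hne i k hik.ne)).1 fun η hη => ?_
    have hs := h.segment_mem
    fin_cases i <;> fin_cases k <;> simp at hik
    · exact h2 hs η (.inl hη)
    · exact h3 hs η hη
    · exact h1 hs η (.inl (.inl hη))
  rcases lt_or_gt_of_ne h.2.1.1 with h' | h'
  · exact key i k h' h
  · exact (key k i h' h.symm).symm

namespace IsTriangulation
variable (hΔ : Δ.IsTriangulation)

lemma totalDegree_le_six {w : Plane → ℝ} {P : ι → BiPoly} (hP : Δ.IsLocalInterpolants w P)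
    (T : ι) : (P T).totalDegree ≤ 6 := by
  rcases cases_triangle (Δ := Δ) T with h | h | h
  · exact (hP.ordinary T h).1.trans (by norm_num)
  · obtain ⟨p, hp, he, -⟩ := hP.pie T h
    rw [he]
    refine (MvPolynomial.totalDegree_mul _ _).trans ?_
    have : (Δ.conic T).totalDegree = 2 := D.q_degree _
    omega
  · exact (hP.buffer T h).1

include hΔ

lemma sharesEdge_unique {T T₁ T₂ : ι} {i k : Fin 3} (h₁ : Δ.SharesEdge T T₁ i k)
    (h₂ : Δ.SharesEdge T T₂ i k) : T₁ = T₂ := by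
  obtain ⟨n₁, s₁, a, b, hab, ha, hb⟩ := h₁
  obtain ⟨n₂, -, c, d, hcd, hc, hd⟩ := h₂
  exact hΔ.neighbor_unique n₁ n₂ s₁ hab hcd ha hb hc hd

lemma bary_mem_cell {T : ι} (hT : T ∉ Δ.pie) :
    (1 / 3 : ℝ) • (Δ.vert T 0 + Δ.vert T 1 + Δ.vert T 2) ∈ Δ.cell T := by
  rw [hΔ.cell_straight T hT, straightened]
  have h := fun i => subset_convexHull ℝ _ (mem_range_self (f := Δ.vert T) i)
  have h01 := convex_convexHull ℝ (range (Δ.vert T)) (h 0) (h 1)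
    (by norm_num : (0 : ℝ) ≤ 1 / 2) (by norm_num : (0 : ℝ) ≤ 1 / 2) (by norm_num)
  have h2 := convex_convexHull ℝ (range (Δ.vert T)) h01 (h 2)
    (by norm_num : (0 : ℝ) ≤ 2 / 3) (by norm_num : (0 : ℝ) ≤ 1 / 3) (by norm_num)
  convert h2 using 1
  module

variable [Finite ι]

lemma exists_sharesEdge {T : ι} {i k : Fin 3} (h : Δ.IsStraight T i k) :
    ∃ T', Δ.SharesEdge T T' i k := by
  obtain ⟨T', h1, h2⟩ := hΔ.exists_neighbor h
  exact ⟨T', h1, h, h2⟩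

variable (hAF : Δ.IsAdmissible) {g : ℕ → ℕ → Plane → ℝ} (H : IsC3Family (D.Ω : Set Plane) g)
include hAF H

/-- For pie-shaped triangles the condition on p at the boundary vertices is of first order only; the
zero of the conic raises the order of agreement of the product by one. -/
lemma jet_eq_of_notBuffer {w : Plane → ℝ} (hw : EqOn w (g 0 0) D.Ω) {P : ι → BiPoly}
    (hP : Δ.IsLocalInterpolants w P) {T : ι} (hT : ¬ Δ.IsBuffer T) (i : Fin 3) (a b : ℕ)
    (hab : a + b < 3) : polyFun (partPoly a b (P T)) (Δ.vert T i) = g a b (Δ.vert T i) := by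
  rcases cases_triangle (Δ := Δ) T with h | h | h
  · exact ((hΔ.forall_nodesOrdinary_iff H hw h.1).1 (hP.ordinary T h).2).1 i a b hab
  · obtain ⟨p, hp, he, hη⟩ := hP.pie T h
    obtain ⟨J₀, J, hJ⟩ := hΔ.exists_data_pie hAF H h
    obtain ⟨h0, h1⟩ := ((hJ p).1 w hw).1 hη
    rw [he]; exact (hJ p).2 h0 h1 i a b hab
  · exact (hT h).elim

/-- The local interpolants have the derivatives of order at most two of the function at all
vertices. -/
lemma jet_eq {w : Plane → ℝ} (hw : EqOn w (g 0 0) D.Ω) {P : ι → BiPoly}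
    (hP : Δ.IsLocalInterpolants w P) (T : ι) (i : Fin 3) (a b : ℕ)
    (hab : a + b < 3) : polyFun (partPoly a b (P T)) (Δ.vert T i) = g a b (Δ.vert T i) := by
  by_cases hT : Δ.IsBuffer T
  -- The jet at each vertex is copied from a neighbour across an edge, and by (F) this neighbour is
  -- not a buffer triangle.
  · have key : ∀ i k : Fin 3, (hik : i ≠ k) → (∀ T', Δ.SharesEdge T T' i k → ∀ a b, a + b ≤ 2 →
        polyFun (partPoly a b (P T)) (Δ.vert T i) = polyFun (partPoly a b (P T')) (Δ.vert T i)) →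
        polyFun (partPoly a b (P T)) (Δ.vert T i) = g a b (Δ.vert T i) := by
      intro i k hik h
      obtain ⟨T', hT'⟩ := hΔ.exists_sharesEdge (isStraight_of_notMem hT.1 hik)
      rw [h T' hT' a b (by omega)]
      obtain ⟨c, -, -, hc, -⟩ := hT'.2.2
      rw [hc]
      exact hΔ.jet_eq_of_notBuffer hAF H hw hP (hT'.notBuffer hAF hT) c a b hab
    have hB := (hP.buffer T hT).2.2
    fin_cases i
    · refine key 0 1 (by decide) fun T' h => forall_jetNodes_iff.1 fun η hη => ?_
      exact (hB T' h.1.symm).2.1 h.segment_mem η (.inr hη)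
    · refine key 1 2 (by decide) fun T' h => forall_jetNodes_iff.1 fun η hη => ?_
      exact (hB T' h.1.symm).1 h.segment_mem η (.inl (.inr hη))
    · refine key 2 1 (by decide) fun T' h => forall_jetNodes_iff.1 fun η hη => ?_
      exact (hB T' h.1.symm).1 h.symm.segment_mem η (.inr hη)
  · exact hΔ.jet_eq_of_notBuffer hAF H hw hP hT i a b hab

lemma vanOrd_three_sub {w : Plane → ℝ} (hw : EqOn w (g 0 0) D.Ω) {P : ι → BiPoly}
    (hP : Δ.IsLocalInterpolants w P) {T T' : ι} {i k : Fin 3} (h : Δ.vert T i = Δ.vert T' k) :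
    VanOrd 3 (P T - P T') (Δ.vert T i) :=
  vanOrd_sub_iff.2 fun a b hab => by
    rw [hΔ.jet_eq hAF H hw hP T i a b hab, h, hΔ.jet_eq hAF H hw hP T' k a b hab]

/-- Two ordinary triangles are joined as quintics, with the normal derivative at the midpoint. On
any other common edge one triangle is a buffer, and it matches its neighbour at the edge nodes for
degree six. -/
lemma vanOrd_two_sub_edge {w : Plane → ℝ} (hw : EqOn w (g 0 0) D.Ω) {P : ι → BiPoly}
    (hP : Δ.IsLocalInterpolants w P) {T T' : ι} {i k : Fin 3} (h : Δ.SharesEdge T T' i k)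
    {x : Plane} (hx : x ∈ segment ℝ (Δ.vert T i) (Δ.vert T k)) : VanOrd 2 (P T - P T') x := by
  have hne : Δ.vert T i ≠ Δ.vert T k := fun he => h.2.1.1 (hΔ.vert_injective T he)
  obtain ⟨a, b, hab, ha, hb⟩ := h.2.2
  have v1 := hΔ.vanOrd_three_sub hAF H hw hP ha
  have v2 := hΔ.vanOrd_three_sub hAF H hw hP hb
  have hdeg : (P T - P T').totalDegree ≤ 6 := (MvPolynomial.totalDegree_sub _ _).trans
    (max_le (totalDegree_le_six hP T) (totalDegree_le_six hP T'))
  rcases h.cases hAF with ⟨hO, hO'⟩ | hB | hB'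
  · have m1 := ((hΔ.forall_nodesOrdinary_iff H hw hO.1).1 (hP.ordinary T hO).2).2 i k h.2.1.1
    have m2 := ((hΔ.forall_nodesOrdinary_iff H hw hO'.1).1 (hP.ordinary T' hO').2).2 a b hab.1
    rw [← ha, ← hb] at m2
    rw [segment_eq_image'] at hx
    obtain ⟨t, -, rfl⟩ := hx
    refine vanOrd_edge_five (sub_ne_zero.2 hne.symm) ?_ v1 (by rwa [add_sub_cancel]) ?_ t
    · exact (MvPolynomial.totalDegree_sub _ _).trans
        (max_le (hP.ordinary T hO).1 (hP.ordinary T' hO').1)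
    · unfold MatchesNormal at m1 m2
      rw [polyD_sub, polyFun_sub, m1, m2, sub_self]
  · exact vanOrd_two_of_vanishesOnEdge hne hdeg v1 v2
      (vanishesOnEdge_of_buffer hΔ hP hB h) hx
  · have h' : Δ.SharesEdge T' T a b := ⟨h.1.symm, hab, i, k, h.2.1, ha.symm, hb.symm⟩
    have hneg : ∀ {m : ℕ} {y : Plane}, VanOrd m (P T - P T') y ↔ VanOrd m (P T' - P T) y := by
      intro m y
      rw [vanOrd_sub_iff, vanOrd_sub_iff]
      exact ⟨fun h c d hcd => (h c d hcd).symm, fun h c d hcd => (h c d hcd).symm⟩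
    have hv := vanishesOnEdge_of_buffer hΔ hP hB' h'
    rw [← ha, ← hb] at hv
    refine hneg.2 (vanOrd_two_of_vanishesOnEdge hne ?_ (hneg.1 v1) (hneg.1 v2) hv hx)
    exact (MvPolynomial.totalDegree_sub _ _).trans
      (max_le (totalDegree_le_six hP T') (totalDegree_le_six hP T))

/-- The values and gradients of the local interpolants agree on the intersections of triangles. -/
lemma vanOrd_two_sub {w : Plane → ℝ} (hw : EqOn w (g 0 0) D.Ω) {P : ι → BiPoly}
    (hP : Δ.IsLocalInterpolants w P) {T T' : ι} {x : Plane} (hx : x ∈ Δ.cell T)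
    (hx' : x ∈ Δ.cell T') : VanOrd 2 (P T - P T') x := by
  by_cases hne : T = T'
  · subst hne
    exact vanOrd_sub_iff.2 fun _ _ _ => rfl
  · rcases hΔ.meet hne hx hx' with ⟨i, k, hi, hk, -⟩ | ⟨i, k, a, b, h1, h2, h3, h4, -, hx⟩
    · rw [← hi]
      exact (hΔ.vanOrd_three_sub hAF H hw hP (hi.trans hk.symm)).mono (by norm_num)
    · exact hΔ.vanOrd_two_sub_edge hAF H hw hP ⟨hne, h1, a, b, h2, h3, h4⟩ hx

/-- The local interpolants are unique. -/
lemma localInterpolant_unique {w w' : Plane → ℝ} (hw : EqOn w (g 0 0) D.Ω)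
    (hw' : EqOn w' (g 0 0) D.Ω) {P P' : ι → BiPoly}
    (hP : Δ.IsLocalInterpolants w P) (hP' : Δ.IsLocalInterpolants w' P') (T : ι) :
    P T = P' T := by
  have hjet : ∀ T i, VanOrd 3 (P T - P' T) (Δ.vert T i) := fun T i =>
    vanOrd_sub_iff.2 fun a b hab => by
      rw [hΔ.jet_eq hAF H hw hP T i a b hab, hΔ.jet_eq hAF H hw' hP' T i a b hab]
  have hnb : ∀ T, ¬ Δ.IsBuffer T → P T = P' T := by
    intro T hT
    rcases cases_triangle (Δ := Δ) T with h | h | h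
    · refine sub_eq_zero.1 (unisolvent_argyris (hΔ.cross_ne T)
        ((MvPolynomial.totalDegree_sub _ _).trans
          (max_le (hP.ordinary T h).1 (hP'.ordinary T h).1)) (hjet T) fun k => ?_)
      have hk : k + 1 ≠ k + 2 := by simp
      have m1 := ((hΔ.forall_nodesOrdinary_iff H hw h.1).1 (hP.ordinary T h).2).2 _ _ hk
      have m2 := ((hΔ.forall_nodesOrdinary_iff H hw' h.1).1 (hP'.ordinary T h).2).2 _ _ hk
      unfold MatchesNormal at m1 m2
      rw [polyD_sub, polyFun_sub, sideVec, m1, m2, sub_self]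
    · obtain ⟨p, hp, he, hη⟩ := hP.pie T h
      obtain ⟨p', hp', he', hη'⟩ := hP'.pie T h
      obtain ⟨J₀, J, hJ⟩ := hΔ.exists_data_pie hAF H h
      obtain ⟨h0, h1⟩ := ((hJ p).1 w hw).1 hη
      obtain ⟨h0', h1'⟩ := ((hJ p').1 w' hw').1 hη'
      have hv : ∀ k, VanOrd 2 (p - p') (![Δ.center T, Δ.vert T 1, Δ.vert T 2] k) := fun k =>
        vanOrd_sub_iff.2 fun a b hab => by rw [h1 k a b hab, h1' k a b hab]
      have hc := (hΔ.center_mem_interior h).2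
      rw [hΔ.interior_straightened] at hc
      have hpp : p - p' = 0 := by
        refine unisolvent_pie (hΔ.cross_ne T) ((MvPolynomial.totalDegree_sub _ _).trans
          (max_le hp hp')) hc (hΔ.sum_coord T _)
          (vanOrd_sub_iff.2 fun a b hab => by rw [h0 a b hab, h0' a b hab]) (hv 1) (hv 2) ?_
        rw [← hΔ.eq_bary]; exact hv 0
      rw [he, he', sub_eq_zero.1 hpp]
    · exact (hT h).elim
  by_cases hT : Δ.IsBuffer T
  · have hedge : ∀ k : Fin 3,
        VanishesOnEdge (P T - P' T) (Δ.vert T (k + 1)) (Δ.vert T (k + 2)) := by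
      intro k
      obtain ⟨T', h⟩ := hΔ.exists_sharesEdge (isStraight_of_notMem hT.1
        (show k + 1 ≠ k + 2 by simp))
      obtain ⟨a1, a2, a3⟩ := vanishesOnEdge_of_buffer hΔ hP hT h
      obtain ⟨b1, b2, b3⟩ := vanishesOnEdge_of_buffer hΔ hP' hT h
      have he := hnb T' (h.notBuffer hAF hT)
      rw [he] at a1 a2 a3
      simp only [polyD_sub, polyFun_sub] at a1 a2 a3 b1 b2 b3
      refine ⟨?_, ?_, ?_⟩ <;> simp only [polyD_sub, polyFun_sub] <;> linarith
    refine sub_eq_zero.1 (unisolvent_buffer (hΔ.cross_ne T)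
        ((MvPolynomial.totalDegree_sub _ _).trans
          (max_le (hP.buffer T hT).1 (hP'.buffer T hT).1)) (hjet T) (fun k => (hedge k).1)
          (fun k => (hedge k).2.1) (fun k => (hedge k).2.2) ?_)
    have hz := hΔ.bary_mem_cell hT.1
    have c1 := (hΔ.forall_hasValue_jetNodes_iff H hw hz (by norm_num)).1 (hP.buffer T hT).2.1
      0 0 le_rfl
    have c2 := (hΔ.forall_hasValue_jetNodes_iff H hw' hz (by norm_num)).1 (hP'.buffer T hT).2.1
      0 0 le_rfl
    rw [polyFun_sub, sub_eq_zero]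
    exact c1.trans c2.symm
  · exact hnb T hT

/-- The local interpolants exist. -/
lemma exists_localInterpolants : ∃ P : ι → BiPoly, Δ.IsLocalInterpolants (g 0 0) P := by
  have h1 : ∀ T, ∃ p : BiPoly,
      (Δ.IsOrdinary T → p.totalDegree ≤ 5 ∧
        ∀ η ∈ Δ.nodesOrdinary T, η.HasValue (Δ.cell T) (g 0 0) (η.poly p)) ∧
      (T ∈ Δ.pie → ∃ p' : BiPoly, p'.totalDegree ≤ 4 ∧ p = p' * Δ.conic T ∧
        ∀ η ∈ Δ.nodesPie T,
          η.HasValue (Δ.cell T) (fun x => g 0 0 x / polyFun (Δ.conic T) x) (η.poly p')) ∧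
      (¬ Δ.IsBuffer T → ∀ i a b, a + b < 3 →
        polyFun (partPoly a b p) (Δ.vert T i) = g a b (Δ.vert T i)) := by
    intro T
    rcases cases_triangle (Δ := Δ) T with h | h | h
    · obtain ⟨p, hp, hJ, hN⟩ := exists_argyris (hΔ.cross_ne T) (fun i a b => g a b (Δ.vert T i))
        fun k => dirFamily (rot (sideVec (Δ.vert T) k)) g 0 0
          (Δ.vert T (k + 1) + (2 / 4 : ℝ) • sideVec (Δ.vert T) k)
      refine ⟨p, fun _ => ⟨hp, ?_⟩, fun h' => (h.1 h').elim, fun _ => hJ⟩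
      refine (hΔ.forall_nodesOrdinary_iff H (fun _ _ => rfl) h.1).2 ⟨hJ, ?_⟩
      have hN' : ∀ k : Fin 3, MatchesNormal g p (Δ.vert T (k + 1)) (Δ.vert T (k + 2)) := hN
      intro i k hik
      fin_cases i <;> fin_cases k <;> first | exact (hik rfl).elim | skip
      exacts [hN' 2, (hN' 1).symm, (hN' 2).symm, hN' 0, hN' 1, (hN' 0).symm]
    · obtain ⟨J₀, J, hJ⟩ := hΔ.exists_data_pie hAF H h
      have hc := (hΔ.center_mem_interior h).2
      rw [hΔ.interior_straightened] at hc
      obtain ⟨p, hp, h0, h1⟩ := exists_pie (hΔ.cross_ne T) hc (hΔ.sum_coord T _) J₀ J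
      rw [← hΔ.eq_bary] at h1
      exact ⟨p * Δ.conic T, fun h' => (h'.1 h).elim,
        fun _ => ⟨p, hp, rfl, ((hJ p).1 _ fun _ _ => rfl).2 ⟨h0, h1⟩⟩,
        fun _ => (hJ p).2 h0 h1⟩
    · exact ⟨0, fun h' => (h'.2 h).elim, fun h' => (h.1 h').elim, fun h' => (h' h).elim⟩
  choose P₀ hO hPie hJ₀ using h1
  -- The conditions on a buffer triangle refer to `P₀` of its neighbours, which by (F) is already
  -- final. Jets at all three vertices are prescribed by `g`, which agrees with the jets of the
  -- neighbours.
  have h2 : ∀ T, ∃ p : BiPoly, (¬ Δ.IsBuffer T → p = P₀ T) ∧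
      (Δ.IsBuffer T → p.totalDegree ≤ 6 ∧
        (∀ i a b, a + b < 3 → polyFun (partPoly a b p) (Δ.vert T i) = g a b (Δ.vert T i)) ∧
        (∀ η ∈ Δ.nodesBuffer T, η.HasValue (Δ.cell T) (g 0 0) (η.poly p)) ∧
        ∀ T' i k, Δ.SharesEdge T T' i k →
          VanishesOnEdge (p - P₀ T') (Δ.vert T i) (Δ.vert T k)) := by
    intro T
    by_cases hT : Δ.IsBuffer T
    · have hnb : ∀ k : Fin 3, ∃ T', Δ.SharesEdge T T' (k + 1) (k + 2) := fun k =>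
        hΔ.exists_sharesEdge (isStraight_of_notMem hT.1 (by simp))
      choose N hN using hnb
      set v := Δ.vert T
      obtain ⟨p, hp, hJ, hM, hN1, hN3, hc⟩ := exists_buffer (hΔ.cross_ne T)
        (fun i a b => g a b (v i))
        (fun k => polyFun (P₀ (N k)) (v (k + 1) + (2 / 4 : ℝ) • sideVec v k))
        (fun k => polyFun (polyD (rot (sideVec v k)) (P₀ (N k)))
          (v (k + 1) + (1 / 4 : ℝ) • sideVec v k))
        (fun k => polyFun (polyD (rot (sideVec v k)) (P₀ (N k)))
          (v (k + 1) + (3 / 4 : ℝ) • sideVec v k))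
        (g 0 0 ((1 / 3 : ℝ) • (v 0 + v 1 + v 2)))
      refine ⟨p, fun h => (h hT).elim, fun _ => ⟨hp, hJ, ?_, ?_⟩⟩
      · refine (hΔ.forall_hasValue_jetNodes_iff H (fun _ _ => rfl) (hΔ.bary_mem_cell hT.1)
          (by norm_num)).2 fun a b hab => ?_
        obtain ⟨rfl, rfl⟩ : a = 0 ∧ b = 0 := by omega
        exact hc
      · have key : ∀ k T', Δ.SharesEdge T T' (k + 1) (k + 2) →
            VanishesOnEdge (p - P₀ T') (v (k + 1)) (v (k + 2)) := by
          intro k T' h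
          rw [hΔ.sharesEdge_unique h (hN k)]
          refine ⟨?_, ?_, ?_⟩ <;> simp only [polyD_sub, polyFun_sub, sub_eq_zero]
          exacts [hM k, hN1 k, hN3 k]
        intro T' i k h
        have hik := h.2.1.1
        fin_cases i <;> fin_cases k <;> first | exact (hik rfl).elim | skip
        exacts [key 2 T' h, (key 1 T' h.symm).symm, (key 2 T' h.symm).symm, key 0 T' h, key 1 T' h,
          (key 0 T' h.symm).symm]
    · exact ⟨P₀ T, fun _ => rfl, fun h => (hT h).elim⟩
  choose P hP hB using h2
  refine ⟨P, ?_, ?_, ?_⟩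
  · intro T h
    rw [hP T h.2]; exact hO T h
  · intro T h
    rw [hP T fun hB => hB.1 h]; exact hPie T h
  · intro T h
    obtain ⟨hd, hJ, hc, hE⟩ := hB T h
    have hjet : ∀ T' i k, Δ.SharesEdge T T' i k → ∀ η ∈ jetNodes (Δ.vert T i) 2,
        η.poly (P T) = η.poly (P T') := by
      intro T' i k hs
      rw [forall_jetNodes_iff]
      intro a b hab
      have hb' := hs.notBuffer hAF h
      obtain ⟨c, -, -, hc, -⟩ := hs.2.2
      rw [hJ i a b (by omega), hP T' hb', hc, hJ₀ T' hb' c a b (by omega)]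
    have hedge : ∀ T' i k, Δ.SharesEdge T T' i k → ∀ η ∈ edgeNodes (Δ.vert T i) (Δ.vert T k),
        η.poly (P T) = η.poly (P T') := by
      intro T' i k hs
      rw [forall_edgeNodes_iff fun he => hs.2.1.1 (hΔ.vert_injective T he),
        hP T' (hs.notBuffer hAF h)]
      exact hE T' i k hs
    have hs : ∀ T' i k, T' ≠ T → i ≠ k → segment ℝ (Δ.vert T i) (Δ.vert T k) ∈ Δ.edges T' →
        Δ.SharesEdge T T' i k := fun T' i k hne hik hseg =>
      .of_segment_mem hne.symm (isStraight_of_notMem h.1 hik) hseg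
    refine ⟨hd, hc, fun T' hne => ⟨fun hseg η hη => ?_, fun hseg η hη => ?_, fun hseg η hη => ?_⟩⟩
    · have := hs T' 1 2 hne (by decide) hseg
      rcases hη with (hη | hη) | hη
      exacts [hedge T' 1 2 this η hη, hjet T' 1 2 this η hη, hjet T' 2 1 this.symm η hη]
    · have := hs T' 0 1 hne (by decide) hseg
      rcases hη with hη | hη
      exacts [hedge T' 0 1 this η hη, hjet T' 0 1 this η hη]
    · exact hedge T' 0 2 (hs T' 0 2 hne (by decide) hseg) η hη

end IsTriangulation
end CurvedTriangles
end ConicSpline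

namespace ConicSpline

/-! ### Smoothness of the interpolant -/

lemma VanOrd.polyGrad_eq {p p' : BiPoly} {x : Plane} (h : VanOrd 2 (p - p') x) :
    polyGrad p x = polyGrad p' x := by
  ext τ
  rw [polyGrad_apply, polyGrad_apply, ← sub_eq_zero, ← polyFun_sub, ← polyD_sub]
  exact (h.polyD τ).eval

lemma VanOrd.polyFun_eq {k : ℕ} {p p' : BiPoly} {x : Plane} (h : VanOrd (k + 1) (p - p') x) :
    polyFun p x = polyFun p' x := by
  rw [← sub_eq_zero, ← polyFun_sub]; exact h.eval

lemma VanOrd.hasFDerivAt_polyGrad {p p' : BiPoly} {x : Plane} (h : VanOrd 3 (p - p') x) :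
    HasFDerivAt (polyGrad p) (fderiv ℝ (polyGrad p') x) x := by
  have h1 := ConicSpline.hasFDerivAt_polyGrad p x
  have e : ∀ i, polyGrad (MvPolynomial.pderiv i p) x = polyGrad (MvPolynomial.pderiv i p') x := by
    intro i
    refine VanOrd.polyGrad_eq ?_
    rw [← map_sub]; exact h.pderiv i
  rw [e 0, e 1] at h1
  rwa [(ConicSpline.hasFDerivAt_polyGrad p' x).fderiv]

/-- The limit of the parallelograms at x lies in the closure of Ω, so the tangent cone contains both
sides and spans the plane. Hence derivatives relative to the closed domain are unique. -/
lemma uniqueDiffWithinAt_of_parallelogram {Ω : Set Plane} {p₁ p₂ x : Plane} (hp : cross p₁ p₂ ≠ 0)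
    (hx : x ∈ closure (parallelogramSet Ω p₁ p₂)) : UniqueDiffWithinAt ℝ (closure Ω) x := by
  have hmem : ∀ s ∈ Icc (0 : ℝ) 1, ∀ t ∈ Icc (0 : ℝ) 1, x + s • p₁ + t • p₂ ∈ closure Ω := by
    intro s hs t ht
    have hc : Continuous fun y : Plane => y + s • p₁ + t • p₂ := by fun_prop
    exact closure_mono (by rintro _ ⟨y, hy, rfl⟩; exact hy s hs t ht)
      (image_closure_subset_closure_image hc ⟨x, hx, rfl⟩)
  have h0 : (0 : ℝ) ∈ Icc (0 : ℝ) 1 := ⟨le_rfl, zero_le_one⟩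
  have t1 : p₁ ∈ tangentConeAt ℝ (closure Ω) x := by
    have := mem_tangentConeAt_of_segment_subset (s := closure Ω) (x := x) (y := x + p₁) (by
      rw [segment_eq_image']
      rintro _ ⟨s, hs, rfl⟩
      simpa using hmem s hs 0 h0)
    rwa [add_sub_cancel_left] at this
  have t2 : p₂ ∈ tangentConeAt ℝ (closure Ω) x := by
    have := mem_tangentConeAt_of_segment_subset (s := closure Ω) (x := x) (y := x + p₂) (by
      rw [segment_eq_image']
      rintro _ ⟨s, hs, rfl⟩
      simpa using hmem 0 h0 s hs)
    rwa [add_sub_cancel_left] at this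
  refine ⟨?_, subset_closure (by simpa using hmem 0 h0 0 h0)⟩
  have htop : Submodule.span ℝ (tangentConeAt ℝ (closure Ω) x) = ⊤ := by
    refine eq_top_iff.2 fun y _ => ?_
    rw [exists_coords hp y]
    exact add_mem (Submodule.smul_mem _ _ (Submodule.subset_span t1))
      (Submodule.smul_mem _ _ (Submodule.subset_span t2))
  rw [htop]
  exact dense_univ

namespace CurvedTriangles.IsTriangulation
variable {n : ℕ} [NeZero n] {D : ConicDomain n} {ι : Type} {Δ : CurvedTriangles D ι}
/-- Functions that agree on the intersections of triangles define a function on the domain. -/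
lemma exists_eqOn_cells {β : Type*} [Inhabited β] (F : ι → Plane → β)
    (h : ∀ T T' x, x ∈ Δ.cell T → x ∈ Δ.cell T' → F T x = F T' x) :
    ∃ f : Plane → β, ∀ T, EqOn f (F T) (Δ.cell T) := by
  classical
  refine ⟨fun x => if hx : ∃ T, x ∈ Δ.cell T then F hx.choose x else default, fun T x hx => ?_⟩
  have hex : ∃ T, x ∈ Δ.cell T := ⟨T, hx⟩
  simp only [hex, dif_pos]
  exact h _ _ x hex.choose_spec hx

variable (hΔ : Δ.IsTriangulation)
include hΔ

lemma mem_of_mem_closure_interior {T : ι} {x p₁ p₂ : Plane} (hx : x ∈ Δ.cell T)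
    (h : ∀ᶠ y in 𝓝 x, y ∈ Δ.cell T → y ∈ D.Ω → y ∈ parallelogramSet (D.Ω : Set Plane) p₁ p₂) :
    x ∈ closure (parallelogramSet (D.Ω : Set Plane) p₁ p₂) := by
  rw [← hΔ.closure_interior_cell] at hx
  rw [mem_closure_iff_frequently] at hx ⊢
  exact (hx.and_eventually h).mono fun y ⟨h1, h2⟩ =>
    h2 (interior_subset h1) (hΔ.interior_cell_subset T h1)

lemma uniqueDiffWithinAt_vert [Finite ι] (hAF : Δ.IsAdmissible) (T : ι) (i : Fin 3) :
    UniqueDiffWithinAt ℝ (closure (D.Ω : Set Plane)) (Δ.vert T i) := by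
  by_cases hfr : Δ.vert T i ∈ frontier (D.Ω : Set Plane)
  · obtain ⟨p₁, p₂, hp, h⟩ := hΔ.exists_parallelogram_vert hAF hfr
    exact uniqueDiffWithinAt_of_parallelogram hp
      (hΔ.mem_of_mem_closure_interior (hΔ.vert_mem_cell T i) h)
  · exact (D.Ω.isOpen.uniqueDiffWithinAt
      (hΔ.mem_of_notMem_frontier (hΔ.vert_mem_cell T i) hfr)).mono subset_closure

lemma uniqueDiffOn_closure [Finite ι] (hAF : Δ.IsAdmissible) :
    UniqueDiffOn ℝ (closure (D.Ω : Set Plane)) := by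
  intro x hx
  by_cases hfr : x ∈ frontier (D.Ω : Set Plane)
  · obtain ⟨T, hT⟩ := hΔ.exists_cell hx
    rcases hΔ.mem_frontier_cases hT hfr with ⟨i, rfl⟩ | ⟨hpie, hc⟩
    · exact hΔ.uniqueDiffWithinAt_vert hAF T i
    · obtain ⟨t, ht, rfl⟩ := hΔ.curvedEdge_subset_closedArc hpie hc
      rcases ht.1.eq_or_lt with h0 | h0
      · obtain ⟨T', i, h⟩ := hAF.condA (Δ.arc T)
        rw [← h0, ← h]; exact hΔ.uniqueDiffWithinAt_vert hAF T' i
      rcases ht.2.eq_or_lt with h1 | h1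
      · obtain ⟨T', i, h⟩ := hAF.condA (Δ.arc T + 1)
        rw [h1, D.curve_joint, ← h]; exact hΔ.uniqueDiffWithinAt_vert hAF T' i
      · obtain ⟨p₁, p₂, hp, h⟩ := D.exists_parallelogram_arc (Δ.arc T) ⟨h0, h1⟩
        exact uniqueDiffWithinAt_of_parallelogram hp
          (hΔ.mem_of_mem_closure_interior hT (h.mono fun y hy _ => hy))
  · have hxΩ : x ∈ D.Ω := by
      by_contra h
      exact hfr ⟨hx, fun h' => h (interior_subset h')⟩
    exact (D.Ω.isOpen.uniqueDiffWithinAt hxΩ).mono subset_closure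

/-- The triangles form a finite cover by closed sets, so relative neighbourhoods of x are unions of
those in the triangles that contain x. -/
lemma hasFDerivWithinAt_of_cells [Finite ι] {E : Type*} [NormedAddCommGroup E] [NormedSpace ℝ E]
    {f : Plane → E} {f' : Plane →L[ℝ] E} {x : Plane}
    (h : ∀ T, x ∈ Δ.cell T → HasFDerivWithinAt f f' (Δ.cell T) x) :
    HasFDerivWithinAt f f' (closure (D.Ω : Set Plane)) x := by
  rw [← hΔ.cover, hasFDerivWithinAt_iff_tendsto, nhdsWithin_iUnion, tendsto_iSup]
  intro T
  rw [← hasFDerivWithinAt_iff_tendsto]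
  by_cases hx : x ∈ Δ.cell T
  · exact h T hx
  · exact .of_notMem_closure (by rwa [(hΔ.isClosed_cell T).closure_eq])

lemma continuousOn_of_cells [Finite ι] {β : Type*} [TopologicalSpace β] {f : Plane → β}
    (h : ∀ T, ContinuousOn f (Δ.cell T)) : ContinuousOn f (closure (D.Ω : Set Plane)) := by
  intro x _
  rw [ContinuousWithinAt, ← hΔ.cover, nhdsWithin_iUnion, tendsto_iSup]
  intro T
  by_cases hx : x ∈ Δ.cell T
  · exact h T x hx
  · rw [(notMem_closure_iff_nhdsWithin_eq_bot).1 (by rwa [(hΔ.isClosed_cell T).closure_eq])]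
    exact tendsto_bot

variable [Finite ι] (hAF : Δ.IsAdmissible) {g : ℕ → ℕ → Plane → ℝ}
  (H : IsC3Family (D.Ω : Set Plane) g)
include hAF H

/-- The gradient of a function composed of the local interpolants. -/
lemma exists_gradient {w : Plane → ℝ} (hw : EqOn w (g 0 0) D.Ω) {P : ι → BiPoly}
    (hP : Δ.IsLocalInterpolants w P) {s : Plane → ℝ}
    (hs : ∀ T, EqOn s (polyFun (P T)) (Δ.cell T)) :
    ∃ G : Plane → Plane →L[ℝ] ℝ, ContinuousOn G (closure (D.Ω : Set Plane)) ∧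
      (∀ x ∈ closure (D.Ω : Set Plane), HasFDerivWithinAt s (G x) (closure (D.Ω : Set Plane)) x) ∧
      ∀ T i, DifferentiableWithinAt ℝ G (closure (D.Ω : Set Plane)) (Δ.vert T i) := by
  obtain ⟨G, hG⟩ := exists_eqOn_cells (fun T => polyGrad (P T)) fun T T' x hx hx' =>
    (hΔ.vanOrd_two_sub hAF H hw hP hx hx').polyGrad_eq
  refine ⟨G, ?_, ?_, ?_⟩
  · exact hΔ.continuousOn_of_cells fun T => (continuous_polyGrad (P T)).continuousOn.congr (hG T)
  · intro x hx
    refine hΔ.hasFDerivWithinAt_of_cells fun T hT => ?_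
    rw [hG T hT]
    exact (hasFDerivAt_polyFun (P T) x).hasFDerivWithinAt.congr (hs T) (hs T hT)
  -- All triangles at the vertex share the 2-jet there, so their polynomial gradients have the same
  -- derivative.
  · intro T i
    refine ⟨fderiv ℝ (polyGrad (P T)) (Δ.vert T i),
      hΔ.hasFDerivWithinAt_of_cells fun T' hT' => ?_⟩
    obtain ⟨k, hk⟩ := hΔ.vert_of_mem_cell hT'
    have hv := hΔ.vanOrd_three_sub hAF H hw hP hk
    rw [hk] at hv
    exact hv.hasFDerivAt_polyGrad.hasFDerivWithinAt.congr (hG T') (hG T' hT')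

/-- Boundary points of a triangle are vertices, where the value is that of `w`, or lie on a curved
edge, where the factor q vanishes. The second derivative at boundary vertices uses the uniqueness of
derivatives relative to the closed domain. -/
theorem memS120_of_localInterpolants {w : Plane → ℝ} (hw : EqOn w (g 0 0) D.Ω) {P : ι → BiPoly}
    (hP : Δ.IsLocalInterpolants w P) {s : Plane → ℝ}
    (hs : ∀ T, EqOn s (polyFun (P T)) (Δ.cell T)) :
    Δ.MemS120 5 s ∧ ∀ T i, TwiceDiffAt D s (Δ.vert T i) := by
  obtain ⟨G, hGc, hGd, hGv⟩ := hΔ.exists_gradient hAF H hw hP hs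
  have hcl : ∀ x ∈ D.Ω, closure (D.Ω : Set Plane) ∈ 𝓝 x := fun x hx =>
    Filter.mem_of_superset (D.Ω.isOpen.mem_nhds hx) subset_closure
  have hd : ∀ x ∈ D.Ω, HasFDerivAt s (G x) x := fun x hx =>
    (hGd x (subset_closure hx)).hasFDerivAt (hcl x hx)
  refine ⟨⟨⟨⟨?_, fun T hT => ⟨P T, (hP.ordinary T hT).1, hs T⟩,
    fun T _ => ⟨P T, totalDegree_le_six hP T, hs T⟩⟩, ?_⟩, ?_⟩, ?_⟩
  · rw [show (1 : ℕ∞ω) = 0 + 1 by norm_num, contDiffOn_succ_iff_fderiv_of_isOpen D.Ω.isOpen]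
    refine ⟨fun x hx => (hd x hx).differentiableAt.differentiableWithinAt, by simp, ?_⟩
    exact contDiffOn_zero.2 ((hGc.mono subset_closure).congr fun x hx => (hd x hx).fderiv)
  · intro T i hi
    refine ((hGv T i).differentiableAt (hcl _ hi)).congr_of_eventuallyEq ?_
    filter_upwards [D.Ω.isOpen.mem_nhds hi] with x hx
    exact (hd x hx).fderiv
  · intro x hx
    obtain ⟨T, hT⟩ := hΔ.exists_cell (frontier_subset_closure hx)
    rw [hs T hT]
    rcases hΔ.mem_frontier_cases hT hx with ⟨i, rfl⟩ | ⟨hpie, hc⟩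
    · exact (hΔ.jet_eq hAF H hw hP T i 0 0 (by norm_num)).trans (H.frontier_eq_zero _ hx)
    · obtain ⟨p, -, he, -⟩ := hP.pie T hpie
      rw [he, polyFun_mul, hΔ.conic_closedArc (hΔ.curvedEdge_subset_closedArc hpie hc), mul_zero]
  · intro T i
    refine ⟨eventually_mem_nhdsWithin.mono fun x hx => (hGd x hx).differentiableWithinAt, ?_⟩
    have hvc : Δ.vert T i ∈ closure (D.Ω : Set Plane) :=
      hΔ.cell_subset_closure T (hΔ.vert_mem_cell T i)
    have heq : ∀ x ∈ closure (D.Ω : Set Plane),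
        fderivWithin ℝ s (closure (D.Ω : Set Plane)) x = G x := fun x hx =>
      (hGd x hx).fderivWithin (hΔ.uniqueDiffOn_closure hAF x hx)
    exact (hGv T i).congr heq (heq _ hvc)

end CurvedTriangles.IsTriangulation
end ConicSpline

theorem mainTheorem2 {n : ℕ} [NeZero n] (D : ConicSpline.ConicDomain n) {ι : Type} [Finite ι]
    (Δ : ConicSpline.CurvedTriangles D ι) (hΔ : Δ.IsTriangulation) (hAF : Δ.IsAdmissible)
    (u : ConicSpline.Plane → ℝ) (hu : ConicSpline.MemH D.Ω 5 u)
    (hu₀ : ConicSpline.MemH10 D.Ω u) :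
    (∃ s, Δ.IsInterpolant u s) ∧
    (∀ s s', Δ.IsInterpolant u s → Δ.IsInterpolant u s' →
      Set.EqOn s s' (closure (D.Ω : Set ConicSpline.Plane))) ∧
    ∀ s, Δ.IsInterpolant u s → Δ.MemS120 5 s ∧
      ∀ T i, ConicSpline.CurvedTriangles.TwiceDiffAt D s (Δ.vert T i) := by
  obtain ⟨g, H, hgu⟩ := hΔ.exists_isC3Family hAF hu hu₀
  have hrep := H.isC3Representative hgu
  refine ⟨?_, ?_, ?_⟩
  · obtain ⟨P, hP⟩ := hΔ.exists_localInterpolants hAF H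
    obtain ⟨s, hs⟩ := ConicSpline.CurvedTriangles.IsTriangulation.exists_eqOn_cells
      (fun T => ConicSpline.polyFun (P T))
      fun T T' x hx hx' => (hΔ.vanOrd_two_sub hAF H (fun _ _ => rfl) hP hx hx').polyFun_eq
    exact ⟨s, g 0 0, P, hrep, hP, hs⟩
  · rintro s s' ⟨w, P, hw, hP, hs⟩ ⟨w', P', hw', hP', hs'⟩ x hx
    obtain ⟨T, hT⟩ := hΔ.exists_cell hx
    -- Any two C³ representatives agree on Ω, and the local conditions depend only on the values in
    -- Ω.
    rw [hs T hT, hs' T hT, hΔ.localInterpolant_unique hAF H (hw.eqOn hrep) (hw'.eqOn hrep) hP hP' T]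
  · rintro s ⟨w, P, hw, hP, hs⟩
    exact hΔ.memS120_of_localInterpolants hAF H (hw.eqOn hrep) hP hs
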